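/- **Definitions.** Fix a set $\Sigma$ of actions. *Bundle event structures.* A bundle event structure (BES) is $\mathcal E=(E,\#,\mapsto,\lambda,\Phi)$ with $\#$ an irreflexive symmetric relation on $E$ (conflict), $\mapsto\ \subseteq\mathcal P(E)\times E$ such that the elements of every $x$ with $x\mapsto e$ are pairwise in conflict, $\lambda:E\rightharpoonup\Sigma$ a partial labelling, and $\Phi\subseteq E$ a set of pairwise conflicting final events. $\mathrm{init}(\mathcal E)$ is the set of events that no bundle points to. An event trace is a finite sequence of distinct, pairwise non-conflicting events in which each $e$ is preceded by an element of every $y$ with $y\mapsto e$. A configuration is the set of events of a trace (a linearisation of it); $\mathcal C(\mathcal E)$ is the set of configurations. A configuration $x$ is ordered by $\preceq_x$, the intersection of the orders of its linearisations; $x\sqsubseteq_s y$ means that there is a label-preserving monotone bijection from the labelled events of $y$ to those of $x$. *Probabilistic BES.* Events $e,e'$ are in immediate conflict if $e\#e'$ and $x,\ x\cup\{e\},\ x\cup\{e'\}$ are configurations for some $x$. A partial cluster is a set of events that are pairwise in immediate conflict and are pointed to by the same bundle sets; a cluster is a maximal one; $\langle e\rangle$ is the intersection of the clusters containing $e$.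 $\mathcal E$ is confusion free if $e\in\langle e'\rangle$ whenever $e,e'$ are in immediate conflict, and if $x,\ x\cup\{e\}\in\mathcal C(\mathcal E)$ and $\langle e\rangle\cap x=\emptyset$ imply $x\cup\{e''\}\in\mathcal C(\mathcal E)$ for all $e''\in\langle e\rangle$. Consider pairs $(\mathcal E,\pi)$ with $\pi$ a set of probability distributions on $E$. Such a pair is a pBES if $\mathcal E$ is confusion free, every $p\in\pi$ has support in some $\langle e\rangle$, every event is in the support of some $p\in\pi$, and final events lie in no bundle set. *Operations* (on disjoint copies; $\alpha\in[0,1]$). $0$ has no events; $1$ has one unlabelled final event $e$ and $\pi=\{\delta_e\}$; $a\in\Sigma$ is the same with label $a$. - $\mathcal E+\mathcal F$: events, bundles, labels, final events and distributions of both, with the additional conflicts $\mathrm{init}(\mathcal E)\times\mathrm{init}(\mathcal F)$ and $\Phi_{\mathcal E}\times\Phi_{\mathcal F}$ (symmetrised). - $\mathcal E\oplus_\alpha\mathcal F$: the BES of $\mathcal E+\mathcal F$; its distributions are all $(1-\alpha)p+\alpha q$ with $p\in\pi_{\mathcal E}$, $q\in\pi_{\mathcal F}$ supported in $\mathrm{init}(\mathcal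 E)$, $\mathrm{init}(\mathcal F)$ respectively, and all elements of $\pi_{\mathcal E}\cup\pi_{\mathcal F}$ not supported in $\mathrm{init}(\mathcal E)\cup\mathrm{init}(\mathcal F)$. - $\mathcal E\cdot\mathcal F$: the union, with the additional bundles $\Phi_{\mathcal E}\mapsto e$ for $e\in\mathrm{init}(\mathcal F)$, and final events $\Phi_{\mathcal F}$. - $\mathcal E\|\mathcal F$: the union plus two fresh unlabelled events $s,f$, with distributions $\delta_s,\delta_f$, the additional bundles $\{s\}\mapsto e$ for $e\in\mathrm{init}(\mathcal E)\cup\mathrm{init}(\mathcal F)$, $\Phi_{\mathcal E}\mapsto f$, $\Phi_{\mathcal F}\mapsto f$, and only final event $f$. - $\mathcal E*\mathcal F$: the limit (union, after renaming events) of the increasing sequence $\mathcal F,\ \mathcal F+\mathcal E\cdot\mathcal F,\ \mathcal F+\mathcal E\cdot(\mathcal F+\mathcal E\cdot\mathcal F),\dots$ A pair is *regular* if it is built from $0$, $1$ and the actions by these operations. *Simulation.* For $x\in\mathcal C(\mathcal E)$ write $x\to\Delta$ if $\Delta=\sum_e p(e)\,\delta_{x\cup\{e\}}$ is a distribution on $\mathcal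 C(\mathcal E)$ for some $p\in\pi$ whose support is disjoint from $x$. The lifting $\overline S$ of $S\subseteq X\times\mathcal D(Y)$ consists of the pairs $(\sum_i\alpha_i\delta_{x_i},\sum_i\alpha_i\Theta_i)$ with $(x_i,\Theta_i)\in S$ and finite convex weights $\alpha_i$. Let $\Rightarrow$ be the reflexive transitive closure of the lifting of $\{(x,\Delta): x\to\Delta\text{ or }\Delta=\delta_x\}$. A simulation from $\mathcal E$ to $\mathcal F$ is $S\subseteq\mathcal C(\mathcal E)\times\mathcal D(\mathcal C(\mathcal F))$ with $(\emptyset,\delta_\emptyset)\in S$ such that for all $(x,\Theta)\in S$: (i) $x\sqsubseteq_s y$ for all $y\in\mathrm{supp}\,\Theta$; (ii) if $x\to\Delta'$ then $\Theta\Rightarrow\Theta'$ and $(\Delta',\Theta')\in\overline S$ for some $\Theta'$; (iii) if $x$ contains a final event then so does every $y\in\mathrm{supp}\,\Theta$. Write $\mathcal E\sqsubseteq\mathcal F$ if there is one, and $\mathcal E\equiv\mathcal F$ if $\mathcal E\sqsubseteq\mathcal F\sqsubseteq\mathcal E$. **Theorem.** On regular pairs, $\sqsubseteq$ is a preorder,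 $+$, $\cdot$, $\|$ and $*$ are monotone in both arguments, $\mathcal E\sqsubseteq\mathcal F$ iff $\mathcal E+\mathcal F\equiv\mathcal F$, and the axioms of a probabilistic concurrent Kleene algebra with binary star hold for all regular $\mathcal E,\mathcal F,\mathcal G,\mathcal E',\mathcal F'$ and $\alpha,\beta\in[0,1]$: - $\mathcal E+\mathcal E\equiv\mathcal E$; $\mathcal E+\mathcal F\equiv\mathcal F+\mathcal E$; $\mathcal E+(\mathcal F+\mathcal G)\equiv(\mathcal E+\mathcal F)+\mathcal G$; $\mathcal E+0\equiv\mathcal E$; - $\mathcal E\equiv\mathcal E\oplus_\alpha\mathcal E$; $\mathcal E\oplus_\alpha\mathcal F\equiv\mathcal F\oplus_{1-\alpha}\mathcal E$; $\mathcal E\oplus_\alpha(\mathcal F\oplus_\beta\mathcal G)\equiv(\mathcal E\oplus_\gamma\mathcal F)\oplus_{\alpha\beta}\mathcal G$ for $\alpha\beta<1$, $\gamma=\frac{\alpha(1-\beta)}{1-\alpha\beta}$; $(\mathcal E\oplus_\alpha\mathcal F)\cdot\mathcal G\equiv\mathcal E\cdot\mathcal G\oplus_\alpha\mathcal F\cdot\mathcal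 G$; - $\mathcal E\cdot(\mathcal F\cdot\mathcal G)\equiv(\mathcal E\cdot\mathcal F)\cdot\mathcal G$; $\mathcal E\cdot1\equiv\mathcal E$; $1\cdot\mathcal E\equiv\mathcal E$; $0\cdot\mathcal E\equiv0$; - $1\|\mathcal E\equiv\mathcal E$; $\mathcal E\|\mathcal F\equiv\mathcal F\|\mathcal E$; $\mathcal E\|(\mathcal F\|\mathcal G)\equiv(\mathcal E\|\mathcal F)\|\mathcal G$; - $(\mathcal E+\mathcal F)\cdot\mathcal G\equiv\mathcal E\cdot\mathcal G+\mathcal F\cdot\mathcal G$; $\mathcal E\cdot\mathcal F+\mathcal E\cdot\mathcal G\sqsubseteq\mathcal E\cdot(\mathcal F+\mathcal G)$; $\mathcal E\cdot(\mathcal F\oplus_\alpha\mathcal G)\sqsubseteq\mathcal E\cdot\mathcal F\oplus_\alpha\mathcal E\cdot\mathcal G$; - $\mathcal E\|\mathcal F+\mathcal E\|\mathcal G\sqsubseteq\mathcal E\|(\mathcal F+\mathcal G)$; $\mathcal E\|(\mathcal F\oplus_\alpha\mathcal G)\sqsubseteq\mathcal E\|\mathcal F\oplus_\alpha\mathcal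 E\|\mathcal G$; $(\mathcal E\|\mathcal F)\cdot(\mathcal E'\|\mathcal F')\sqsubseteq(\mathcal E\cdot\mathcal E')\|(\mathcal F\cdot\mathcal F')$; - $\mathcal F+\mathcal E\cdot(\mathcal E*\mathcal F)\equiv\mathcal E*\mathcal F$; if $\mathcal G+\mathcal E\cdot\mathcal F\sqsubseteq\mathcal F$ then $\mathcal E*\mathcal G\sqsubseteq\mathcal F$. Moreover every regular pair is confusion free; $0$, $1$ and the actions are pBES; and if $\mathcal E,\mathcal F$ are regular pBES, then so are $\mathcal E+\mathcal F$ and $\mathcal E\|\mathcal F$, also $\mathcal E\oplus_\alpha\mathcal F$ if $0<\alpha<1$ and both have an initial event, and also $\mathcal E\cdot\mathcal F$ and $\mathcal E*\mathcal F$ if some configuration of $\mathcal E$ contains a final event. -/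

import Mathlib

universe u

namespace PBES

/-! ### Bundle event structures -/

/-- A bundle event structure over the set `Act` of actions: events, conflict, bundles, partial
labelling (unlabelled events have label `none`) and final events. `x.Pairwise conf` is `x # x`. -/
structure BES (Act : Type u) where
  Ev : Type
  conf : Ev → Ev → Prop
  conf_irrefl : ∀ e, ¬ conf e e
  conf_symm : ∀ e e', conf e e' → conf e' e
  bundle : Set Ev → Ev → Prop
  bundle_conf : ∀ x e, bundle x e → x.Pairwise conf
  label : Ev → Option Act
  final : Set Ev
  final_conf : final.Pairwise conf

namespace BES

variable {Act : Type u}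

/-- Initial events: those that no bundle points to. -/
def init (E : BES Act) : Set E.Ev := {e | ∀ x, ¬ E.bundle x e}

/-- Event traces: an event may be appended if it is new, in conflict with no earlier event, and
every bundle set pointing to it contains an earlier event. -/
inductive IsTrace (E : BES Act) : List E.Ev → Prop
  | nil : IsTrace E []
  | snoc (l : List E.Ev) (e : E.Ev) : IsTrace E l → e ∉ l → (∀ e' ∈ l, ¬ E.conf e e') →
      (∀ y, E.bundle y e → ∃ e' ∈ l, e' ∈ y) → IsTrace E (l ++ [e])

/-- The trace `l` is a linearisation of the set `x`. -/
def Linearises (E : BES Act) (l : List E.Ev) (x : Set E.Ev) : Prop :=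
  E.IsTrace l ∧ {e | e ∈ l} = x

def IsConfig (E : BES Act) (x : Set E.Ev) : Prop := ∃ l, E.Linearises l x

/-- The type of configurations. -/
abbrev Config (E : BES Act) : Type := {x : Set E.Ev // E.IsConfig x}

/-- The empty configuration. -/
def emptyConfig (E : BES Act) : E.Config :=
  ⟨∅, [], IsTrace.nil, by ext e; simp⟩

/-- `e` occurs in the sequence `l` no later than `e'`. -/
def ListLE {α : Type} (l : List α) (e e' : α) : Prop :=
  ∃ i j : Fin l.length, i ≤ j ∧ l.get i = e ∧ l.get j = e'

/-- The order of the labelled partial order of a configuration: the intersection of the orders of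
its linearisations. -/
def configLE (E : BES Act) (x : Set E.Ev) (e e' : E.Ev) : Prop :=
  ∀ l, E.Linearises l x → ListLE l e e'

/-- The labelled events of `x`. -/
def labelled (E : BES Act) (x : Set E.Ev) : Set E.Ev := {e | e ∈ x ∧ E.label e ≠ none}

/-- The implementation (subsumption) relation `x ⊑ₛ y`: a label-preserving monotone bijection from
the labelled events of `y` to those of `x`. -/
def Implements (E F : BES Act) (x : Set E.Ev) (y : Set F.Ev) : Prop :=
  ∃ f : F.labelled y ≃ E.labelled x,
    (∀ a, E.label (f a).1 = F.label a.1) ∧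
    ∀ a b, F.configLE y a.1 b.1 → E.configLE x (f a).1 (f b).1

/-- The structure has a configuration that contains a final event. -/
def CanTerminate (E : BES Act) : Prop := ∃ x, E.IsConfig x ∧ (x ∩ E.final).Nonempty

/-! ### Immediate conflict, clusters, confusion freeness -/

def ImmConf (E : BES Act) (e e' : E.Ev) : Prop :=
  E.conf e e' ∧ ∃ x, E.IsConfig x ∧ E.IsConfig (insert e x) ∧ E.IsConfig (insert e' x)

def IsPartialCluster (E : BES Act) (K : Set E.Ev) : Prop :=
  (∀ e ∈ K, ∀ e' ∈ K, e ≠ e' → E.ImmConf e e') ∧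
  ∀ e ∈ K, ∀ e' ∈ K, ∀ x, E.bundle x e → E.bundle x e'

/-- Clusters are the partial clusters that are maximal with respect to inclusion. -/
def IsCluster (E : BES Act) (K : Set E.Ev) : Prop := Maximal E.IsPartialCluster K

/-- `⟨e⟩`: the intersection of all clusters that contain `e`. -/
def clusterOf (E : BES Act) (e : E.Ev) : Set E.Ev := ⋂₀ {K | E.IsCluster K ∧ e ∈ K}

def ConfusionFree (E : BES Act) : Prop :=
  (∀ e e', E.ImmConf e e' → e ∈ E.clusterOf e') ∧
  ∀ e x, E.IsConfig x → E.clusterOf e ∩ x = ∅ → E.IsConfig (insert e x) →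
    ∀ e'' ∈ E.clusterOf e, E.IsConfig (insert e'' x)

/-! ### Operations on bundle event structures -/

/-- Deadlock. -/
abbrev zero : BES Act where
  Ev := Empty
  conf _ _ := False
  conf_irrefl _ h := h
  conf_symm _ _ h := h
  bundle _ _ := False
  bundle_conf _ _ h := h.elim
  label _ := none
  final := ∅
  final_conf := by simp

/-- A single final event, with label `a`. -/
abbrev single (a : Option Act) : BES Act where
  Ev := Unit
  conf _ _ := False
  conf_irrefl _ h := h
  conf_symm _ _ h := h
  bundle _ _ := False
  bundle_conf _ _ h := h.elim
  label _ := a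
  final := {()}
  final_conf := by simp

/-- Events of `E ‖ F`: those of `E` and `F`, and two fresh delimiters. -/
inductive ParEv (α β : Type) : Type
  | left (e : α)
  | right (e : β)
  | start
  | finish

def ParConf (E F : BES Act) : ParEv E.Ev F.Ev → ParEv E.Ev F.Ev → Prop
  | .left a, .left b => E.conf a b
  | .right a, .right b => F.conf a b
  | _, _ => False

inductive ParBundle (E F : BES Act) : Set (ParEv E.Ev F.Ev) → ParEv E.Ev F.Ev → Prop
  | left (x e) : E.bundle x e → ParBundle E F (ParEv.left '' x) (ParEv.left e)
  | right (x e) : F.bundle x e → ParBundle E F (ParEv.right '' x) (ParEv.right e)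
  | startLeft (e) : e ∈ E.init → ParBundle E F {ParEv.start} (ParEv.left e)
  | startRight (e) : e ∈ F.init → ParBundle E F {ParEv.start} (ParEv.right e)
  | finishLeft : ParBundle E F (ParEv.left '' E.final) ParEv.finish
  | finishRight : ParBundle E F (ParEv.right '' F.final) ParEv.finish

theorem pairwise_image {α β : Type} {r : α → α → Prop} {s : β → β → Prop} {x : Set α}
    (f : α → β) (h : ∀ a b, r a b → s (f a) (f b)) (hx : x.Pairwise r) :
    (f '' x).Pairwise s := by
  rintro _ ⟨a, ha, rfl⟩ _ ⟨b, hb, rfl⟩ hab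
  exact h a b (hx ha hb fun h => hab (by rw [h]))

/-- Concurrent composition. -/
abbrev par (E F : BES Act) : BES Act where
  Ev := ParEv E.Ev F.Ev
  conf := ParConf E F
  conf_irrefl := by
    rintro (e | e | _ | _) h
    · exact E.conf_irrefl e h
    · exact F.conf_irrefl e h
    · exact h
    · exact h
  conf_symm := by
    rintro (a | a | _ | _) (b | b | _ | _) h <;> first | exact h | skip
    · exact E.conf_symm a b h
    · exact F.conf_symm a b h
  bundle := ParBundle E F
  bundle_conf := by
    rintro _ _ (⟨x, e, h⟩ | ⟨x, e, h⟩ | _ | _ | _ | _)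
    · exact pairwise_image _ (fun _ _ h => h) (E.bundle_conf x e h)
    · exact pairwise_image _ (fun _ _ h => h) (F.bundle_conf x e h)
    · simp
    · simp
    · exact pairwise_image _ (fun _ _ h => h) E.final_conf
    · exact pairwise_image _ (fun _ _ h => h) F.final_conf
  label
    | .left e => E.label e
    | .right e => F.label e
    | _ => none
  final := {ParEv.finish}
  final_conf := by simp

def SeqConf (E F : BES Act) : E.Ev ⊕ F.Ev → E.Ev ⊕ F.Ev → Prop
  | .inl a, .inl b => E.conf a b
  | .inr a, .inr b => F.conf a b
  | _, _ => False

inductive SeqBundle (E F : BES Act) : Set (E.Ev ⊕ F.Ev) → E.Ev ⊕ F.Ev → Prop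
  | left (x e) : E.bundle x e → SeqBundle E F (Sum.inl '' x) (Sum.inl e)
  | right (x e) : F.bundle x e → SeqBundle E F (Sum.inr '' x) (Sum.inr e)
  | link (e) : e ∈ F.init → SeqBundle E F (Sum.inl '' E.final) (Sum.inr e)

/-- Sequential composition. -/
abbrev seq (E F : BES Act) : BES Act where
  Ev := E.Ev ⊕ F.Ev
  conf := SeqConf E F
  conf_irrefl := by
    rintro (e | e) h
    · exact E.conf_irrefl e h
    · exact F.conf_irrefl e h
  conf_symm := by
    rintro (a | a) (b | b) h <;> first | exact h | skip
    · exact E.conf_symm a b h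
    · exact F.conf_symm a b h
  bundle := SeqBundle E F
  bundle_conf := by
    rintro _ _ (⟨x, e, h⟩ | ⟨x, e, h⟩ | _)
    · exact pairwise_image _ (fun _ _ h => h) (E.bundle_conf x e h)
    · exact pairwise_image _ (fun _ _ h => h) (F.bundle_conf x e h)
    · exact pairwise_image _ (fun _ _ h => h) E.final_conf
  label := Sum.elim E.label F.label
  final := Sum.inr '' F.final
  final_conf := pairwise_image _ (fun _ _ h => h) F.final_conf

def PlusConf (E F : BES Act) : E.Ev ⊕ F.Ev → E.Ev ⊕ F.Ev → Prop
  | .inl a, .inl b => E.conf a b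
  | .inr a, .inr b => F.conf a b
  | .inl a, .inr b => (a ∈ E.init ∧ b ∈ F.init) ∨ (a ∈ E.final ∧ b ∈ F.final)
  | .inr b, .inl a => (a ∈ E.init ∧ b ∈ F.init) ∨ (a ∈ E.final ∧ b ∈ F.final)

inductive PlusBundle (E F : BES Act) : Set (E.Ev ⊕ F.Ev) → E.Ev ⊕ F.Ev → Prop
  | left (x e) : E.bundle x e → PlusBundle E F (Sum.inl '' x) (Sum.inl e)
  | right (x e) : F.bundle x e → PlusBundle E F (Sum.inr '' x) (Sum.inr e)

/-- Nondeterministic choice. -/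
abbrev plus (E F : BES Act) : BES Act where
  Ev := E.Ev ⊕ F.Ev
  conf := PlusConf E F
  conf_irrefl := by
    rintro (e | e) h
    · exact E.conf_irrefl e h
    · exact F.conf_irrefl e h
  conf_symm := by
    rintro (a | a) (b | b) h
    · exact E.conf_symm a b h
    · exact h
    · exact h
    · exact F.conf_symm a b h
  bundle := PlusBundle E F
  bundle_conf := by
    rintro _ _ (⟨x, e, h⟩ | ⟨x, e, h⟩)
    · exact pairwise_image _ (fun _ _ h => h) (E.bundle_conf x e h)
    · exact pairwise_image _ (fun _ _ h => h) (F.bundle_conf x e h)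
  label := Sum.elim E.label F.label
  final := Sum.inl '' E.final ∪ Sum.inr '' F.final
  final_conf := by
    rintro _ (⟨a, ha, rfl⟩ | ⟨a, ha, rfl⟩) _ (⟨b, hb, rfl⟩ | ⟨b, hb, rfl⟩) hab
    · exact E.final_conf ha hb fun h => hab (by rw [h])
    · exact Or.inr ⟨ha, hb⟩
    · exact Or.inr ⟨hb, ha⟩
    · exact F.final_conf ha hb fun h => hab (by rw [h])

/-- Events of `E * F`: the limit of `F ⊑ F + E·F ⊑ F + E·(F + E·F) ⊑ ⋯` consists of countably many
copies (unfolding levels `n = 0, 1, 2, …`) of `E` and of `F`. -/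
inductive StarEv (α β : Type) : Type
  | body (n : ℕ) (e : α)
  | exit (n : ℕ) (e : β)

/-- At each level `n` there is a choice between the `n`-th copy of `F` and the `n`-th copy of `E`
followed by the levels beyond `n`. -/
def StarConf (E F : BES Act) : StarEv E.Ev F.Ev → StarEv E.Ev F.Ev → Prop
  | .body n a, .body m b => n = m ∧ E.conf a b
  | .exit n a, .exit m b => (n = m ∧ F.conf a b) ∨ (n ≠ m ∧ a ∈ F.final ∧ b ∈ F.final)
  | .body n a, .exit m b => n = m ∧ a ∈ E.init ∧ b ∈ F.init
  | .exit m b, .body n a => n = m ∧ a ∈ E.init ∧ b ∈ F.init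

inductive StarBundle (E F : BES Act) : Set (StarEv E.Ev F.Ev) → StarEv E.Ev F.Ev → Prop
  | body (n x e) : E.bundle x e → StarBundle E F (StarEv.body n '' x) (StarEv.body n e)
  | exit (n x e) : F.bundle x e → StarBundle E F (StarEv.exit n '' x) (StarEv.exit n e)
  | linkBody (n e) : e ∈ E.init →
      StarBundle E F (StarEv.body n '' E.final) (StarEv.body (n + 1) e)
  | linkExit (n e) : e ∈ F.init →
      StarBundle E F (StarEv.body n '' E.final) (StarEv.exit (n + 1) e)

/-- The binary Kleene star. It is the limit of the approximants, see `star_is_limit` below. -/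
abbrev star (E F : BES Act) : BES Act where
  Ev := StarEv E.Ev F.Ev
  conf := StarConf E F
  conf_irrefl := by
    rintro (⟨n, e⟩ | ⟨n, e⟩) h
    · exact E.conf_irrefl e h.2
    · rcases h with h | h
      · exact F.conf_irrefl e h.2
      · exact h.1 rfl
  conf_symm := by
    rintro (⟨n, a⟩ | ⟨n, a⟩) (⟨m, b⟩ | ⟨m, b⟩) h
    · exact ⟨h.1.symm, E.conf_symm a b h.2⟩
    · exact h
    · exact h
    · rcases h with h | h
      · exact Or.inl ⟨h.1.symm, F.conf_symm a b h.2⟩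
      · exact Or.inr ⟨fun e => h.1 e.symm, h.2.2, h.2.1⟩
  bundle := StarBundle E F
  bundle_conf := by
    rintro _ _ (⟨n, x, e, h⟩ | ⟨n, x, e, h⟩ | ⟨n, e, h⟩ | ⟨n, e, h⟩)
    · exact pairwise_image _ (fun _ _ h => ⟨rfl, h⟩) (E.bundle_conf x e h)
    · exact pairwise_image _ (fun _ _ h => Or.inl ⟨rfl, h⟩) (F.bundle_conf x e h)
    · exact pairwise_image _ (fun _ _ h => ⟨rfl, h⟩) E.final_conf
    · exact pairwise_image _ (fun _ _ h => ⟨rfl, h⟩) E.final_conf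
  label
    | .body _ e => E.label e
    | .exit _ e => F.label e
  final := {z | ∃ n, ∃ e ∈ F.final, z = StarEv.exit n e}
  final_conf := by
    rintro _ ⟨n, a, ha, rfl⟩ _ ⟨m, b, hb, rfl⟩ hab
    by_cases h : n = m
    · subst h
      exact Or.inl ⟨rfl, F.final_conf ha hb fun h => hab (by rw [h])⟩
    · exact Or.inr ⟨h, ha, hb⟩

end BES

/-! ### Probabilistic bundle event structures -/

/-- A bundle event structure with a set of probability distributions on its events. -/
structure PES (Act : Type u) extends BES Act where
  dist : Set (PMF Ev)

namespace PES

variable {Act : Type u}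

/-- The defining conditions on a probabilistic bundle event structure: confusion freeness, every
distribution is supported in some `⟨e⟩`, and every event is in the support of some distribution;
together with the standing convention that final events belong to no bundle set. -/
structure IsPBES (E : PES Act) : Prop where
  confusionFree : E.ConfusionFree
  support_subset : ∀ p ∈ E.dist, ∃ e, p.support ⊆ E.clusterOf e
  covered : ∀ e : E.Ev, ∃ p ∈ E.dist, e ∈ p.support
  final_disjoint : ∀ x e, E.bundle x e → E.final ∩ x = ∅

noncomputable section

/-- Deadlock `(0, ∅)`. -/
abbrev zero : PES Act := { BES.zero with dist := ∅ }

/-- Skip `(1, {δ_e})`: one unlabelled event. -/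
abbrev one : PES Act := { BES.single none with dist := {PMF.pure ()} }

/-- The one-step action `(a, {δ_e})`. -/
abbrev atom (a : Act) : PES Act := { BES.single (some a) with dist := {PMF.pure ()} }

/-- Nondeterministic choice. -/
abbrev plus (E F : PES Act) : PES Act :=
  { BES.plus E.toBES F.toBES with
    dist := PMF.map Sum.inl '' E.dist ∪ PMF.map Sum.inr '' F.dist }

/-- Sequential composition. -/
abbrev seq (E F : PES Act) : PES Act :=
  { BES.seq E.toBES F.toBES with
    dist := PMF.map Sum.inl '' E.dist ∪ PMF.map Sum.inr '' F.dist }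

/-- Concurrent composition. -/
abbrev par (E F : PES Act) : PES Act :=
  { BES.par E.toBES F.toBES with
    dist := PMF.map BES.ParEv.left '' E.dist ∪ PMF.map BES.ParEv.right '' F.dist ∪
      {PMF.pure BES.ParEv.start, PMF.pure BES.ParEv.finish} }

/-- Probabilistic choice, which takes `E` with probability `1 - α` and `F` with probability `α`.
A distribution `r` is either `(1 - α) p + α q` for distributions `p` of `E` and `q` of `F` on initial
events, or a distribution of `E` or of `F` that is not supported in the initial events. -/
abbrev pchoice (α : unitInterval) (E F : PES Act) : PES Act :=
  { BES.plus E.toBES F.toBES with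
    dist := {r : PMF (E.Ev ⊕ F.Ev) |
      (∃ p ∈ E.dist, ∃ q ∈ F.dist, p.support ⊆ E.init ∧ q.support ⊆ F.init ∧
        ∀ z, r z = ENNReal.ofReal (1 - α) * (p.map Sum.inl) z
          + ENNReal.ofReal α * (q.map Sum.inr) z) ∨
      (r ∈ PMF.map Sum.inl '' E.dist ∪ PMF.map Sum.inr '' F.dist ∧
        ¬ r.support ⊆ Sum.inl '' E.init ∪ Sum.inr '' F.init)} }

/-- The binary Kleene star. -/
abbrev star (E F : PES Act) : PES Act :=
  { BES.star E.toBES F.toBES with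
    dist := {r | ∃ n, r ∈ PMF.map (BES.StarEv.body n) '' E.dist ∪
      PMF.map (BES.StarEv.exit n) '' F.dist} }

/-- The approximants `F`, `F + E·F`, `F + E·(F + E·F)`, … of `E * F`. -/
def approx (E F : PES Act) : ℕ → PES Act
  | 0 => F
  | n + 1 => plus F (seq E (approx E F n))

end

/-- `X ⊑ Y` after the renaming `j` of events: `X` is the substructure of `Y` on the range of `j`. -/
structure IsSub (X Y : PES Act) (j : X.Ev → Y.Ev) : Prop where
  inj : Function.Injective j
  conf : ∀ a b, X.conf a b ↔ Y.conf (j a) (j b)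
  bundle : ∀ x e, X.bundle x e → Y.bundle (j '' x) (j e)
  bundle_restrict : ∀ y e, Y.bundle y (j e) → ∃ x, y = j '' x ∧ X.bundle x e
  label : ∀ e, X.label e = Y.label (j e)
  final : ∀ e, e ∈ X.final ↔ j e ∈ Y.final
  dist : PMF.map j '' X.dist = {q | q ∈ Y.dist ∧ q.support ⊆ Set.range j}

/-- Passage to the next unfolding level. -/
def shift {α β : Type} : BES.StarEv α β → BES.StarEv α β
  | .body n e => .body (n + 1) e
  | .exit n e => .exit (n + 1) e

/-- The renaming of the events of the approximants to events of `E * F`. -/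
def toStar (E F : PES Act) : (n : ℕ) → (approx E F n).Ev → (star E F).Ev
  | 0, f => BES.StarEv.exit 0 f
  | _ + 1, Sum.inl f => BES.StarEv.exit 0 f
  | _ + 1, Sum.inr (Sum.inl e) => BES.StarEv.body 0 e
  | n + 1, Sum.inr (Sum.inr x) => shift (toStar E F n x)

theorem IsSub.init_iff {X Y : PES Act} {j : X.Ev → Y.Ev} (h : IsSub X Y j) (e : X.Ev) :
    e ∈ X.init ↔ j e ∈ Y.init := by
  constructor
  · intro he y hy
    obtain ⟨x, -, hx⟩ := h.bundle_restrict y e hy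
    exact he x hx
  · intro he x hx
    exact he _ (h.bundle x e hx)

theorem shift_injective {α β : Type} : Function.Injective (shift (α := α) (β := β)) := by
  rintro (⟨n, a⟩ | ⟨n, a⟩) (⟨m, b⟩ | ⟨m, b⟩) h <;> simp_all [shift]

theorem body_mem_init (E F : PES Act) (n : ℕ) (e : E.Ev) :
    BES.StarEv.body n e ∈ (star E F).init ↔ n = 0 ∧ e ∈ E.init := by
  constructor
  · intro h
    have he : e ∈ E.init := fun x hx => h _ (BES.StarBundle.body n x e hx)
    cases n with
    | zero => exact ⟨rfl, he⟩
    | succ n => exact (h _ (BES.StarBundle.linkBody n e he)).elim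
  · rintro ⟨rfl, he⟩ x hx
    cases hx with
    | body _ x _ hx => exact he x hx

theorem exit_mem_init (E F : PES Act) (n : ℕ) (e : F.Ev) :
    BES.StarEv.exit n e ∈ (star E F).init ↔ n = 0 ∧ e ∈ F.init := by
  constructor
  · intro h
    have he : e ∈ F.init := fun x hx => h _ (BES.StarBundle.exit n x e hx)
    cases n with
    | zero => exact ⟨rfl, he⟩
    | succ n => exact (h _ (BES.StarBundle.linkExit n e he)).elim
  · rintro ⟨rfl, he⟩ x hx
    cases hx with
    | exit _ x _ hx => exact he x hx

/-- The events of the `n`-th approximant: `E` at the levels below `n`, `F` at the levels up to `n`. -/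
theorem mem_range_toStar (E F : PES Act) (n : ℕ) (z : (star E F).Ev) :
    z ∈ Set.range (toStar E F n) ↔
      (∃ k e, k < n ∧ z = BES.StarEv.body k e) ∨ ∃ k e, k ≤ n ∧ z = BES.StarEv.exit k e := by
  induction n generalizing z with
  | zero =>
    constructor
    · rintro ⟨e, rfl⟩
      exact Or.inr ⟨0, e, le_rfl, rfl⟩
    · rintro (⟨k, e, hk, rfl⟩ | ⟨k, e, hk, rfl⟩)
      · omega
      · obtain rfl : k = 0 := by omega
        exact ⟨e, rfl⟩
  | succ n ih =>
    constructor
    · rintro ⟨e | e | e, rfl⟩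
      · exact Or.inr ⟨0, e, by omega, rfl⟩
      · exact Or.inl ⟨0, e, by omega, rfl⟩
      · rcases (ih (toStar E F n e)).1 ⟨e, rfl⟩ with ⟨k, a, hk, h⟩ | ⟨k, a, hk, h⟩
        · exact Or.inl ⟨k + 1, a, by omega, by simp only [toStar, h]; rfl⟩
        · exact Or.inr ⟨k + 1, a, by omega, by simp only [toStar, h]; rfl⟩
    · rintro (⟨k, e, hk, rfl⟩ | ⟨k, e, hk, rfl⟩)
      · cases k with
        | zero => exact ⟨Sum.inr (Sum.inl e), rfl⟩
        | succ k =>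
          obtain ⟨a, ha⟩ := (ih (BES.StarEv.body k e)).2 (Or.inl ⟨k, e, by omega, rfl⟩)
          exact ⟨Sum.inr (Sum.inr a), by simp only [toStar, ha]; rfl⟩
      · cases k with
        | zero => exact ⟨Sum.inl e, rfl⟩
        | succ k =>
          obtain ⟨a, ha⟩ := (ih (BES.StarEv.exit k e)).2 (Or.inr ⟨k, e, by omega, rfl⟩)
          exact ⟨Sum.inr (Sum.inr a), by simp only [toStar, ha]; rfl⟩

/-- One step of the unfolding: the renaming of `F + E·X` induced by a renaming of `X`. -/
def unfoldMap {E F X : PES Act} (j : X.Ev → (star E F).Ev) :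
    (plus F (seq E X)).Ev → (star E F).Ev
  | Sum.inl f => BES.StarEv.exit 0 f
  | Sum.inr (Sum.inl e) => BES.StarEv.body 0 e
  | Sum.inr (Sum.inr x) => shift (j x)

theorem shift_conf (E F : PES Act) (a b : (star E F).Ev) :
    (star E F).conf a b ↔ (star E F).conf (shift a) (shift b) := by
  rcases a with ⟨n, a⟩ | ⟨n, a⟩ <;> rcases b with ⟨m, b⟩ | ⟨m, b⟩ <;>
    simp [BES.StarConf, shift]

theorem shift_final (E F : PES Act) (a : (star E F).Ev) :
    a ∈ (star E F).final ↔ shift a ∈ (star E F).final := by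
  rcases a with ⟨n, a⟩ | ⟨n, a⟩ <;> simp [star, BES.star, shift]

theorem seq_init (E X : PES Act) (z : (seq E X).Ev) :
    z ∈ (seq E X).init ↔ ∃ e ∈ E.init, z = Sum.inl e := by
  rcases z with e | e
  · constructor
    · intro h
      exact ⟨e, fun x hx => h _ (BES.SeqBundle.left x e hx), rfl⟩
    · rintro ⟨e', he, h⟩ x hx
      cases h
      cases hx with
      | left x _ hx => exact he x hx
  · constructor
    · intro h
      have he : e ∈ X.init := fun x hx => h _ (BES.SeqBundle.right x e hx)
      exact (h _ (BES.SeqBundle.link e he)).elim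
    · rintro ⟨_, _, h⟩
      cases h

theorem isSub_unfold {E F X : PES Act} {j : X.Ev → (star E F).Ev} (h : IsSub X (star E F) j) :
    IsSub (plus F (seq E X)) (star E F) (unfoldMap j) where
  inj := by
    have hs (z : (star E F).Ev) (e) : shift z ≠ BES.StarEv.body 0 e := by
      rcases z with ⟨n, a⟩ | ⟨n, a⟩ <;> simp [shift]
    have hs' (z : (star E F).Ev) (e) : shift z ≠ BES.StarEv.exit 0 e := by
      rcases z with ⟨n, a⟩ | ⟨n, a⟩ <;> simp [shift]
    rintro (a | a | a) (b | b | b) hab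
    · cases hab; rfl
    · cases hab
    · exact (hs' _ _ hab.symm).elim
    · cases hab
    · cases hab; rfl
    · exact (hs _ _ hab.symm).elim
    · exact (hs' _ _ hab).elim
    · exact (hs _ _ hab).elim
    · rw [h.inj (shift_injective hab)]
  conf := by
    have key (a : F.Ev) (z : X.Ev) :
        (star E F).conf (BES.StarEv.exit 0 a) (shift (j z)) ↔ a ∈ F.final ∧ z ∈ X.final := by
      rw [h.final, shift_final]
      rcases j z with ⟨n, b⟩ | ⟨n, b⟩ <;> simp [BES.StarConf, shift]
    have key2 (a : E.Ev) (z : X.Ev) :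
        ¬ (star E F).conf (BES.StarEv.body 0 a) (shift (j z)) := by
      rcases j z with ⟨n, b⟩ | ⟨n, b⟩ <;> simp [BES.StarConf, shift]
    have i1 (a : E.Ev) : (Sum.inl a : (seq E X).Ev) ∈ (seq E X).init ↔ a ∈ E.init := by
      rw [seq_init]
      exact ⟨fun ⟨e, he, h⟩ => by cases h; exact he, fun h => ⟨a, h, rfl⟩⟩
    have i2 (a : X.Ev) : (Sum.inr a : (seq E X).Ev) ∉ (seq E X).init := by
      rw [seq_init]
      rintro ⟨e, he, h⟩
      cases h
    have f1 (a : E.Ev) : (Sum.inl a : (seq E X).Ev) ∉ (seq E X).final := by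
      rintro ⟨_, _, h⟩
      cases h
    have f2 (a : X.Ev) : (Sum.inr a : (seq E X).Ev) ∈ (seq E X).final ↔ a ∈ X.final :=
      ⟨fun ⟨e, he, h⟩ => by cases h; exact he, fun h => ⟨a, h, rfl⟩⟩
    have c1 (a : F.Ev) (b : E.Ev) : (plus F (seq E X)).conf (.inl a) (.inr (.inl b)) ↔
        b ∈ E.init ∧ a ∈ F.init := by
      change (a ∈ F.init ∧ _ ∈ (seq E X).init) ∨ (a ∈ F.final ∧ _ ∈ (seq E X).final) ↔ _
      rw [i1]
      have := f1 b
      tauto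
    have c2 (a : F.Ev) (b : X.Ev) : (plus F (seq E X)).conf (.inl a) (.inr (.inr b)) ↔
        a ∈ F.final ∧ b ∈ X.final := by
      change (a ∈ F.init ∧ _ ∈ (seq E X).init) ∨ (a ∈ F.final ∧ _ ∈ (seq E X).final) ↔ _
      rw [f2]
      have := i2 b
      tauto
    have sym (Y : PES Act) (a b : Y.Ev) : Y.conf a b ↔ Y.conf b a :=
      ⟨Y.conf_symm a b, Y.conf_symm b a⟩
    rintro (a | a | a) (b | b | b)
    · change F.conf a b ↔ (0 = 0 ∧ F.conf a b) ∨ (0 ≠ 0 ∧ _)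
      simp
    · rw [c1]
      change _ ↔ 0 = 0 ∧ _
      simp
    · rw [c2, ← key]; rfl
    · rw [sym, c1]
      change _ ↔ 0 = 0 ∧ _
      simp
    · change E.conf a b ↔ 0 = 0 ∧ E.conf a b
      simp
    · exact ⟨False.elim, fun h => (key2 _ _ h).elim⟩
    · rw [sym, c2, ← key, sym]; rfl
    · exact ⟨False.elim, fun h => (key2 _ _ ((sym _ _ _).1 h)).elim⟩
    · exact (h.conf a b).trans (shift_conf E F _ _)
  bundle := by
    have sh (x) (e : (star E F).Ev) (hx : (star E F).bundle x e) :
        (star E F).bundle (shift '' x) (shift e) := by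
      rcases hx with ⟨n, x, e, hx⟩ | ⟨n, x, e, hx⟩ | ⟨n, e, hx⟩ | ⟨n, e, hx⟩
      · have := BES.StarBundle.body (E := E.toBES) (F := F.toBES) (n + 1) x e hx
        rw [Set.image_image]; exact this
      · have := BES.StarBundle.exit (E := E.toBES) (F := F.toBES) (n + 1) x e hx
        rw [Set.image_image]; exact this
      · have := BES.StarBundle.linkBody (E := E.toBES) (F := F.toBES) (n + 1) e hx
        rw [Set.image_image]; exact this
      · have := BES.StarBundle.linkExit (E := E.toBES) (F := F.toBES) (n + 1) e hx
        rw [Set.image_image]; exact this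
    rintro _ _ (⟨x, e, hx⟩ | ⟨_, _, ⟨x, e, hx⟩ | ⟨x, e, hx⟩ | ⟨e, hx⟩⟩)
    · rw [Set.image_image]
      exact BES.StarBundle.exit 0 x e hx
    · rw [Set.image_image, Set.image_image]
      exact BES.StarBundle.body 0 x e hx
    · rw [Set.image_image, Set.image_image]
      have := sh _ _ (h.bundle x e hx)
      rw [Set.image_image] at this
      exact this
    · rw [Set.image_image, Set.image_image]
      have he := (h.init_iff e).1 hx
      change (star E F).bundle _ (shift (j e))
      rcases hz : j e with ⟨n, b⟩ | ⟨n, b⟩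
      · rw [hz] at he
        obtain ⟨rfl, hb⟩ := (body_mem_init E F n b).1 he
        exact BES.StarBundle.linkBody 0 b hb
      · rw [hz] at he
        obtain ⟨rfl, hb⟩ := (exit_mem_init E F n b).1 he
        exact BES.StarBundle.linkExit 0 b hb
  bundle_restrict := by
    rintro y (e | e | e) hy
    · change (star E F).bundle y (BES.StarEv.exit 0 e) at hy
      cases hy with
      | exit _ x _ hx =>
        exact ⟨Sum.inl '' x, by rw [Set.image_image]; rfl, BES.PlusBundle.left x e hx⟩
    · change (star E F).bundle y (BES.StarEv.body 0 e) at hy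
      cases hy with
      | body _ x _ hx =>
        exact ⟨Sum.inr '' (Sum.inl '' x), by rw [Set.image_image, Set.image_image]; rfl,
          BES.PlusBundle.right _ _ (BES.SeqBundle.left x e hx)⟩
    · change (star E F).bundle y (shift (j e)) at hy
      have main : (∃ y', y = shift '' y' ∧ (star E F).bundle y' (j e)) ∨
          (j e ∈ (star E F).init ∧ y = BES.StarEv.body 0 '' E.final) := by
        rcases hz : j e with ⟨n, b⟩ | ⟨n, b⟩ <;> rw [hz] at hy
        · change (star E F).bundle y (BES.StarEv.body (n + 1) b) at hy
          cases hy with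
          | body _ x _ hx =>
            exact Or.inl ⟨BES.StarEv.body n '' x, by rw [Set.image_image]; rfl,
              BES.StarBundle.body n x b hx⟩
          | linkBody _ _ hb =>
            cases n with
            | zero => exact Or.inr ⟨(body_mem_init E F 0 b).2 ⟨rfl, hb⟩, rfl⟩
            | succ n =>
              exact Or.inl ⟨BES.StarEv.body n '' E.final, by rw [Set.image_image]; rfl,
                BES.StarBundle.linkBody n b hb⟩
        · change (star E F).bundle y (BES.StarEv.exit (n + 1) b) at hy
          cases hy with
          | exit _ x _ hx =>
            exact Or.inl ⟨BES.StarEv.exit n '' x, by rw [Set.image_image]; rfl,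
              BES.StarBundle.exit n x b hx⟩
          | linkExit _ _ hb =>
            cases n with
            | zero => exact Or.inr ⟨(exit_mem_init E F 0 b).2 ⟨rfl, hb⟩, rfl⟩
            | succ n =>
              exact Or.inl ⟨BES.StarEv.body n '' E.final, by rw [Set.image_image]; rfl,
                BES.StarBundle.linkExit n b hb⟩
      rcases main with ⟨y', rfl, hy'⟩ | ⟨hi, rfl⟩
      · obtain ⟨x, rfl, hx⟩ := h.bundle_restrict y' e hy'
        exact ⟨Sum.inr '' (Sum.inr '' x), by simp only [Set.image_image]; rfl,
          BES.PlusBundle.right _ _ (BES.SeqBundle.right x e hx)⟩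
      · exact ⟨Sum.inr '' (Sum.inl '' E.final), by simp only [Set.image_image]; rfl,
          BES.PlusBundle.right _ _ (BES.SeqBundle.link e ((h.init_iff e).2 hi))⟩
  label := by
    rintro (e | e | e)
    · rfl
    · rfl
    · refine (h.label e).trans ?_
      change _ = (star E F).label (shift (j e))
      rcases j e with ⟨n, b⟩ | ⟨n, b⟩ <;> rfl
  final := by
    rintro (e | e | e)
    · constructor
      · rintro (⟨a, ha, hh⟩ | ⟨a, ha, hh⟩) <;> cases hh
        exact ⟨0, e, ha, rfl⟩
      · rintro ⟨n, a, ha, hh⟩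
        cases hh
        exact Or.inl ⟨e, ha, rfl⟩
    · constructor
      · rintro (⟨a, ha, hh⟩ | ⟨_, ⟨a, ha, rfl⟩, hh⟩) <;> cases hh
      · rintro ⟨n, a, ha, hh⟩
        cases hh
    · change _ ↔ shift (j e) ∈ _
      rw [← shift_final, ← h.final]
      constructor
      · rintro (⟨a, ha, hh⟩ | ⟨_, ⟨a, ha, rfl⟩, hh⟩) <;> cases hh
        exact ha
      · intro he
        exact Or.inr ⟨_, ⟨e, he, rfl⟩, rfl⟩
  dist := by
    have down (r : PMF (star E F).Ev) (hr : r ∈ (star E F).dist)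
        (hs : r.map shift ∈ (star E F).dist ∧
          (r.map shift).support ⊆ Set.range (unfoldMap (X := X) j)) :
        ∃ p ∈ X.dist, p.map j = r := by
      have : r ∈ PMF.map j '' X.dist := by
        rw [h.dist]
        refine ⟨hr, fun z hz => ?_⟩
        obtain ⟨w, hw⟩ := hs.2 ((PMF.mem_support_map_iff _ _ _).2 ⟨z, hz, rfl⟩)
        rcases w with w | w | w
        · rcases z with ⟨n, b⟩ | ⟨n, b⟩ <;> cases hw
        · rcases z with ⟨n, b⟩ | ⟨n, b⟩ <;> cases hw
        · exact ⟨w, shift_injective hw⟩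
      exact this
    have up (r : PMF (star E F).Ev) (hr : r ∈ (star E F).dist) :
        r.map shift ∈ (star E F).dist := by
      obtain ⟨n, ⟨p, hp, rfl⟩ | ⟨p, hp, rfl⟩⟩ := hr
      · exact ⟨n + 1, Or.inl ⟨p, hp, by rw [PMF.map_comp]; rfl⟩⟩
      · exact ⟨n + 1, Or.inr ⟨p, hp, by rw [PMF.map_comp]; rfl⟩⟩
    ext r
    constructor
    · rintro ⟨q, hq, rfl⟩
      refine ⟨?_, fun z hz => ?_⟩
      · rcases hq with ⟨p, hp, rfl⟩ | ⟨_, ⟨p, hp, rfl⟩ | ⟨p, hp, rfl⟩, rfl⟩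
        · exact ⟨0, Or.inr ⟨p, hp, by rw [PMF.map_comp]; rfl⟩⟩
        · refine ⟨0, Or.inl ⟨p, hp, ?_⟩⟩
          rw [PMF.map_comp, PMF.map_comp]; rfl
        · have h1 : p.map j ∈ (star E F).dist := by
            have : p.map j ∈ PMF.map j '' X.dist := ⟨p, hp, rfl⟩
            rw [h.dist] at this
            exact this.1
          have h2 := up _ h1
          rw [PMF.map_comp] at h2
          have h3 : PMF.map (unfoldMap (F := F) j) (PMF.map Sum.inr (PMF.map Sum.inr p)) =
              p.map (shift ∘ j) := (PMF.map_comp _ _ _).trans (PMF.map_comp _ _ _)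
          exact h3 ▸ h2
      · obtain ⟨w, -, hw⟩ := (PMF.mem_support_map_iff _ _ _).1 hz
        exact ⟨w, hw⟩
    · rintro ⟨⟨n, ⟨p, hp, rfl⟩ | ⟨p, hp, rfl⟩⟩, hs⟩
      · cases n with
        | zero =>
          refine ⟨(p.map Sum.inl).map Sum.inr, Or.inr ⟨_, Or.inl ⟨p, hp, rfl⟩, rfl⟩, ?_⟩
          exact (PMF.map_comp _ _ _).trans (PMF.map_comp _ _ _)
        | succ n =>
          have e1 : PMF.map (BES.StarEv.body (n + 1)) p =
              PMF.map shift (PMF.map (BES.StarEv.body (β := F.Ev) n) p) :=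
            by rw [PMF.map_comp]; rfl
          have hd : PMF.map (BES.StarEv.body n) p ∈ (star E F).dist := ⟨n, Or.inl ⟨p, hp, rfl⟩⟩
          rw [e1] at hs ⊢
          obtain ⟨q, hq, hqe⟩ := down _ hd ⟨up _ hd, hs⟩
          refine ⟨(q.map Sum.inr).map Sum.inr, Or.inr ⟨_, Or.inr ⟨q, hq, rfl⟩, rfl⟩, ?_⟩
          rw [← hqe]
          rw [PMF.map_comp, PMF.map_comp, PMF.map_comp]; rfl
      · cases n with
        | zero =>
          exact ⟨p.map Sum.inl, Or.inl ⟨p, hp, rfl⟩, PMF.map_comp _ _ _⟩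
        | succ n =>
          have e1 : PMF.map (BES.StarEv.exit (n + 1)) p =
              PMF.map shift (PMF.map (BES.StarEv.exit (α := E.Ev) n) p) :=
            by rw [PMF.map_comp]; rfl
          have hd : PMF.map (BES.StarEv.exit n) p ∈ (star E F).dist := ⟨n, Or.inr ⟨p, hp, rfl⟩⟩
          rw [e1] at hs ⊢
          obtain ⟨q, hq, hqe⟩ := down _ hd ⟨up _ hd, hs⟩
          refine ⟨(q.map Sum.inr).map Sum.inr, Or.inr ⟨_, Or.inr ⟨q, hq, rfl⟩, rfl⟩, ?_⟩
          rw [← hqe]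
          rw [PMF.map_comp, PMF.map_comp, PMF.map_comp]; rfl

theorem isSub_exit (E F : PES Act) : IsSub F (star E F) (BES.StarEv.exit 0) where
  inj := by
    intro a b h
    cases h
    rfl
  conf a b := by
    change F.conf a b ↔ (0 = 0 ∧ F.conf a b) ∨ (0 ≠ 0 ∧ _)
    simp
  bundle x e hx := BES.StarBundle.exit 0 x e hx
  bundle_restrict y e hy := by
    cases hy with
    | exit _ x _ hx => exact ⟨x, rfl, hx⟩
  label _ := rfl
  final e := by
    constructor
    · intro he
      exact ⟨0, e, he, rfl⟩
    · rintro ⟨n, a, ha, hh⟩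
      cases hh
      exact ha
  dist := by
    ext r
    constructor
    · rintro ⟨q, hq, rfl⟩
      refine ⟨⟨0, Or.inr ⟨q, hq, rfl⟩⟩, fun z hz => ?_⟩
      obtain ⟨w, -, hw⟩ := (PMF.mem_support_map_iff _ _ _).1 hz
      exact ⟨w, hw⟩
    · rintro ⟨⟨n, ⟨p, hp, rfl⟩ | ⟨p, hp, rfl⟩⟩, hs⟩
      · obtain ⟨z, hz⟩ := p.support_nonempty
        obtain ⟨w, hw⟩ := hs ((PMF.mem_support_map_iff _ _ _).2 ⟨z, hz, rfl⟩)
        cases hw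
      · obtain ⟨z, hz⟩ := p.support_nonempty
        obtain ⟨w, hw⟩ := hs ((PMF.mem_support_map_iff _ _ _).2 ⟨z, hz, rfl⟩)
        cases hw
        exact ⟨p, hp, rfl⟩

/-- Every approximant is, after renaming, a substructure of `E * F`. -/
theorem isSub_toStar (E F : PES Act) (n : ℕ) :
    IsSub (approx E F n) (star E F) (toStar E F n) := by
  induction n with
  | zero => exact isSub_exit E F
  | succ n ih =>
    have : toStar E F (n + 1) = unfoldMap (toStar E F n) := by
      funext z
      rcases z with z | z | z <;> rfl
    rw [this]
    exact isSub_unfold ih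

/-- `E * F` is the union of the increasing sequence of its approximants. -/
theorem star_is_limit (E F : PES Act) :
    (∀ n, IsSub (approx E F n) (star E F) (toStar E F n)) ∧
    (∀ n, Set.range (toStar E F n) ⊆ Set.range (toStar E F (n + 1))) ∧
    (⋃ n, Set.range (toStar E F n)) = Set.univ ∧
    ∀ r ∈ (star E F).dist, ∃ n, r.support ⊆ Set.range (toStar E F n) := by
  refine ⟨isSub_toStar E F, fun n z hz => ?_, ?_, ?_⟩
  · rw [mem_range_toStar] at hz ⊢
    rcases hz with ⟨k, e, hk, rfl⟩ | ⟨k, e, hk, rfl⟩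
    · exact Or.inl ⟨k, e, by omega, rfl⟩
    · exact Or.inr ⟨k, e, by omega, rfl⟩
  · refine Set.eq_univ_of_forall fun z => Set.mem_iUnion.2 ?_
    rcases z with ⟨k, e⟩ | ⟨k, e⟩
    · exact ⟨k + 1, (mem_range_toStar E F _ _).2 (Or.inl ⟨k, e, by omega, rfl⟩)⟩
    · exact ⟨k, (mem_range_toStar E F _ _).2 (Or.inr ⟨k, e, le_rfl, rfl⟩)⟩
  · rintro r ⟨k, ⟨p, -, rfl⟩ | ⟨p, -, rfl⟩⟩
    · refine ⟨k + 1, fun z hz => ?_⟩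
      obtain ⟨e, -, rfl⟩ := (PMF.mem_support_map_iff _ _ _).1 hz
      exact (mem_range_toStar E F _ _).2 (Or.inl ⟨k, e, by omega, rfl⟩)
    · refine ⟨k, fun z hz => ?_⟩
      obtain ⟨e, -, rfl⟩ := (PMF.mem_support_map_iff _ _ _).1 hz
      exact (mem_range_toStar E F _ _).2 (Or.inr ⟨k, e, le_rfl, rfl⟩)

/-! ### Probabilistic simulation -/

/-- Probabilistic prefixing `x ⊑ Δ`: for some distribution `p` of the structure whose support is
disjoint from `x`, `Δ` is the distribution `∑ p(e) δ_{x ∪ {e}}` (on configurations). -/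
def Step (E : PES Act) (x : E.Config) (Δ : PMF E.Config) : Prop :=
  ∃ p ∈ E.dist, p.support ∩ x.1 = ∅ ∧ Δ.map Subtype.val = p.map fun e => insert e x.1

/-- The lifting of `S ⊆ X × D(Y)` to `D(X) × D(Y)`: `Δ = ∑ᵢ αᵢ δ_{xᵢ}` and `Θ = ∑ᵢ αᵢ Θᵢ` with
`(xᵢ, Θᵢ) ∈ S`, where `i` ranges over a finite set and `∑ᵢ αᵢ = 1`. -/
def Lift {X Y : Type} (S : X → PMF Y → Prop) (Δ : PMF X) (Θ : PMF Y) : Prop :=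
  ∃ (n : ℕ) (α : PMF (Fin n)) (x : Fin n → X) (T : Fin n → PMF Y),
    (∀ i, S (x i) (T i)) ∧ Δ = α.map x ∧ Θ = α.bind T

/-- Weak transitions: finitely many lifted steps, in each of which every part of the distribution
either makes a prefixing step or stays where it is. -/
def Weak (E : PES Act) : PMF E.Config → PMF E.Config → Prop :=
  Relation.ReflTransGen (Lift fun x Δ => Δ = PMF.pure x ∨ E.Step x Δ)

/-- Probabilistic simulations from `E` to `F`. -/
structure IsSimulation (E F : PES Act) (S : E.Config → PMF F.Config → Prop) : Prop where
  empty : S E.emptyConfig (PMF.pure F.emptyConfig)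
  implements : ∀ x Θ, S x Θ → ∀ y ∈ Θ.support, BES.Implements E.toBES F.toBES x.1 y.1
  step : ∀ x Θ, S x Θ → ∀ Δ', E.Step x Δ' → ∃ Θ', F.Weak Θ Θ' ∧ Lift S Δ' Θ'
  final : ∀ x Θ, S x Θ → (x.1 ∩ E.final).Nonempty →
    ∀ y ∈ Θ.support, (y.1 ∩ F.final).Nonempty

/-- `E ⊑ F`: there is a probabilistic simulation from `E` to `F`. -/
def Sim (E F : PES Act) : Prop := ∃ S, IsSimulation E F S

/-- The regular structures: those built from deadlock, skip and the one-step actions by the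
operations. -/
inductive Regular : PES Act → Prop
  | zero : Regular zero
  | one : Regular one
  | atom (a : Act) : Regular (atom a)
  | plus {E F : PES Act} : Regular E → Regular F → Regular (plus E F)
  | pchoice (α : unitInterval) {E F : PES Act} : Regular E → Regular F → Regular (pchoice α E F)
  | seq {E F : PES Act} : Regular E → Regular F → Regular (seq E F)
  | par {E F : PES Act} : Regular E → Regular F → Regular (par E F)
  | star {E F : PES Act} : Regular E → Regular F → Regular (star E F)

end PES

/-- The type of regular probabilistic bundle event structures, with its operations and the
simulation preorder. -/
abbrev RegPES (Act : Type u) : Type (max 1 u) := {E : PES Act // E.Regular}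

namespace RegPES

variable {Act : Type u}

abbrev le (E F : RegPES Act) : Prop := E.1.Sim F.1
noncomputable abbrev zero : RegPES Act := ⟨PES.zero, .zero⟩
noncomputable abbrev one : RegPES Act := ⟨PES.one, .one⟩
noncomputable abbrev atom (a : Act) : RegPES Act := ⟨PES.atom a, .atom a⟩
noncomputable abbrev plus (E F : RegPES Act) : RegPES Act := ⟨E.1.plus F.1, E.2.plus F.2⟩
noncomputable abbrev pchoice (α : unitInterval) (E F : RegPES Act) : RegPES Act :=
  ⟨E.1.pchoice α F.1, E.2.pchoice α F.2⟩
noncomputable abbrev seq (E F : RegPES Act) : RegPES Act := ⟨E.1.seq F.1, E.2.seq F.2⟩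
noncomputable abbrev par (E F : RegPES Act) : RegPES Act := ⟨E.1.par F.1, E.2.par F.2⟩
noncomputable abbrev star (E F : RegPES Act) : RegPES Act := ⟨E.1.star F.1, E.2.star F.2⟩

end RegPES

/-- `A`, preordered by `le` and taken modulo the equivalence `≡` generated by `le`, is a
probabilistic concurrent Kleene algebra with a binary Kleene star: `le` is a preorder for which
`plus`, `seq`, `par` and `star` are monotone (so that they are compatible with `≡`), and the
axioms hold. `pc α x y` is the probabilistic choice with probability `α` of `y`. -/
structure IsPCKA {A : Type*} (le : A → A → Prop) (zero one : A) (plus : A → A → A)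
    (pc : unitInterval → A → A → A) (seq par star : A → A → A) : Prop where
  le_refl : ∀ x, le x x
  le_trans : ∀ x y z, le x y → le y z → le x z
  plus_mono : ∀ x x' y y', le x x' → le y y' → le (plus x y) (plus x' y')
  seq_mono : ∀ x x' y y', le x x' → le y y' → le (seq x y) (seq x' y')
  par_mono : ∀ x x' y y', le x x' → le y y' → le (par x y) (par x' y')
  star_mono : ∀ x x' y y', le x x' → le y y' → le (star x y) (star x' y')
  le_iff_plus : ∀ x y, le x y ↔ AntisymmRel le (plus x y) y
  plus_idem : ∀ x, AntisymmRel le (plus x x) x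
  plus_comm : ∀ x y, AntisymmRel le (plus x y) (plus y x)
  plus_assoc : ∀ x y z, AntisymmRel le (plus x (plus y z)) (plus (plus x y) z)
  plus_zero : ∀ x, AntisymmRel le (plus x zero) x
  pc_idem : ∀ α x, AntisymmRel le x (pc α x x)
  pc_comm : ∀ α x y, AntisymmRel le (pc α x y) (pc (unitInterval.symm α) y x)
  pc_assoc : ∀ (α β γ : unitInterval) (x y z), (α * β : ℝ) < 1 →
    (γ : ℝ) = α * (1 - β) / (1 - α * β) →
    AntisymmRel le (pc α x (pc β y z)) (pc (α * β) (pc γ x y) z)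
  pc_seq : ∀ α x y z, AntisymmRel le (seq (pc α x y) z) (pc α (seq x z) (seq y z))
  seq_assoc : ∀ x y z, AntisymmRel le (seq x (seq y z)) (seq (seq x y) z)
  seq_one : ∀ x, AntisymmRel le (seq x one) x
  one_seq : ∀ x, AntisymmRel le (seq one x) x
  zero_seq : ∀ x, AntisymmRel le (seq zero x) zero
  one_par : ∀ x, AntisymmRel le (par one x) x
  par_comm : ∀ x y, AntisymmRel le (par x y) (par y x)
  par_assoc : ∀ x y z, AntisymmRel le (par x (par y z)) (par (par x y) z)
  plus_seq : ∀ x y z, AntisymmRel le (seq (plus x y) z) (plus (seq x z) (seq y z))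
  seq_plus_le : ∀ x y z, le (plus (seq x y) (seq x z)) (seq x (plus y z))
  seq_pc_le : ∀ α x y z, le (seq x (pc α y z)) (pc α (seq x y) (seq x z))
  par_plus_le : ∀ x y z, le (plus (par x y) (par x z)) (par x (plus y z))
  par_pc_le : ∀ α x y z, le (par x (pc α y z)) (pc α (par x y) (par x z))
  interchange : ∀ x y x' y', le (seq (par x y) (par x' y')) (par (seq x x') (seq y y'))
  star_unfold : ∀ x y, AntisymmRel le (plus y (seq x (star x y))) (star x y)
  star_induction : ∀ x y z, le (plus z (seq x y)) y → le (star x z) y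

end PBES

/-! The axioms are statements about simulations, so the proof is a small calculus of simulations,
applied to explicit descriptions of the configurations of composite structures.

Three facts make configurations manageable. They can be handled as sets: whether an event can be
added depends only on the set (`enab_of_insert`), and the order of a configuration is determined by
its subconfigurations (`configLE_iff`), so that `x ⊑ₛ y` is verified by matching subconfigurations
(`implements_of_configs`). Each operation has a description of its configurations
(`isConfig_plus_iff`, `isConfig_seq_iff`, `isConfig_par_iff`, `IsConfig.starShape`). Regular
structures satisfy the invariants `Good`: finite supports, pairwise conflicting initial events, and
maximality of configurations with a final event. By the last one, a factor that has terminated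
cannot move any more.

Simulations relate configurations to distributions. `Sim.nsim` replaces a simulation by one that is
convex and whose answers are kernels. Weak transitions can be pushed through such a simulation
(`NSim.weak`), and transitivity follows. `Weak.bind` lets the parts of a mixture move independently.

Choice is the join (`plus_le` with `le_plus_left` and `le_plus_right`); this settles its own laws
and, with monotonicity, the easy halves of distributivity. The other axioms need one of four kinds
of simulation. Maps of events (`sim_of_map_dist`) give associativity of `seq` and of `pchoice`, and
the commutativity laws. Maps of configurations (`sim_of_fun`) give the units, associativity of `par`
and the interchange law; there, unlabelled events are skipped or executed at convenient moments.
Coverings (`sim_of_cover`) give right distributivity, where one copy of `G` is simulated by two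
copies. Mixtures (`pcMix`) give idempotence of `pchoice` and its two inequalities: the right-hand
side tosses its coin no later than the left-hand side, and an undecided configuration is answered by
the average of both outcomes.

The unfolding of the star is an isomorphism. For the induction rule, a configuration of `E * G` is
finite and meets only finitely many copies of `E`; it is evaluated in `F` from the inside out, with
`G ⊑ F` at the exit and `E·F ⊑ F` at every copy of `E` (`StarRel`). No continuity argument is
needed.

For the remaining claims, every regular structure carries an equivalence relation `ClusterRel` of
alternatives that share their bundles and are enabled together. Hence the cluster of `e` consists of
`e` and the events in immediate conflict with it (`clusterOf_eq`), and confusion freeness follows.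
Supports stay inside clusters because the configurations that witness immediate conflict can be
carried into the composite structure (`Transport`). For the second factor of a sequential
composition, and for the levels of a star, this requires that the first factor can terminate. -/

namespace PBES
namespace BES

variable {Act : Type u}

/-! ### Configurations as sets -/

/-- The event `e` can be appended to a linearisation of `x`. -/
def Enab (E : BES Act) (x : Set E.Ev) (e : E.Ev) : Prop :=
  e ∉ x ∧ (∀ e' ∈ x, ¬ E.conf e e') ∧ ∀ y, E.bundle y e → ∃ e' ∈ x, e' ∈ y

theorem Linearises.snoc {E : BES Act} {l : List E.Ev} {x : Set E.Ev} {e : E.Ev}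
    (h : E.Linearises l x) (he : E.Enab x e) : E.Linearises (l ++ [e]) (insert e x) := by
  obtain ⟨ht, rfl⟩ := h
  refine ⟨IsTrace.snoc l e ht he.1 he.2.1 he.2.2, ?_⟩
  ext a
  simp [or_comm]

theorem isConfig_empty (E : BES Act) : E.IsConfig ∅ := E.emptyConfig.2

theorem IsConfig.insert {E : BES Act} {x : Set E.Ev} {e : E.Ev} (h : E.IsConfig x)
    (he : E.Enab x e) : E.IsConfig (insert e x) := by
  obtain ⟨l, hl⟩ := h
  exact ⟨_, hl.snoc he⟩

/-- Configurations are generated from `∅` by adding enabled events. With this principle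
linearisations are hardly needed any more. -/
theorem IsConfig.induction {E : BES Act} {P : ∀ x, E.IsConfig x → Prop}
    (h0 : P ∅ E.isConfig_empty)
    (h1 : ∀ x e (hx : E.IsConfig x) (he : E.Enab x e), P x hx → P _ (hx.insert he))
    {x : Set E.Ev} (hx : E.IsConfig x) : P x hx := by
  -- The proof that the set is a configuration is bundled with `P`, so that the set equality `h8`
  -- can rewrite both at once.
  have key : ∃ h : E.IsConfig x, P x h := by
    obtain ⟨l, hl, rfl⟩ := hx
    induction hl with
    | nil => exact ⟨by simpa using E.isConfig_empty, by simpa using h0⟩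
    | snoc l e ht h2 h3 h4 ih =>
      have h5 : E.Enab {a | a ∈ l} e := ⟨h2, h3, h4⟩
      obtain ⟨h6, h7⟩ := ih
      have h8 : Insert.insert e {a | a ∈ l} = {a | a ∈ l ++ [e]} := by
        ext a
        simp [or_comm]
      exact h8 ▸ ⟨_, h1 _ e h6 h5 h7⟩
  exact key.2

theorem IsConfig.finite {E : BES Act} {x : Set E.Ev} (hx : E.IsConfig x) : x.Finite :=
  IsConfig.induction (P := fun x _ => x.Finite) Set.finite_empty (fun _ _ _ _ h => h.insert _) hx

theorem IsConfig.conflictFree {E : BES Act} {x : Set E.Ev} (hx : E.IsConfig x) :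
    ∀ a ∈ x, ∀ b ∈ x, ¬ E.conf a b := by
  induction hx using IsConfig.induction with
  | h0 => simp
  | h1 x e hx he ih =>
    rintro a (rfl | ha) b (rfl | hb)
    · exact E.conf_irrefl _
    · exact he.2.1 b hb
    · exact fun h => he.2.1 a ha (E.conf_symm _ _ h)
    · exact ih a ha b hb

/-- The witness occurs before `e` in a linearisation. Of this, the clause `e' ≠ e` is what survives
in terms of sets, and it is all that `enab_of_insert` needs. -/
theorem IsConfig.bundle_met {E : BES Act} {x : Set E.Ev} (hx : E.IsConfig x) :
    ∀ e ∈ x, ∀ y, E.bundle y e → ∃ e' ∈ x, e' ≠ e ∧ e' ∈ y := by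
  induction hx using IsConfig.induction with
  | h0 => simp
  | h1 x e hx he ih =>
    rintro a (rfl | ha) y hy
    · obtain ⟨e', h1, h2⟩ := he.2.2 y hy
      exact ⟨e', Or.inr h1, fun h => he.1 (h ▸ h1), h2⟩
    · obtain ⟨e', h1, h2⟩ := ih a ha y hy
      exact ⟨e', Or.inr h1, h2⟩

/-- Conflict freeness and the presence of bundle elements do not refer to an order. Hence `e` need
not come last in a linearisation, and `x` need not be known to be a configuration. -/
theorem IsConfig.enab_of_insert {E : BES Act} {x : Set E.Ev} {e : E.Ev}
    (hi : E.IsConfig (Insert.insert e x)) (he : e ∉ x) : E.Enab x e := by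
  refine ⟨he, fun e' h => hi.conflictFree e (Or.inl rfl) e' (Or.inr h), fun y hy => ?_⟩
  obtain ⟨e', h1, h2, h3⟩ := hi.bundle_met e (Or.inl rfl) y hy
  exact ⟨e', h1.resolve_left h2, h3⟩

/-- A nonempty configuration contains an initial event. -/
theorem IsConfig.exists_init {E : BES Act} {x : Set E.Ev} (hx : E.IsConfig x)
    (hn : x.Nonempty) : ∃ e ∈ x, e ∈ E.init := by
  induction hx using IsConfig.induction with
  | h0 => simp at hn
  | h1 x e hx he ih =>
    rcases x.eq_empty_or_nonempty with rfl | h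
    · refine ⟨e, Or.inl rfl, fun y hy => ?_⟩
      obtain ⟨e', h1, -⟩ := he.2.2 y hy
      exact h1
    · obtain ⟨a, h1, h2⟩ := ih h
      exact ⟨a, Or.inr h1, h2⟩

theorem Enab.mem_init {E : BES Act} {e : E.Ev} (h : E.Enab ∅ e) : e ∈ E.init := fun y hy => by
  obtain ⟨e', h1, -⟩ := h.2.2 y hy
  exact h1

theorem enab_empty_iff {E : BES Act} {e : E.Ev} : E.Enab ∅ e ↔ e ∈ E.init :=
  ⟨Enab.mem_init, fun h => ⟨by simp, by simp, fun y hy => (h y hy).elim⟩⟩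

/-- Take the first event of a linearisation of `x` that is missing from `w`: all events before it
are in `w`. The set `w` can be any proper subset. -/
theorem IsConfig.exists_enab {E : BES Act} {x w : Set E.Ev} (hx : E.IsConfig x) (hw : w ⊆ x)
    (hne : w ≠ x) : ∃ e ∈ x, E.Enab w e := by
  have key : ∀ w ⊆ x, w ≠ x → ∃ e ∈ x, e ∉ w ∧ ∀ y, E.bundle y e → ∃ e' ∈ w, e' ∈ y := by
    clear hw hne w
    induction hx using IsConfig.induction with
    | h0 => intro w hw hne; exact (hne (Set.subset_empty_iff.1 hw)).elim
    | h1 x e hx he ih =>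
      intro w hw hne
      by_cases hxw : x ⊆ w
      · have hew : e ∉ w := fun h => hne (hw.antisymm (Set.insert_subset h hxw))
        refine ⟨e, Or.inl rfl, hew, fun y hy => ?_⟩
        obtain ⟨e', h1, h2⟩ := he.2.2 y hy
        exact ⟨e', hxw h1, h2⟩
      · obtain ⟨a, h1, h2, h3⟩ := ih (w ∩ x) Set.inter_subset_right
          (fun h => hxw (h ▸ Set.inter_subset_left))
        refine ⟨a, Or.inr h1, fun h => h2 ⟨h, h1⟩, fun y hy => ?_⟩
        obtain ⟨e', h4, h5⟩ := h3 y hy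
        exact ⟨e', h4.1, h5⟩
  obtain ⟨e, h1, h2, h3⟩ := key w hw hne
  exact ⟨e, h1, h2, fun e' h => hx.conflictFree e h1 e' (hw h), h3⟩

/-- As long as events of `x` are missing, `exists_enab` provides one that can be appended; the
induction is on the number of missing events. -/
theorem Linearises.extend {E : BES Act} {x : Set E.Ev} (hx : E.IsConfig x) (n : ℕ) :
    ∀ {w : Set E.Ev} {l : List E.Ev}, w ⊆ x → E.Linearises l w → (x \ w).ncard = n →
      ∃ l', E.Linearises (l ++ l') x := by
  induction n with
  | zero =>
    intro w l hw hl hn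
    rw [Set.ncard_eq_zero (hx.finite.sdiff), Set.sdiff_eq_empty] at hn
    exact ⟨[], by simpa [hn.antisymm hw] using hl⟩
  | succ n ih =>
    intro w l hw hl hn
    have hne : w ≠ x := by
      rintro rfl
      simp at hn
    obtain ⟨e, he, hen⟩ := hx.exists_enab hw hne
    have h2 : (x \ insert e w).ncard = n := by
      have : x \ insert e w = (x \ w) \ {e} := by
        ext a
        simp only [Set.mem_sdiff, Set.mem_insert_iff, Set.mem_singleton_iff]
        tauto
      rw [this, Set.ncard_sdiff_singleton_of_mem (show e ∈ x \ w from ⟨he, hen.1⟩), hn]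
      rfl
    obtain ⟨l', hl'⟩ := ih (Set.insert_subset he hw) (hl.snoc hen) h2
    exact ⟨e :: l', by simpa using hl'⟩

theorem IsTrace.of_append {E : BES Act} {l l' : List E.Ev} (h : E.IsTrace (l ++ l')) :
    E.IsTrace l := by
  induction l' using List.reverseRecOn with
  | nil => simpa using h
  | append_singleton l' a ih =>
    apply ih
    rw [← List.append_assoc] at h
    generalize hm : l ++ l' ++ [a] = m at h
    cases h with
    | nil => simp at hm
    | snoc k e hk =>
      obtain ⟨rfl, -⟩ := List.append_inj' hm rfl
      exact hk

theorem IsTrace.nodup {E : BES Act} {l : List E.Ev} (h : E.IsTrace l) : l.Nodup := by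
  induction h with
  | nil => simp
  | snoc l e _ h _ _ ih =>
    rw [List.nodup_append]
    refine ⟨ih, by simp, ?_⟩
    rintro a ha b hb rfl
    simp at hb
    exact h (hb ▸ ha)

/-- The order of a configuration in terms of its subconfigurations. -/
theorem configLE_iff {E : BES Act} {x : Set E.Ev} (hx : E.IsConfig x) (a b : E.Ev) :
    E.configLE x a b ↔
      a ∈ x ∧ b ∈ x ∧ ∀ w, E.IsConfig w → w ⊆ x → b ∈ w → a ∈ w := by
  constructor
  · intro h
    have h0 : ∀ l, E.Linearises l x → a ∈ x ∧ b ∈ x := by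
      rintro l ⟨hl, rfl⟩
      obtain ⟨i, j, -, rfl, rfl⟩ := h l ⟨hl, rfl⟩
      exact ⟨List.get_mem _ _, List.get_mem _ _⟩
    obtain ⟨l, hl⟩ := hx
    refine ⟨(h0 l hl).1, (h0 l hl).2, ?_⟩
    -- A linearisation of `w` is continued to one of `x`. In it `a` is not later than `b`, and `b`
    -- lies in the initial part, so `a` lies there too.
    rintro w ⟨k, hk⟩ hwx hb
    obtain ⟨k', hk'⟩ := Linearises.extend ⟨l, hl⟩ _ hwx hk rfl
    obtain ⟨i, j, hij, rfl, rfl⟩ := h _ hk'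
    have hkw := hk.2
    subst hkw
    have hj : j.1 < k.length := by
      obtain ⟨m, hm, hme⟩ := List.mem_iff_getElem.1 hb
      have h1 : (k ++ k')[m]'(by simp; omega) = (k ++ k')[j.1] := by
        rw [List.getElem_append_left hm, hme]; rfl
      have h2 := (List.Nodup.getElem_inj_iff hk'.1.nodup).1 h1
      omega
    have hi : i.1 < k.length := lt_of_le_of_lt hij hj
    have : (k ++ k').get i = k[i.1] := by
      simp [List.getElem_append_left hi]
    simp only [Set.mem_ofPred_eq]
    rw [this]
    exact List.getElem_mem _
  · rintro ⟨ha, hb, h⟩ l ⟨hl, rfl⟩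
    obtain ⟨j, hj, rfl⟩ := List.mem_iff_getElem.1 hb
    -- The prefix up to and including `b`, hence of length `j + 1`, is a subconfiguration; so it
    -- contains `a`.
    have h1 : E.IsTrace (l.take (j + 1)) := by
      apply IsTrace.of_append (l' := l.drop (j + 1))
      rwa [List.take_append_drop]
    have h2 := h _ ⟨_, h1, rfl⟩ (fun e he => List.mem_of_mem_take he)
      (List.mem_take_iff_getElem.2 ⟨j, by simp; omega, rfl⟩)
    obtain ⟨i, hi, rfl⟩ := List.mem_take_iff_getElem.1 h2
    exact ⟨⟨i, by omega⟩, ⟨j, hj⟩, by simp only [Fin.mk_le_mk]; omega, rfl, rfl⟩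

/-- When `x` is built up event by event, one of `a`, `b` is added first, which yields a
subconfiguration with just one of them unless they are equal. -/
theorem configLE_antisymm {E : BES Act} {x : Set E.Ev} (hx : E.IsConfig x) {a b : E.Ev}
    (h : E.configLE x a b) (h' : E.configLE x b a) : a = b := by
  have hab := h
  rw [configLE_iff hx] at h h'
  by_contra hne
  obtain ⟨ha, hb, h⟩ := h
  obtain ⟨-, -, h'⟩ := h'
  have key : ∀ z, E.IsConfig z → z ⊆ x → a ∉ z ∧ b ∉ z := by
    intro z hz
    induction hz using IsConfig.induction with
    | h0 => simp
    | h1 z e hz he ih =>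
      intro hzx
      obtain ⟨i1, i2⟩ := ih ((Set.subset_insert _ _).trans hzx)
      have j1 := h _ (hz.insert he) hzx
      have j2 := h' _ (hz.insert he) hzx
      simp only [Set.mem_insert_iff, i1, i2, or_false] at j1 j2 ⊢
      constructor
      · intro hae
        exact hne (hae.trans (j2 hae).symm)
      · intro hbe
        exact hne ((j1 hbe).trans hbe.symm)
  exact (key x hx subset_rfl).1 ha

theorem configLE_refl {E : BES Act} {x : Set E.Ev} (hx : E.IsConfig x) {a : E.Ev} (h : a ∈ x) :
    E.configLE x a a := (configLE_iff hx a a).2 ⟨h, h, fun _ _ _ h => h⟩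

/-! ### The implementation relation through relations between events -/

/-- The relation `r` restricts to a label-preserving bijection of the labelled events of `y` and `x`
that is monotone. -/
structure Impl (E F : BES Act) (x : Set E.Ev) (y : Set F.Ev) (r : F.Ev → E.Ev → Prop) : Prop where
  mem : ∀ a b, r a b → a ∈ y ∧ b ∈ x
  label : ∀ a b, r a b → E.label b = F.label a
  left : ∀ a ∈ y, F.label a ≠ none → ∃ b, r a b
  right : ∀ b ∈ x, E.label b ≠ none → ∃ a, r a b
  inj : ∀ a a' b, E.label b ≠ none → r a b → r a' b → a = a'
  mono : ∀ a a' b b', E.label b ≠ none → E.label b' ≠ none → r a b → r a' b' →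
    F.configLE y a a' → E.configLE x b b'

/-- `Impl` does not ask `r` to be single-valued on labelled events, because this is automatic: if
`a` is related to `b` and `b'`, monotonicity applied to `a ≤ a` gives `b ≤ b'` and `b' ≤ b`. -/
theorem Impl.implements {E F : BES Act} {x : Set E.Ev} {y : Set F.Ev} {r : F.Ev → E.Ev → Prop}
    (h : Impl E F x y r) (hx : E.IsConfig x) (hy : F.IsConfig y) : Implements E F x y := by
  have h1 : ∀ a : F.labelled y, ∃ b : E.labelled x, r a.1 b.1 := by
    rintro ⟨a, ha, hl⟩
    obtain ⟨b, hb⟩ := h.left a ha hl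
    exact ⟨⟨b, (h.mem a b hb).2, by rw [h.label a b hb]; exact hl⟩, hb⟩
  have h2 : ∀ b : E.labelled x, ∃ a : F.labelled y, r a.1 b.1 := by
    rintro ⟨b, hb, hl⟩
    obtain ⟨a, ha⟩ := h.right b hb hl
    exact ⟨⟨a, (h.mem a b ha).1, by rw [← h.label a b ha]; exact hl⟩, ha⟩
  choose f hf using h1
  choose g hg using h2
  have u : ∀ a b b', E.label b ≠ none → E.label b' ≠ none → r a b → r a b' → b = b' :=
    fun a b b' l l' h3 h4 =>
    configLE_antisymm hx
      (h.mono a a b b' l l' h3 h4 (configLE_refl hy (h.mem _ _ h3).1))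
      (h.mono a a b' b l' l h4 h3 (configLE_refl hy (h.mem _ _ h3).1))
  refine ⟨⟨f, g, fun a => Subtype.ext ?_, fun b => Subtype.ext ?_⟩,
    fun a => h.label _ _ (hf a), fun a b => h.mono _ _ _ _ (f a).2.2 (f b).2.2 (hf a) (hf b)⟩
  · exact h.inj _ _ (f a).1 (f a).2.2 (hg (f a)) (hf a)
  · exact u (g b).1 _ _ (f (g b)).2.2 b.2.2 (hf (g b)) (hg b)

theorem Implements.impl {E F : BES Act} {x : Set E.Ev} {y : Set F.Ev}
    (h : Implements E F x y) : ∃ r, Impl E F x y r := by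
  obtain ⟨f, h1, h2⟩ := h
  refine ⟨fun a b => ∃ ha : a ∈ F.labelled y, (f ⟨a, ha⟩).1 = b, ?_, ?_, ?_, ?_, ?_, ?_⟩
  · rintro a b ⟨ha, rfl⟩
    exact ⟨ha.1, (f _).2.1⟩
  · rintro a b ⟨ha, rfl⟩
    exact h1 _
  · intro a ha hl
    exact ⟨_, ⟨ha, hl⟩, rfl⟩
  · intro b hb hl
    refine ⟨(f.symm ⟨b, hb, hl⟩).1, (f.symm ⟨b, hb, hl⟩).2, ?_⟩
    simp
  · rintro a a' b - ⟨ha, h3⟩ ⟨ha', h4⟩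
    have := f.injective (Subtype.ext (h3.trans h4.symm))
    exact congrArg Subtype.val this
  · rintro a a' b b' - - ⟨ha, rfl⟩ ⟨ha', rfl⟩ h
    exact h2 ⟨a, ha⟩ ⟨a', ha'⟩ h

theorem Implements.trans {E F G : BES Act} {x : Set E.Ev} {y : Set F.Ev} {z : Set G.Ev}
    (h : Implements E F x y) (h' : Implements F G y z) : Implements E G x z := by
  obtain ⟨f, h1, h2⟩ := h
  obtain ⟨g, h3, h4⟩ := h'
  exact ⟨g.trans f, fun a => (h1 _).trans (h3 a), fun a b hab => h2 _ _ (h4 _ _ hab)⟩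

theorem Implements.refl (E : BES Act) (x : Set E.Ev) : Implements E E x x :=
  ⟨Equiv.refl _, fun _ => rfl, fun _ _ h => h⟩

/-- Monotonicity follows when subconfigurations of `x` correspond to subconfigurations of `y`. -/
theorem implements_of_configs {E F : BES Act} {x : Set E.Ev} {y : Set F.Ev}
    (r : F.Ev → E.Ev → Prop) (hx : E.IsConfig x) (hy : F.IsConfig y)
    (mem : ∀ a b, r a b → a ∈ y ∧ b ∈ x)
    (label : ∀ a b, r a b → E.label b = F.label a)
    (left : ∀ a ∈ y, F.label a ≠ none → ∃ b, r a b)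
    (right : ∀ b ∈ x, E.label b ≠ none → ∃ a, r a b)
    (inj : ∀ a a' b, E.label b ≠ none → r a b → r a' b → a = a')
    (sub : ∀ w, E.IsConfig w → w ⊆ x → ∃ w', F.IsConfig w' ∧ w' ⊆ y ∧
      ∀ a b, r a b → (a ∈ w' ↔ b ∈ w)) : Implements E F x y := by
  refine Impl.implements (r := r) ⟨mem, label, left, right, inj, ?_⟩ hx hy
  intro a a' b b' _ _ h h' hle
  rw [configLE_iff hy] at hle
  rw [configLE_iff hx]
  refine ⟨(mem _ _ h).2, (mem _ _ h').2, fun w hw hwx hb => ?_⟩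
  obtain ⟨w', h1, h2, h3⟩ := sub w hw hwx
  exact (h3 _ _ h).1 (hle.2.2 w' h1 h2 ((h3 _ _ h').2 hb))

end BES
end PBES

namespace PBES

/-! ### Probability mass functions with finite support -/

section Pmf

theorem bind_congr_support {α β : Type} {p : PMF α} {f g : α → PMF β}
    (h : ∀ a ∈ p.support, f a = g a) : p.bind f = p.bind g := by
  ext b
  rw [PMF.bind_apply, PMF.bind_apply]
  refine tsum_congr fun a => ?_
  by_cases ha : p a = 0
  · simp [ha]
  · rw [h a ((PMF.mem_support_iff _ _).2 ha)]

theorem map_congr_support {α β : Type} {p : PMF α} {f g : α → β}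
    (h : ∀ a ∈ p.support, f a = g a) : p.map f = p.map g :=
  bind_congr_support fun a ha => by simp [h a ha]

theorem bind_eq_of_support {α β : Type} {p : PMF α} {f : α → PMF β} {q : PMF β}
    (h : ∀ a ∈ p.support, f a = q) : p.bind f = q :=
  (bind_congr_support h).trans (PMF.bind_const p q)

theorem map_injective {α β : Type} {f : α → β} (hf : Function.Injective f) :
    Function.Injective (PMF.map f) := by
  classical
  intro p q h
  ext a
  have h1 := congrArg (fun r => r (f a)) h
  simp only [PMF.map_apply] at h1
  have h2 : ∀ (p : PMF α), (∑' b, if f a = f b then p b else 0) = p a := by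
    intro p
    rw [tsum_eq_single a]
    · simp
    · intro b hb
      rw [if_neg fun h => hb (hf h).symm]
  rwa [h2, h2] at h1

/-- Disintegration of `p` along `f`. -/
theorem exists_disintegration {α β : Type} (p : PMF α) (f : α → β) :
    ∃ κ : β → PMF α, (∀ b ∈ (p.map f).support, ∀ a ∈ (κ b).support, f a = b ∧ a ∈ p.support) ∧
      (p.map f).bind κ = p := by
  classical
  have hs : ∀ b, b ∈ (p.map f).support ↔ ∃ a ∈ f ⁻¹' {b}, a ∈ p.support := by
    intro b
    rw [PMF.mem_support_map_iff]
    exact ⟨fun ⟨a, h1, h2⟩ => ⟨a, h2, h1⟩, fun ⟨a, h1, h2⟩ => ⟨a, h2, h1⟩⟩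
  -- `κ b` is `p` conditioned on the fibre over `b`. Where the fibre has no mass the value `p` is
  -- arbitrary.
  refine ⟨fun b => if h : ∃ a ∈ f ⁻¹' {b}, a ∈ p.support then p.filter _ h else p, ?_, ?_⟩
  · intro b hb a ha
    rw [hs] at hb
    simp only [dif_pos hb, PMF.mem_support_filter_iff] at ha
    exact ha
  · ext a
    rw [PMF.bind_apply, tsum_eq_single (f a)]
    · by_cases ha : p a = 0
      · rw [ha]
        split_ifs with h
        · rw [PMF.filter_apply_eq_zero_iff _ a |>.2 (Or.inr (by simpa using ha)), mul_zero]
        · rw [ha, mul_zero]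
      · have h : ∃ a' ∈ f ⁻¹' {f a}, a' ∈ p.support := ⟨a, rfl, ha⟩
        rw [dif_pos h, PMF.filter_apply]
        -- The normalising constant of the conditional distribution is the mass of `f a` under
        -- `p.map f`, so the two factors cancel.
        have h1 : (∑' a', (f ⁻¹' {f a}).indicator p a') = (p.map f) (f a) := by
          rw [PMF.map_apply]
          refine tsum_congr fun b => ?_
          simp only [Set.indicator, Set.mem_preimage, Set.mem_singleton_iff, eq_comm]
        have h2 : (f ⁻¹' {f a}).indicator p a = p a := by simp
        rw [h1, h2, mul_comm (p a), ← mul_assoc, ENNReal.mul_inv_cancel, one_mul]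
        · exact (hs _).2 h
        · exact PMF.apply_ne_top _ _
    · intro b hb
      by_cases hb0 : (p.map f) b = 0
      · rw [hb0, zero_mul]
      · have h := (hs b).1 hb0
        rw [dif_pos h, PMF.filter_apply_eq_zero_of_notMem h (a := a), mul_zero]
        exact fun h => hb h.symm

/-- Finite support. -/
abbrev FinSupp {α : Type} (p : PMF α) : Prop := p.support.Finite

theorem finSupp_pure {α : Type} (a : α) : FinSupp (PMF.pure a) := by simp [FinSupp]

theorem FinSupp.map {α β : Type} {p : PMF α} (h : FinSupp p) (f : α → β) : FinSupp (p.map f) := by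
  rw [FinSupp, PMF.support_map]
  exact Set.Finite.image f h

theorem FinSupp.bind {α β : Type} {p : PMF α} (h : FinSupp p) {f : α → PMF β}
    (hf : ∀ a ∈ p.support, FinSupp (f a)) : FinSupp (p.bind f) := by
  rw [FinSupp, PMF.support_bind]
  exact Set.Finite.biUnion h hf

theorem FinSupp.of_bind {α β : Type} {p : PMF α} {f : α → PMF β} (h : FinSupp (p.bind f))
    {a : α} (ha : a ∈ p.support) : FinSupp (f a) :=
  Set.Finite.subset h fun _ hb => (PMF.mem_support_bind_iff _ _ _).2 ⟨a, ha, hb⟩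

theorem finSupp_fin {n : ℕ} (p : PMF (Fin n)) : FinSupp p := Set.toFinite _

end Pmf

/-! ### Lifting -/

namespace PES

/-- `Lift` wants the index type `Fin n` and the relation at every index, even at those of weight
zero. Enumerating the support of the weights removes both restrictions. -/
theorem lift_intro {ι X Y : Type} {S : X → PMF Y → Prop} (α : PMF ι) (hα : FinSupp α) (x : ι → X)
    (T : ι → PMF Y) (h : ∀ i ∈ α.support, S (x i) (T i)) : Lift S (α.map x) (α.bind T) := by
  obtain ⟨i0, hi0⟩ := α.support_nonempty
  obtain ⟨n, ⟨e⟩⟩ := Finite.exists_equiv_fin (α := α.support) (h := hα)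
  classical
  -- Indices outside the support have weight zero and are sent to an arbitrary point.
  let f : ι → Fin n := fun i => if h : i ∈ α.support then e ⟨i, h⟩ else e ⟨i0, hi0⟩
  let g : Fin n → ι := fun k => (e.symm k).1
  have hgf : ∀ i ∈ α.support, g (f i) = i := by
    intro i hi
    simp only [f, g, dif_pos hi, Equiv.symm_apply_apply]
  refine ⟨n, α.map f, x ∘ g, T ∘ g, fun k => h _ (e.symm k).2, ?_, ?_⟩
  · rw [PMF.map_comp]
    exact map_congr_support fun i hi => by simp [hgf i hi]
  · rw [PMF.bind_map]
    exact bind_congr_support fun i hi => by simp [hgf i hi]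

theorem lift_pure {X Y : Type} {S : X → PMF Y → Prop} {x : X} {Θ : PMF Y} (h : S x Θ) :
    Lift S (PMF.pure x) Θ := by
  have := lift_intro (S := S) (PMF.pure ()) (finSupp_pure _) (fun _ => x) (fun _ => Θ)
    (fun _ _ => h)
  rwa [PMF.pure_map, PMF.pure_bind] at this

/-- The pairs themselves serve as indices: a lifting is a finitely supported joint distribution `μ`
on the relation. In this form liftings can be mixed and conditioned. -/
theorem lift_iff {X Y : Type} {S : X → PMF Y → Prop} {Δ : PMF X} {Θ : PMF Y} :
    Lift S Δ Θ ↔ ∃ μ : PMF (X × PMF Y), μ.support.Finite ∧ (∀ z ∈ μ.support, S z.1 z.2) ∧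
      Δ = μ.map Prod.fst ∧ Θ = μ.bind Prod.snd := by
  constructor
  · rintro ⟨n, α, x, T, h, rfl, rfl⟩
    refine ⟨α.bind fun i => PMF.pure (x i, T i), ?_, ?_, ?_, ?_⟩
    · exact FinSupp.bind (finSupp_fin α) fun i _ => finSupp_pure _
    · intro z hz
      rw [PMF.mem_support_bind_iff] at hz
      obtain ⟨i, -, hi⟩ := hz
      rw [PMF.mem_support_pure_iff] at hi
      rw [hi]
      exact h i
    · rw [PMF.map_bind]
      simp only [PMF.pure_map]
      rfl
    · rw [PMF.bind_bind]
      simp only [PMF.pure_bind]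
  · rintro ⟨μ, h1, h2, rfl, rfl⟩
    exact lift_intro μ h1 _ _ h2

theorem lift_bind {ι X Y : Type} {S : X → PMF Y → Prop} {α : PMF ι} (hα : FinSupp α)
    {D : ι → PMF X} {T : ι → PMF Y} (h : ∀ i ∈ α.support, Lift S (D i) (T i)) :
    Lift S (α.bind D) (α.bind T) := by
  simp only [lift_iff] at h
  obtain ⟨i0, hi0⟩ := α.support_nonempty
  have : Nonempty (PMF (X × PMF Y)) := ⟨(h i0 hi0).choose⟩
  choose! μ h1 h2 h3 h4 using h
  rw [lift_iff]
  refine ⟨α.bind μ, FinSupp.bind hα h1, ?_, ?_, ?_⟩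
  · intro z hz
    rw [PMF.mem_support_bind_iff] at hz
    obtain ⟨i, hi, hz⟩ := hz
    exact h2 i hi z hz
  · rw [PMF.map_bind]
    exact bind_congr_support h3
  · rw [PMF.bind_bind]
    exact bind_congr_support h4

/-- Condition the joint distribution on its first component. Several pairs may share that component
with different second components, so `K x` is a mixture and is related to `x` only through the
lifting. -/
theorem lift_kernel {X Y : Type} {S : X → PMF Y → Prop} {Δ : PMF X} {Θ : PMF Y}
    (h : Lift S Δ Θ) : ∃ K : X → PMF Y, (∀ x ∈ Δ.support, Lift S (PMF.pure x) (K x)) ∧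
      Θ = Δ.bind K := by
  rw [lift_iff] at h
  obtain ⟨μ, h1, h2, rfl, rfl⟩ := h
  obtain ⟨κ, h3, h4⟩ := exists_disintegration μ Prod.fst
  refine ⟨fun x => (κ x).bind Prod.snd, ?_, ?_⟩
  · intro x hx
    have h5 : PMF.pure x = (κ x).map Prod.fst := by
      have : (κ x).map Prod.fst = (κ x).bind fun _ => PMF.pure x :=
        bind_congr_support fun z hz => by simp [(h3 x hx z hz).1]
      rw [this, PMF.bind_const]
    rw [h5]
    exact lift_intro _ (h1.subset fun z hz => (h3 x hx z hz).2) _ _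
      fun z hz => h2 z (h3 x hx z hz).2
  · conv_lhs => rw [← h4]
    rw [PMF.bind_bind]

/-! ### Steps -/

variable {Act : Type u}

/-- `x ∪ {e}` as a configuration, provided that it is one. -/
noncomputable def add {E : PES Act} (x : E.Config) (e : E.Ev) : E.Config :=
  open Classical in if h : E.IsConfig (insert e x.1) then ⟨_, h⟩ else x

theorem add_val {E : PES Act} {x : E.Config} {e : E.Ev} (h : E.Enab x.1 e) :
    (add x e).1 = insert e x.1 := by
  rw [add, dif_pos (x.2.insert h)]

theorem add_val_of_isConfig {E : PES Act} {x : E.Config} {e : E.Ev}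
    (h : E.IsConfig (insert e x.1)) : (add x e).1 = insert e x.1 := by
  rw [add, dif_pos h]

/-- The distribution `p` can be executed at `x`. -/
def PEnab (E : PES Act) (x : Set E.Ev) (p : PMF E.Ev) : Prop :=
  p ∈ E.dist ∧ ∀ e ∈ p.support, E.Enab x e

/-- The equation in `Step` forces `insert e x` to be a configuration for every `e` in the support of
`p`, which is enabledness by `enab_of_insert`. Since the inclusion of configurations into sets is
injective, the equation also determines `Δ`. -/
theorem step_iff {E : PES Act} {x : E.Config} {Δ : PMF E.Config} :
    E.Step x Δ ↔ ∃ p, E.PEnab x.1 p ∧ Δ = p.map (add x) := by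
  constructor
  · rintro ⟨p, hp, hd, hm⟩
    have h1 : ∀ e ∈ p.support, E.Enab x.1 e := by
      intro e he
      have h2 : insert e x.1 ∈ (Δ.map Subtype.val).support := by
        rw [hm, PMF.mem_support_map_iff]
        exact ⟨e, he, rfl⟩
      obtain ⟨y, -, hy⟩ := (PMF.mem_support_map_iff _ _ _).1 h2
      refine BES.IsConfig.enab_of_insert (hy ▸ y.2) fun hx => ?_
      exact (Set.mem_empty_iff_false e).1 (hd ▸ ⟨he, hx⟩)
    refine ⟨p, ⟨hp, h1⟩, map_injective Subtype.val_injective ?_⟩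
    rw [hm, PMF.map_comp]
    exact map_congr_support fun e he => (add_val (h1 e he)).symm
  · rintro ⟨p, ⟨hp, h1⟩, rfl⟩
    refine ⟨p, hp, ?_, ?_⟩
    · ext e
      simp only [Set.mem_inter_iff, Set.mem_empty_iff_false, iff_false, not_and]
      exact fun he => (h1 e he).1
    · rw [PMF.map_comp]
      exact map_congr_support fun e he => add_val (h1 e he)

/-- All distributions have finite support. -/
def FinDist (E : PES Act) : Prop := ∀ p ∈ E.dist, FinSupp p

theorem FinDist.step {E : PES Act} (hE : E.FinDist) {x : E.Config} {Δ : PMF E.Config}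
    (h : E.Step x Δ) : FinSupp Δ := by
  rw [step_iff] at h
  obtain ⟨p, hp, rfl⟩ := h
  exact (hE p hp.1).map _

/-! ### Weak transitions -/

theorem Weak.refl {E : PES Act} (Θ : PMF E.Config) : E.Weak Θ Θ := Relation.ReflTransGen.refl

theorem Weak.trans {E : PES Act} {Θ Θ' Θ'' : PMF E.Config} (h : E.Weak Θ Θ')
    (h' : E.Weak Θ' Θ'') : E.Weak Θ Θ'' := Relation.ReflTransGen.trans h h'

theorem Weak.of_step {E : PES Act} {x : E.Config} {Δ : PMF E.Config} (h : E.Step x Δ) :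
    E.Weak (PMF.pure x) Δ :=
  Relation.ReflTransGen.single (lift_pure (Or.inr h))

theorem Weak.of_pEnab {E : PES Act} {x : E.Config} {p : PMF E.Ev} (h : E.PEnab x.1 p) :
    E.Weak (PMF.pure x) (p.map (add x)) := Weak.of_step (step_iff.2 ⟨p, h, rfl⟩)

theorem Weak.finSupp {E : PES Act} (hE : E.FinDist) {Θ Θ' : PMF E.Config} (h : E.Weak Θ Θ') :
    FinSupp Θ → FinSupp Θ' := by
  induction h with
  | refl => exact id
  | tail _ h ih =>
    intro _
    obtain ⟨n, α, x, T, h1, -, rfl⟩ := h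
    refine (finSupp_fin α).bind fun i _ => ?_
    rcases h1 i with h | h
    · rw [h]
      exact finSupp_pure _
    · exact hE.step h

theorem lift_stay {E : PES Act} {Θ : PMF E.Config} (h : FinSupp Θ) :
    Lift (fun x Δ => Δ = PMF.pure x ∨ E.Step x Δ) Θ Θ := by
  have := lift_intro (S := fun x Δ => Δ = PMF.pure x ∨ E.Step x Δ) Θ h id PMF.pure
    fun _ _ => Or.inl rfl
  rwa [PMF.map_id, PMF.bind_pure] at this

/-- The parts may need different numbers of steps, so they are moved one after the other; while one
part moves the others stay put, which a weak transition allows. -/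
theorem Weak.bind {E : PES Act} (hE : E.FinDist) {ι : Type} {α : PMF ι} (hα : FinSupp α)
    {T T' : ι → PMF E.Config} (hT : ∀ i ∈ α.support, FinSupp (T i))
    (h : ∀ i ∈ α.support, E.Weak (T i) (T' i)) : E.Weak (α.bind T) (α.bind T') := by
  classical
  have hT' : ∀ i ∈ α.support, FinSupp (T' i) := fun i hi => (h i hi).finSupp hE (hT i hi)
  have key : ∀ s : Finset ι, ↑s ⊆ α.support →
      E.Weak (α.bind T) (α.bind fun i => if i ∈ s then T' i else T i) := by
    intro s
    induction s using Finset.induction_on with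
    | empty => intro _; simpa using Weak.refl _
    | insert a s ha ih =>
      intro hs
      rw [Finset.coe_insert, Set.insert_subset_iff] at hs
      refine (ih hs.2).trans ?_
      -- The mixture as a function of its `a`-th part; parts in `s` have already moved.
      let c : PMF E.Config → PMF E.Config := fun Θ =>
        α.bind fun i => if i = a then Θ else if i ∈ s then T' i else T i
      have h1 : c (T a) = α.bind fun i => if i ∈ s then T' i else T i := by
        refine bind_congr_support fun i _ => ?_
        by_cases hi : i = a
        · subst hi
          simp [ha]
        · simp [hi]
      have h2 : c (T' a) = α.bind fun i => if i ∈ insert a s then T' i else T i := by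
        refine bind_congr_support fun i _ => ?_
        by_cases hi : i = a
        · subst hi
          simp
        · simp [hi]
      rw [← h1, ← h2]
      refine Relation.ReflTransGen.lift c (fun Θ Θ' hl => ?_) _ _ (h a hs.1)
      refine lift_bind hα fun i hi => ?_
      by_cases hia : i = a
      · simpa [hia] using hl
      · simp only [if_neg hia]
        apply lift_stay
        split_ifs
        · exact hT' i hi
        · exact hT i hi
  have h3 := key hα.toFinset (by simp)
  have h4 : (α.bind fun i => if i ∈ hα.toFinset then T' i else T i) = α.bind T' :=
    bind_congr_support fun i hi => by rw [if_pos (hα.mem_toFinset.2 hi)]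
  rwa [h4] at h3

theorem Weak.bind_pure {E : PES Act} (hE : E.FinDist) {ι : Type} {α : PMF ι} (hα : FinSupp α)
    {y : ι → E.Config} {T' : ι → PMF E.Config}
    (h : ∀ i ∈ α.support, E.Weak (PMF.pure (y i)) (T' i)) : E.Weak (α.map y) (α.bind T') :=
  Weak.bind hE hα (fun _ _ => finSupp_pure _) h

theorem Weak.map_pure {E : PES Act} (hE : E.FinDist) {ι : Type} {α : PMF ι} (hα : FinSupp α)
    {y y' : ι → E.Config}
    (h : ∀ i ∈ α.support, E.Weak (PMF.pure (y i)) (PMF.pure (y' i))) :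
    E.Weak (α.map y) (α.map y') :=
  Weak.bind hE hα (fun _ _ => finSupp_pure _) h

/-- Weak transitions are transported along embeddings into a context `C`. -/
theorem Weak.embed {E F : PES Act} (j : E.Ev → F.Ev) (hj : Function.Injective j)
    (hd : ∀ p ∈ E.dist, p.map j ∈ F.dist) (φ : E.Config → F.Config) (C : Set F.Ev)
    (hC : ∀ e, j e ∉ C) (hφ : ∀ y, (φ y).1 = C ∪ j '' y.1) {Θ Θ' : PMF E.Config}
    (h : E.Weak Θ Θ') : F.Weak (Θ.map φ) (Θ'.map φ) := by
  refine Relation.ReflTransGen.lift (PMF.map φ) ?_ _ _ h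
  rintro Θ Θ' ⟨n, α, x, T, h1, rfl, rfl⟩
  simp only [Function.onFun, PMF.map_bind, PMF.map_comp]
  refine lift_intro α (finSupp_fin α) _ _ fun i _ => ?_
  rcases h1 i with h | h
  · left
    rw [h, PMF.pure_map]
    rfl
  · right
    rw [step_iff] at h ⊢
    obtain ⟨p, hp, hT⟩ := h
    -- Bundles and conflicts of `F` need not be inspected: `φ (add (x i) e)` is a configuration of
    -- `F` by assumption, and `j e` is a new event, so `enab_of_insert` applies.
    have hadd : ∀ e, E.Enab (x i).1 e →
        F.Enab (φ (x i)).1 (j e) ∧ φ (add (x i) e) = add (φ (x i)) (j e) := by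
      intro e he
      have h2 : (φ (add (x i) e)).1 = insert (j e) (φ (x i)).1 := by
        rw [hφ, hφ, add_val he, Set.image_insert_eq, Set.union_insert]
      have h3 : F.IsConfig (insert (j e) (φ (x i)).1) := h2 ▸ (φ (add (x i) e)).2
      refine ⟨h3.enab_of_insert ?_, Subtype.ext ?_⟩
      · rw [hφ]
        rintro (h | ⟨e', h, h'⟩)
        · exact hC _ h
        · exact he.1 (hj h' ▸ h)
      · rw [h2, add_val_of_isConfig h3]
    refine ⟨p.map j, ⟨hd p hp.1, ?_⟩, ?_⟩
    · intro e he
      obtain ⟨a, ha, rfl⟩ := (PMF.mem_support_map_iff _ _ _).1 he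
      exact (hadd a (hp.2 a ha)).1
    · rw [hT, PMF.map_comp, PMF.map_comp]
      exact map_congr_support fun e he => (hadd e (hp.2 e he)).2

/-! ### Simulations with kernels -/

/-- A simulation that is closed under finite convex combinations, relates configurations to finitely
supported distributions, and in which steps are matched by kernels. -/
structure NSim (E F : PES Act) (S : E.Config → PMF F.Config → Prop) : Prop where
  empty : S E.emptyConfig (PMF.pure F.emptyConfig)
  fin : ∀ x Θ, S x Θ → FinSupp Θ
  convex : ∀ {ι : Type} (α : PMF ι) (x : E.Config) (T : ι → PMF F.Config), FinSupp α →
    (∀ i ∈ α.support, S x (T i)) → S x (α.bind T)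
  implements : ∀ x Θ, S x Θ → ∀ y ∈ Θ.support, BES.Implements E.toBES F.toBES x.1 y.1
  step : ∀ x Θ, S x Θ → ∀ Δ, E.Step x Δ → ∃ K : E.Config → PMF F.Config,
    (∀ x' ∈ Δ.support, S x' (K x')) ∧ F.Weak Θ (Δ.bind K)
  final : ∀ x Θ, S x Θ → (x.1 ∩ E.final).Nonempty →
    ∀ y ∈ Θ.support, (y.1 ∩ F.final).Nonempty

/-- The new relation consists of the finitely supported convex combinations of the distributions
related to `x`. A step is answered part by part, every answer is turned into a kernel by
`lift_kernel`, and the kernels are averaged. -/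
theorem Sim.nsim {E F : PES Act} (hF : F.FinDist) (h : E.Sim F) :
    ∃ S, NSim E F S := by
  obtain ⟨S, hS⟩ := h
  have key : ∀ x Θ, Lift S (PMF.pure x) Θ →
      ∃ μ : PMF (E.Config × PMF F.Config), μ.support.Finite ∧ (∀ z ∈ μ.support, S x z.2) ∧
        Θ = μ.bind Prod.snd := by
    intro x Θ h
    obtain ⟨μ, h1, h2, h3, h4⟩ := lift_iff.1 h
    refine ⟨μ, h1, fun z hz => ?_, h4⟩
    have : z.1 ∈ (PMF.pure x).support := by
      rw [h3, PMF.mem_support_map_iff]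
      exact ⟨z, hz, rfl⟩
    rw [PMF.mem_support_pure_iff] at this
    rw [← this]
    exact h2 z hz
  refine ⟨fun x Θ => FinSupp Θ ∧ Lift S (PMF.pure x) Θ, ⟨finSupp_pure _, lift_pure hS.empty⟩,
    fun x Θ h => h.1, ?_, ?_, ?_, ?_⟩
  · intro ι α x T hα h
    refine ⟨hα.bind fun i hi => (h i hi).1, ?_⟩
    have := lift_bind (S := S) hα (D := fun _ => PMF.pure x) (T := T) fun i hi => (h i hi).2
    rwa [PMF.bind_const] at this
  · rintro x Θ ⟨-, h⟩ y hy
    obtain ⟨μ, h1, h2, rfl⟩ := key x Θ h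
    obtain ⟨z, hz, hy⟩ := (PMF.mem_support_bind_iff _ _ _).1 hy
    exact hS.implements _ _ (h2 z hz) y hy
  · rintro x Θ ⟨hfin, h⟩ Δ hΔ
    obtain ⟨μ, h1, h2, rfl⟩ := key x Θ h
    have hfz : ∀ z ∈ μ.support, FinSupp z.2 := fun z hz => hfin.of_bind hz
    have h3 : ∀ z ∈ μ.support, ∃ K : E.Config → PMF F.Config,
        (∀ x' ∈ Δ.support, Lift S (PMF.pure x') (K x')) ∧ F.Weak z.2 (Δ.bind K) := by
      intro z hz
      obtain ⟨Θ', hw, hl⟩ := hS.step _ _ (h2 z hz) Δ hΔ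
      obtain ⟨K, hK, rfl⟩ := lift_kernel hl
      exact ⟨K, hK, hw⟩
    have : Nonempty (PMF F.Config) := ⟨PMF.pure F.emptyConfig⟩
    choose! K hK hw using h3
    refine ⟨fun x' => μ.bind fun z => K z x', ?_, ?_⟩
    · intro x' hx'
      refine ⟨FinSupp.bind h1 fun z hz => ?_, ?_⟩
      · exact ((hw z hz).finSupp hF (hfz z hz)).of_bind hx'
      · have := lift_bind (S := S) (α := μ) h1 (D := fun _ => PMF.pure x')
          (T := fun z => K z x') fun z hz => hK z hz x' hx'
        rwa [PMF.bind_const] at this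
    · rw [PMF.bind_comm]
      exact Weak.bind hF h1 hfz hw
  · rintro x Θ ⟨-, h⟩ hx y hy
    obtain ⟨μ, h1, h2, rfl⟩ := key x Θ h
    obtain ⟨z, hz, hy⟩ := (PMF.mem_support_bind_iff _ _ _).1 hy
    exact hS.final _ _ (h2 z hz) hx y hy

/-- A kernel for the events of a distribution yields the lifting. -/
theorem sim_of {E F : PES Act} (hE : E.FinDist) (S : E.Config → PMF F.Config → Prop)
    (empty : S E.emptyConfig (PMF.pure F.emptyConfig))
    (implements : ∀ x Θ, S x Θ → ∀ y ∈ Θ.support, BES.Implements E.toBES F.toBES x.1 y.1)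
    (step : ∀ x Θ, S x Θ → ∀ p, E.PEnab x.1 p → ∃ K : E.Ev → PMF F.Config,
      (∀ e ∈ p.support, S (add x e) (K e)) ∧ F.Weak Θ (p.bind K))
    (final : ∀ x Θ, S x Θ → (x.1 ∩ E.final).Nonempty →
      ∀ y ∈ Θ.support, (y.1 ∩ F.final).Nonempty) : E.Sim F := by
  refine ⟨S, empty, implements, ?_, final⟩
  intro x Θ h Δ hΔ
  obtain ⟨p, hp, rfl⟩ := step_iff.1 hΔ
  obtain ⟨K, hK, hw⟩ := step x Θ h p hp
  exact ⟨_, hw, lift_intro p (hE p hp.1) _ _ hK⟩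

/-- Simulations whose right-hand sides are point distributions. -/
theorem sim_of_rel {E F : PES Act} (hE : E.FinDist) (R : E.Config → F.Config → Prop)
    (empty : R E.emptyConfig F.emptyConfig)
    (implements : ∀ x y, R x y → BES.Implements E.toBES F.toBES x.1 y.1)
    (step : ∀ x y, R x y → ∀ p, E.PEnab x.1 p → ∃ k : E.Ev → F.Config,
      (∀ e ∈ p.support, R (add x e) (k e)) ∧ F.Weak (PMF.pure y) (p.map k))
    (final : ∀ x y, R x y → (x.1 ∩ E.final).Nonempty → (y.1 ∩ F.final).Nonempty) :
    E.Sim F := by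
  refine sim_of hE (fun x Θ => ∃ y, Θ = PMF.pure y ∧ R x y) ⟨_, rfl, empty⟩ ?_ ?_ ?_
  · rintro x _ ⟨y, rfl, h⟩ y' hy'
    rw [PMF.mem_support_pure_iff] at hy'
    rw [hy']
    exact implements x y h
  · rintro x _ ⟨y, rfl, h⟩ p hp
    obtain ⟨k, h1, h2⟩ := step x y h p hp
    exact ⟨fun e => PMF.pure (k e), fun e he => ⟨_, rfl, h1 e he⟩, h2⟩
  · rintro x _ ⟨y, rfl, h⟩ hx y' hy'
    rw [PMF.mem_support_pure_iff] at hy'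
    rw [hy']
    exact final x y h hx

theorem NSim.step_enab {E F : PES Act} {S : E.Config → PMF F.Config → Prop} (h : NSim E F S)
    {x : E.Config} {Θ : PMF F.Config} (hx : S x Θ) {p : PMF E.Ev} (hp : E.PEnab x.1 p) :
    ∃ K : E.Config → PMF F.Config, (∀ e ∈ p.support, S (add x e) (K (add x e))) ∧
      F.Weak Θ (p.bind fun e => K (add x e)) := by
  obtain ⟨K, h1, h2⟩ := h.step x Θ hx _ (step_iff.2 ⟨p, hp, rfl⟩)
  refine ⟨K, fun e he => h1 _ ((PMF.mem_support_map_iff _ _ _).2 ⟨e, he, rfl⟩), ?_⟩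
  rw [PMF.bind_map] at h2
  exact h2

/-- A weak transition is matched through a simulation. -/
theorem NSim.weak {F G : PES Act} (hF : F.FinDist) (hG : G.FinDist)
    {T : F.Config → PMF G.Config → Prop}
    (hT : NSim F G T) {Θ Θ' : PMF F.Config} (h : F.Weak Θ Θ') (K : F.Config → PMF G.Config)
    (hK : ∀ y ∈ Θ.support, T y (K y)) (hΘ : FinSupp Θ) :
    ∃ K' : F.Config → PMF G.Config, (∀ y ∈ Θ'.support, T y (K' y)) ∧
      G.Weak (Θ.bind K) (Θ'.bind K') := by
  induction h with
  | refl => exact ⟨K, hK, Weak.refl _⟩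
  | @tail Θ₁ Θ₂ h hl ih =>
    obtain ⟨K₁, hK₁, hw⟩ := ih
    have hΘ₁ : FinSupp Θ₁ := Weak.finSupp hF h hΘ
    obtain ⟨n, α, x, D, hD, rfl, rfl⟩ := hl
    have h1 : ∀ i ∈ α.support, ∃ L : F.Config → PMF G.Config,
        (∀ y ∈ (D i).support, T y (L y)) ∧ G.Weak (K₁ (x i)) ((D i).bind L) := by
      intro i hi
      have hx : T (x i) (K₁ (x i)) := hK₁ _ ((PMF.mem_support_map_iff _ _ _).2 ⟨i, hi, rfl⟩)
      rcases hD i with h | h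
      · refine ⟨K₁, ?_, ?_⟩
        · intro y hy
          rw [h, PMF.mem_support_pure_iff] at hy
          rw [hy]
          exact hx
        · rw [h, PMF.pure_bind]
          exact Weak.refl _
      · exact hT.step _ _ hx _ h
    have : Nonempty (F.Config → PMF G.Config) := ⟨fun _ => PMF.pure G.emptyConfig⟩
    choose! L hL hLw using h1
    have hDf : ∀ i, FinSupp (D i) := by
      intro i
      rcases hD i with h | h
      · rw [h]; exact finSupp_pure _
      · exact hF.step h
    -- The same configuration `y` may be reached from several indices `i`, with different answers `L
    -- i y`. The answer at `y` is their conditional average given `y`; this is where convexity of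
    -- `T` is used.
    obtain ⟨κ, hκ, hκe⟩ := exists_disintegration
      (α.bind fun i => (D i).map (Prod.mk i)) Prod.snd
    have hm : (α.bind fun i => (D i).map (Prod.mk i)).map Prod.snd = α.bind D := by
      rw [PMF.map_bind]
      refine bind_congr_support fun i _ => ?_
      rw [PMF.map_comp]
      exact PMF.map_id _
    rw [hm] at hκ hκe
    have hsupp : ∀ z ∈ (α.bind fun i => (D i).map (Prod.mk i)).support,
        z.1 ∈ α.support ∧ z.2 ∈ (D z.1).support := by
      intro z hz
      obtain ⟨i, hi, hz⟩ := (PMF.mem_support_bind_iff _ _ _).1 hz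
      obtain ⟨y, hy, rfl⟩ := (PMF.mem_support_map_iff _ _ _).1 hz
      exact ⟨hi, hy⟩
    refine ⟨fun y => (κ y).bind fun z => L z.1 z.2, ?_, hw.trans ?_⟩
    · intro y hy
      refine hT.convex _ _ _ ?_ ?_
      · refine Set.Finite.subset (s := (α.bind fun i => (D i).map (Prod.mk i)).support)
          ?_ fun z hz => (hκ y hy z hz).2
        exact (finSupp_fin α).bind fun i _ => (hDf i).map _
      · intro z hz
        obtain ⟨h1, h2⟩ := hκ y hy z hz
        obtain ⟨h3, h4⟩ := hsupp z h2
        rw [← h1]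
        exact hL _ h3 _ h4
    · have h5 : ((α.bind D).bind fun y => (κ y).bind fun z => L z.1 z.2) =
          α.bind fun i => (D i).bind (L i) := by
        rw [← PMF.bind_bind, hκe, PMF.bind_bind]
        refine bind_congr_support fun i _ => ?_
        rw [PMF.bind_map]
        rfl
      rw [h5, PMF.bind_map]
      refine Weak.bind hG (finSupp_fin α) (fun i hi => ?_) hLw
      exact hT.fin _ _ (hK₁ _ ((PMF.mem_support_map_iff _ _ _).2 ⟨i, hi, rfl⟩))

/-- Compose through the middle distribution: `x` is related to `Θ`, and each `y` in its support to
`K y`, with mean `Θ.bind K`. The answer of `F` to a step of `E` is a weak transition, which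
`NSim.weak` carries over to `G`. -/
theorem Sim.trans {E F G : PES Act} (hE : E.FinDist) (hF : F.FinDist) (hG : G.FinDist)
    (h : E.Sim F) (h' : F.Sim G) : E.Sim G := by
  obtain ⟨S, hS⟩ := h.nsim hF
  obtain ⟨T, hT⟩ := h'.nsim hG
  refine sim_of hE (fun x Ψ => ∃ Θ K, S x Θ ∧ (∀ y ∈ Θ.support, T y (K y)) ∧ Ψ = Θ.bind K)
    ⟨_, fun _ => PMF.pure G.emptyConfig, hS.empty, ?_, ?_⟩ ?_ ?_ ?_
  · intro y hy
    rw [PMF.mem_support_pure_iff] at hy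
    rw [hy]
    exact hT.empty
  · rw [PMF.pure_bind]
  · rintro x _ ⟨Θ, K, h1, h2, rfl⟩ z hz
    obtain ⟨y, hy, hz⟩ := (PMF.mem_support_bind_iff _ _ _).1 hz
    exact (hS.implements _ _ h1 y hy).trans (hT.implements _ _ (h2 y hy) z hz)
  · rintro x _ ⟨Θ, K, h1, h2, rfl⟩ p hp
    obtain ⟨L, h3, h4⟩ := hS.step_enab h1 hp
    obtain ⟨K', h5, h6⟩ := hT.weak hF hG h4 K h2 (hS.fin _ _ h1)
    refine ⟨fun e => (L (add x e)).bind K', fun e he => ⟨_, K', h3 e he, ?_, rfl⟩, ?_⟩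
    · intro y hy
      exact h5 y ((PMF.mem_support_bind_iff _ _ _).2 ⟨e, he, hy⟩)
    · rwa [PMF.bind_bind] at h6
  · rintro x _ ⟨Θ, K, h1, h2, rfl⟩ hx z hz
    obtain ⟨y, hy, hz⟩ := (PMF.mem_support_bind_iff _ _ _).1 hz
    exact hT.final _ _ (h2 y hy) (hS.final _ _ h1 hx y hy) z hz

end PES
end PBES

namespace PBES
namespace BES

variable {Act : Type u}

/-! ### Configurations of composite structures -/

/-- The union of disjoint copies of two sets. -/
def sumSet {α β : Type} (x : Set α) (y : Set β) : Set (α ⊕ β) := Sum.inl '' x ∪ Sum.inr '' y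

section SumSet

variable {α β : Type} {x : Set α} {y : Set β}

@[simp] theorem inl_mem_sumSet {a : α} : Sum.inl a ∈ sumSet x y ↔ a ∈ x := by simp [sumSet]

@[simp] theorem inr_mem_sumSet {b : β} : Sum.inr b ∈ sumSet x y ↔ b ∈ y := by simp [sumSet]

@[simp] theorem inl_preimage_sumSet : Sum.inl ⁻¹' sumSet x y = x := by ext; simp

@[simp] theorem inr_preimage_sumSet : Sum.inr ⁻¹' sumSet x y = y := by ext; simp

theorem sumSet_preimage (z : Set (α ⊕ β)) : sumSet (Sum.inl ⁻¹' z) (Sum.inr ⁻¹' z) = z := by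
  ext (a | a) <;> simp

@[simp] theorem insert_inl_sumSet {a : α} :
    insert (Sum.inl a) (sumSet x y) = sumSet (insert a x) y := by
  ext (b | b) <;> simp

@[simp] theorem insert_inr_sumSet {b : β} :
    insert (Sum.inr b) (sumSet x y) = sumSet x (insert b y) := by
  ext (b | b) <;> simp

@[simp] theorem inl_preimage_insert_inl {a : α} {z : Set (α ⊕ β)} :
    Sum.inl ⁻¹' insert (Sum.inl a) z = insert a (Sum.inl ⁻¹' z) := by ext; simp

@[simp] theorem inr_preimage_insert_inl {a : α} {z : Set (α ⊕ β)} :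
    Sum.inr ⁻¹' insert (Sum.inl a) z = Sum.inr ⁻¹' z := by ext; simp

@[simp] theorem inl_preimage_insert_inr {b : β} {z : Set (α ⊕ β)} :
    Sum.inl ⁻¹' insert (Sum.inr b) z = Sum.inl ⁻¹' z := by ext; simp

@[simp] theorem inr_preimage_insert_inr {b : β} {z : Set (α ⊕ β)} :
    Sum.inr ⁻¹' insert (Sum.inr b) z = insert b (Sum.inr ⁻¹' z) := by ext; simp

theorem sumSet_empty : sumSet (∅ : Set α) (∅ : Set β) = ∅ := by simp [sumSet]

theorem sumSet_mono {x' : Set α} {y' : Set β} (h : x ⊆ x') (h' : y ⊆ y') :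
    sumSet x y ⊆ sumSet x' y' := Set.union_subset_union (Set.image_mono h) (Set.image_mono h')

end SumSet

/-! ### Configurations of a choice -/

section Plus

variable {E F : BES Act}

theorem inl_mem_init_plus {e : E.Ev} : Sum.inl e ∈ (plus E F).init ↔ e ∈ E.init := by
  constructor
  · intro h x hx
    exact h _ (PlusBundle.left x e hx)
  · intro h x hx
    cases hx with
    | left x _ hx => exact h x hx

theorem inr_mem_init_plus {e : F.Ev} : Sum.inr e ∈ (plus E F).init ↔ e ∈ F.init := by
  constructor
  · intro h x hx
    exact h _ (PlusBundle.right x e hx)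
  · intro h x hx
    cases hx with
    | right x _ hx => exact h x hx

theorem enab_plus_inl {z : Set (E.Ev ⊕ F.Ev)} {e : E.Ev} :
    (plus E F).Enab z (Sum.inl e) ↔ E.Enab (Sum.inl ⁻¹' z) e ∧
      ∀ f ∈ Sum.inr ⁻¹' z, ¬ ((e ∈ E.init ∧ f ∈ F.init) ∨ (e ∈ E.final ∧ f ∈ F.final)) := by
  constructor
  · rintro ⟨h1, h2, h3⟩
    refine ⟨⟨h1, fun e' he' => h2 (Sum.inl e') he', fun y hy => ?_⟩,
      fun f hf => h2 (Sum.inr f) hf⟩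
    obtain ⟨_, h4, e', h5, rfl⟩ := h3 _ (PlusBundle.left y e hy)
    exact ⟨e', h4, h5⟩
  · rintro ⟨⟨h1, h2, h3⟩, h4⟩
    refine ⟨h1, ?_, ?_⟩
    · rintro (a | a) ha
      · exact h2 a ha
      · exact h4 a ha
    · rintro _ (⟨y, _, hy⟩ | _)
      obtain ⟨e', h5, h6⟩ := h3 y hy
      exact ⟨_, h5, e', h6, rfl⟩

theorem enab_plus_inr {z : Set (E.Ev ⊕ F.Ev)} {e : F.Ev} :
    (plus E F).Enab z (Sum.inr e) ↔ F.Enab (Sum.inr ⁻¹' z) e ∧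
      ∀ f ∈ Sum.inl ⁻¹' z, ¬ ((f ∈ E.init ∧ e ∈ F.init) ∨ (f ∈ E.final ∧ e ∈ F.final)) := by
  constructor
  · rintro ⟨h1, h2, h3⟩
    refine ⟨⟨h1, fun e' he' => h2 (Sum.inr e') he', fun y hy => ?_⟩,
      fun f hf => h2 (Sum.inl f) hf⟩
    obtain ⟨_, h4, e', h5, rfl⟩ := h3 _ (PlusBundle.right y e hy)
    exact ⟨e', h4, h5⟩
  · rintro ⟨⟨h1, h2, h3⟩, h4⟩
    refine ⟨h1, ?_, ?_⟩
    · rintro (a | a) ha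
      · exact h4 a ha
      · exact h2 a ha
    · rintro _ (_ | ⟨y, _, hy⟩)
      obtain ⟨e', h5, h6⟩ := h3 y hy
      exact ⟨_, h5, e', h6, rfl⟩

theorem isConfig_plus_inl {x : Set E.Ev} (hx : E.IsConfig x) :
    (plus E F).IsConfig (sumSet x ∅) := by
  induction hx using IsConfig.induction with
  | h0 => exact sumSet_empty (α := E.Ev) (β := F.Ev) ▸ isConfig_empty _
  | h1 x e hx he ih =>
    rw [← insert_inl_sumSet]
    refine IsConfig.insert ih (enab_plus_inl.2 ⟨?_, ?_⟩)
    · simpa using he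
    · simp

theorem isConfig_plus_inr {x : Set F.Ev} (hx : F.IsConfig x) :
    (plus E F).IsConfig (sumSet ∅ x) := by
  induction hx using IsConfig.induction with
  | h0 => exact sumSet_empty (α := E.Ev) (β := F.Ev) ▸ isConfig_empty _
  | h1 x e hx he ih =>
    rw [← insert_inr_sumSet]
    refine IsConfig.insert ih (enab_plus_inr.2 ⟨?_, ?_⟩)
    · simpa using he
    · simp

/-- The first event taken from either component is initial, a nonempty configuration contains an
initial event, and initial events of the two components are in conflict. -/
theorem isConfig_plus_iff {z : Set (plus E F).Ev} : (plus E F).IsConfig z ↔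
    E.IsConfig (Sum.inl ⁻¹' z) ∧ F.IsConfig (Sum.inr ⁻¹' z) ∧
      (Sum.inl ⁻¹' z = ∅ ∨ Sum.inr ⁻¹' z = ∅) := by
  constructor
  · intro hz
    induction hz using IsConfig.induction with
    | h0 => simp [isConfig_empty]
    | h1 z e hz he ih =>
      obtain ⟨i1, i2, i3⟩ := ih
      rcases e with e | e
      · rw [enab_plus_inl] at he
        rw [inl_preimage_insert_inl, inr_preimage_insert_inl]
        refine ⟨i1.insert he.1, i2, Or.inr ?_⟩
        rcases i3 with i3 | i3
        · rw [i3] at he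
          by_contra hne
          obtain ⟨f, hf, hfi⟩ := i2.exists_init (Set.nonempty_iff_ne_empty.2 hne)
          exact he.2 f hf (Or.inl ⟨he.1.mem_init, hfi⟩)
        · exact i3
      · rw [enab_plus_inr] at he
        rw [inl_preimage_insert_inr, inr_preimage_insert_inr]
        refine ⟨i1, i2.insert he.1, Or.inl ?_⟩
        rcases i3 with i3 | i3
        · exact i3
        · rw [i3] at he
          by_contra hne
          obtain ⟨f, hf, hfi⟩ := i1.exists_init (Set.nonempty_iff_ne_empty.2 hne)
          exact he.2 f hf (Or.inl ⟨hfi, he.1.mem_init⟩)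
  · rintro ⟨h1, h2, h3 | h3⟩
    · rw [← sumSet_preimage z, h3]
      exact isConfig_plus_inr h2
    · rw [← sumSet_preimage z, h3]
      exact isConfig_plus_inl h1

end Plus

/-! ### Configurations of a sequential composition -/

section Seq

variable {E F : BES Act}

theorem mem_init_seq {z : E.Ev ⊕ F.Ev} : z ∈ (seq E F).init ↔ ∃ e ∈ E.init, z = Sum.inl e := by
  rcases z with e | e
  · constructor
    · intro h
      exact ⟨e, fun x hx => h _ (SeqBundle.left x e hx), rfl⟩
    · rintro ⟨e', he, h⟩ x hx
      cases h
      cases hx with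
      | left x _ hx => exact he x hx
  · constructor
    · intro h
      have he : e ∈ F.init := fun x hx => h _ (SeqBundle.right x e hx)
      exact (h _ (SeqBundle.link e he)).elim
    · rintro ⟨_, _, h⟩
      cases h

theorem inl_mem_init_seq {e : E.Ev} : Sum.inl e ∈ (seq E F).init ↔ e ∈ E.init :=
  mem_init_seq.trans (by simp)

theorem inr_notMem_init_seq {e : F.Ev} : Sum.inr e ∉ (seq E F).init :=
  mem_init_seq.not.2 (by simp)

theorem enab_seq_inl {z : Set (E.Ev ⊕ F.Ev)} {e : E.Ev} :
    (seq E F).Enab z (Sum.inl e) ↔ E.Enab (Sum.inl ⁻¹' z) e := by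
  constructor
  · rintro ⟨h1, h2, h3⟩
    refine ⟨h1, fun e' he' => h2 (Sum.inl e') he', fun y hy => ?_⟩
    obtain ⟨_, h4, e', h5, rfl⟩ := h3 _ (SeqBundle.left y e hy)
    exact ⟨e', h4, h5⟩
  · rintro ⟨h1, h2, h3⟩
    refine ⟨h1, ?_, ?_⟩
    · rintro (a | a) ha
      · exact h2 a ha
      · exact id
    · rintro _ (⟨y, _, hy⟩ | _ | _)
      obtain ⟨e', h5, h6⟩ := h3 y hy
      exact ⟨_, h5, e', h6, rfl⟩

theorem enab_seq_inr {z : Set (E.Ev ⊕ F.Ev)} {e : F.Ev} :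
    (seq E F).Enab z (Sum.inr e) ↔ F.Enab (Sum.inr ⁻¹' z) e ∧
      (e ∈ F.init → (Sum.inl ⁻¹' z ∩ E.final).Nonempty) := by
  constructor
  · rintro ⟨h1, h2, h3⟩
    refine ⟨⟨h1, fun e' he' => h2 (Sum.inr e') he', fun y hy => ?_⟩, fun he => ?_⟩
    · obtain ⟨_, h4, e', h5, rfl⟩ := h3 _ (SeqBundle.right y e hy)
      exact ⟨e', h4, h5⟩
    · obtain ⟨_, h4, e', h5, rfl⟩ := h3 _ (SeqBundle.link e he)
      exact ⟨e', h4, h5⟩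
  · rintro ⟨⟨h1, h2, h3⟩, h4⟩
    refine ⟨h1, ?_, ?_⟩
    · rintro (a | a) ha
      · exact id
      · exact h2 a ha
    · rintro _ (_ | ⟨y, _, hy⟩ | ⟨_, hi⟩)
      · obtain ⟨e', h5, h6⟩ := h3 y hy
        exact ⟨_, h5, e', h6, rfl⟩
      · obtain ⟨e', h5, h6⟩ := h4 hi
        exact ⟨_, h5, e', h6, rfl⟩

/-- Nothing in `E` waits for `F`, so all of `x` can be executed before `y`. -/
theorem isConfig_seq {x : Set E.Ev} {y : Set F.Ev} (hx : E.IsConfig x) (hy : F.IsConfig y)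
    (h : y.Nonempty → (x ∩ E.final).Nonempty) : (seq E F).IsConfig (sumSet x y) := by
  have h1 : (seq E F).IsConfig (sumSet x ∅) := by
    clear h
    induction hx using IsConfig.induction with
    | h0 => exact sumSet_empty (α := E.Ev) (β := F.Ev) ▸ isConfig_empty _
    | h1 x e hx he ih =>
      rw [← insert_inl_sumSet]
      exact IsConfig.insert ih (enab_seq_inl.2 (by simpa using he))
  induction hy using IsConfig.induction with
  | h0 => exact h1
  | h1 y e hy he ih =>
    have hf := h ⟨e, Or.inl rfl⟩
    rw [← insert_inr_sumSet]
    exact IsConfig.insert (ih fun _ => hf) (enab_seq_inr.2 (by simpa using ⟨he, fun _ => hf⟩))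

/-- Only initial events of `F` carry the bundle of final events of `E`; but the first event of `F`
in a configuration is initial, so a nonempty second part presupposes termination of the first. -/
theorem isConfig_seq_iff {z : Set (seq E F).Ev} : (seq E F).IsConfig z ↔
    E.IsConfig (Sum.inl ⁻¹' z) ∧ F.IsConfig (Sum.inr ⁻¹' z) ∧
      ((Sum.inr ⁻¹' z).Nonempty → (Sum.inl ⁻¹' z ∩ E.final).Nonempty) := by
  constructor
  · intro hz
    induction hz using IsConfig.induction with
    | h0 => simp [isConfig_empty]
    | h1 z e hz he ih =>
      obtain ⟨i1, i2, i3⟩ := ih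
      rcases e with e | e
      · rw [enab_seq_inl] at he
        rw [inl_preimage_insert_inl, inr_preimage_insert_inl]
        exact ⟨i1.insert he, i2,
          fun h => (i3 h).mono (Set.inter_subset_inter_left _ (Set.subset_insert _ _))⟩
      · rw [enab_seq_inr] at he
        rw [inl_preimage_insert_inr, inr_preimage_insert_inr]
        refine ⟨i1, i2.insert he.1, fun _ => ?_⟩
        rcases (Sum.inr ⁻¹' z).eq_empty_or_nonempty with h | h
        · rw [h] at he
          exact he.2 he.1.mem_init
        · exact i3 h
  · rintro ⟨h1, h2, h3⟩
    rw [← sumSet_preimage z]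
    exact isConfig_seq h1 h2 h3

end Seq

/-! ### Configurations of a concurrent composition -/

section Par

/-- A set of events of a concurrent composition. -/
def parSet {α β : Type} (s : Prop) (x : Set α) (y : Set β) (f : Prop) : Set (ParEv α β) :=
  {z | match z with
    | .left a => a ∈ x
    | .right b => b ∈ y
    | .start => s
    | .finish => f}

section

variable {α β : Type} {s f : Prop} {x : Set α} {y : Set β}

@[simp] theorem left_mem_parSet {a : α} : ParEv.left a ∈ parSet s x y f ↔ a ∈ x := Iff.rfl

@[simp] theorem right_mem_parSet {b : β} : ParEv.right b ∈ parSet s x y f ↔ b ∈ y := Iff.rfl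

@[simp] theorem start_mem_parSet : ParEv.start ∈ parSet s x y f ↔ s := Iff.rfl

@[simp] theorem finish_mem_parSet : ParEv.finish ∈ parSet s x y f ↔ f := Iff.rfl

@[simp] theorem left_preimage_parSet : ParEv.left ⁻¹' parSet s x y f = x := rfl

@[simp] theorem right_preimage_parSet : ParEv.right ⁻¹' parSet s x y f = y := rfl

theorem parSet_preimage (z : Set (ParEv α β)) :
    parSet (ParEv.start ∈ z) (ParEv.left ⁻¹' z) (ParEv.right ⁻¹' z) (ParEv.finish ∈ z) = z := by
  ext (a | a | _ | _) <;> simp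

@[simp] theorem insert_left_parSet {a : α} :
    insert (ParEv.left a) (parSet s x y f) = parSet s (insert a x) y f := by
  ext (b | b | _ | _) <;> simp

@[simp] theorem insert_right_parSet {b : β} :
    insert (ParEv.right b) (parSet s x y f) = parSet s x (insert b y) f := by
  ext (b | b | _ | _) <;> simp

@[simp] theorem insert_start_parSet :
    insert ParEv.start (parSet s x y f) = parSet True x y f := by
  ext (b | b | _ | _) <;> simp

@[simp] theorem insert_finish_parSet :
    insert ParEv.finish (parSet s x y f) = parSet s x y True := by
  ext (b | b | _ | _) <;> simp

theorem parSet_empty : parSet False (∅ : Set α) (∅ : Set β) False = ∅ := by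
  ext (b | b | _ | _) <;> simp

theorem parSet_mono {s' f' : Prop} {x' : Set α} {y' : Set β} (hs : s → s') (hx : x ⊆ x')
    (hy : y ⊆ y') (hf : f → f') : parSet s x y f ⊆ parSet s' x' y' f' := by
  rintro (a | a | _ | _) h
  · exact hx h
  · exact hy h
  · exact hs h
  · exact hf h

end

variable {E F : BES Act}

theorem mem_init_par {z : ParEv E.Ev F.Ev} : z ∈ (par E F).init ↔ z = ParEv.start := by
  constructor
  · rcases z with e | e | _ | _
    · intro h
      have he : e ∈ E.init := fun x hx => h _ (ParBundle.left x e hx)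
      exact (h _ (ParBundle.startLeft e he)).elim
    · intro h
      have he : e ∈ F.init := fun x hx => h _ (ParBundle.right x e hx)
      exact (h _ (ParBundle.startRight e he)).elim
    · exact fun _ => rfl
    · exact fun h => (h _ ParBundle.finishLeft).elim
  · rintro rfl x hx
    cases hx

theorem enab_par_left {z : Set (ParEv E.Ev F.Ev)} {e : E.Ev} :
    (par E F).Enab z (ParEv.left e) ↔ E.Enab (ParEv.left ⁻¹' z) e ∧
      (e ∈ E.init → ParEv.start ∈ z) := by
  constructor
  · rintro ⟨h1, h2, h3⟩
    refine ⟨⟨h1, fun e' he' => h2 (ParEv.left e') he', fun y hy => ?_⟩, fun he => ?_⟩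
    · obtain ⟨_, h4, e', h5, rfl⟩ := h3 _ (ParBundle.left y e hy)
      exact ⟨e', h4, h5⟩
    · obtain ⟨_, h4, rfl⟩ := h3 _ (ParBundle.startLeft e he)
      exact h4
  · rintro ⟨⟨h1, h2, h3⟩, h4⟩
    refine ⟨h1, ?_, ?_⟩
    · rintro (a | a | _ | _) ha
      · exact h2 a ha
      all_goals exact id
    · rintro _ (⟨y, _, hy⟩ | _ | ⟨_, hi⟩ | _ | _ | _)
      · obtain ⟨e', h5, h6⟩ := h3 y hy
        exact ⟨_, h5, e', h6, rfl⟩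
      · exact ⟨_, h4 hi, rfl⟩

theorem enab_par_right {z : Set (ParEv E.Ev F.Ev)} {e : F.Ev} :
    (par E F).Enab z (ParEv.right e) ↔ F.Enab (ParEv.right ⁻¹' z) e ∧
      (e ∈ F.init → ParEv.start ∈ z) := by
  constructor
  · rintro ⟨h1, h2, h3⟩
    refine ⟨⟨h1, fun e' he' => h2 (ParEv.right e') he', fun y hy => ?_⟩, fun he => ?_⟩
    · obtain ⟨_, h4, e', h5, rfl⟩ := h3 _ (ParBundle.right y e hy)
      exact ⟨e', h4, h5⟩
    · obtain ⟨_, h4, rfl⟩ := h3 _ (ParBundle.startRight e he)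
      exact h4
  · rintro ⟨⟨h1, h2, h3⟩, h4⟩
    refine ⟨h1, ?_, ?_⟩
    · rintro (a | a | _ | _) ha
      · exact id
      · exact h2 a ha
      all_goals exact id
    · rintro _ (_ | ⟨y, _, hy⟩ | _ | ⟨_, hi⟩ | _ | _)
      · obtain ⟨e', h5, h6⟩ := h3 y hy
        exact ⟨_, h5, e', h6, rfl⟩
      · exact ⟨_, h4 hi, rfl⟩

theorem enab_par_start {z : Set (ParEv E.Ev F.Ev)} :
    (par E F).Enab z ParEv.start ↔ ParEv.start ∉ z := by
  refine ⟨fun h => h.1, fun h => ⟨h, ?_, ?_⟩⟩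
  · rintro (a | a | _ | _) _ <;> exact id
  · intro y hy
    cases hy

theorem enab_par_finish {z : Set (ParEv E.Ev F.Ev)} :
    (par E F).Enab z ParEv.finish ↔ ParEv.finish ∉ z ∧
      (ParEv.left ⁻¹' z ∩ E.final).Nonempty ∧ (ParEv.right ⁻¹' z ∩ F.final).Nonempty := by
  constructor
  · rintro ⟨h1, h2, h3⟩
    refine ⟨h1, ?_, ?_⟩
    · obtain ⟨_, h4, e', h5, rfl⟩ := h3 _ ParBundle.finishLeft
      exact ⟨e', h4, h5⟩
    · obtain ⟨_, h4, e', h5, rfl⟩ := h3 _ ParBundle.finishRight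
      exact ⟨e', h4, h5⟩
  · rintro ⟨h1, ⟨a, h2, h3⟩, b, h4, h5⟩
    refine ⟨h1, ?_, ?_⟩
    · rintro (a | a | _ | _) _ <;> exact id
    · rintro _ (_ | _ | _ | _ | _ | _)
      · exact ⟨_, h2, a, h3, rfl⟩
      · exact ⟨_, h4, b, h5, rfl⟩

/-- One suitable linearisation is `start`, then `x`, then `y`, then `finish`. The propositions `s`
and `f` say which delimiters occur; without `start` everything is empty. -/
theorem isConfig_par {s f : Prop} {x : Set E.Ev} {y : Set F.Ev} (hx : E.IsConfig x)
    (hy : F.IsConfig y) (h1 : x.Nonempty → s) (h2 : y.Nonempty → s)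
    (h3 : f → (x ∩ E.final).Nonempty ∧ (y ∩ F.final).Nonempty) :
    (par E F).IsConfig (parSet s x y f) := by
  have key : s → (par E F).IsConfig (parSet True x y False) := by
    intro _
    have k0 : (par E F).IsConfig (parSet True ∅ ∅ False) := by
      rw [← insert_start_parSet (s := False), parSet_empty]
      exact IsConfig.insert (isConfig_empty _) (enab_par_start.2 (by simp))
    have k1 : (par E F).IsConfig (parSet True x ∅ False) := by
      clear h1 h3
      induction hx using IsConfig.induction with
      | h0 => exact k0
      | h1 x e hx he ih =>
        rw [← insert_left_parSet]
        exact IsConfig.insert ih (enab_par_left.2 ⟨he, fun _ => trivial⟩)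
    clear h2 h3
    induction hy using IsConfig.induction with
    | h0 => exact k1
    | h1 x e hx he ih =>
      rw [← insert_right_parSet]
      exact IsConfig.insert ih (enab_par_right.2 ⟨he, fun _ => trivial⟩)
  by_cases hs : s
  · have hst : s = True := by simp [hs]
    rw [hst]
    by_cases hf : f
    · have hft : f = True := by simp [hf]
      rw [hft, ← insert_finish_parSet (f := False)]
      exact IsConfig.insert (key hs) (enab_par_finish.2 ⟨id, h3 hf⟩)
    · have hft : f = False := by simp [hf]
      rw [hft]
      exact key hs
  · have hx0 : x = ∅ := Set.not_nonempty_iff_eq_empty.1 fun h => hs (h1 h)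
    have hy0 : y = ∅ := Set.not_nonempty_iff_eq_empty.1 fun h => hs (h2 h)
    have hf : ¬ f := by
      intro hf
      obtain ⟨a, ha, -⟩ := (h3 hf).1
      rw [hx0] at ha
      exact ha
    simp only [hs, hx0, hy0, hf, parSet_empty]
    exact isConfig_empty _

theorem isConfig_par_iff {z : Set (par E F).Ev} : (par E F).IsConfig z ↔
    E.IsConfig (ParEv.left ⁻¹' z) ∧ F.IsConfig (ParEv.right ⁻¹' z) ∧
      ((ParEv.left ⁻¹' z).Nonempty → ParEv.start ∈ z) ∧
      ((ParEv.right ⁻¹' z).Nonempty → ParEv.start ∈ z) ∧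
      (ParEv.finish ∈ z → (ParEv.left ⁻¹' z ∩ E.final).Nonempty ∧
        (ParEv.right ⁻¹' z ∩ F.final).Nonempty) := by
  constructor
  · intro hz
    induction hz using IsConfig.induction with
    | h0 => simp [isConfig_empty]
    | h1 z e hz he ih =>
      obtain ⟨i1, i2, i3, i4, i5⟩ := ih
      rw [← parSet_preimage z]
      rcases e with e | e | _ | _
      · rw [enab_par_left] at he
        simp only [insert_left_parSet, left_preimage_parSet, right_preimage_parSet,
          start_mem_parSet, finish_mem_parSet]
        refine ⟨i1.insert he.1, i2, fun _ => ?_, i4, fun h => ⟨(i5 h).1.mono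
          (Set.inter_subset_inter_left _ (Set.subset_insert _ _)), (i5 h).2⟩⟩
        rcases (ParEv.left ⁻¹' z).eq_empty_or_nonempty with h | h
        · rw [h] at he
          exact he.2 he.1.mem_init
        · exact i3 h
      · rw [enab_par_right] at he
        simp only [insert_right_parSet, left_preimage_parSet, right_preimage_parSet,
          start_mem_parSet, finish_mem_parSet]
        refine ⟨i1, i2.insert he.1, i3, fun _ => ?_, fun h => ⟨(i5 h).1, (i5 h).2.mono
          (Set.inter_subset_inter_left _ (Set.subset_insert _ _))⟩⟩
        rcases (ParEv.right ⁻¹' z).eq_empty_or_nonempty with h | h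
        · rw [h] at he
          exact he.2 he.1.mem_init
        · exact i4 h
      · simp only [insert_start_parSet, left_preimage_parSet, right_preimage_parSet,
          start_mem_parSet, finish_mem_parSet]
        exact ⟨i1, i2, fun _ => trivial, fun _ => trivial, i5⟩
      · rw [enab_par_finish] at he
        simp only [insert_finish_parSet, left_preimage_parSet, right_preimage_parSet,
          start_mem_parSet, finish_mem_parSet]
        exact ⟨i1, i2, i3, i4, fun _ => he.2⟩
  · rintro ⟨h1, h2, h3, h4, h5⟩
    rw [← parSet_preimage z]
    exact isConfig_par h1 h2 h3 h4 h5

end Par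

/-! ### Configurations of a star -/

section Star

variable {E F : BES Act}

/-- The link bundles lead only into levels of the form `m + 1`, so at level `0` the last clause is
vacuous. -/
theorem enab_star_body {z : Set (StarEv E.Ev F.Ev)} {n : ℕ} {e : E.Ev} :
    (star E F).Enab z (StarEv.body n e) ↔ E.Enab (StarEv.body n ⁻¹' z) e ∧
      (∀ f ∈ StarEv.exit n ⁻¹' z, ¬ (e ∈ E.init ∧ f ∈ F.init)) ∧
      (e ∈ E.init → ∀ m, n = m + 1 → (StarEv.body m ⁻¹' z ∩ E.final).Nonempty) := by
  constructor
  · rintro ⟨h1, h2, h3⟩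
    refine ⟨⟨h1, fun e' he' h => h2 (StarEv.body n e') he' ⟨rfl, h⟩, fun y hy => ?_⟩,
      fun f hf h => h2 (StarEv.exit n f) hf ⟨rfl, h⟩, ?_⟩
    · obtain ⟨_, h4, e', h5, rfl⟩ := h3 _ (StarBundle.body n y e hy)
      exact ⟨e', h4, h5⟩
    · rintro he m rfl
      obtain ⟨_, h4, e', h5, rfl⟩ := h3 _ (StarBundle.linkBody m e he)
      exact ⟨e', h4, h5⟩
  · rintro ⟨⟨h1, h2, h3⟩, h4, h5⟩
    refine ⟨h1, ?_, ?_⟩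
    · rintro (⟨m, a⟩ | ⟨m, a⟩) ha ⟨rfl, hc⟩
      · exact h2 a ha hc
      · exact h4 a ha hc
    · rintro _ (⟨_, y, _, hy⟩ | _ | ⟨m, _, hi⟩ | _)
      · obtain ⟨e', h5, h6⟩ := h3 y hy
        exact ⟨_, h5, e', h6, rfl⟩
      · obtain ⟨e', h5, h6⟩ := h5 hi m rfl
        exact ⟨_, h5, e', h6, rfl⟩

theorem enab_star_exit {z : Set (StarEv E.Ev F.Ev)} {n : ℕ} {e : F.Ev} :
    (star E F).Enab z (StarEv.exit n e) ↔ F.Enab (StarEv.exit n ⁻¹' z) e ∧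
      (∀ a ∈ StarEv.body n ⁻¹' z, ¬ (a ∈ E.init ∧ e ∈ F.init)) ∧
      (∀ m, n ≠ m → ∀ b ∈ StarEv.exit m ⁻¹' z, ¬ (e ∈ F.final ∧ b ∈ F.final)) ∧
      (e ∈ F.init → ∀ m, n = m + 1 → (StarEv.body m ⁻¹' z ∩ E.final).Nonempty) := by
  constructor
  · rintro ⟨h1, h2, h3⟩
    refine ⟨⟨h1, fun e' he' h => h2 (StarEv.exit n e') he' (Or.inl ⟨rfl, h⟩), fun y hy => ?_⟩,
      fun f hf h => h2 (StarEv.body n f) hf ⟨rfl, h⟩,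
      fun m hm b hb h => h2 (StarEv.exit m b) hb (Or.inr ⟨hm, h⟩), ?_⟩
    · obtain ⟨_, h4, e', h5, rfl⟩ := h3 _ (StarBundle.exit n y e hy)
      exact ⟨e', h4, h5⟩
    · rintro he m rfl
      obtain ⟨_, h4, e', h5, rfl⟩ := h3 _ (StarBundle.linkExit m e he)
      exact ⟨e', h4, h5⟩
  · rintro ⟨⟨h1, h2, h3⟩, h4, h5, h6⟩
    refine ⟨h1, ?_, ?_⟩
    · rintro (⟨m, a⟩ | ⟨m, a⟩) ha
      · rintro ⟨rfl, hc⟩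
        exact h4 a ha hc
      · rintro (⟨rfl, hc⟩ | ⟨hm, hc⟩)
        · exact h2 a ha hc
        · exact h5 m hm a ha hc
    · rintro _ (_ | ⟨_, y, _, hy⟩ | _ | ⟨m, _, hi⟩)
      · obtain ⟨e', h5, h6⟩ := h3 y hy
        exact ⟨_, h5, e', h6, rfl⟩
      · obtain ⟨e', h5, h6⟩ := h6 hi m rfl
        exact ⟨_, h5, e', h6, rfl⟩

/-- What configurations of `E * F` look like. -/
structure StarShape (E F : BES Act) (z : Set (StarEv E.Ev F.Ev)) : Prop where
  body : ∀ n, E.IsConfig (StarEv.body n ⁻¹' z)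
  exit : ∀ n, F.IsConfig (StarEv.exit n ⁻¹' z)
  excl : ∀ n, (StarEv.exit n ⁻¹' z).Nonempty → StarEv.body n ⁻¹' z = ∅
  prevBody : ∀ n, (StarEv.body (n + 1) ⁻¹' z).Nonempty → (StarEv.body n ⁻¹' z ∩ E.final).Nonempty
  prevExit : ∀ n, (StarEv.exit (n + 1) ⁻¹' z).Nonempty → (StarEv.body n ⁻¹' z ∩ E.final).Nonempty

/-- The first event of any copy of `E` or `F` is initial there. Hence it needs termination of the
previous level, and it excludes the alternative copy at its own level, whose first event is initial
as well. -/
theorem IsConfig.starShape {z : Set (star E F).Ev} (hz : (star E F).IsConfig z) :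
    StarShape E F z := by
  induction hz using IsConfig.induction with
  | h0 => constructor <;> simp [isConfig_empty]
  | h1 z e hz he ih =>
    have mono : ∀ n, (StarEv.body n ⁻¹' z ∩ E.final).Nonempty →
        (StarEv.body n ⁻¹' (Insert.insert e z) ∩ E.final).Nonempty := fun n h => h.mono
      (Set.inter_subset_inter_left _ (Set.preimage_mono (Set.subset_insert _ _)))
    rcases e with ⟨n, e⟩ | ⟨n, e⟩
    · have hb : StarEv.body n ⁻¹' (Insert.insert (StarEv.body n e) z) =
          Insert.insert e (StarEv.body n ⁻¹' z) := by ext; simp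
      have hb' : ∀ m, m ≠ n → StarEv.body m ⁻¹' (Insert.insert (StarEv.body n e) z) =
          StarEv.body m ⁻¹' z := by intro m hm; ext; simp [hm]
      have hx : ∀ m, StarEv.exit m ⁻¹' (Insert.insert (StarEv.body n e) z) =
          StarEv.exit m ⁻¹' z := by intro m; ext; simp
      rw [enab_star_body] at he
      constructor
      · intro m
        by_cases h : m = n
        · rw [h, hb]
          exact (ih.body n).insert he.1
        · rw [hb' m h]
          exact ih.body m
      · intro m
        rw [hx]
        exact ih.exit m
      · intro m
        rw [hx]
        intro hne
        by_cases h : m = n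
        · subst h
          obtain ⟨f, hf, hfi⟩ := (ih.exit m).exists_init hne
          rw [ih.excl m hne] at he
          exact (he.2.1 f hf ⟨he.1.mem_init, hfi⟩).elim
        · rw [hb' m h]
          exact ih.excl m hne
      · intro m hne
        apply mono
        by_cases h : m + 1 = n
        · rcases (StarEv.body n ⁻¹' z).eq_empty_or_nonempty with h0 | h0
          · rw [h0] at he
            exact he.2.2 he.1.mem_init m h.symm
          · exact ih.prevBody m (h ▸ h0)
        · rw [hb' _ h] at hne
          exact ih.prevBody m hne
      · intro m hne
        rw [hx] at hne
        exact mono m (ih.prevExit m hne)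
    · have hb : StarEv.exit n ⁻¹' (Insert.insert (StarEv.exit n e) z) =
          Insert.insert e (StarEv.exit n ⁻¹' z) := by ext; simp
      have hb' : ∀ m, m ≠ n → StarEv.exit m ⁻¹' (Insert.insert (StarEv.exit n e) z) =
          StarEv.exit m ⁻¹' z := by intro m hm; ext; simp [hm]
      have hx : ∀ m, StarEv.body m ⁻¹' (Insert.insert (StarEv.exit n e) z) =
          StarEv.body m ⁻¹' z := by intro m; ext; simp
      rw [enab_star_exit] at he
      constructor
      · intro m
        rw [hx]
        exact ih.body m
      · intro m
        by_cases h : m = n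
        · rw [h, hb]
          exact (ih.exit n).insert he.1
        · rw [hb' m h]
          exact ih.exit m
      · intro m
        rw [hx]
        intro hne
        by_cases h : m = n
        · subst h
          rcases (StarEv.exit m ⁻¹' z).eq_empty_or_nonempty with h0 | h0
          · by_contra hc
            obtain ⟨f, hf, hfi⟩ := (ih.body m).exists_init (Set.nonempty_iff_ne_empty.2 hc)
            rw [h0] at he
            exact he.2.1 f hf ⟨hfi, he.1.mem_init⟩
          · exact ih.excl m h0
        · rw [hb' m h] at hne
          exact ih.excl m hne
      · intro m hne
        rw [hx] at hne
        exact mono m (ih.prevBody m hne)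
      · intro m hne
        apply mono
        by_cases h : m + 1 = n
        · rcases (StarEv.exit n ⁻¹' z).eq_empty_or_nonempty with h0 | h0
          · rw [h0] at he
            exact he.2.2.2 he.1.mem_init m h.symm
          · exact ih.prevExit m (h ▸ h0)
        · rw [hb' _ h] at hne
          exact ih.prevExit m hne

/-- Termination of the preceding level makes that level nonempty, so the argument descends level by
level. -/
theorem StarShape.final_below {z : Set (StarEv E.Ev F.Ev)} (h : StarShape E F z) {n : ℕ} :
    ∀ {m : ℕ}, m < n → ((StarEv.body n ⁻¹' z).Nonempty ∨ (StarEv.exit n ⁻¹' z).Nonempty) →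
      (StarEv.body m ⁻¹' z ∩ E.final).Nonempty := by
  induction n with
  | zero => intro m hm; omega
  | succ n ih =>
    intro m hm hne
    have h1 : (StarEv.body n ⁻¹' z ∩ E.final).Nonempty :=
      hne.elim (h.prevBody n) (h.prevExit n)
    by_cases hmn : m = n
    · rwa [hmn]
    · exact ih (by omega) (Or.inl (h1.mono Set.inter_subset_left))

/-- A later copy of `E` would require that the copy at level `n` has terminated, but that copy is
excluded by the exit. -/
theorem StarShape.body_empty {z : Set (StarEv E.Ev F.Ev)} (h : StarShape E F z) {n m : ℕ}
    (hn : (StarEv.exit n ⁻¹' z).Nonempty) (hm : n ≤ m) : StarEv.body m ⁻¹' z = ∅ := by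
  by_contra hne
  rcases hm.eq_or_lt with rfl | hlt
  · exact hne (h.excl n hn)
  · have := h.final_below hlt (Or.inl (Set.nonempty_iff_ne_empty.2 hne))
    rw [h.excl n hn, Set.empty_inter] at this
    exact Set.not_nonempty_empty this

/-- Of two exits, the one at the higher level needs a terminated copy of `E` at the lower level,
where the other exit excludes it. -/
theorem StarShape.exit_empty {z : Set (StarEv E.Ev F.Ev)} (h : StarShape E F z) {n m : ℕ}
    (hn : (StarEv.exit n ⁻¹' z).Nonempty) (hm : n ≠ m) : StarEv.exit m ⁻¹' z = ∅ := by
  by_contra hne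
  rw [← Ne, ← Set.nonempty_iff_ne_empty] at hne
  rcases Nat.lt_or_gt_of_ne hm with hlt | hlt
  · have := h.final_below hlt (Or.inr hne)
    rw [h.excl n hn, Set.empty_inter] at this
    exact Set.not_nonempty_empty this
  · have := h.final_below hlt (Or.inr hn)
    rw [h.excl m hne, Set.empty_inter] at this
    exact Set.not_nonempty_empty this

end Star

end BES
end PBES

namespace PBES

/-! ### Biased choice -/

/-- The distribution of a coin that shows `true` with probability `α`. -/
noncomputable def coin (α : unitInterval) : PMF Bool :=
  PMF.ofFintype (fun b => cond b (ENNReal.ofReal α) (ENNReal.ofReal (1 - α))) (by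
    rw [Fintype.sum_bool]
    simp only [cond_true, cond_false]
    rw [← ENNReal.ofReal_add α.2.1 (sub_nonneg.2 α.2.2), add_sub_cancel, ENNReal.ofReal_one])

theorem finSupp_coin (α : unitInterval) : FinSupp (coin α) := Set.toFinite _

theorem coin_bind_apply {β : Type} (α : unitInterval) (T : Bool → PMF β) (z : β) :
    (coin α).bind T z = ENNReal.ofReal (1 - α) * T false z + ENNReal.ofReal α * T true z := by
  rw [PMF.bind_apply, tsum_fintype, Fintype.sum_bool, add_comm]
  rfl

namespace PES

variable {Act : Type u}

/-- A mixture written as a `bind` over a coin is accessible to the monad laws, and the support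
condition on unmixed distributions is pulled back to the component they come from. -/
theorem mem_pchoice_dist {α : unitInterval} {E F : PES Act} {r : PMF (E.Ev ⊕ F.Ev)} :
    r ∈ (pchoice α E F).dist ↔
      (∃ p ∈ E.dist, ∃ q ∈ F.dist, p.support ⊆ E.init ∧ q.support ⊆ F.init ∧
        r = (coin α).bind fun b => cond b (q.map Sum.inr) (p.map Sum.inl)) ∨
      ((∃ p ∈ E.dist, p.map Sum.inl = r ∧ ¬ p.support ⊆ E.init) ∨
       (∃ q ∈ F.dist, q.map Sum.inr = r ∧ ¬ q.support ⊆ F.init)) := by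
  refine or_congr ?_ ?_
  · refine exists_congr fun p => and_congr_right fun _ => exists_congr fun q =>
      and_congr_right fun _ => and_congr_right fun _ => and_congr_right fun _ => ?_
    rw [PMF.ext_iff]
    refine forall_congr' fun z => ?_
    rw [coin_bind_apply]
    rfl
  · constructor
    · rintro ⟨⟨p, hp, rfl⟩ | ⟨p, hp, rfl⟩, h⟩
      · refine Or.inl ⟨p, hp, rfl, fun hs => h ?_⟩
        rw [PMF.support_map]
        exact (Set.image_mono hs).trans Set.subset_union_left
      · refine Or.inr ⟨p, hp, rfl, fun hs => h ?_⟩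
        rw [PMF.support_map]
        exact (Set.image_mono hs).trans Set.subset_union_right
    · rintro (⟨p, hp, rfl, h⟩ | ⟨p, hp, rfl, h⟩)
      · refine ⟨Or.inl ⟨p, hp, rfl⟩, fun hs => h fun e he => ?_⟩
        rcases hs ((PMF.mem_support_map_iff _ _ _).2 ⟨e, he, rfl⟩) with ⟨a, ha, h⟩ | ⟨a, ha, h⟩
        · cases h
          exact ha
        · cases h
      · refine ⟨Or.inr ⟨p, hp, rfl⟩, fun hs => h fun e he => ?_⟩
        rcases hs ((PMF.mem_support_map_iff _ _ _).2 ⟨e, he, rfl⟩) with ⟨a, ha, h⟩ | ⟨a, ha, h⟩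
        · cases h
        · cases h
          exact ha

/-! ### Invariants of regular structures -/

/-- Distributions have finite support, distinct initial events are in conflict, and configurations
with a final event are maximal. -/
structure Good (E : PES Act) : Prop where
  finDist : E.FinDist
  init_conf : ∀ e ∈ E.init, ∀ e' ∈ E.init, e ≠ e' → E.conf e e'
  final_max : ∀ x, E.IsConfig x → (x ∩ E.final).Nonempty → ∀ e, ¬ E.Enab x e

/-- A nonempty configuration contains an initial event, and that one excludes every other initial
event. -/
theorem Good.eq_empty {E : PES Act} (hE : E.Good) {x : Set E.Ev} (hx : E.IsConfig x) {e : E.Ev}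
    (he : e ∈ E.init) (hen : E.Enab x e) : x = ∅ := by
  by_contra hne
  obtain ⟨a, ha, hai⟩ := hx.exists_init (Set.nonempty_iff_ne_empty.2 hne)
  exact hen.2.1 a ha (hE.init_conf e he a hai fun h => hen.1 (h ▸ ha))

theorem Good.eq_of_final {E : PES Act} (hE : E.Good) {w x : Set E.Ev} (hw : E.IsConfig w)
    (hx : E.IsConfig x) (hwx : w ⊆ x) (hf : (w ∩ E.final).Nonempty) : w = x := by
  by_contra hne
  obtain ⟨e, -, he⟩ := hx.exists_enab hwx hne
  exact hE.final_max w hw hf e he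

theorem good_zero : (zero : PES Act).Good where
  finDist _ hp := hp.elim
  init_conf e := e.elim
  final_max _ _ _ e := e.elim

theorem good_single (a : Option Act) :
    Good { BES.single a with dist := {PMF.pure ()} } where
  finDist p hp := by
    rw [Set.mem_singleton_iff] at hp
    rw [hp]
    exact finSupp_pure _
  init_conf _ _ _ _ h := (h rfl).elim
  final_max := by
    rintro x - ⟨⟨⟩, hx, -⟩ ⟨⟩ he
    exact he.1 hx

theorem final_inter_plus {E F : BES Act} {z : Set (BES.plus E F).Ev} :
    (z ∩ (BES.plus E F).final).Nonempty ↔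
      (Sum.inl ⁻¹' z ∩ E.final).Nonempty ∨ (Sum.inr ⁻¹' z ∩ F.final).Nonempty := by
  constructor
  · rintro ⟨_, h, ⟨a, ha, rfl⟩ | ⟨a, ha, rfl⟩⟩
    · exact Or.inl ⟨a, h, ha⟩
    · exact Or.inr ⟨a, h, ha⟩
  · rintro (⟨a, h, ha⟩ | ⟨a, h, ha⟩)
    · exact ⟨Sum.inl a, h, Or.inl ⟨a, ha, rfl⟩⟩
    · exact ⟨Sum.inr a, h, Or.inr ⟨a, ha, rfl⟩⟩

theorem final_inter_seq {E F : BES Act} {z : Set (BES.seq E F).Ev} :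
    (z ∩ (BES.seq E F).final).Nonempty ↔ (Sum.inr ⁻¹' z ∩ F.final).Nonempty := by
  constructor
  · rintro ⟨_, h, a, ha, rfl⟩
    exact ⟨a, h, ha⟩
  · rintro ⟨a, h, ha⟩
    exact ⟨Sum.inr a, h, a, ha, rfl⟩

theorem final_inter_par {E F : BES Act} {z : Set (BES.par E F).Ev} :
    (z ∩ (BES.par E F).final).Nonempty ↔ BES.ParEv.finish ∈ z := by
  constructor
  · rintro ⟨_, h, rfl⟩
    exact h
  · intro h
    exact ⟨_, h, rfl⟩

theorem final_inter_star {E F : BES Act} {z : Set (BES.star E F).Ev} :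
    (z ∩ (BES.star E F).final).Nonempty ↔
      ∃ n, (BES.StarEv.exit n ⁻¹' z ∩ F.final).Nonempty := by
  constructor
  · rintro ⟨_, h, n, a, ha, rfl⟩
    exact ⟨n, a, h, ha⟩
  · rintro ⟨n, a, h, ha⟩
    exact ⟨_, h, n, a, ha, rfl⟩

theorem Good.plus {E F : PES Act} (hE : E.Good) (hF : F.Good) : (plus E F).Good where
  finDist := by
    rintro _ (⟨p, hp, rfl⟩ | ⟨p, hp, rfl⟩)
    · exact (hE.finDist p hp).map _
    · exact (hF.finDist p hp).map _
  init_conf := by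
    rintro (a | a) ha (b | b) hb hne
    · exact hE.init_conf a (BES.inl_mem_init_plus.1 ha) b (BES.inl_mem_init_plus.1 hb)
        fun h => hne (by rw [h])
    · exact Or.inl ⟨BES.inl_mem_init_plus.1 ha, BES.inr_mem_init_plus.1 hb⟩
    · exact Or.inl ⟨BES.inl_mem_init_plus.1 hb, BES.inr_mem_init_plus.1 ha⟩
    · exact hF.init_conf a (BES.inr_mem_init_plus.1 ha) b (BES.inr_mem_init_plus.1 hb)
        fun h => hne (by rw [h])
  final_max := by
    intro z hz hf e he
    have h1 := BES.isConfig_plus_iff.1 (hz.insert he)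
    obtain ⟨h2, h3, -⟩ := BES.isConfig_plus_iff.1 hz
    rw [final_inter_plus] at hf
    rcases e with e | e
    · have h4 := (BES.enab_plus_inl.1 he).1
      rw [BES.inl_preimage_insert_inl, BES.inr_preimage_insert_inl] at h1
      rcases hf with hf | hf
      · exact hE.final_max _ h2 hf e h4
      · rcases h1.2.2 with h | h
        · exact (Set.insert_nonempty _ _).ne_empty h
        · rw [h, Set.empty_inter] at hf
          exact Set.not_nonempty_empty hf
    · have h4 := (BES.enab_plus_inr.1 he).1
      rw [BES.inl_preimage_insert_inr, BES.inr_preimage_insert_inr] at h1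
      rcases hf with hf | hf
      · rcases h1.2.2 with h | h
        · rw [h, Set.empty_inter] at hf
          exact Set.not_nonempty_empty hf
        · exact (Set.insert_nonempty _ _).ne_empty h
      · exact hF.final_max _ h3 hf e h4

theorem Good.pchoice (α : unitInterval) {E F : PES Act} (hE : E.Good) (hF : F.Good) :
    (pchoice α E F).Good where
  finDist := by
    intro r hr
    rcases mem_pchoice_dist.1 hr with
      ⟨p, hp, q, hq, -, -, rfl⟩ | ⟨p, hp, rfl, -⟩ | ⟨p, hp, rfl, -⟩
    · refine (finSupp_coin α).bind fun b _ => ?_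
      cases b
      · exact (hE.finDist p hp).map _
      · exact (hF.finDist q hq).map _
    · exact (hE.finDist p hp).map _
    · exact (hF.finDist p hp).map _
  init_conf := (hE.plus hF).init_conf
  final_max := (hE.plus hF).final_max

theorem Good.seq {E F : PES Act} (hE : E.Good) (hF : F.Good) : (seq E F).Good where
  finDist := by
    rintro _ (⟨p, hp, rfl⟩ | ⟨p, hp, rfl⟩)
    · exact (hE.finDist p hp).map _
    · exact (hF.finDist p hp).map _
  init_conf := by
    intro a ha b hb hne
    obtain ⟨a, ha', rfl⟩ := BES.mem_init_seq.1 ha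
    obtain ⟨b, hb', rfl⟩ := BES.mem_init_seq.1 hb
    exact hE.init_conf a ha' b hb' fun h => hne (by rw [h])
  final_max := by
    intro z hz hf e he
    obtain ⟨h2, h3, h4⟩ := BES.isConfig_seq_iff.1 hz
    rw [final_inter_seq] at hf
    rcases e with e | e
    · exact hE.final_max _ h2 (h4 (hf.mono Set.inter_subset_left)) e (BES.enab_seq_inl.1 he)
    · exact hF.final_max _ h3 hf e (BES.enab_seq_inr.1 he).1

theorem Good.par {E F : PES Act} (hE : E.Good) (hF : F.Good) : (par E F).Good where
  finDist := by
    rintro _ ((⟨p, hp, rfl⟩ | ⟨p, hp, rfl⟩) | rfl | rfl)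
    · exact (hE.finDist p hp).map _
    · exact (hF.finDist p hp).map _
    · exact finSupp_pure _
    · exact finSupp_pure _
  init_conf := by
    intro a ha b hb hne
    rw [BES.mem_init_par] at ha hb
    exact (hne (ha.trans hb.symm)).elim
  final_max := by
    intro z hz hf e he
    obtain ⟨h1, h2, h3, h4, h5⟩ := BES.isConfig_par_iff.1 hz
    rw [final_inter_par] at hf
    obtain ⟨h6, h7⟩ := h5 hf
    rcases e with e | e | _ | _
    · exact hE.final_max _ h1 h6 e (BES.enab_par_left.1 he).1
    · exact hF.final_max _ h2 h7 e (BES.enab_par_right.1 he).1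
    · exact he.1 (h3 (h6.mono Set.inter_subset_left))
    · exact he.1 hf

theorem Good.star {E F : PES Act} (hE : E.Good) (hF : F.Good) : (star E F).Good where
  finDist := by
    rintro _ ⟨n, ⟨p, hp, rfl⟩ | ⟨p, hp, rfl⟩⟩
    · exact (hE.finDist p hp).map _
    · exact (hF.finDist p hp).map _
  init_conf := by
    rintro (⟨n, a⟩ | ⟨n, a⟩) ha (⟨m, b⟩ | ⟨m, b⟩) hb hne
    · obtain ⟨rfl, ha'⟩ := (body_mem_init E F n a).1 ha
      obtain ⟨rfl, hb'⟩ := (body_mem_init E F m b).1 hb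
      exact ⟨rfl, hE.init_conf a ha' b hb' fun h => hne (by rw [h])⟩
    · obtain ⟨rfl, ha'⟩ := (body_mem_init E F n a).1 ha
      obtain ⟨rfl, hb'⟩ := (exit_mem_init E F m b).1 hb
      exact ⟨rfl, ha', hb'⟩
    · obtain ⟨rfl, ha'⟩ := (exit_mem_init E F n a).1 ha
      obtain ⟨rfl, hb'⟩ := (body_mem_init E F m b).1 hb
      exact ⟨rfl, hb', ha'⟩
    · obtain ⟨rfl, ha'⟩ := (exit_mem_init E F n a).1 ha
      obtain ⟨rfl, hb'⟩ := (exit_mem_init E F m b).1 hb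
      exact Or.inl ⟨rfl, hF.init_conf a ha' b hb' fun h => hne (by rw [h])⟩
  final_max := by
    intro z hz hf e he
    have hs := hz.starShape
    have hs' := (hz.insert he).starShape
    rw [final_inter_star] at hf
    obtain ⟨n, hf⟩ := hf
    have hne : (BES.StarEv.exit n ⁻¹' z).Nonempty := hf.mono Set.inter_subset_left
    have hne' : (BES.StarEv.exit n ⁻¹' insert e z).Nonempty :=
      hne.mono (Set.preimage_mono (Set.subset_insert _ _))
    rcases e with ⟨m, e⟩ | ⟨m, e⟩
    · rcases lt_or_ge m n with h | h
      · exact hE.final_max _ (hs.body m) (hs.final_below h (Or.inr hne)) e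
          (BES.enab_star_body.1 he).1
      · have := hs'.body_empty hne' h
        rw [Set.eq_empty_iff_forall_notMem] at this
        exact this e (Or.inl rfl)
    · by_cases h : n = m
      · subst h
        exact hF.final_max _ (hs.exit n) hf e (BES.enab_star_exit.1 he).1
      · have := hs'.exit_empty hne' h
        rw [Set.eq_empty_iff_forall_notMem] at this
        exact this e (Or.inl rfl)

theorem Regular.good {E : PES Act} (h : E.Regular) : E.Good := by
  induction h with
  | zero => exact good_zero
  | one => exact good_single none
  | atom a => exact good_single (some a)
  | plus _ _ h h' => exact h.plus h'
  | pchoice α _ _ h h' => exact h.pchoice α h'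
  | seq _ _ h h' => exact h.seq h'
  | par _ _ h h' => exact h.par h'
  | star _ _ h h' => exact h.star h'

/-! ### Simulations from maps between events -/

theorem isConfig_image {X Y : PES Act} {j : X.Ev → Y.Ev}
    (hen : ∀ x, X.IsConfig x → ∀ e, X.Enab x e → Y.Enab (j '' x) (j e)) {x : Set X.Ev}
    (hx : X.IsConfig x) : Y.IsConfig (j '' x) := by
  induction hx using BES.IsConfig.induction with
  | h0 => simpa using BES.isConfig_empty _
  | h1 x e hx he ih =>
    rw [Set.image_insert_eq]
    exact ih.insert (hen x hx e he)

/-- An enabled event is a new event, so images never coincide within a configuration. The map may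
still identify events that exclude each other, as codiagonals do. -/
theorem injOn_of_enab {X Y : PES Act} {j : X.Ev → Y.Ev}
    (hen : ∀ x, X.IsConfig x → ∀ e, X.Enab x e → Y.Enab (j '' x) (j e)) {x : Set X.Ev}
    (hx : X.IsConfig x) : Set.InjOn j x := by
  induction hx using BES.IsConfig.induction with
  | h0 => simp
  | h1 x e hx he ih =>
    rw [Set.injOn_insert he.1]
    exact ⟨ih, (hen x hx e he).1⟩

/-- Images of subconfigurations are subconfigurations, hence the image is ordered at most as
strictly as `x`. Enabledness has to be preserved but not reflected. -/
theorem implements_image {X Y : PES Act} {j : X.Ev → Y.Ev}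
    (hen : ∀ x, X.IsConfig x → ∀ e, X.Enab x e → Y.Enab (j '' x) (j e))
    (hl : ∀ e, Y.label (j e) = X.label e) {x : Set X.Ev} (hx : X.IsConfig x) :
    BES.Implements X.toBES Y.toBES x (j '' x) := by
  have hinj := injOn_of_enab hen hx
  refine BES.implements_of_configs (fun a b => b ∈ x ∧ j b = a) hx (isConfig_image hen hx)
    ?_ ?_ ?_ ?_ ?_ ?_
  · rintro _ b ⟨hb, rfl⟩
    exact ⟨⟨b, hb, rfl⟩, hb⟩
  · rintro _ b ⟨hb, rfl⟩
    exact (hl b).symm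
  · rintro _ ⟨b, hb, rfl⟩ -
    exact ⟨b, hb, rfl⟩
  · intro b hb _
    exact ⟨_, hb, rfl⟩
  · rintro _ _ b - ⟨-, rfl⟩ ⟨-, rfl⟩
    rfl
  · intro w hw hwx
    refine ⟨j '' w, isConfig_image hen hw, Set.image_mono hwx, ?_⟩
    rintro _ b ⟨hb, rfl⟩
    exact ⟨fun ⟨c, hc, h⟩ => hinj (hwx hc) hb h ▸ hc, fun h => ⟨b, h, rfl⟩⟩

/-- The condition `hd` on steps is left open because the image of a distribution need not be a
distribution of `Y`; this freedom is used in `pc_le`. -/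
theorem sim_of_map {X Y : PES Act} (hX : X.FinDist) (j : X.Ev → Y.Ev)
    (hen : ∀ x, X.IsConfig x → ∀ e, X.Enab x e → Y.Enab (j '' x) (j e))
    (hl : ∀ e, Y.label (j e) = X.label e) (hf : ∀ e ∈ X.final, j e ∈ Y.final)
    (hd : ∀ (x : X.Config) (y : Y.Config), y.1 = j '' x.1 → ∀ p, X.PEnab x.1 p →
      Y.Weak (PMF.pure y) (p.map fun e => add y (j e))) : X.Sim Y := by
  refine sim_of_rel hX (fun x y => y.1 = j '' x.1) (by simp [BES.emptyConfig]) ?_ ?_ ?_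
  · intro x y h
    rw [h]
    exact implements_image hen hl x.2
  · intro x y h p hp
    refine ⟨fun e => add y (j e), fun e he => ?_, hd x y h p hp⟩
    have h1 := hp.2 e he
    have h2 := hen x.1 x.2 e h1
    rw [← h] at h2
    rw [add_val h1, add_val h2, h, Set.image_insert_eq]
  · rintro x y h ⟨e, he, hef⟩
    rw [h]
    exact ⟨j e, ⟨e, he, rfl⟩, hf e hef⟩

/-- Maps between events that preserve distributions. -/
theorem sim_of_map_dist {X Y : PES Act} (hX : X.FinDist) (j : X.Ev → Y.Ev)
    (hen : ∀ x, X.IsConfig x → ∀ e, X.Enab x e → Y.Enab (j '' x) (j e))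
    (hl : ∀ e, Y.label (j e) = X.label e) (hf : ∀ e ∈ X.final, j e ∈ Y.final)
    (hd : ∀ x, X.IsConfig x → ∀ p, X.PEnab x p → p.map j ∈ Y.dist) : X.Sim Y := by
  refine sim_of_map hX j hen hl hf fun x y h p hp => ?_
  have h1 : Y.PEnab y.1 (p.map j) := by
    refine ⟨hd x.1 x.2 p hp, fun e he => ?_⟩
    obtain ⟨a, ha, rfl⟩ := (PMF.mem_support_map_iff _ _ _).1 he
    rw [h]
    exact hen x.1 x.2 a (hp.2 a ha)
  have h2 := Weak.of_pEnab h1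
  rwa [PMF.map_comp] at h2

theorem Sim.refl {E : PES Act} (hE : E.FinDist) : E.Sim E :=
  sim_of_map_dist hE id (fun x _ e he => by simpa using he) (fun _ => rfl) (fun _ h => h)
    fun _ _ p hp => by rw [PMF.map_id]; exact hp.1

theorem IsSub.enab_iff {X Y : PES Act} {j : X.Ev → Y.Ev} (h : IsSub X Y j) {x : Set X.Ev}
    {e : X.Ev} : Y.Enab (j '' x) (j e) ↔ X.Enab x e := by
  constructor
  · rintro ⟨h1, h2, h3⟩
    refine ⟨fun he => h1 ⟨e, he, rfl⟩, fun e' he' hc => h2 _ ⟨e', he', rfl⟩ ((h.conf _ _).1 hc),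
      fun y hy => ?_⟩
    obtain ⟨_, ⟨a, ha, rfl⟩, b, hb, hab⟩ := h3 _ (h.bundle y e hy)
    exact ⟨a, ha, h.inj hab ▸ hb⟩
  · rintro ⟨h1, h2, h3⟩
    refine ⟨?_, ?_, ?_⟩
    · rintro ⟨a, ha, hae⟩
      exact h1 (h.inj hae ▸ ha)
    · rintro _ ⟨a, ha, rfl⟩ hc
      exact h2 a ha ((h.conf _ _).2 hc)
    · intro y hy
      obtain ⟨x', rfl, hx'⟩ := h.bundle_restrict y e hy
      obtain ⟨a, ha, ha'⟩ := h3 x' hx'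
      exact ⟨_, ⟨a, ha, rfl⟩, a, ha', rfl⟩

theorem IsSub.sim {X Y : PES Act} {j : X.Ev → Y.Ev} (h : IsSub X Y j) (hX : X.FinDist) :
    X.Sim Y := by
  refine sim_of_map_dist hX j (fun x _ e he => h.enab_iff.2 he) (fun e => (h.label e).symm)
    (fun e he => (h.final e).1 he) fun x _ p hp => ?_
  have : p.map j ∈ PMF.map j '' X.dist := ⟨p, hp.1, rfl⟩
  rw [h.dist] at this
  exact this.1

/-- A substructure on all events is an isomorphic copy, and a right inverse of `j` is the simulating
map. -/
theorem IsSub.sim_symm {X Y : PES Act} {j : X.Ev → Y.Ev} (h : IsSub X Y j)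
    (hj : Function.Surjective j) (hY : Y.FinDist) : Y.Sim X := by
  obtain ⟨i, hi⟩ := hj.hasRightInverse
  have hii : ∀ z : Set Y.Ev, j '' (i '' z) = z := by
    intro z
    rw [Set.image_image]
    simp [hi _]
  refine sim_of_map_dist hY i (fun x _ e he => ?_) (fun e => ?_) (fun e he => ?_)
    fun x _ p hp => ?_
  · rw [← h.enab_iff, hii, hi]
    exact he
  · rw [h.label, hi]
  · rw [h.final, hi]
    exact he
  · have h1 : p ∈ {q | q ∈ Y.dist ∧ q.support ⊆ Set.range j} :=
      ⟨hp.1, fun z _ => hj z⟩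
    rw [← h.dist] at h1
    obtain ⟨q, hq, rfl⟩ := h1
    have : i ∘ j = id := by
      funext a
      exact h.inj (hi _)
    rwa [PMF.map_comp, this, PMF.map_id]

/-- Kernels for images of distributions. -/
theorem exists_kernel {X Y : PES Act} {A : Type} {U : X.Config → PMF Y.Config → Prop}
    {z : X.Config} {Θ : PMF Y.Config} (j : A → X.Ev) (hj : Function.Injective j) (p : PMF A)
    (k : A → PMF Y.Config) (h : ∀ a ∈ p.support, U (add z (j a)) (k a))
    (hw : Y.Weak Θ (p.bind k)) : ∃ K : X.Ev → PMF Y.Config,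
      (∀ e ∈ (p.map j).support, U (add z e) (K e)) ∧ Y.Weak Θ ((p.map j).bind K) := by
  -- The value `Θ` off the range of `j` is arbitrary.
  refine ⟨Function.extend j k fun _ => Θ, ?_, ?_⟩
  · intro e he
    obtain ⟨a, ha, rfl⟩ := (PMF.mem_support_map_iff _ _ _).1 he
    rw [hj.extend_apply]
    exact h a ha
  · rw [PMF.bind_map, Function.extend_comp hj]
    exact hw

end PES
end PBES

namespace PBES

/-! ### Identities for biased coins -/

theorem coin_symm_bind {β : Type} (α : unitInterval) (T : Bool → PMF β) :
    (coin (unitInterval.symm α)).bind T = (coin α).bind fun b => T (!b) := by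
  ext z
  rw [coin_bind_apply, coin_bind_apply, add_comm, unitInterval.coe_symm_eq, sub_sub_cancel]
  rfl

/-- Both sides give the weights `1 - α`, `α (1 - β)` and `α β` to `P`, `Q` and `R`; the identities
`h1` and `h2` say so for the first two. -/
theorem coin_assoc {Z : Type} {α β γ : unitInterval} (h : (α * β : ℝ) < 1)
    (hγ : (γ : ℝ) = α * (1 - β) / (1 - α * β)) (P Q R : PMF Z) :
    ((coin α).bind fun b => cond b ((coin β).bind fun b => cond b R Q) P) =
      (coin (α * β)).bind fun b => cond b R ((coin γ).bind fun b => cond b Q P) := by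
  have h0 : (1 - α * β : ℝ) ≠ 0 := by linarith
  have h1 : (1 - α * β : ℝ) * (1 - γ) = 1 - α := by
    rw [hγ]
    field_simp
    ring
  have h2 : (1 - α * β : ℝ) * γ = α * (1 - β) := by
    rw [hγ]
    field_simp
  have p1 : (0 : ℝ) ≤ 1 - α * β := by linarith
  ext z
  rw [coin_bind_apply, coin_bind_apply]
  simp only [cond_true, cond_false]
  rw [coin_bind_apply, coin_bind_apply]
  simp only [cond_true, cond_false, Set.Icc.coe_mul]
  rw [mul_add, mul_add, ← mul_assoc, ← mul_assoc, ← mul_assoc, ← mul_assoc,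
    ← ENNReal.ofReal_mul α.2.1, ← ENNReal.ofReal_mul α.2.1, ← ENNReal.ofReal_mul p1,
    ← ENNReal.ofReal_mul p1, h1, h2, add_assoc]

namespace PES

variable {Act : Type u}

/-! ### Nondeterministic choice is the join -/

theorem enab_plus_inl_of {E F : BES Act} {z : Set (E.Ev ⊕ F.Ev)} {e : E.Ev}
    (h : E.Enab (Sum.inl ⁻¹' z) e) (hz : Sum.inr ⁻¹' z = ∅) :
    (BES.plus E F).Enab z (Sum.inl e) :=
  BES.enab_plus_inl.2 ⟨h, by simp [hz]⟩

theorem enab_plus_inr_of {E F : BES Act} {z : Set (E.Ev ⊕ F.Ev)} {e : F.Ev}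
    (h : F.Enab (Sum.inr ⁻¹' z) e) (hz : Sum.inl ⁻¹' z = ∅) :
    (BES.plus E F).Enab z (Sum.inr e) :=
  BES.enab_plus_inr.2 ⟨h, by simp [hz]⟩

theorem enab_plus_inl_config {E F : BES Act} {z : Set (BES.plus E F).Ev}
    (hz : (BES.plus E F).IsConfig z) {e : E.Ev} (h : (BES.plus E F).Enab z (Sum.inl e)) :
    E.Enab (Sum.inl ⁻¹' z) e ∧ Sum.inr ⁻¹' z = ∅ := by
  refine ⟨(BES.enab_plus_inl.1 h).1, ?_⟩
  have h1 := (BES.isConfig_plus_iff.1 (hz.insert h)).2.2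
  rw [BES.inl_preimage_insert_inl, BES.inr_preimage_insert_inl] at h1
  exact h1.resolve_left (Set.insert_nonempty _ _).ne_empty

theorem enab_plus_inr_config {E F : BES Act} {z : Set (BES.plus E F).Ev}
    (hz : (BES.plus E F).IsConfig z) {e : F.Ev} (h : (BES.plus E F).Enab z (Sum.inr e)) :
    F.Enab (Sum.inr ⁻¹' z) e ∧ Sum.inl ⁻¹' z = ∅ := by
  refine ⟨(BES.enab_plus_inr.1 h).1, ?_⟩
  have h1 := (BES.isConfig_plus_iff.1 (hz.insert h)).2.2
  rw [BES.inl_preimage_insert_inr, BES.inr_preimage_insert_inr] at h1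
  exact h1.resolve_right (Set.insert_nonempty _ _).ne_empty

theorem inr_preimage_inl_image {α β : Type} (x : Set α) :
    (Sum.inr : β → α ⊕ β) ⁻¹' (Sum.inl '' x) = ∅ := by ext; simp

theorem inl_preimage_inr_image {α β : Type} (x : Set β) :
    (Sum.inl : α → α ⊕ β) ⁻¹' (Sum.inr '' x) = ∅ := by ext; simp

theorem enab_inl_image {E F : BES Act} {x : Set E.Ev} {e : E.Ev} (h : E.Enab x e) :
    (BES.plus E F).Enab (Sum.inl '' x) (Sum.inl e) :=
  enab_plus_inl_of (by rwa [Set.preimage_image_eq _ Sum.inl_injective])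
    (inr_preimage_inl_image x)

theorem enab_inr_image {E F : BES Act} {x : Set F.Ev} {e : F.Ev} (h : F.Enab x e) :
    (BES.plus E F).Enab (Sum.inr '' x) (Sum.inr e) :=
  enab_plus_inr_of (by rwa [Set.preimage_image_eq _ Sum.inr_injective])
    (inl_preimage_inr_image x)

theorem le_plus_left {E F : PES Act} (hE : E.Good) : E.Sim (plus E F) :=
  sim_of_map_dist (Y := plus E F) hE.finDist Sum.inl (fun _ _ _ he => enab_inl_image he)
    (fun _ => rfl) (fun e he => Or.inl ⟨e, he, rfl⟩) fun _ _ p hp => Or.inl ⟨p, hp.1, rfl⟩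

theorem le_plus_right {E F : PES Act} (hF : F.Good) : F.Sim (plus E F) :=
  sim_of_map_dist (Y := plus E F) hF.finDist Sum.inr (fun _ _ _ he => enab_inr_image he)
    (fun _ => rfl) (fun e he => Or.inr ⟨e, he, rfl⟩) fun _ _ p hp => Or.inr ⟨p, hp.1, rfl⟩

theorem implements_inl (E F : BES Act) {x : Set E.Ev} (hx : E.IsConfig x) :
    BES.Implements (BES.plus E F) E (BES.sumSet x ∅) x := by
  refine BES.implements_of_configs (fun a b => a ∈ x ∧ b = Sum.inl a)
    (BES.isConfig_plus_inl hx) hx ?_ ?_ ?_ ?_ ?_ ?_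
  · rintro a _ ⟨h, rfl⟩
    exact ⟨h, BES.inl_mem_sumSet.2 h⟩
  · rintro a _ ⟨h, rfl⟩
    rfl
  · intro a ha _
    exact ⟨_, ha, rfl⟩
  · rintro (a | a) ha _
    · exact ⟨a, BES.inl_mem_sumSet.1 ha, rfl⟩
    · exact (BES.inr_mem_sumSet.1 ha).elim
  · rintro a a' _ - ⟨-, rfl⟩ ⟨-, h⟩
    exact Sum.inl_injective h
  · intro w hw hwx
    refine ⟨Sum.inl ⁻¹' w, (BES.isConfig_plus_iff.1 hw).1,
      fun a ha => BES.inl_mem_sumSet.1 (hwx ha), ?_⟩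
    rintro a _ ⟨-, rfl⟩
    rfl

theorem implements_inr (E F : BES Act) {x : Set F.Ev} (hx : F.IsConfig x) :
    BES.Implements (BES.plus E F) F (BES.sumSet ∅ x) x := by
  refine BES.implements_of_configs (fun a b => a ∈ x ∧ b = Sum.inr a)
    (BES.isConfig_plus_inr hx) hx ?_ ?_ ?_ ?_ ?_ ?_
  · rintro a _ ⟨h, rfl⟩
    exact ⟨h, BES.inr_mem_sumSet.2 h⟩
  · rintro a _ ⟨h, rfl⟩
    rfl
  · intro a ha _
    exact ⟨_, ha, rfl⟩
  · rintro (a | a) ha _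
    · exact (BES.inl_mem_sumSet.1 ha).elim
    · exact ⟨a, BES.inr_mem_sumSet.1 ha, rfl⟩
  · rintro a a' _ - ⟨-, rfl⟩ ⟨-, h⟩
    exact Sum.inr_injective h
  · intro w hw hwx
    refine ⟨Sum.inr ⁻¹' w, (BES.isConfig_plus_iff.1 hw).2.1,
      fun a ha => BES.inr_mem_sumSet.1 (hwx ha), ?_⟩
    rintro a _ ⟨-, rfl⟩
    rfl

/-- The first event decides which of the two simulations is followed. Before it nothing is decided,
and both simulations relate `∅` to the point distribution at `∅`; the clause on empty `x` ensures
that this is the only answer in use there. -/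
theorem plus_le {E F G : PES Act} (hE : E.Good) (hF : F.Good) (hG : G.Good)
    (h : E.Sim G) (h' : F.Sim G) : (plus E F).Sim G := by
  obtain ⟨S, hS⟩ := h.nsim hG.finDist
  obtain ⟨T, hT⟩ := h'.nsim hG.finDist
  let U : (plus E F).Config → PMF G.Config → Prop := fun z Θ =>
    (∃ x : E.Config, z.1 = BES.sumSet x.1 ∅ ∧ S x Θ ∧ (x.1 = ∅ → Θ = PMF.pure G.emptyConfig)) ∨
    (∃ x : F.Config, z.1 = BES.sumSet ∅ x.1 ∧ T x Θ ∧ (x.1 = ∅ → Θ = PMF.pure G.emptyConfig))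
  refine sim_of (hE.plus hF).finDist U ?_ ?_ ?_ ?_
  · exact Or.inl ⟨E.emptyConfig, BES.sumSet_empty.symm, hS.empty, fun _ => rfl⟩
  · rintro z Θ (⟨x, hz, h, -⟩ | ⟨x, hz, h, -⟩) y hy
    · rw [hz]
      exact (implements_inl _ _ x.2).trans (hS.implements _ _ h y hy)
    · rw [hz]
      exact (implements_inr _ _ x.2).trans (hT.implements _ _ h y hy)
  · have hl : ∀ (z : (plus E F).Config) (x : E.Config) Θ, z.1 = BES.sumSet x.1 ∅ → S x Θ →
        ∀ p : PMF E.Ev, (plus E F).PEnab z.1 (p.map Sum.inl) → p ∈ E.dist →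
        ∃ k : E.Ev → PMF G.Config, (∀ e ∈ p.support, ∃ x' : E.Config,
          (add z (Sum.inl e)).1 = BES.sumSet x'.1 ∅ ∧ S x' (k e) ∧
          (x'.1 = ∅ → k e = PMF.pure G.emptyConfig)) ∧ G.Weak Θ (p.bind k) := by
      intro z x Θ hz h p hp hpE
      have hen : ∀ e ∈ p.support, (plus E F).Enab z.1 (Sum.inl e) :=
        fun e he => hp.2 _ ((PMF.mem_support_map_iff _ _ _).2 ⟨e, he, rfl⟩)
      have hen' : ∀ e ∈ p.support, E.Enab x.1 e := fun e he => by
        simpa [hz] using (BES.enab_plus_inl.1 (hen e he)).1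
      obtain ⟨K, h1, h2⟩ := hS.step_enab h ⟨hpE, hen'⟩
      refine ⟨_, fun e he => ⟨add x e, ?_, h1 e he, fun h0 => ?_⟩, h2⟩
      · rw [add_val (hen e he), add_val (hen' e he), hz, BES.insert_inl_sumSet]
      · rw [add_val (hen' e he)] at h0
        exact ((Set.insert_nonempty _ _).ne_empty h0).elim
    have hr : ∀ (z : (plus E F).Config) (x : F.Config) Θ, z.1 = BES.sumSet ∅ x.1 → T x Θ →
        ∀ p : PMF F.Ev, (plus E F).PEnab z.1 (p.map Sum.inr) → p ∈ F.dist →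
        ∃ k : F.Ev → PMF G.Config, (∀ e ∈ p.support, ∃ x' : F.Config,
          (add z (Sum.inr e)).1 = BES.sumSet ∅ x'.1 ∧ T x' (k e) ∧
          (x'.1 = ∅ → k e = PMF.pure G.emptyConfig)) ∧ G.Weak Θ (p.bind k) := by
      intro z x Θ hz h p hp hpE
      have hen : ∀ e ∈ p.support, (plus E F).Enab z.1 (Sum.inr e) :=
        fun e he => hp.2 _ ((PMF.mem_support_map_iff _ _ _).2 ⟨e, he, rfl⟩)
      have hen' : ∀ e ∈ p.support, F.Enab x.1 e := fun e he => by
        simpa [hz] using (BES.enab_plus_inr.1 (hen e he)).1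
      obtain ⟨K, h1, h2⟩ := hT.step_enab h ⟨hpE, hen'⟩
      refine ⟨_, fun e he => ⟨add x e, ?_, h1 e he, fun h0 => ?_⟩, h2⟩
      · rw [add_val (hen e he), add_val (hen' e he), hz, BES.insert_inr_sumSet]
      · rw [add_val (hen' e he)] at h0
        exact ((Set.insert_nonempty _ _).ne_empty h0).elim
    rintro z Θ hzΘ _ ⟨⟨p, hp, rfl⟩ | ⟨p, hp, rfl⟩, hen⟩
    · have hx : ∃ x : E.Config, z.1 = BES.sumSet x.1 ∅ ∧ S x Θ := by
        rcases hzΘ with ⟨x, hz, h, h0⟩ | ⟨x, hz, h, h0⟩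
        · exact ⟨x, hz, h⟩
        -- The recorded side is `F` but the step belongs to `E`. Then the configuration is still
        -- empty, and the record can be changed to `S`.
        · obtain ⟨e, he⟩ := p.support_nonempty
          have h1 := enab_plus_inl_config z.2
            (hen _ ((PMF.mem_support_map_iff _ _ _).2 ⟨e, he, rfl⟩))
          rw [hz, BES.inr_preimage_sumSet] at h1
          rw [h1.2] at hz
          rw [h0 h1.2]
          exact ⟨E.emptyConfig, hz, hS.empty⟩
      obtain ⟨x, hz, h⟩ := hx
      obtain ⟨k, h1, h2⟩ := hl z x Θ hz h p ⟨Or.inl ⟨p, hp, rfl⟩, hen⟩ hp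
      exact exists_kernel (U := U) Sum.inl Sum.inl_injective p k (fun a ha => Or.inl (h1 a ha)) h2
    · have hx : ∃ x : F.Config, z.1 = BES.sumSet ∅ x.1 ∧ T x Θ := by
        rcases hzΘ with ⟨x, hz, h, h0⟩ | ⟨x, hz, h, h0⟩
        · obtain ⟨e, he⟩ := p.support_nonempty
          have h1 := enab_plus_inr_config z.2
            (hen _ ((PMF.mem_support_map_iff _ _ _).2 ⟨e, he, rfl⟩))
          rw [hz, BES.inl_preimage_sumSet] at h1
          rw [h1.2] at hz
          rw [h0 h1.2]
          exact ⟨F.emptyConfig, hz, hT.empty⟩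
        · exact ⟨x, hz, h⟩
      obtain ⟨x, hz, h⟩ := hx
      obtain ⟨k, h1, h2⟩ := hr z x Θ hz h p ⟨Or.inr ⟨p, hp, rfl⟩, hen⟩ hp
      exact exists_kernel (U := U) Sum.inr Sum.inr_injective p k (fun a ha => Or.inr (h1 a ha)) h2
  · rintro z Θ (⟨x, hz, h, -⟩ | ⟨x, hz, h, -⟩) hzf y hy
    · rw [hz, final_inter_plus] at hzf
      exact hS.final _ _ h (by simpa using hzf) y hy
    · rw [hz, final_inter_plus] at hzf
      exact hT.final _ _ h (by simpa using hzf) y hy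

theorem zero_le {E : PES Act} (_hE : E.Good) : (zero : PES Act).Sim E :=
  sim_of_map_dist good_zero.finDist Empty.elim (fun _ _ e => e.elim) (fun e => e.elim)
    (fun e => e.elim) fun _ _ _ hp => hp.1.elim

theorem plus_mono {E E' F F' : PES Act} (hE : E.Good) (hE' : E'.Good) (hF : F.Good)
    (hF' : F'.Good) (h : E.Sim E') (h' : F.Sim F') : (plus E F).Sim (plus E' F') :=
  plus_le hE hF (hE'.plus hF')
    (h.trans hE.finDist hE'.finDist (hE'.plus hF').finDist (le_plus_left hE'))
    (h'.trans hF.finDist hF'.finDist (hE'.plus hF').finDist (le_plus_right hF'))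

/-! ### Isomorphisms -/

/-- Reassociation of events is an isomorphism: the initial events of `F·G` are those of `F` and the
final events of `E·F` are those of `F`, so the link bundles agree. -/
theorem seq_assoc_le {E F G : PES Act} (hE : E.Good) (hF : F.Good) (hG : G.Good) :
    (seq E (seq F G)).Sim (seq (seq E F) G) := by
  refine sim_of_map_dist (hE.seq (hF.seq hG)).finDist (Equiv.sumAssoc _ _ _).symm ?_ ?_ ?_ ?_
  · rintro x hx (a | b | c) he
    · rw [Equiv.image_symm_eq_preimage]
      have h1 := BES.enab_seq_inl.1 he
      exact BES.enab_seq_inl.2 (BES.enab_seq_inl.2 h1)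
    · rw [Equiv.image_symm_eq_preimage]
      have h1 := BES.enab_seq_inr.1 he
      exact BES.enab_seq_inl.2 (BES.enab_seq_inr.2 ⟨BES.enab_seq_inl.1 h1.1,
        fun hb => h1.2 (BES.inl_mem_init_seq.2 hb)⟩)
    · rw [Equiv.image_symm_eq_preimage]
      have h1 := BES.enab_seq_inr.1 (BES.enab_seq_inr.1 he).1
      exact BES.enab_seq_inr.2 ⟨h1.1, fun hc => final_inter_seq.2 (h1.2 hc)⟩
  · rintro (a | b | c) <;> rfl
  · rintro _ ⟨_, ⟨c, hc, rfl⟩, rfl⟩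
    exact ⟨c, hc, rfl⟩
  · rintro x hx _ ⟨⟨p, hp, rfl⟩ | ⟨_, ⟨p, hp, rfl⟩ | ⟨p, hp, rfl⟩, rfl⟩, -⟩
    · exact Or.inl ⟨_, Or.inl ⟨p, hp, rfl⟩, by simp only [PMF.map_comp]; rfl⟩
    · exact Or.inl ⟨_, Or.inr ⟨p, hp, rfl⟩, by simp only [PMF.map_comp]; rfl⟩
    · exact Or.inr ⟨p, hp, by simp only [PMF.map_comp]; rfl⟩

theorem seq_assoc_ge {E F G : PES Act} (hE : E.Good) (hF : F.Good) (hG : G.Good) :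
    (seq (seq E F) G).Sim (seq E (seq F G)) := by
  refine sim_of_map_dist ((hE.seq hF).seq hG).finDist (Equiv.sumAssoc _ _ _) ?_ ?_ ?_ ?_
  · rintro x hx ((a | b) | c) he
    · rw [Equiv.image_eq_preimage_symm]
      have h1 := BES.enab_seq_inl.1 (BES.enab_seq_inl.1 he)
      exact BES.enab_seq_inl.2 h1
    · rw [Equiv.image_eq_preimage_symm]
      have h1 := BES.enab_seq_inr.1 (BES.enab_seq_inl.1 he)
      exact BES.enab_seq_inr.2 ⟨BES.enab_seq_inl.2 h1.1,
        fun hb => h1.2 (BES.inl_mem_init_seq.1 hb)⟩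
    · rw [Equiv.image_eq_preimage_symm]
      have h1 := BES.enab_seq_inr.1 he
      exact BES.enab_seq_inr.2 ⟨BES.enab_seq_inr.2 ⟨h1.1, fun hc => final_inter_seq.1 (h1.2 hc)⟩,
        fun hc => (BES.inr_notMem_init_seq hc).elim⟩
  · rintro ((a | b) | c) <;> rfl
  · rintro _ ⟨c, hc, rfl⟩
    exact ⟨_, ⟨c, hc, rfl⟩, rfl⟩
  · rintro x hx _ ⟨⟨_, ⟨p, hp, rfl⟩ | ⟨p, hp, rfl⟩, rfl⟩ | ⟨p, hp, rfl⟩, -⟩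
    · exact Or.inl ⟨p, hp, by simp only [PMF.map_comp]; rfl⟩
    · exact Or.inr ⟨_, Or.inl ⟨p, hp, rfl⟩, by simp only [PMF.map_comp]; rfl⟩
    · exact Or.inr ⟨_, Or.inr ⟨p, hp, rfl⟩, by simp only [PMF.map_comp]; rfl⟩

/-- Exchange of the components of a concurrent composition. -/
def parSwap (α β : Type) : BES.ParEv α β ≃ BES.ParEv β α where
  toFun
    | .left a => .right a
    | .right b => .left b
    | .start => .start
    | .finish => .finish
  invFun
    | .left a => .right a
    | .right b => .left b
    | .start => .start
    | .finish => .finish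
  left_inv := by rintro (a | a | _ | _) <;> rfl
  right_inv := by rintro (a | a | _ | _) <;> rfl

theorem par_comm_le {E F : PES Act} (hE : E.Good) (hF : F.Good) :
    (par E F).Sim (par F E) := by
  refine sim_of_map_dist (hE.par hF).finDist (parSwap _ _) ?_ ?_ ?_ ?_
  · rintro x hx (a | b | _ | _) he
    · rw [Equiv.image_eq_preimage_symm]
      exact BES.enab_par_right.2 (BES.enab_par_left.1 he)
    · rw [Equiv.image_eq_preimage_symm]
      exact BES.enab_par_left.2 (BES.enab_par_right.1 he)
    · rw [Equiv.image_eq_preimage_symm]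
      have h1 := BES.enab_par_start.1 he
      exact BES.enab_par_start.2 h1
    · rw [Equiv.image_eq_preimage_symm]
      have h1 := BES.enab_par_finish.1 he
      exact BES.enab_par_finish.2 ⟨h1.1, h1.2.2, h1.2.1⟩
  · rintro (a | b | _ | _) <;> rfl
  · rintro _ rfl
    rfl
  · rintro x hx _ ⟨(⟨p, hp, rfl⟩ | ⟨p, hp, rfl⟩) | rfl | rfl, -⟩
    · exact Or.inl (Or.inr ⟨p, hp, by simp only [PMF.map_comp]; rfl⟩)
    · exact Or.inl (Or.inl ⟨p, hp, by simp only [PMF.map_comp]; rfl⟩)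
    · exact Or.inr (Or.inl (PMF.pure_map _ _))
    · exact Or.inr (Or.inr (PMF.pure_map _ _))

theorem pc_comm_le {E F : PES Act} (hE : E.Good) (hF : F.Good) (α : unitInterval) :
    (pchoice α E F).Sim (pchoice (unitInterval.symm α) F E) := by
  refine sim_of_map_dist (hE.pchoice α hF).finDist (Equiv.sumComm _ _) ?_ ?_ ?_ ?_
  · rintro x hx (a | b) he
    · rw [Equiv.image_eq_preimage_symm]
      obtain ⟨h1, h2⟩ := enab_plus_inl_config hx he
      exact enab_plus_inr_of h1 h2
    · rw [Equiv.image_eq_preimage_symm]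
      obtain ⟨h1, h2⟩ := enab_plus_inr_config hx he
      exact enab_plus_inl_of h1 h2
  · rintro (a | b) <;> rfl
  · rintro _ (⟨c, hc, rfl⟩ | ⟨c, hc, rfl⟩)
    · exact Or.inr ⟨c, hc, rfl⟩
    · exact Or.inl ⟨c, hc, rfl⟩
  · rintro x hx r ⟨hr, -⟩
    rw [mem_pchoice_dist] at hr ⊢
    rcases hr with ⟨p, hp, q, hq, h1, h2, rfl⟩ | ⟨p, hp, rfl, h⟩ | ⟨p, hp, rfl, h⟩
    · refine Or.inl ⟨q, hq, p, hp, h2, h1, ?_⟩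
      rw [coin_symm_bind, PMF.map_bind]
      refine bind_congr_support fun b _ => ?_
      cases b
      · exact PMF.map_comp _ _ _
      · exact PMF.map_comp _ _ _
    · exact Or.inr (Or.inr ⟨p, hp, by simp only [PMF.map_comp]; rfl, h⟩)
    · exact Or.inr (Or.inl ⟨p, hp, by simp only [PMF.map_comp]; rfl, h⟩)

theorem support_map_inl_subset {E F : BES Act} {p : PMF E.Ev} :
    (p.map Sum.inl).support ⊆ (BES.plus E F).init ↔ p.support ⊆ E.init := by
  rw [PMF.support_map, Set.image_subset_iff]
  exact forall_congr' fun e => imp_congr_right fun _ => BES.inl_mem_init_plus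

theorem support_map_inr_subset {E F : BES Act} {p : PMF F.Ev} :
    (p.map Sum.inr).support ⊆ (BES.plus E F).init ↔ p.support ⊆ F.init := by
  rw [PMF.support_map, Set.image_subset_iff]
  exact forall_congr' fun e => imp_congr_right fun _ => BES.inr_mem_init_plus

theorem support_mix_subset {E F : BES Act} {p : PMF E.Ev} {q : PMF F.Ev} (α : unitInterval)
    (hp : p.support ⊆ E.init) (hq : q.support ⊆ F.init) :
    ((coin α).bind fun b => cond b (q.map Sum.inr) (p.map Sum.inl)).support ⊆
      (BES.plus E F).init := by
  intro z hz
  obtain ⟨b, -, hb⟩ := (PMF.mem_support_bind_iff _ _ _).1 hz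
  cases b
  · exact support_map_inl_subset.2 hp hb
  · exact support_map_inr_subset.2 hq hb

/-- Initial events of a choice are the initial events of its components. So inner mixtures are
exactly what the outer choice mixes again, non-initial distributions pass through both choices, and
the weights agree by `coin_assoc`. -/
theorem pc_assoc_le {E F G : PES Act} (hE : E.Good) (hF : F.Good) (hG : G.Good)
    {α β γ : unitInterval} (h : (α * β : ℝ) < 1)
    (hγ : (γ : ℝ) = α * (1 - β) / (1 - α * β)) :
    (pchoice α E (pchoice β F G)).Sim (pchoice (α * β) (pchoice γ E F) G) := by
  refine sim_of_map_dist (hE.pchoice α (hF.pchoice β hG)).finDist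
    (Equiv.sumAssoc _ _ _).symm ?_ ?_ ?_ ?_
  · rintro x hx (a | b) he
    · rw [Equiv.image_symm_eq_preimage]
      obtain ⟨h1, h2⟩ := enab_plus_inl_config hx he
      refine enab_plus_inl_of (enab_plus_inl_of h1 ?_) ?_
      · exact Set.preimage_eq_empty_iff.2 (by
          rw [Set.disjoint_left]
          rintro _ h3 ⟨a, rfl⟩
          exact (Set.eq_empty_iff_forall_notMem.1 h2) _ h3)
      · exact Set.preimage_eq_empty_iff.2 (by
          rw [Set.disjoint_left]
          rintro _ h3 ⟨a, rfl⟩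
          exact (Set.eq_empty_iff_forall_notMem.1 h2) _ h3)
    · obtain ⟨h1, h2⟩ := enab_plus_inr_config hx he
      have hx' := (BES.isConfig_plus_iff.1 hx).2.1
      rcases b with b | b
      · rw [Equiv.image_symm_eq_preimage]
        obtain ⟨h3, h4⟩ := enab_plus_inl_config hx' h1
        exact enab_plus_inl_of (enab_plus_inr_of h3 h2) h4
      · rw [Equiv.image_symm_eq_preimage]
        obtain ⟨h3, h4⟩ := enab_plus_inr_config hx' h1
        refine enab_plus_inr_of h3 ?_
        ext (a | a)
        · exact iff_of_false (fun h5 => Set.eq_empty_iff_forall_notMem.1 h2 a h5) id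
        · exact iff_of_false (fun h5 => Set.eq_empty_iff_forall_notMem.1 h4 a h5) id
  · rintro (a | b | c) <;> rfl
  · rintro _ (⟨c, hc, rfl⟩ | ⟨_, ⟨c, hc, rfl⟩ | ⟨c, hc, rfl⟩, rfl⟩)
    · exact Or.inl ⟨_, Or.inl ⟨c, hc, rfl⟩, rfl⟩
    · exact Or.inl ⟨_, Or.inr ⟨c, hc, rfl⟩, rfl⟩
    · exact Or.inr ⟨c, hc, rfl⟩
  · rintro x hx r ⟨hr, -⟩
    rw [mem_pchoice_dist] at hr ⊢
    rcases hr with ⟨p, hp, q, hq, h1, h2, rfl⟩ | ⟨p, hp, rfl, hpi⟩ | ⟨p, hp, rfl, hpi⟩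
    · rw [mem_pchoice_dist] at hq
      rcases hq with ⟨q, hq, s, hs, h3, h4, rfl⟩ | ⟨q, hq, rfl, h⟩ | ⟨q, hq, rfl, h⟩
      · refine Or.inl ⟨_, mem_pchoice_dist.2 (Or.inl ⟨p, hp, q, hq, h1, h3, rfl⟩), s, hs,
          support_mix_subset γ h1 h3, h4, ?_⟩
        have := coin_assoc h hγ (p.map (Sum.inl ∘ Sum.inl)) (q.map (Sum.inl ∘ Sum.inr))
          (s.map (Sum.inr : G.Ev → (E.Ev ⊕ F.Ev) ⊕ G.Ev))
        convert this using 1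
        · rw [PMF.map_bind]
          refine bind_congr_support fun b _ => ?_
          cases b
          · exact PMF.map_comp _ _ _
          · simp only [cond_true]
            rw [PMF.map_comp, PMF.map_bind]
            refine bind_congr_support fun b _ => ?_
            cases b <;> exact PMF.map_comp _ _ _
        · refine bind_congr_support fun b _ => ?_
          cases b
          · simp only [cond_false]
            rw [PMF.map_bind]
            refine bind_congr_support fun b _ => ?_
            cases b <;> exact PMF.map_comp _ _ _
          · rfl
      -- An unmixed distribution of the inner choice is not supported in initial events, so it
      -- cannot be part of an outer mixture.
      · exact (h (support_map_inl_subset.1 h2)).elim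
      · exact (h (support_map_inr_subset.1 h2)).elim
    · refine Or.inr (Or.inl ⟨_, mem_pchoice_dist.2 (Or.inr (Or.inl ⟨p, hp, rfl, hpi⟩)), ?_, ?_⟩)
      · simp only [PMF.map_comp]; rfl
      · rwa [support_map_inl_subset]
    · rcases mem_pchoice_dist.1 hp with
        ⟨q, hq, s, hs, h3, h4, rfl⟩ | ⟨q, hq, rfl, h⟩ | ⟨q, hq, rfl, h⟩
      · exact (hpi (support_mix_subset β h3 h4)).elim
      · refine Or.inr (Or.inl ⟨_, mem_pchoice_dist.2 (Or.inr (Or.inr ⟨q, hq, rfl, h⟩)), ?_, ?_⟩)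
        · simp only [PMF.map_comp]; rfl
        · rwa [support_map_inr_subset]
      · refine Or.inr (Or.inr ⟨q, hq, ?_, h⟩)
        simp only [PMF.map_comp]; rfl

theorem pc_assoc_ge {E F G : PES Act} (hE : E.Good) (hF : F.Good) (hG : G.Good)
    {α β γ : unitInterval} (h : (α * β : ℝ) < 1)
    (hγ : (γ : ℝ) = α * (1 - β) / (1 - α * β)) :
    (pchoice (α * β) (pchoice γ E F) G).Sim (pchoice α E (pchoice β F G)) := by
  refine sim_of_map_dist ((hE.pchoice γ hF).pchoice (α * β) hG).finDist
    (Equiv.sumAssoc _ _ _) ?_ ?_ ?_ ?_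
  · rintro x hx (a | b) he
    · obtain ⟨h1, h2⟩ := enab_plus_inl_config hx he
      have hx' := (BES.isConfig_plus_iff.1 hx).1
      rcases a with b | b
      · rw [Equiv.image_eq_preimage_symm]
        obtain ⟨h3, h4⟩ := enab_plus_inl_config hx' h1
        refine enab_plus_inl_of h3 ?_
        ext (a | a)
        · exact iff_of_false (fun h5 => Set.eq_empty_iff_forall_notMem.1 h4 a h5) id
        · exact iff_of_false (fun h5 => Set.eq_empty_iff_forall_notMem.1 h2 a h5) id
      · rw [Equiv.image_eq_preimage_symm]
        obtain ⟨h3, h4⟩ := enab_plus_inr_config hx' h1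
        exact enab_plus_inr_of (enab_plus_inl_of h3 h2) h4
    · rw [Equiv.image_eq_preimage_symm]
      obtain ⟨h1, h2⟩ := enab_plus_inr_config hx he
      refine enab_plus_inr_of (enab_plus_inr_of h1 ?_) ?_
      · ext a
        exact iff_of_false (fun h5 => Set.eq_empty_iff_forall_notMem.1 h2 (Sum.inr a) h5) id
      · ext a
        exact iff_of_false (fun h5 => Set.eq_empty_iff_forall_notMem.1 h2 (Sum.inl a) h5) id
  · rintro ((a | b) | c) <;> rfl
  · rintro _ (⟨_, ⟨c, hc, rfl⟩ | ⟨c, hc, rfl⟩, rfl⟩ | ⟨c, hc, rfl⟩)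
    · exact Or.inl ⟨c, hc, rfl⟩
    · exact Or.inr ⟨_, Or.inl ⟨c, hc, rfl⟩, rfl⟩
    · exact Or.inr ⟨_, Or.inr ⟨c, hc, rfl⟩, rfl⟩
  · rintro x hx r ⟨hr, -⟩
    rw [mem_pchoice_dist] at hr ⊢
    rcases hr with ⟨p, hp, s, hs, h2, h4, rfl⟩ | ⟨p, hp, rfl, hpi⟩ | ⟨p, hp, rfl, hpi⟩
    · rw [mem_pchoice_dist] at hp
      rcases hp with ⟨p, hp, q, hq, h1, h3, rfl⟩ | ⟨q, hq, rfl, h⟩ | ⟨q, hq, rfl, h⟩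
      · refine Or.inl ⟨p, hp, _, mem_pchoice_dist.2 (Or.inl ⟨q, hq, s, hs, h3, h4, rfl⟩), h1,
          support_mix_subset β h3 h4, ?_⟩
        have := (coin_assoc h hγ (p.map (Sum.inl : E.Ev → E.Ev ⊕ F.Ev ⊕ G.Ev))
          (q.map (Sum.inr ∘ Sum.inl)) (s.map (Sum.inr ∘ Sum.inr))).symm
        convert this using 1
        · rw [PMF.map_bind]
          refine bind_congr_support fun b _ => ?_
          cases b
          · simp only [cond_false]
            rw [PMF.map_comp, PMF.map_bind]
            refine bind_congr_support fun b _ => ?_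
            cases b <;> exact PMF.map_comp _ _ _
          · exact PMF.map_comp _ _ _
        · refine bind_congr_support fun b _ => ?_
          cases b
          · rfl
          · simp only [cond_true]
            rw [PMF.map_bind]
            refine bind_congr_support fun b _ => ?_
            cases b <;> exact PMF.map_comp _ _ _
      · exact (h (support_map_inl_subset.1 h2)).elim
      · exact (h (support_map_inr_subset.1 h2)).elim
    · rcases mem_pchoice_dist.1 hp with
        ⟨q, hq, s, hs, h3, h4, rfl⟩ | ⟨q, hq, rfl, h⟩ | ⟨q, hq, rfl, h⟩
      · exact (hpi (support_mix_subset γ h3 h4)).elim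
      · refine Or.inr (Or.inl ⟨q, hq, ?_, h⟩)
        simp only [PMF.map_comp]; rfl
      · refine Or.inr (Or.inr ⟨_, mem_pchoice_dist.2 (Or.inr (Or.inl ⟨q, hq, rfl, h⟩)), ?_, ?_⟩)
        · simp only [PMF.map_comp]; rfl
        · rwa [support_map_inl_subset]
    · refine Or.inr (Or.inr ⟨_, mem_pchoice_dist.2 (Or.inr (Or.inr ⟨p, hp, rfl, hpi⟩)), ?_, ?_⟩)
      · simp only [PMF.map_comp]; rfl
      · rwa [support_map_inr_subset]

theorem isSub_refl (X : PES Act) : IsSub X X id where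
  inj := Function.injective_id
  conf _ _ := Iff.rfl
  bundle x e h := by rwa [Set.image_id]
  bundle_restrict y e h := ⟨y, (Set.image_id y).symm, h⟩
  label _ := rfl
  final _ := Iff.rfl
  dist := by
    ext p
    simp [PMF.map_id]

/-- The isomorphism of `F + E·(E * F)` and `E * F`. -/
theorem isSub_star_unfold (E F : PES Act) :
    IsSub (plus F (seq E (star E F))) (star E F) (unfoldMap id) := isSub_unfold (isSub_refl _)

theorem unfoldMap_surjective (E F : PES Act) :
    Function.Surjective (unfoldMap (E := E) (F := F) (X := star E F) id) := by
  rintro (⟨_ | n, e⟩ | ⟨_ | n, e⟩)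
  · exact ⟨Sum.inr (Sum.inl e), rfl⟩
  · exact ⟨Sum.inr (Sum.inr (BES.StarEv.body n e)), rfl⟩
  · exact ⟨Sum.inl e, rfl⟩
  · exact ⟨Sum.inr (Sum.inr (BES.StarEv.exit n e)), rfl⟩

theorem star_unfold_le {E F : PES Act} (hE : E.Good) (hF : F.Good) :
    (plus F (seq E (star E F))).Sim (star E F) :=
  (isSub_star_unfold E F).sim (hF.plus (hE.seq (hE.star hF))).finDist

theorem star_unfold_ge {E F : PES Act} (hE : E.Good) (hF : F.Good) :
    (star E F).Sim (plus F (seq E (star E F))) :=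
  (isSub_star_unfold E F).sim_symm (unfoldMap_surjective E F) (hE.star hF).finDist

end PES
end PBES

namespace PBES

namespace BES

variable {Act : Type u}

/-! ### The implementation relation for composite structures -/

theorem sumSet_subset {α β : Type} {x x' : Set α} {y y' : Set β} :
    sumSet x y ⊆ sumSet x' y' ↔ x ⊆ x' ∧ y ⊆ y' := by
  constructor
  · intro h
    exact ⟨fun a ha => inl_mem_sumSet.1 (h (inl_mem_sumSet.2 ha)),
      fun a ha => inr_mem_sumSet.1 (h (inr_mem_sumSet.2 ha))⟩
  · rintro ⟨h, h'⟩
    exact sumSet_mono h h'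

/-- Within a component the order is tested on subconfigurations of that component. An event of `E`
precedes every event of `F` in `x`, since a subconfiguration that reaches `F` contains a terminated
part of `x`, which by `hmax` is all of `x`. An event of `F'` never precedes one of `E'`, since `y`
alone is a subconfiguration. -/
theorem implements_seq {E F E' F' : BES Act} {x : Set E.Ev} {x' : Set F.Ev} {y : Set E'.Ev}
    {y' : Set F'.Ev} (hx : E.IsConfig x) (hx' : F.IsConfig x') (hy : E'.IsConfig y)
    (hy' : F'.IsConfig y') (hxf : x'.Nonempty → (x ∩ E.final).Nonempty)
    (hyf : y'.Nonempty → (y ∩ E'.final).Nonempty)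
    (hmax : ∀ w, E.IsConfig w → w ⊆ x → (w ∩ E.final).Nonempty → w = x)
    (h : Implements E E' x y) (h' : Implements F F' x' y') :
    Implements (seq E F) (seq E' F') (sumSet x x') (sumSet y y') := by
  obtain ⟨r, hr⟩ := h.impl
  obtain ⟨s, hs⟩ := h'.impl
  have hX := isConfig_seq hx hx' hxf
  have hY := isConfig_seq hy hy' hyf
  refine Impl.implements (r := Sum.LiftRel r s) ⟨?_, ?_, ?_, ?_, ?_, ?_⟩ hX hY
  · rintro _ _ (⟨h⟩ | ⟨h⟩)
    · exact ⟨inl_mem_sumSet.2 (hr.mem _ _ h).1, inl_mem_sumSet.2 (hr.mem _ _ h).2⟩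
    · exact ⟨inr_mem_sumSet.2 (hs.mem _ _ h).1, inr_mem_sumSet.2 (hs.mem _ _ h).2⟩
  · rintro _ _ (⟨h⟩ | ⟨h⟩)
    · exact hr.label _ _ h
    · exact hs.label _ _ h
  · rintro (a | a) ha hl
    · obtain ⟨b, hb⟩ := hr.left a (inl_mem_sumSet.1 ha) hl
      exact ⟨_, .inl hb⟩
    · obtain ⟨b, hb⟩ := hs.left a (inr_mem_sumSet.1 ha) hl
      exact ⟨_, .inr hb⟩
  · rintro (a | a) ha hl
    · obtain ⟨b, hb⟩ := hr.right a (inl_mem_sumSet.1 ha) hl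
      exact ⟨_, .inl hb⟩
    · obtain ⟨b, hb⟩ := hs.right a (inr_mem_sumSet.1 ha) hl
      exact ⟨_, .inr hb⟩
  · rintro _ _ _ hl (⟨h⟩ | ⟨h⟩) (⟨h'⟩ | ⟨h'⟩)
    · exact congrArg _ (hr.inj _ _ _ hl h h')
    · exact congrArg _ (hs.inj _ _ _ hl h h')
  · intro a a' b b' hl hl' hab hab' hle
    have hb : b ∈ sumSet x x' ∧ b' ∈ sumSet x x' := by
      constructor
      · rcases hab with ⟨h⟩ | ⟨h⟩
        · exact inl_mem_sumSet.2 (hr.mem _ _ h).2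
        · exact inr_mem_sumSet.2 (hs.mem _ _ h).2
      · rcases hab' with ⟨h⟩ | ⟨h⟩
        · exact inl_mem_sumSet.2 (hr.mem _ _ h).2
        · exact inr_mem_sumSet.2 (hs.mem _ _ h).2
    rw [configLE_iff hX]
    refine ⟨hb.1, hb.2, fun w hw hwX hbw => ?_⟩
    rw [configLE_iff hY] at hle
    obtain ⟨hw1, hw2, hw3⟩ := isConfig_seq_iff.1 hw
    rw [← sumSet_preimage w, sumSet_subset] at hwX
    rcases hab with ⟨h⟩ | ⟨h⟩ <;> rcases hab' with ⟨h'⟩ | ⟨h'⟩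
    · have h1 : E'.configLE y _ _ := (configLE_iff hy _ _).2 ⟨(hr.mem _ _ h).1, (hr.mem _ _ h').1,
        fun v hv hvy ha => by
          simpa using hle.2.2 (sumSet v ∅) (isConfig_seq hv (isConfig_empty _) (by simp))
            (sumSet_mono hvy (Set.empty_subset _)) (inl_mem_sumSet.2 ha)⟩
      exact ((configLE_iff hx _ _).1 (hr.mono _ _ _ _ hl hl' h h' h1)).2.2 _ hw1 hwX.1 hbw
    · have h1 := hmax _ hw1 hwX.1 (hw3 ⟨_, hbw⟩)
      have h2 := (hr.mem _ _ h).2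
      rw [← h1] at h2
      exact h2
    · have h1 := hle.2.2 (sumSet y ∅) (isConfig_seq hy (isConfig_empty _) (by simp))
        (sumSet_mono subset_rfl (Set.empty_subset _)) (inl_mem_sumSet.2 (hr.mem _ _ h').1)
      exact (inr_mem_sumSet.1 h1).elim
    · have h1 : F'.configLE y' _ _ := (configLE_iff hy' _ _).2
        ⟨(hs.mem _ _ h).1, (hs.mem _ _ h').1, fun v hv hvy ha => by
          simpa using hle.2.2 (sumSet y v) (isConfig_seq hy hv fun hne => hyf (hne.mono hvy))
            (sumSet_mono subset_rfl hvy) (inr_mem_sumSet.2 ha)⟩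
      exact ((configLE_iff hx' _ _).1 (hs.mono _ _ _ _ hl hl' h h' h1)).2.2 _ hw2 hwX.2 hbw

/-- A pair of relations on the components of a concurrent composition. -/
inductive ParRel {α β γ δ : Type} (r : α → γ → Prop) (s : β → δ → Prop) :
    ParEv α β → ParEv γ δ → Prop
  | left {a b} : r a b → ParRel r s (.left a) (.left b)
  | right {a b} : s a b → ParRel r s (.right a) (.right b)

/-- The two components are not ordered relative to each other: executing just one of them, after
`start`, gives a subconfiguration that avoids the other. -/
theorem implements_par {E F E' F' : BES Act} {x : Set E.Ev} {x' : Set F.Ev} {y : Set E'.Ev}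
    {y' : Set F'.Ev} {t f t' f' : Prop} (hX : (par E F).IsConfig (parSet t x x' f))
    (hY : (par E' F').IsConfig (parSet t' y y' f'))
    (h : Implements E E' x y) (h' : Implements F F' x' y') :
    Implements (par E F) (par E' F') (parSet t x x' f) (parSet t' y y' f') := by
  obtain ⟨r, hr⟩ := h.impl
  obtain ⟨s, hs⟩ := h'.impl
  obtain ⟨hx, hx', -⟩ := isConfig_par_iff.1 hX
  obtain ⟨hy, hy', hy1, hy2, -⟩ := isConfig_par_iff.1 hY
  simp only [left_preimage_parSet, right_preimage_parSet, start_mem_parSet] at hx hx' hy hy' hy1 hy2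
  refine Impl.implements (r := ParRel r s) ⟨?_, ?_, ?_, ?_, ?_, ?_⟩ hX hY
  · rintro _ _ (⟨h⟩ | ⟨h⟩)
    · exact hr.mem _ _ h
    · exact hs.mem _ _ h
  · rintro _ _ (⟨h⟩ | ⟨h⟩)
    · exact hr.label _ _ h
    · exact hs.label _ _ h
  · rintro (a | a | _ | _) ha hl
    · obtain ⟨b, hb⟩ := hr.left a ha hl
      exact ⟨_, .left hb⟩
    · obtain ⟨b, hb⟩ := hs.left a ha hl
      exact ⟨_, .right hb⟩
    · exact (hl rfl).elim
    · exact (hl rfl).elim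
  · rintro (a | a | _ | _) ha hl
    · obtain ⟨b, hb⟩ := hr.right a ha hl
      exact ⟨_, .left hb⟩
    · obtain ⟨b, hb⟩ := hs.right a ha hl
      exact ⟨_, .right hb⟩
    · exact (hl rfl).elim
    · exact (hl rfl).elim
  · rintro _ _ _ hl (⟨h⟩ | ⟨h⟩) (⟨h'⟩ | ⟨h'⟩)
    · exact congrArg _ (hr.inj _ _ _ hl h h')
    · exact congrArg _ (hs.inj _ _ _ hl h h')
  · intro a a' b b' hl hl' hab hab' hle
    have hb : b ∈ parSet t x x' f ∧ b' ∈ parSet t x x' f := by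
      constructor
      · rcases hab with ⟨h⟩ | ⟨h⟩
        · exact (hr.mem _ _ h).2
        · exact (hs.mem _ _ h).2
      · rcases hab' with ⟨h⟩ | ⟨h⟩
        · exact (hr.mem _ _ h).2
        · exact (hs.mem _ _ h).2
    rw [configLE_iff hX]
    refine ⟨hb.1, hb.2, fun w hw hwX hbw => ?_⟩
    rw [configLE_iff hY] at hle
    obtain ⟨hw1, hw2, -⟩ := isConfig_par_iff.1 hw
    have hL : ∀ v, E'.IsConfig v → v ⊆ y → (par E' F').IsConfig (parSet t' v ∅ False) ∧
        parSet t' v ∅ False ⊆ parSet t' y y' f' := fun v hv hvy =>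
      ⟨isConfig_par hv (isConfig_empty _) (fun hne => hy1 (hne.mono hvy)) (by simp) False.elim,
        parSet_mono id hvy (Set.empty_subset _) False.elim⟩
    have hR : ∀ v, F'.IsConfig v → v ⊆ y' → (par E' F').IsConfig (parSet t' ∅ v False) ∧
        parSet t' ∅ v False ⊆ parSet t' y y' f' := fun v hv hvy =>
      ⟨isConfig_par (isConfig_empty _) hv (by simp) (fun hne => hy2 (hne.mono hvy)) False.elim,
        parSet_mono id (Set.empty_subset _) hvy False.elim⟩
    rcases hab with ⟨h⟩ | ⟨h⟩ <;> rcases hab' with ⟨h'⟩ | ⟨h'⟩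
    · have h1 : E'.configLE y _ _ := (configLE_iff hy _ _).2 ⟨(hr.mem _ _ h).1, (hr.mem _ _ h').1,
        fun v hv hvy ha => hle.2.2 _ (hL v hv hvy).1 (hL v hv hvy).2 ha⟩
      exact ((configLE_iff hx _ _).1 (hr.mono _ _ _ _ hl hl' h h' h1)).2.2 _ hw1
        (fun a ha => hwX ha) hbw
    · exact (hle.2.2 _ (hR y' hy' subset_rfl).1 (hR y' hy' subset_rfl).2 (hs.mem _ _ h').1).elim
    · exact (hle.2.2 _ (hL y hy subset_rfl).1 (hL y hy subset_rfl).2 (hr.mem _ _ h').1).elim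
    · have h1 : F'.configLE y' _ _ := (configLE_iff hy' _ _).2
        ⟨(hs.mem _ _ h).1, (hs.mem _ _ h').1,
        fun v hv hvy ha => hle.2.2 _ (hR v hv hvy).1 (hR v hv hvy).2 ha⟩
      exact ((configLE_iff hx' _ _).1 (hs.mono _ _ _ _ hl hl' h h' h1)).2.2 _ hw2
        (fun a ha => hwX ha) hbw

end BES

namespace PES

variable {Act : Type u}

/-! ### Monotonicity of sequential composition -/

/-- The configuration of `E·F` with the given parts, provided that it is one. -/
noncomputable def seqCfg {E F : PES Act} (x : E.Config) (y : F.Config) : (seq E F).Config :=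
  open Classical in
  if h : y.1.Nonempty → (x.1 ∩ E.final).Nonempty then
    ⟨BES.sumSet x.1 y.1, BES.isConfig_seq x.2 y.2 h⟩ else (seq E F).emptyConfig

theorem seqCfg_val {E F : PES Act} {x : E.Config} {y : F.Config}
    (h : y.1.Nonempty → (x.1 ∩ E.final).Nonempty) : (seqCfg x y).1 = BES.sumSet x.1 y.1 := by
  rw [seqCfg, dif_pos h]

theorem seqCfg_empty_val {E F : PES Act} (x : E.Config) :
    (seqCfg x F.emptyConfig).1 = BES.sumSet x.1 ∅ :=
  seqCfg_val fun h => (Set.not_nonempty_empty h).elim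

theorem seqCfg_empty {E F : PES Act} :
    seqCfg E.emptyConfig F.emptyConfig = (seq E F).emptyConfig :=
  Subtype.ext ((seqCfg_empty_val _).trans BES.sumSet_empty)

theorem enab_seqCfg_inl {E F : PES Act} {x : E.Config} {y : F.Config}
    (h : y.1.Nonempty → (x.1 ∩ E.final).Nonempty) {e : E.Ev} :
    (seq E F).Enab (seqCfg x y).1 (Sum.inl e) ↔ E.Enab x.1 e := by
  rw [seqCfg_val h]
  refine BES.enab_seq_inl.trans ?_
  rw [BES.inl_preimage_sumSet]

theorem enab_seqCfg_inr {E F : PES Act} {x : E.Config} {y : F.Config}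
    (h : y.1.Nonempty → (x.1 ∩ E.final).Nonempty) {e : F.Ev} :
    (seq E F).Enab (seqCfg x y).1 (Sum.inr e) ↔ F.Enab y.1 e ∧ (x.1 ∩ E.final).Nonempty := by
  rw [seqCfg_val h]
  refine BES.enab_seq_inr.trans ?_
  rw [BES.inl_preimage_sumSet, BES.inr_preimage_sumSet]
  refine and_congr_right fun he => ⟨fun h1 => ?_, fun h1 _ => h1⟩
  rcases y.1.eq_empty_or_nonempty with h2 | h2
  · rw [h2] at he
    exact h1 he.mem_init
  · exact h h2

theorem add_seqCfg_inl {E F : PES Act} {x : E.Config} {e : E.Ev} (he : E.Enab x.1 e) :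
    add (seqCfg x F.emptyConfig) (Sum.inl e) = seqCfg (add x e) F.emptyConfig := by
  have h : (F.emptyConfig.1.Nonempty → (x.1 ∩ E.final).Nonempty) :=
    fun h => (Set.not_nonempty_empty h).elim
  apply Subtype.ext
  rw [add_val ((enab_seqCfg_inl h).2 he), seqCfg_empty_val, seqCfg_empty_val, add_val he,
    BES.insert_inl_sumSet]

theorem add_seqCfg_inr {E F : PES Act} {x : E.Config} {y : F.Config} {e : F.Ev}
    (hx : (x.1 ∩ E.final).Nonempty) (he : F.Enab y.1 e) :
    add (seqCfg x y) (Sum.inr e) = seqCfg x (add y e) := by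
  apply Subtype.ext
  rw [add_val ((enab_seqCfg_inr fun _ => hx).2 ⟨he, hx⟩), seqCfg_val fun _ => hx,
    seqCfg_val fun _ => hx, add_val he, BES.insert_inr_sumSet]

theorem final_seqCfg {E F : PES Act} {x : E.Config} {y : F.Config}
    (h : y.1.Nonempty → (x.1 ∩ E.final).Nonempty) :
    ((seqCfg x y).1 ∩ (seq E F).final).Nonempty ↔ (y.1 ∩ F.final).Nonempty := by
  rw [seqCfg_val h]
  refine final_inter_seq.trans ?_
  rw [BES.inr_preimage_sumSet]

theorem eq_emptyConfig {E : PES Act} {x : E.Config} (h : ¬ x.1.Nonempty) : x = E.emptyConfig :=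
  Subtype.ext (Set.not_nonempty_iff_eq_empty.1 h)

/-- A step of `E·F` is a step of `E` before termination or one of `F` after it. -/
theorem pEnab_seqCfg {E F : PES Act} (hE : E.Good) {x : E.Config} {y : F.Config}
    (h : y.1.Nonempty → (x.1 ∩ E.final).Nonempty) {p : PMF (seq E F).Ev}
    (hp : (seq E F).PEnab (seqCfg x y).1 p) :
    (∃ q, E.PEnab x.1 q ∧ p = q.map Sum.inl ∧ y = F.emptyConfig) ∨
    ∃ q, F.PEnab y.1 q ∧ p = q.map Sum.inr ∧ (x.1 ∩ E.final).Nonempty := by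
  obtain ⟨⟨q, hq, rfl⟩ | ⟨q, hq, rfl⟩, hen⟩ := hp
  · have h1 : ∀ e ∈ q.support, E.Enab x.1 e := fun e he =>
      (enab_seqCfg_inl h).1 (hen _ ((PMF.mem_support_map_iff _ _ _).2 ⟨e, he, rfl⟩))
    refine Or.inl ⟨q, ⟨hq, h1⟩, rfl, eq_emptyConfig fun hne => ?_⟩
    obtain ⟨e, he⟩ := q.support_nonempty
    exact hE.final_max _ x.2 (h hne) e (h1 e he)
  · have h1 : ∀ e ∈ q.support, F.Enab y.1 e ∧ (x.1 ∩ E.final).Nonempty := fun e he =>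
      (enab_seqCfg_inr h).1 (hen _ ((PMF.mem_support_map_iff _ _ _).2 ⟨e, he, rfl⟩))
    obtain ⟨e, he⟩ := q.support_nonempty
    exact Or.inr ⟨q, ⟨hq, fun e he => (h1 e he).1⟩, rfl, (h1 e he).2⟩

theorem Weak.seqCfg_left {E F : PES Act} {Θ Θ' : PMF E.Config} (h : E.Weak Θ Θ') :
    (seq E F).Weak (Θ.map fun x => seqCfg x F.emptyConfig)
      (Θ'.map fun x => seqCfg x F.emptyConfig) := by
  refine Weak.embed (F := seq E F) Sum.inl Sum.inl_injective (fun p hp => Or.inl ⟨p, hp, rfl⟩) _ ∅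
    (fun _ => id) (fun y => ?_) h
  rw [seqCfg_empty_val, BES.sumSet, Set.image_empty, Set.union_empty, Set.empty_union]

theorem Weak.seqCfg_right {E F : PES Act} {x : E.Config} (hx : (x.1 ∩ E.final).Nonempty)
    {Θ Θ' : PMF F.Config} (h : F.Weak Θ Θ') :
    (seq E F).Weak (Θ.map (seqCfg x)) (Θ'.map (seqCfg x)) := by
  refine Weak.embed (F := seq E F) Sum.inr Sum.inr_injective (fun p hp => Or.inr ⟨p, hp, rfl⟩) _
    (Sum.inl '' x.1) (fun e => by simp) (fun y => ?_) h
  rw [seqCfg_val fun _ => hx, BES.sumSet]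

theorem weak_seqCfg_inr {E F : PES Act} {x : E.Config} (hx : (x.1 ∩ E.final).Nonempty)
    {y : F.Config} {q : PMF F.Ev} (hq : F.PEnab y.1 q) :
    (seq E F).Weak (PMF.pure (seqCfg x y)) (q.map fun e => seqCfg x (add y e)) := by
  have h := Weak.seqCfg_right hx (Weak.of_pEnab hq)
  rw [PMF.pure_map, PMF.map_comp] at h
  exact h

theorem implements_seqCfg {E F E' F' : PES Act} (hE : E.Good) {x : E.Config} {x' : F.Config}
    {y : E'.Config} {y' : F'.Config} (hxf : x'.1.Nonempty → (x.1 ∩ E.final).Nonempty)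
    (hyf : y'.1.Nonempty → (y.1 ∩ E'.final).Nonempty)
    (h : BES.Implements E.toBES E'.toBES x.1 y.1)
    (h' : BES.Implements F.toBES F'.toBES x'.1 y'.1) :
    BES.Implements (seq E F).toBES (seq E' F').toBES (seqCfg x x').1 (seqCfg y y').1 := by
  rw [seqCfg_val hxf, seqCfg_val hyf]
  exact BES.implements_seq x.2 x'.2 y.2 y'.2 hxf hyf
    (fun w hw hwx hf => hE.eq_of_final hw x.2 hwx hf) h h'

/-- Steps of `E` are answered through `S`. Once `E` has terminated, every configuration in the
support of `Θ₁` has terminated too, so a step of `F` can be copied behind each of them. -/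
theorem seq_mono_left {E E' F : PES Act} (hE : E.Good) (hE' : E'.Good) (hF : F.Good)
    (h : E.Sim E') : (seq E F).Sim (seq E' F) := by
  obtain ⟨S, hS⟩ := h.nsim hE'.finDist
  let U : (seq E F).Config → PMF (seq E' F).Config → Prop := fun z Θ =>
    ∃ (x : E.Config) (y : F.Config) (Θ₁ : PMF E'.Config), z = seqCfg x y ∧ S x Θ₁ ∧
      (y.1.Nonempty → (x.1 ∩ E.final).Nonempty) ∧ Θ = Θ₁.map fun x' => seqCfg x' y
  refine sim_of (hE.seq hF).finDist U ?_ ?_ ?_ ?_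
  · refine ⟨E.emptyConfig, F.emptyConfig, _, seqCfg_empty.symm, hS.empty,
      fun h => (Set.not_nonempty_empty h).elim, ?_⟩
    rw [PMF.pure_map, seqCfg_empty]
  · rintro z _ ⟨x, y, Θ₁, rfl, h, hf, rfl⟩ w hw
    obtain ⟨x', hx', rfl⟩ := (PMF.mem_support_map_iff _ _ _).1 hw
    exact implements_seqCfg hE hf (fun hne => hS.final _ _ h (hf hne) x' hx')
      (hS.implements _ _ h x' hx') (BES.Implements.refl _ _)
  · rintro z _ ⟨x, y, Θ₁, rfl, h, hf, rfl⟩ p hp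
    rcases pEnab_seqCfg hE hf hp with ⟨q, hq, rfl, rfl⟩ | ⟨q, hq, rfl, hxf⟩
    · obtain ⟨K, h1, h2⟩ := hS.step_enab h hq
      refine exists_kernel (U := U) Sum.inl Sum.inl_injective q
        (fun e => (K (add x e)).map fun x' => seqCfg x' F.emptyConfig) (fun e he => ?_) ?_
      · exact ⟨add x e, F.emptyConfig, _, add_seqCfg_inl (hq.2 e he), h1 e he,
          fun h => (Set.not_nonempty_empty h).elim, rfl⟩
      · have h3 := Weak.seqCfg_left (F := F) h2
        rwa [PMF.map_bind] at h3
    · have hyf := hS.final _ _ h hxf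
      refine exists_kernel (U := U) Sum.inr Sum.inr_injective q
        (fun e => Θ₁.map fun x' => seqCfg x' (add y e)) (fun e he => ?_) ?_
      · exact ⟨x, add y e, Θ₁, add_seqCfg_inr hxf (hq.2 e he), h, fun _ => hxf, rfl⟩
      · have h3 := Weak.bind_pure (hE'.seq hF).finDist (hS.fin _ _ h) (y := fun x' => seqCfg x' y)
          fun x' hx' => weak_seqCfg_inr (hyf x' hx') hq
        -- The configuration of `E'` and the event of `F` are drawn independently, so the order of
        -- drawing is immaterial.
        have h4 : (Θ₁.bind fun x' => q.map fun e => seqCfg x' (add y e)) =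
            q.bind fun e => Θ₁.map fun x' => seqCfg x' (add y e) := PMF.bind_comm _ _ _
        rwa [h4] at h3
  · rintro z _ ⟨x, y, Θ₁, rfl, h, hf, rfl⟩ hz w hw
    obtain ⟨x', hx', rfl⟩ := (PMF.mem_support_map_iff _ _ _).1 hw
    rw [final_seqCfg hf] at hz
    exact (final_seqCfg fun hne => hS.final _ _ h (hf hne) x' hx').2 hz

/-- The relation has to say that `F'` is idle as long as `E` has not terminated: otherwise `Θ₁`
might describe configurations of `F'` that cannot be placed behind `x`. -/
theorem seq_mono_right {E F F' : PES Act} (hE : E.Good) (hF : F.Good) (hF' : F'.Good)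
    (h : F.Sim F') : (seq E F).Sim (seq E F') := by
  obtain ⟨T, hT⟩ := h.nsim hF'.finDist
  let U : (seq E F).Config → PMF (seq E F').Config → Prop := fun z Θ =>
    ∃ (x : E.Config) (y : F.Config) (Θ₁ : PMF F'.Config), z = seqCfg x y ∧ T y Θ₁ ∧
      (y.1.Nonempty → (x.1 ∩ E.final).Nonempty) ∧
      (Θ₁ = PMF.pure F'.emptyConfig ∨ (x.1 ∩ E.final).Nonempty) ∧ Θ = Θ₁.map (seqCfg x)
  have hU : ∀ (x : E.Config) (Θ₁ : PMF F'.Config),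
      (Θ₁ = PMF.pure F'.emptyConfig ∨ (x.1 ∩ E.final).Nonempty) → ∀ y' ∈ Θ₁.support,
      y'.1.Nonempty → (x.1 ∩ E.final).Nonempty := by
    rintro x Θ₁ (rfl | h) y' hy' hne
    · rw [PMF.mem_support_pure_iff] at hy'
      subst hy'
      exact (Set.not_nonempty_empty hne).elim
    · exact h
  refine sim_of (hE.seq hF).finDist U ?_ ?_ ?_ ?_
  · refine ⟨E.emptyConfig, F.emptyConfig, _, seqCfg_empty.symm, hT.empty,
      fun h => (Set.not_nonempty_empty h).elim, Or.inl rfl, ?_⟩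
    rw [PMF.pure_map, seqCfg_empty]
  · rintro z _ ⟨x, y, Θ₁, rfl, h, hf, h', rfl⟩ w hw
    obtain ⟨y', hy', rfl⟩ := (PMF.mem_support_map_iff _ _ _).1 hw
    exact implements_seqCfg hE hf (hU x Θ₁ h' y' hy') (BES.Implements.refl _ _)
      (hT.implements _ _ h y' hy')
  · rintro z _ ⟨x, y, Θ₁, rfl, h, hf, h', rfl⟩ p hp
    rcases pEnab_seqCfg hE hf hp with ⟨q, hq, rfl, rfl⟩ | ⟨q, hq, rfl, hxf⟩
    -- Since `E` can still move, it has not terminated.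
    · have h0 : Θ₁ = PMF.pure F'.emptyConfig := h'.resolve_right fun hxf => by
        obtain ⟨e, he⟩ := q.support_nonempty
        exact hE.final_max _ x.2 hxf e (hq.2 e he)
      subst h0
      refine exists_kernel (U := U) Sum.inl Sum.inl_injective q
        (fun e => PMF.pure (seqCfg (add x e) F'.emptyConfig)) (fun e he => ?_) ?_
      · exact ⟨add x e, F.emptyConfig, _, add_seqCfg_inl (hq.2 e he), hT.empty,
          fun h => (Set.not_nonempty_empty h).elim, Or.inl rfl, (PMF.pure_map _ _).symm⟩
      · have h3 := Weak.seqCfg_left (F := F') (Weak.of_pEnab hq)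
        rw [PMF.pure_map, PMF.map_comp] at h3
        rw [PMF.pure_map]
        exact h3
    · obtain ⟨K, h1, h2⟩ := hT.step_enab h hq
      refine exists_kernel (U := U) Sum.inr Sum.inr_injective q
        (fun e => (K (add y e)).map (seqCfg x)) (fun e he => ?_) ?_
      · exact ⟨x, add y e, _, add_seqCfg_inr hxf (hq.2 e he), h1 e he, fun _ => hxf, Or.inr hxf, rfl⟩
      · have h3 := Weak.seqCfg_right hxf h2
        rwa [PMF.map_bind] at h3
  · rintro z _ ⟨x, y, Θ₁, rfl, h, hf, h', rfl⟩ hz w hw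
    obtain ⟨y', hy', rfl⟩ := (PMF.mem_support_map_iff _ _ _).1 hw
    rw [final_seqCfg hf] at hz
    exact (final_seqCfg (hU x Θ₁ h' y' hy')).2 (hT.final _ _ h hz y' hy')

theorem seq_mono {E E' F F' : PES Act} (hE : E.Good) (hE' : E'.Good) (hF : F.Good)
    (hF' : F'.Good) (h : E.Sim E') (h' : F.Sim F') : (seq E F).Sim (seq E' F') :=
  (seq_mono_left hE hE' hF h).trans (hE.seq hF).finDist (hE'.seq hF).finDist
    (hE'.seq hF').finDist (seq_mono_right hE' hF hF' h')

/-! ### Monotonicity of concurrent composition -/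

/-- The configuration of `E ‖ F` that consists of the delimiter `s` and of the given parts. -/
def parCfg {E F : PES Act} (x : E.Config) (y : F.Config) : (par E F).Config :=
  ⟨BES.parSet True x.1 y.1 False,
    BES.isConfig_par x.2 y.2 (fun _ => trivial) (fun _ => trivial) False.elim⟩

theorem parCfg_val {E F : PES Act} (x : E.Config) (y : F.Config) :
    (parCfg x y).1 = BES.parSet True x.1 y.1 False := rfl

/-- The configuration of `E ‖ F` with both delimiters and the given parts, provided that it is
one. -/
noncomputable def parEnd {E F : PES Act} (x : E.Config) (y : F.Config) : (par E F).Config :=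
  open Classical in
  if h : (x.1 ∩ E.final).Nonempty ∧ (y.1 ∩ F.final).Nonempty then
    ⟨BES.parSet True x.1 y.1 True,
      BES.isConfig_par x.2 y.2 (fun _ => trivial) (fun _ => trivial) fun _ => h⟩
  else parCfg x y

theorem parEnd_val {E F : PES Act} {x : E.Config} {y : F.Config}
    (h : (x.1 ∩ E.final).Nonempty) (h' : (y.1 ∩ F.final).Nonempty) :
    (parEnd x y).1 = BES.parSet True x.1 y.1 True := by
  rw [parEnd, dif_pos ⟨h, h'⟩]

theorem enab_parCfg_left {E F : PES Act} {x : E.Config} {y : F.Config} {e : E.Ev} :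
    (par E F).Enab (parCfg x y).1 (.left e) ↔ E.Enab x.1 e :=
  BES.enab_par_left.trans (and_iff_left fun _ => trivial)

theorem enab_parCfg_right {E F : PES Act} {x : E.Config} {y : F.Config} {e : F.Ev} :
    (par E F).Enab (parCfg x y).1 (.right e) ↔ F.Enab y.1 e :=
  BES.enab_par_right.trans (and_iff_left fun _ => trivial)

theorem enab_parCfg_finish {E F : PES Act} {x : E.Config} {y : F.Config} :
    (par E F).Enab (parCfg x y).1 .finish ↔
      (x.1 ∩ E.final).Nonempty ∧ (y.1 ∩ F.final).Nonempty :=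
  BES.enab_par_finish.trans (and_iff_right id)

theorem add_parCfg_left {E F : PES Act} {x : E.Config} {y : F.Config} {e : E.Ev}
    (he : E.Enab x.1 e) : add (parCfg x y) (.left e) = parCfg (add x e) y := by
  apply Subtype.ext
  rw [add_val (enab_parCfg_left.2 he), parCfg_val, parCfg_val, add_val he, BES.insert_left_parSet]

theorem add_parCfg_right {E F : PES Act} {x : E.Config} {y : F.Config} {e : F.Ev}
    (he : F.Enab y.1 e) : add (parCfg x y) (.right e) = parCfg x (add y e) := by
  apply Subtype.ext
  rw [add_val (enab_parCfg_right.2 he), parCfg_val, parCfg_val, add_val he, BES.insert_right_parSet]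

theorem add_parCfg_finish {E F : PES Act} {x : E.Config} {y : F.Config}
    (h : (x.1 ∩ E.final).Nonempty) (h' : (y.1 ∩ F.final).Nonempty) :
    add (parCfg x y) .finish = parEnd x y := by
  apply Subtype.ext
  rw [add_val (enab_parCfg_finish.2 ⟨h, h'⟩), parEnd_val h h', parCfg_val, BES.insert_finish_parSet]

theorem enab_empty_start {E F : PES Act} :
    (par E F).Enab (par E F).emptyConfig.1 .start := BES.enab_par_start.2 id

theorem add_empty_start {E F : PES Act} :
    add (par E F).emptyConfig .start = parCfg E.emptyConfig F.emptyConfig := by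
  apply Subtype.ext
  rw [add_val enab_empty_start, parCfg_val]
  have : (par E F).emptyConfig.1 = BES.parSet False ∅ ∅ False := BES.parSet_empty.symm
  rw [this, BES.insert_start_parSet]
  rfl

theorem final_max_config {E : PES Act} (hE : E.Good) {x : E.Config}
    (hx : (x.1 ∩ E.final).Nonempty) {p : PMF E.Ev} (hp : E.PEnab x.1 p) : False := by
  obtain ⟨e, he⟩ := p.support_nonempty
  exact hE.final_max _ x.2 hx e (hp.2 e he)

theorem final_parEnd {E F : PES Act} {x : E.Config} {y : F.Config}
    (h : (x.1 ∩ E.final).Nonempty) (h' : (y.1 ∩ F.final).Nonempty) :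
    ((parEnd x y).1 ∩ (par E F).final).Nonempty := by
  rw [parEnd_val h h']
  exact final_inter_par.2 trivial

theorem not_final_parCfg {E F : PES Act} {x : E.Config} {y : F.Config} :
    ¬ ((parCfg x y).1 ∩ (par E F).final).Nonempty := fun h => final_inter_par.1 h

theorem not_final_empty {E : PES Act} : ¬ (E.emptyConfig.1 ∩ E.final).Nonempty := by
  rintro ⟨e, h, -⟩
  exact h

theorem pEnab_pure {E : PES Act} {x : Set E.Ev} {e : E.Ev} (h : PMF.pure e ∈ E.dist)
    (he : E.Enab x e) : E.PEnab x (PMF.pure e) :=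
  ⟨h, fun a ha => by rw [PMF.mem_support_pure_iff] at ha; rwa [ha]⟩

/-- Execution of a single event. -/
theorem weak_add {E : PES Act} {x : E.Config} {e : E.Ev} (h : PMF.pure e ∈ E.dist)
    (he : E.Enab x.1 e) : E.Weak (PMF.pure x) (PMF.pure (add x e)) := by
  have := Weak.of_pEnab (pEnab_pure h he)
  rwa [PMF.pure_map] at this

theorem start_mem_dist {E F : PES Act} : PMF.pure BES.ParEv.start ∈ (par E F).dist :=
  Or.inr (Or.inl rfl)

theorem finish_mem_dist {E F : PES Act} : PMF.pure BES.ParEv.finish ∈ (par E F).dist :=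
  Or.inr (Or.inr rfl)

theorem weak_start {E F : PES Act} : (par E F).Weak (PMF.pure (par E F).emptyConfig)
    (PMF.pure (parCfg E.emptyConfig F.emptyConfig)) := by
  have := weak_add start_mem_dist (enab_empty_start (E := E) (F := F))
  rwa [add_empty_start] at this

theorem weak_finish {E F : PES Act} {x : E.Config} {y : F.Config}
    (h : (x.1 ∩ E.final).Nonempty) (h' : (y.1 ∩ F.final).Nonempty) :
    (par E F).Weak (PMF.pure (parCfg x y)) (PMF.pure (parEnd x y)) := by
  have := weak_add finish_mem_dist (enab_parCfg_finish.2 ⟨h, h'⟩)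
  rwa [add_parCfg_finish h h'] at this

/-- Steps of `E ‖ F` from its empty configuration. -/
theorem pEnab_par_empty {E F : PES Act} {p : PMF (par E F).Ev}
    (hp : (par E F).PEnab (par E F).emptyConfig.1 p) : p = PMF.pure .start := by
  have key : ∀ e ∈ p.support, e = BES.ParEv.start := fun e he =>
    BES.mem_init_par.1 (hp.2 e he).mem_init
  obtain ⟨(⟨q, hq, rfl⟩ | ⟨q, hq, rfl⟩) | rfl | rfl, hen⟩ := hp
  · obtain ⟨e, he⟩ := q.support_nonempty
    cases key _ ((PMF.mem_support_map_iff _ _ _).2 ⟨e, he, rfl⟩)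
  · obtain ⟨e, he⟩ := q.support_nonempty
    cases key _ ((PMF.mem_support_map_iff _ _ _).2 ⟨e, he, rfl⟩)
  · rfl
  · cases key BES.ParEv.finish ((PMF.mem_support_pure_iff _ _).2 rfl)

/-- Steps of `E ‖ F` after its start. -/
theorem pEnab_parCfg {E F : PES Act} {x : E.Config} {y : F.Config} {p : PMF (par E F).Ev}
    (hp : (par E F).PEnab (parCfg x y).1 p) :
    (∃ q, E.PEnab x.1 q ∧ p = q.map .left) ∨ (∃ q, F.PEnab y.1 q ∧ p = q.map .right) ∨
    ((x.1 ∩ E.final).Nonempty ∧ (y.1 ∩ F.final).Nonempty ∧ p = PMF.pure .finish) := by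
  obtain ⟨(⟨q, hq, rfl⟩ | ⟨q, hq, rfl⟩) | rfl | rfl, hen⟩ := hp
  · exact Or.inl ⟨q, ⟨hq, fun e he => enab_parCfg_left.1
      (hen _ ((PMF.mem_support_map_iff _ _ _).2 ⟨e, he, rfl⟩))⟩, rfl⟩
  · exact Or.inr (Or.inl ⟨q, ⟨hq, fun e he => enab_parCfg_right.1
      (hen _ ((PMF.mem_support_map_iff _ _ _).2 ⟨e, he, rfl⟩))⟩, rfl⟩)
  · have := hen BES.ParEv.start ((PMF.mem_support_pure_iff _ _).2 rfl)
    exact (this.1 trivial).elim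
  · have := enab_parCfg_finish.1 (hen BES.ParEv.finish ((PMF.mem_support_pure_iff _ _).2 rfl))
    exact Or.inr (Or.inr ⟨this.1, this.2, rfl⟩)

theorem pEnab_parEnd {E F : PES Act} (hE : E.Good) (hF : F.Good) {x : E.Config} {y : F.Config}
    (h : (x.1 ∩ E.final).Nonempty) (h' : (y.1 ∩ F.final).Nonempty) {p : PMF (par E F).Ev}
    (hp : (par E F).PEnab (parEnd x y).1 p) : False :=
  final_max_config (hE.par hF) (final_parEnd h h') hp

theorem left_injective {α β : Type} : Function.Injective (BES.ParEv.left : α → BES.ParEv α β) :=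
  fun _ _ h => by cases h; rfl

theorem right_injective {α β : Type} : Function.Injective (BES.ParEv.right : β → BES.ParEv α β) :=
  fun _ _ h => by cases h; rfl

theorem Weak.parCfg_left {E F : PES Act} (y : F.Config) {Θ Θ' : PMF E.Config}
    (h : E.Weak Θ Θ') :
    (par E F).Weak (Θ.map fun x => parCfg x y) (Θ'.map fun x => parCfg x y) := by
  refine Weak.embed (F := par E F) .left left_injective
    (fun p hp => Or.inl (Or.inl ⟨p, hp, rfl⟩)) _ (BES.parSet True ∅ y.1 False)
    (fun _ => id) (fun x => ?_) h
  ext (a | a | _ | _) <;> simp [parCfg]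

theorem Weak.parCfg_right {E F : PES Act} (x : E.Config) {Θ Θ' : PMF F.Config}
    (h : F.Weak Θ Θ') : (par E F).Weak (Θ.map (parCfg x)) (Θ'.map (parCfg x)) := by
  refine Weak.embed (F := par E F) .right right_injective
    (fun p hp => Or.inl (Or.inr ⟨p, hp, rfl⟩)) _ (BES.parSet True x.1 ∅ False)
    (fun _ => id) (fun x => ?_) h
  ext (a | a | _ | _) <;> simp [parCfg]

theorem weak_parCfg_right {E F : PES Act} (x : E.Config) {y : F.Config} {q : PMF F.Ev}
    (hq : F.PEnab y.1 q) :
    (par E F).Weak (PMF.pure (parCfg x y)) (q.map fun e => parCfg x (add y e)) := by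
  have h := Weak.parCfg_right x (Weak.of_pEnab hq)
  rw [PMF.pure_map, PMF.map_comp] at h
  exact h

/-- The relation distinguishes three phases, namely before `start`, between the delimiters, and
after `finish`. Termination of `E` carries over to the whole support of `Θ₁`, so `finish` can be
answered in every part of the mixture. -/
theorem par_mono_left {E E' F : PES Act} (hE : E.Good) (hE' : E'.Good) (hF : F.Good)
    (h : E.Sim E') : (par E F).Sim (par E' F) := by
  obtain ⟨S, hS⟩ := h.nsim hE'.finDist
  let U : (par E F).Config → PMF (par E' F).Config → Prop := fun z Θ =>
    (z = (par E F).emptyConfig ∧ Θ = PMF.pure (par E' F).emptyConfig) ∨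
    (∃ (x : E.Config) (y : F.Config) (Θ₁ : PMF E'.Config), z = parCfg x y ∧ S x Θ₁ ∧
      Θ = Θ₁.map fun x' => parCfg x' y) ∨
    (∃ (x : E.Config) (y : F.Config) (Θ₁ : PMF E'.Config), z = parEnd x y ∧ S x Θ₁ ∧
      (x.1 ∩ E.final).Nonempty ∧ (y.1 ∩ F.final).Nonempty ∧ Θ = Θ₁.map fun x' => parEnd x' y)
  refine sim_of (hE.par hF).finDist U (Or.inl ⟨rfl, rfl⟩) ?_ ?_ ?_
  · rintro z _ (⟨rfl, rfl⟩ | ⟨x, y, Θ₁, rfl, h, rfl⟩ | ⟨x, y, Θ₁, rfl, h, hx, hy, rfl⟩) w hw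
    · rw [PMF.mem_support_pure_iff] at hw
      subst hw
      have h0 : ∀ E : PES Act, (par E F).emptyConfig.1 = BES.parSet False ∅ ∅ False :=
        fun E => BES.parSet_empty.symm
      have c0 : ∀ E : PES Act, (par E F).IsConfig (BES.parSet False ∅ ∅ False) :=
        fun E => h0 E ▸ (par E F).emptyConfig.2
      rw [h0, h0]
      exact BES.implements_par (c0 E) (c0 E')
        (hS.implements _ _ hS.empty _ ((PMF.mem_support_pure_iff _ _).2 rfl))
        (BES.Implements.refl _ _)
    · obtain ⟨x', hx', rfl⟩ := (PMF.mem_support_map_iff _ _ _).1 hw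
      exact BES.implements_par (parCfg x y).2 (parCfg x' y).2 (hS.implements _ _ h x' hx')
        (BES.Implements.refl _ _)
    · obtain ⟨x', hx', rfl⟩ := (PMF.mem_support_map_iff _ _ _).1 hw
      have h1 := (parEnd x y).2
      have h2 := (parEnd x' y).2
      rw [parEnd_val hx hy] at h1 ⊢
      rw [parEnd_val (hS.final _ _ h hx x' hx') hy] at h2 ⊢
      exact BES.implements_par h1 h2 (hS.implements _ _ h x' hx') (BES.Implements.refl _ _)
  · rintro z _ (⟨rfl, rfl⟩ | ⟨x, y, Θ₁, rfl, h, rfl⟩ | ⟨x, y, Θ₁, rfl, h, hx, hy, rfl⟩) p hp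
    · have := pEnab_par_empty hp
      subst this
      refine ⟨fun _ => PMF.pure (parCfg E'.emptyConfig F.emptyConfig), fun e he => ?_, ?_⟩
      · rw [PMF.mem_support_pure_iff] at he
        subst he
        exact Or.inr (Or.inl ⟨_, _, _, add_empty_start, hS.empty, (PMF.pure_map (fun x' => parCfg x' F.emptyConfig) _).symm⟩)
      · rw [PMF.bind_const]
        exact weak_start
    · rcases pEnab_parCfg hp with ⟨q, hq, rfl⟩ | ⟨q, hq, rfl⟩ | ⟨hx, hy, rfl⟩
      · obtain ⟨K, h1, h2⟩ := hS.step_enab h hq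
        refine exists_kernel (U := U) .left left_injective q
          (fun e => (K (add x e)).map fun x' => parCfg x' y) (fun e he => ?_) ?_
        · exact Or.inr (Or.inl ⟨_, _, _, add_parCfg_left (hq.2 e he), h1 e he, rfl⟩)
        · have h3 := Weak.parCfg_left y h2
          rwa [PMF.map_bind] at h3
      · refine exists_kernel (U := U) .right right_injective q
          (fun e => Θ₁.map fun x' => parCfg x' (add y e)) (fun e he => ?_) ?_
        · exact Or.inr (Or.inl ⟨_, _, _, add_parCfg_right (hq.2 e he), h, rfl⟩)
        · have h3 := Weak.bind_pure (hE'.par hF).finDist (hS.fin _ _ h) (y := fun x' => parCfg x' y)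
            fun x' hx' => weak_parCfg_right x' hq
          have h4 : (Θ₁.bind fun x' => q.map fun e => parCfg x' (add y e)) =
              q.bind fun e => Θ₁.map fun x' => parCfg x' (add y e) := PMF.bind_comm _ _ _
          rwa [h4] at h3
      · refine ⟨fun _ => Θ₁.map fun x' => parEnd x' y, fun e he => ?_, ?_⟩
        · rw [PMF.mem_support_pure_iff] at he
          subst he
          exact Or.inr (Or.inr ⟨_, _, _, add_parCfg_finish hx hy, h, hx, hy, rfl⟩)
        · rw [PMF.bind_const]
          exact Weak.map_pure (hE'.par hF).finDist (hS.fin _ _ h) fun x' hx' =>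
            weak_finish (hS.final _ _ h hx x' hx') hy
    · exact (pEnab_parEnd hE hF hx hy hp).elim
  · rintro z _ (⟨rfl, rfl⟩ | ⟨x, y, Θ₁, rfl, h, rfl⟩ | ⟨x, y, Θ₁, rfl, h, hx, hy, rfl⟩) hz w hw
    · exact (not_final_empty hz).elim
    · exact (not_final_parCfg hz).elim
    · obtain ⟨x', hx', rfl⟩ := (PMF.mem_support_map_iff _ _ _).1 hw
      exact final_parEnd (hS.final _ _ h hx x' hx') hy

/-- Monotonicity on the right reduces to the left by commutativity. -/
theorem par_mono {E E' F F' : PES Act} (hE : E.Good) (hE' : E'.Good) (hF : F.Good)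
    (hF' : F'.Good) (h : E.Sim E') (h' : F.Sim F') : (par E F).Sim (par E' F') := by
  have h1 := (par_mono_left hE hE' hF h).trans (hE.par hF).finDist (hE'.par hF).finDist
    (hF.par hE').finDist (par_comm_le hE' hF)
  have h2 := (par_mono_left hF hF' hE' h').trans (hF.par hE').finDist (hF'.par hE').finDist
    (hE'.par hF').finDist (par_comm_le hF' hE')
  exact h1.trans (hE.par hF).finDist (hF.par hE').finDist (hE'.par hF').finDist h2

end PES
end PBES

namespace PBES

namespace PES

variable {Act : Type u}

/-! ### Induction for the star -/

theorem IsSub.pEnab {X Y : PES Act} {j : X.Ev → Y.Ev} (h : IsSub X Y j)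
    (hj : Function.Surjective j) {x : Set X.Ev} {p : PMF Y.Ev} (hp : Y.PEnab (j '' x) p) :
    ∃ q, X.PEnab x q ∧ p = q.map j := by
  have h1 : p ∈ {q | q ∈ Y.dist ∧ q.support ⊆ Set.range j} := ⟨hp.1, fun z _ => hj z⟩
  rw [← h.dist] at h1
  obtain ⟨q, hq, rfl⟩ := h1
  exact ⟨q, ⟨hq, fun e he =>
    h.enab_iff.1 (hp.2 _ ((PMF.mem_support_map_iff _ _ _).2 ⟨e, he, rfl⟩))⟩, rfl⟩

theorem IsSub.implements_symm {X Y : PES Act} {j : X.Ev → Y.Ev} (h : IsSub X Y j) {x : Set X.Ev}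
    (hx : X.IsConfig x) : BES.Implements Y.toBES X.toBES (j '' x) x := by
  have hY : Y.IsConfig (j '' x) := isConfig_image (fun x _ e he => h.enab_iff.2 he) hx
  refine BES.implements_of_configs (fun a b => a ∈ x ∧ j a = b) hY hx ?_ ?_ ?_ ?_ ?_ ?_
  · rintro a _ ⟨ha, rfl⟩
    exact ⟨ha, a, ha, rfl⟩
  · rintro a _ ⟨ha, rfl⟩
    exact (h.label a).symm
  · intro a ha _
    exact ⟨_, ha, rfl⟩
  · rintro _ ⟨a, ha, rfl⟩ -
    exact ⟨a, ha, rfl⟩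
  · rintro a a' _ - ⟨-, rfl⟩ ⟨-, h'⟩
    exact (h.inj h').symm
  · intro w hw hwx
    refine ⟨j ⁻¹' w, ?_, fun a ha => ?_, ?_⟩
    · have key : ∀ w, Y.IsConfig w → w ⊆ Set.range j → X.IsConfig (j ⁻¹' w) := by
        intro w hw
        induction hw using BES.IsConfig.induction with
        | h0 => intro _; exact BES.isConfig_empty _
        | h1 w e hw he ih =>
          intro hr
          obtain ⟨a, rfl⟩ := hr (Set.mem_insert _ _)
          have hr' : w ⊆ Set.range j := (Set.subset_insert _ _).trans hr
          have h1 : j ⁻¹' insert (j a) w = insert a (j ⁻¹' w) := by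
            ext b
            simp [h.inj.eq_iff]
          rw [h1]
          refine (ih hr').insert (h.enab_iff.1 ?_)
          rwa [Set.image_preimage_eq_of_subset hr']
      exact key w hw (hwx.trans (Set.image_subset_range _ _))
    · obtain ⟨b, hb, hab⟩ := hwx ha
      exact h.inj hab ▸ hb
    · rintro a _ ⟨-, rfl⟩
      exact Iff.rfl

theorem pEnab_plus_inl {E F : PES Act} {x : Set E.Ev} (hx : E.IsConfig x) (hne : x.Nonempty)
    {p : PMF (plus E F).Ev} (hp : (plus E F).PEnab (BES.sumSet x ∅) p) :
    ∃ q, E.PEnab x q ∧ p = q.map Sum.inl := by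
  obtain ⟨⟨q, hq, rfl⟩ | ⟨q, hq, rfl⟩, hen⟩ := hp
  · refine ⟨q, ⟨hq, fun e he => ?_⟩, rfl⟩
    have h1 := BES.enab_plus_inl.1 (hen _ ((PMF.mem_support_map_iff _ _ _).2 ⟨e, he, rfl⟩))
    simpa using h1.1
  · obtain ⟨e, he⟩ := q.support_nonempty
    have h1 := enab_plus_inr_config (BES.isConfig_plus_inl hx)
      (hen _ ((PMF.mem_support_map_iff _ _ _).2 ⟨e, he, rfl⟩))
    rw [BES.inl_preimage_sumSet] at h1
    exact (hne.ne_empty h1.2).elim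

theorem pEnab_plus_inr {E F : PES Act} {x : Set F.Ev} (hx : F.IsConfig x) (hne : x.Nonempty)
    {p : PMF (plus E F).Ev} (hp : (plus E F).PEnab (BES.sumSet ∅ x) p) :
    ∃ q, F.PEnab x q ∧ p = q.map Sum.inr := by
  obtain ⟨⟨q, hq, rfl⟩ | ⟨q, hq, rfl⟩, hen⟩ := hp
  · obtain ⟨e, he⟩ := q.support_nonempty
    have h1 := enab_plus_inl_config (BES.isConfig_plus_inr hx)
      (hen _ ((PMF.mem_support_map_iff _ _ _).2 ⟨e, he, rfl⟩))
    rw [BES.inr_preimage_sumSet] at h1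
    exact (hne.ne_empty h1.2).elim
  · refine ⟨q, ⟨hq, fun e he => ?_⟩, rfl⟩
    have h1 := BES.enab_plus_inr.1 (hen _ ((PMF.mem_support_map_iff _ _ _).2 ⟨e, he, rfl⟩))
    simpa using h1.1

theorem pEnab_plus_empty {E F : PES Act} {p : PMF (plus E F).Ev}
    (hp : (plus E F).PEnab ∅ p) :
    (∃ q, E.PEnab ∅ q ∧ p = q.map Sum.inl) ∨ ∃ q, F.PEnab ∅ q ∧ p = q.map Sum.inr := by
  obtain ⟨⟨q, hq, rfl⟩ | ⟨q, hq, rfl⟩, hen⟩ := hp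
  · exact Or.inl ⟨q, ⟨hq, fun e he =>
      (BES.enab_plus_inl.1 (hen _ ((PMF.mem_support_map_iff _ _ _).2 ⟨e, he, rfl⟩))).1⟩, rfl⟩
  · exact Or.inr ⟨q, ⟨hq, fun e he =>
      (BES.enab_plus_inr.1 (hen _ ((PMF.mem_support_map_iff _ _ _).2 ⟨e, he, rfl⟩))).1⟩, rfl⟩

theorem implements_empty (E F : BES Act) : BES.Implements E F ∅ ∅ :=
  BES.implements_of_configs (fun _ _ => False) (BES.isConfig_empty _) (BES.isConfig_empty _)
    (by simp) (by simp) (fun _ h => h.elim) (fun _ h => h.elim) (by simp)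
    fun _ _ _ => ⟨∅, BES.isConfig_empty _, subset_rfl, by simp⟩

/-- The relation between `E * G` and `F` that is generated by relations `S` between `E·F` and `F`
and `T` between `G` and `F`. -/
inductive StarRel {E F G : PES Act} (S : (seq E F).Config → PMF F.Config → Prop)
    (T : G.Config → PMF F.Config → Prop) : (star E G).Config → PMF F.Config → Prop
  | empty : StarRel S T (star E G).emptyConfig (PMF.pure F.emptyConfig)
  | exit (Z : (star E G).Config) (g : G.Config) (Θ : PMF F.Config) : g.1.Nonempty →
      Z.1 = unfoldMap (X := star E G) id '' BES.sumSet g.1 ∅ → T g Θ → StarRel S T Z Θ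
  -- Here `Z` consists of `x` in the first copy of `E` and of `z` in the rest of the star. The rest
  -- has been evaluated to `Ψ` in `F`, and the kernel `K`, an instance of `S`, evaluates `x`
  -- followed by that result.
  | body (Z : (star E G).Config) (x : E.Config) (z : (star E G).Config) (Ψ : PMF F.Config)
      (K : (seq E F).Config → PMF F.Config) : x.1.Nonempty →
      (z.1.Nonempty → (x.1 ∩ E.final).Nonempty) →
      Z.1 = unfoldMap (X := star E G) id '' BES.sumSet ∅ (seqCfg x z).1 → StarRel S T z Ψ →
      (Ψ = PMF.pure F.emptyConfig ∨ (x.1 ∩ E.final).Nonempty) →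
      (∀ y ∈ Ψ.support, S (seqCfg x y) (K (seqCfg x y))) →
      StarRel S T Z ((Ψ.map (seqCfg x)).bind K)

namespace StarRel

variable {E F G : PES Act} {S : (seq E F).Config → PMF F.Config → Prop}
  {T : G.Config → PMF F.Config → Prop}

theorem finSupp (hS : NSim (PES.seq E F) F S) (hT : NSim G F T) {Z : (PES.star E G).Config}
    {Θ : PMF F.Config} (h : StarRel S T Z Θ) : FinSupp Θ := by
  induction h with
  | empty => exact finSupp_pure _
  | exit Z g Θ _ _ h => exact hT.fin _ _ h
  | body Z x z Ψ K _ _ _ _ _ hK ih =>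
    refine (ih.map _).bind fun w hw => ?_
    obtain ⟨y, hy, rfl⟩ := (PMF.mem_support_map_iff _ _ _).1 hw
    exact hS.fin _ _ (hK y hy)

theorem nonempty_final {x : E.Config} {Ψ : PMF F.Config}
    (h : Ψ = PMF.pure F.emptyConfig ∨ (x.1 ∩ E.final).Nonempty) {y : F.Config}
    (hy : y ∈ Ψ.support) (hne : y.1.Nonempty) : (x.1 ∩ E.final).Nonempty := by
  refine h.resolve_left fun h => ?_
  rw [h, PMF.mem_support_pure_iff] at hy
  subst hy
  exact Set.not_nonempty_empty hne

/-- In the inductive case `x` followed by `z` implements `x` followed by any value of `Ψ`, by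
`implements_seqCfg`, and this implements the corresponding values of `K`. -/
theorem implements (hE : E.Good) (hS : NSim (PES.seq E F) F S) (hT : NSim G F T)
    {Z : (PES.star E G).Config} {Θ : PMF F.Config} (h : StarRel S T Z Θ) :
    ∀ y ∈ Θ.support, BES.Implements (PES.star E G).toBES F.toBES Z.1 y.1 := by
  induction h with
  | empty =>
    intro y hy
    rw [PMF.mem_support_pure_iff] at hy
    subst hy
    exact implements_empty _ _
  | exit Z g Θ _ hZ h =>
    intro y hy
    rw [hZ]
    exact ((isSub_star_unfold E G).implements_symm (BES.isConfig_plus_inl g.2)).trans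
      ((BES.Implements.trans (implements_inl _ _ g.2) (hT.implements _ _ h y hy)))
  | body Z x z Ψ K _ hzf hZ _ hΨ hK ih =>
    intro y hy
    obtain ⟨w, hw, hy⟩ := (PMF.mem_support_bind_iff _ _ _).1 hy
    obtain ⟨y', hy', rfl⟩ := (PMF.mem_support_map_iff _ _ _).1 hw
    rw [hZ]
    refine ((isSub_star_unfold E G).implements_symm
      (BES.isConfig_plus_inr (seqCfg x z).2)).trans ?_
    refine (implements_inr _ _ (seqCfg x z).2).trans ?_
    exact (implements_seqCfg hE hzf (nonempty_final hΨ hy') (BES.Implements.refl _ _)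
      (ih y' hy')).trans (hS.implements _ _ (hK y' hy') y hy)

theorem final (hS : NSim (PES.seq E F) F S) (hT : NSim G F T) {Z : (PES.star E G).Config}
    {Θ : PMF F.Config} (h : StarRel S T Z Θ) : (Z.1 ∩ (PES.star E G).final).Nonempty →
    ∀ y ∈ Θ.support, (y.1 ∩ F.final).Nonempty := by
  have key : ∀ w : Set (plus G (PES.seq E (PES.star E G))).Ev,
      (unfoldMap id '' w ∩ (PES.star E G).final).Nonempty →
      (w ∩ (plus G (PES.seq E (PES.star E G))).final).Nonempty := by
    rintro w ⟨_, ⟨a, ha, rfl⟩, hf⟩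
    exact ⟨a, ha, ((isSub_star_unfold E G).final a).2 hf⟩
  induction h with
  | empty => exact fun h => (not_final_empty h).elim
  | exit Z g Θ _ hZ h =>
    intro hf
    rw [hZ] at hf
    have h1 := final_inter_plus.1 (key _ hf)
    exact hT.final _ _ h (by simpa using h1)
  | body Z x z Ψ K _ hzf hZ _ hΨ hK ih =>
    intro hf y hy
    rw [hZ] at hf
    have h1 := final_inter_plus.1 (key _ hf)
    rw [BES.inl_preimage_sumSet, BES.inr_preimage_sumSet, Set.empty_inter] at h1
    have h2 := (final_seqCfg hzf).1 (h1.resolve_left Set.not_nonempty_empty)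
    obtain ⟨w, hw, hy⟩ := (PMF.mem_support_bind_iff _ _ _).1 hy
    obtain ⟨y', hy', rfl⟩ := (PMF.mem_support_map_iff _ _ _).1 hw
    refine hS.final _ _ (hK y' hy') ((final_seqCfg (nonempty_final hΨ hy')).2 ?_) y hy
    exact ih h2 y' hy'

/-- A step in the exit is answered by `T` and a step in the first copy of `E` by `S`. A step in the
rest of the star is answered in `F` by induction; that answer is placed behind `x` in `E·F` and then
pushed through `S` by `NSim.weak`. -/
theorem step (hE : E.Good) (hF : F.Good) (hS : NSim (PES.seq E F) F S) (hT : NSim G F T)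
    {Z : (PES.star E G).Config} {Θ : PMF F.Config} (h : StarRel S T Z Θ) :
    ∀ p, (PES.star E G).PEnab Z.1 p → ∃ K : (PES.star E G).Ev → PMF F.Config,
      (∀ e ∈ p.support, StarRel S T (add Z e) (K e)) ∧ F.Weak Θ (p.bind K) := by
  have hsub := isSub_star_unfold E G
  have hsurj := unfoldMap_surjective E G
  -- A step of the first copy of `E` while the rest of the star is empty. It leads again to an
  -- instance of `StarRel.body`, with empty remainder.
  have body_step : ∀ (Z : (PES.star E G).Config) (x : E.Config) (q : PMF E.Ev) (Θ : PMF F.Config),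
      Z.1 = unfoldMap (X := PES.star E G) id '' BES.sumSet ∅ (BES.sumSet x.1 ∅) → E.PEnab x.1 q →
      (PES.star E G).PEnab Z.1 ((q.map Sum.inl).map Sum.inr |>.map (unfoldMap id)) →
      S (seqCfg x F.emptyConfig) Θ → ∃ K : (PES.star E G).Ev → PMF F.Config,
      (∀ e ∈ (((q.map Sum.inl).map Sum.inr).map (unfoldMap (X := PES.star E G) id)).support,
        StarRel S T (add Z e) (K e)) ∧
      F.Weak Θ ((((q.map Sum.inl).map Sum.inr).map (unfoldMap id)).bind K) := by
    intro Z x q Θ hZ hq hp h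
    have hse : (PES.seq E F).PEnab (seqCfg x F.emptyConfig).1 (q.map Sum.inl) := by
      refine ⟨Or.inl ⟨q, hq.1, rfl⟩, fun e he => ?_⟩
      obtain ⟨a, ha, rfl⟩ := (PMF.mem_support_map_iff _ _ _).1 he
      exact (enab_seqCfg_inl fun h => (Set.not_nonempty_empty h).elim).2 (hq.2 a ha)
    obtain ⟨K, h1, h2⟩ := hS.step_enab h hse
    have hj : Function.Injective (fun e : E.Ev => unfoldMap (X := PES.star E G) (E := E) (F := G) id
      (Sum.inr (Sum.inl e))) := fun a b hab => by
        have := hsub.inj hab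
        simpa using this
    simp only [PMF.map_comp] at hp ⊢
    refine exists_kernel (U := StarRel S T) _ hj q
      (fun e => K (seqCfg (add x e) F.emptyConfig)) (fun e he => ?_) ?_
    · have h3 := StarRel.body (S := S) (T := T)
        (add Z (unfoldMap (X := PES.star E G) (E := E) (F := G) id (Sum.inr (Sum.inl e)))) (add x e)
        (PES.star E G).emptyConfig (PMF.pure F.emptyConfig) K ?_
        (fun h => (Set.not_nonempty_empty h).elim) ?_ StarRel.empty (Or.inl rfl) ?_
      · rwa [PMF.pure_map, PMF.pure_bind] at h3
      · rw [add_val (hq.2 e he)]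
        exact Set.insert_nonempty _ _
      · have hen : (PES.star E G).Enab Z.1 (unfoldMap id (Sum.inr (Sum.inl e))) :=
          hp.2 _ ((PMF.mem_support_map_iff _ _ _).2 ⟨e, he, rfl⟩)
        rw [add_val hen, hZ,
          seqCfg_empty_val, add_val (hq.2 e he), ← BES.insert_inl_sumSet, ← BES.insert_inr_sumSet,
          Set.image_insert_eq]
      · intro y hy
        rw [PMF.mem_support_pure_iff] at hy
        subst hy
        have h4 := h1 _ ((PMF.mem_support_map_iff _ _ _).2 ⟨e, he, rfl⟩)
        rwa [add_seqCfg_inl (hq.2 e he)] at h4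
    · rw [PMF.bind_map] at h2
      have h5 : q.bind (fun e => K (seqCfg (add x e) F.emptyConfig)) =
          q.bind ((fun e => K (add (seqCfg x F.emptyConfig) e)) ∘ Sum.inl) :=
        bind_congr_support fun e he => by rw [Function.comp, add_seqCfg_inl (hq.2 e he)]
      rwa [h5]
  have exit_step : ∀ (Z : (PES.star E G).Config) (g : G.Config) (q : PMF G.Ev) (Θ : PMF F.Config),
      Z.1 = unfoldMap (X := PES.star E G) id '' BES.sumSet g.1 ∅ → G.PEnab g.1 q →
      (PES.star E G).PEnab Z.1 ((q.map Sum.inl).map (unfoldMap id)) →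
      T g Θ → ∃ K : (PES.star E G).Ev → PMF F.Config,
      (∀ e ∈ ((q.map Sum.inl).map (unfoldMap (X := PES.star E G) id)).support,
        StarRel S T (add Z e) (K e)) ∧
      F.Weak Θ (((q.map Sum.inl).map (unfoldMap id)).bind K) := by
    intro Z g q Θ hZ hq hp h
    obtain ⟨K, h1, h2⟩ := hT.step_enab h hq
    have hj : Function.Injective (fun e : G.Ev => unfoldMap (X := PES.star E G) (E := E) (F := G) id
      (Sum.inl e)) := fun a b hab => by
        have := hsub.inj hab
        simpa using this
    simp only [PMF.map_comp] at hp ⊢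
    refine exists_kernel (U := StarRel S T) _ hj q _ (fun e he => ?_) h2
    refine StarRel.exit _ (add g e) _ ?_ ?_ (h1 e he)
    · rw [add_val (hq.2 e he)]
      exact Set.insert_nonempty _ _
    · have hen : (PES.star E G).Enab Z.1 (unfoldMap id (Sum.inl e)) :=
        hp.2 _ ((PMF.mem_support_map_iff _ _ _).2 ⟨e, he, rfl⟩)
      rw [add_val hen, hZ,
        add_val (hq.2 e he), ← BES.insert_inl_sumSet, Set.image_insert_eq]
  induction h with
  | empty =>
    intro p hp
    have hZ : ((PES.star E G).emptyConfig).1 = unfoldMap (X := PES.star E G) id '' ∅ :=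
      (Set.image_empty _).symm
    have hp' := hp
    rw [hZ] at hp'
    obtain ⟨q, hq, rfl⟩ := hsub.pEnab hsurj hp'
    rcases pEnab_plus_empty hq with ⟨r, hr, rfl⟩ | ⟨r, hr, rfl⟩
    · exact exit_step _ G.emptyConfig r _ (by rw [hZ, ← BES.sumSet_empty]; rfl) hr hp hT.empty
    · have hq' : (PES.seq E (PES.star E G)).PEnab
          (seqCfg E.emptyConfig (PES.star E G).emptyConfig).1 r := by
        rw [seqCfg_empty]; exact hr
      rcases pEnab_seqCfg hE (fun h => (Set.not_nonempty_empty h).elim) hq' with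
        ⟨s, hs, rfl, -⟩ | ⟨s, hs, rfl, hf⟩
      · refine body_step _ E.emptyConfig s _ ?_ hs hp ?_
        · rw [hZ, ← BES.sumSet_empty, ← BES.sumSet_empty]; rfl
        · rw [seqCfg_empty]
          exact hS.empty
      · exact (not_final_empty hf).elim
  | exit Z g Θ hne hZ h =>
    intro p hp
    have hp' := hp
    rw [hZ] at hp'
    obtain ⟨q, hq, rfl⟩ := hsub.pEnab hsurj hp'
    obtain ⟨r, hr, rfl⟩ := pEnab_plus_inl g.2 hne hq
    exact exit_step Z g r Θ hZ hr hp h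
  | body Z x z Ψ K hne hzf hZ hR hΨ hK ih =>
    intro p hp
    have hp' := hp
    rw [hZ] at hp'
    obtain ⟨q, hq, rfl⟩ := hsub.pEnab hsurj hp'
    have hne' : (seqCfg x z).1.Nonempty := by
      rw [seqCfg_val hzf]
      obtain ⟨a, ha⟩ := hne
      exact ⟨_, BES.inl_mem_sumSet.2 ha⟩
    obtain ⟨r, hr, rfl⟩ := pEnab_plus_inr (seqCfg x z).2 hne' hq
    rcases pEnab_seqCfg hE hzf hr with ⟨s, hs, rfl, hz⟩ | ⟨s, hs, rfl, hf⟩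
    -- The first copy of `E` moves, so it has not terminated and the rest has not been entered.
    · have hx : Ψ = PMF.pure F.emptyConfig :=
        hΨ.resolve_right fun hf => final_max_config hE hf hs
      subst hx hz
      rw [PMF.pure_map, PMF.pure_bind]
      refine body_step Z x s _ ?_ hs hp (hK _ ((PMF.mem_support_pure_iff _ _).2 rfl))
      rw [hZ, seqCfg_empty_val]
    -- `L` answers in `F` for the rest of the star, and `K'` is the new evaluation of `E·F` after
    -- that answer.
    · obtain ⟨L, h1, h2⟩ := ih s hs
      have h3 := Weak.seqCfg_right (E := E) hf h2
      obtain ⟨K', h4, h5⟩ := hS.weak (hE.seq hF).finDist hF.finDist h3 K (by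
        intro w hw
        obtain ⟨y, hy, rfl⟩ := (PMF.mem_support_map_iff _ _ _).1 hw
        exact hK y hy) ((finSupp hS hT hR).map _)
      have hj : Function.Injective (fun e : (PES.star E G).Ev =>
        unfoldMap (X := PES.star E G) (E := E) (F := G) id (Sum.inr (Sum.inr e))) :=
        fun a b hab => by
          have := hsub.inj hab
          simpa using this
      simp only [PMF.map_comp] at hp ⊢
      refine exists_kernel (U := StarRel S T) _ hj s (fun e => ((L e).map (seqCfg x)).bind K')
        (fun e he => ?_) ?_
      · refine StarRel.body _ x (add z e) (L e) K' hne (fun _ => hf) ?_ (h1 e he) (Or.inr hf) ?_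
        · have hen : (PES.star E G).Enab Z.1 (unfoldMap id (Sum.inr (Sum.inr e))) :=
            hp.2 _ ((PMF.mem_support_map_iff _ _ _).2 ⟨e, he, rfl⟩)
          rw [add_val hen, hZ,
            seqCfg_val hzf, seqCfg_val fun _ => hf, add_val (hs.2 e he), ← BES.insert_inr_sumSet,
            ← BES.insert_inr_sumSet, Set.image_insert_eq]
        · intro y hy
          exact h4 _ ((PMF.mem_support_map_iff _ _ _).2 ⟨y,
            (PMF.mem_support_bind_iff _ _ _).2 ⟨e, he, hy⟩, rfl⟩)
      · rw [PMF.map_bind, PMF.bind_bind] at h5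
        exact h5

end StarRel

/-- The premise splits into `G ⊑ F` and `E·F ⊑ F`. Their simulations generate `StarRel`, whose
inductive character replaces an induction over the approximants. -/
theorem star_le {E F G : PES Act} (hE : E.Good) (hF : F.Good) (hG : G.Good)
    (h : (plus G (seq E F)).Sim F) : (star E G).Sim F := by
  have hGE := hG.plus (hE.seq hF)
  have h1 := (le_plus_left hG).trans hG.finDist hGE.finDist hF.finDist h
  have h2 := (le_plus_right (hE.seq hF)).trans (hE.seq hF).finDist hGE.finDist hF.finDist h
  obtain ⟨T, hT⟩ := h1.nsim hF.finDist
  obtain ⟨S, hS⟩ := h2.nsim hF.finDist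
  exact sim_of (hE.star hG).finDist (StarRel S T) StarRel.empty
    (fun _ _ h => h.implements hE hS hT) (fun _ _ h => h.step hE hF hS hT)
    fun _ _ h => h.final hS hT

/-- By induction for the star it suffices that `F + E·(E' * F') ⊑ E' * F'`, which follows from
monotonicity of the other operations and unfolding. -/
theorem star_mono {E E' F F' : PES Act} (hE : E.Good) (hE' : E'.Good) (hF : F.Good)
    (hF' : F'.Good) (h : E.Sim E') (h' : F.Sim F') : (star E F).Sim (star E' F') := by
  have hs := hE'.star hF'
  refine star_le hE hs hF ?_
  exact (plus_mono hF hF' (hE.seq hs) (hE'.seq hs) h' (seq_mono hE hE' hs hs h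
    (Sim.refl hs.finDist))).trans (hF.plus (hE.seq hs)).finDist (hF'.plus (hE'.seq hs)).finDist
    hs.finDist (star_unfold_le hE' hF')

end PES
end PBES

namespace PBES

namespace PES

variable {Act : Type u}

/-! ### Simulations from maps between configurations -/

/-- Execution of a distribution followed by weak transitions. -/
theorem weak_image_trans {Y : PES Act} (hY : Y.FinDist) {A : Type} {q : PMF A} {j : A → Y.Ev}
    {y : Y.Config} {k k' : A → Y.Config} (hq : FinSupp q) (hd : q.map j ∈ Y.dist)
    (hn : ∀ a ∈ q.support, j a ∉ y.1) (hk : ∀ a ∈ q.support, (k a).1 = insert (j a) y.1)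
    (hw : ∀ a ∈ q.support, Y.Weak (PMF.pure (k a)) (PMF.pure (k' a))) :
    Y.Weak (PMF.pure y) (q.map k') := by
  have h1 : ∀ a ∈ q.support, Y.Enab y.1 (j a) := fun a ha =>
    BES.IsConfig.enab_of_insert (hk a ha ▸ (k a).2) (hn a ha)
  have h2 : Y.PEnab y.1 (q.map j) := by
    refine ⟨hd, fun e he => ?_⟩
    obtain ⟨a, ha, rfl⟩ := (PMF.mem_support_map_iff _ _ _).1 he
    exact h1 a ha
  have h3 := Weak.of_pEnab h2
  rw [PMF.map_comp] at h3
  have h4 : q.map (add y ∘ j) = q.map k := map_congr_support fun a ha =>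
    Subtype.ext ((add_val (h1 a ha)).trans (hk a ha).symm)
  rw [h4] at h3
  exact h3.trans (Weak.map_pure hY hq hw)

theorem weak_image {Y : PES Act} {A : Type} {q : PMF A} {j : A → Y.Ev} {y : Y.Config}
    {k : A → Y.Config} (hd : q.map j ∈ Y.dist) (hn : ∀ a ∈ q.support, j a ∉ y.1)
    (hk : ∀ a ∈ q.support, (k a).1 = insert (j a) y.1) : Y.Weak (PMF.pure y) (q.map k) := by
  have h1 : ∀ a ∈ q.support, Y.Enab y.1 (j a) := fun a ha =>
    BES.IsConfig.enab_of_insert (hk a ha ▸ (k a).2) (hn a ha)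
  have h2 : Y.PEnab y.1 (q.map j) := by
    refine ⟨hd, fun e he => ?_⟩
    obtain ⟨a, ha, rfl⟩ := (PMF.mem_support_map_iff _ _ _).1 he
    exact h1 a ha
  have h3 := Weak.of_pEnab h2
  rw [PMF.map_comp] at h3
  have h4 : q.map (add y ∘ j) = q.map k := map_congr_support fun a ha =>
    Subtype.ext ((add_val (h1 a ha)).trans (hk a ha).symm)
  rwa [h4] at h3

theorem weak_insert {Y : PES Act} {y y' : Y.Config} {e : Y.Ev} (hd : PMF.pure e ∈ Y.dist)
    (h : y'.1 = insert e y.1) : Y.Weak (PMF.pure y) (PMF.pure y') := by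
  by_cases he : e ∈ y.1
  · rw [Set.insert_eq_of_mem he] at h
    rw [Subtype.ext h]
    exact Weak.refl _
  · have h1 := weak_add hd (BES.IsConfig.enab_of_insert (h ▸ y'.2) he)
    have h2 : add y e = y' := Subtype.ext ((add_val_of_isConfig (h ▸ y'.2)).trans h.symm)
    rwa [h2] at h1

theorem weak_of_eq {Y : PES Act} {y y' : Y.Config} (h : y'.1 = y.1) :
    Y.Weak (PMF.pure y) (PMF.pure y') := by
  rw [Subtype.ext h]
  exact Weak.refl _

theorem weak_stay {Y : PES Act} {A : Type} {q : PMF A} {y : Y.Config} {k : A → Y.Config}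
    (h : ∀ a ∈ q.support, (k a).1 = y.1) : Y.Weak (PMF.pure y) (q.map k) := by
  have : q.map k = q.map (Function.const A y) :=
    map_congr_support fun a ha => Subtype.ext (h a ha)
  rw [this, PMF.map_const]
  exact Weak.refl _

theorem PEnab.enab_map {X : PES Act} {A : Type} {z : Set X.Ev} {q : PMF A} {j : A → X.Ev}
    (h : X.PEnab z (q.map j)) {a : A} (ha : a ∈ q.support) : X.Enab z (j a) :=
  h.2 _ ((PMF.mem_support_map_iff _ _ _).2 ⟨a, ha, rfl⟩)

theorem PEnab.enab_pure {X : PES Act} {z : Set X.Ev} {e : X.Ev}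
    (h : X.PEnab z (PMF.pure e)) : X.Enab z e := h.2 e ((PMF.mem_support_pure_iff _ _).2 rfl)

/-- A simulation given by a monotone map between configurations, which renames the labelled
events. -/
theorem sim_of_fun {X Y : PES Act} (hX : X.FinDist) (φ : X.Config → Y.Config)
    (i : X.Ev → Option Y.Ev) (empty : (φ X.emptyConfig).1 = ∅)
    (mono : ∀ x x' : X.Config, x.1 ⊆ x'.1 → (φ x).1 ⊆ (φ x').1)
    (mem : ∀ (x : X.Config) (b : X.Ev) (a : Y.Ev), i b = some a → (a ∈ (φ x).1 ↔ b ∈ x.1))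
    (label : ∀ b a, i b = some a → X.label b = Y.label a)
    (unlabelled : ∀ b, i b = none → X.label b = none)
    (surj : ∀ a, Y.label a ≠ none → ∃ b, i b = some a)
    (step : ∀ (x : X.Config) (p : PMF X.Ev), X.PEnab x.1 p →
      Y.Weak (PMF.pure (φ x)) (p.map fun e => φ (add x e)))
    (final : ∀ x : X.Config, (x.1 ∩ X.final).Nonempty → ((φ x).1 ∩ Y.final).Nonempty) :
    X.Sim Y := by
  refine sim_of_rel hX (fun x y => y = φ x) (Subtype.ext empty).symm ?_ ?_ ?_
  · rintro x _ rfl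
    refine BES.implements_of_configs (fun a b => i b = some a ∧ b ∈ x.1) x.2 (φ x).2
      ?_ ?_ ?_ ?_ ?_ ?_
    · rintro a b ⟨h, hb⟩
      exact ⟨(mem x b a h).2 hb, hb⟩
    · rintro a b ⟨h, -⟩
      exact label b a h
    · intro a ha hl
      obtain ⟨b, hb⟩ := surj a hl
      exact ⟨b, hb, (mem x b a hb).1 ha⟩
    · intro b hb hl
      obtain ⟨a, ha⟩ := Option.ne_none_iff_exists'.1 fun h => hl (unlabelled b h)
      exact ⟨a, ha, hb⟩
    · rintro a a' b - ⟨h, -⟩ ⟨h', -⟩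
      exact Option.some.inj (h.symm.trans h')
    · intro w hw hwx
      exact ⟨(φ ⟨w, hw⟩).1, (φ ⟨w, hw⟩).2, mono ⟨w, hw⟩ x hwx, fun a b h => mem ⟨w, hw⟩ b a h.1⟩
  · rintro x _ rfl p hp
    exact ⟨fun e => φ (add x e), fun _ _ => rfl, step x p hp⟩
  · rintro x _ rfl h
    exact final x h

/-! ### Units -/

theorem isConfig_single (a : Option Act) (P : Prop) :
    (BES.single a).IsConfig {_e : Unit | P} := by
  by_cases h : P
  · have h1 : {_e : Unit | P} = insert () ∅ := by
      ext ⟨⟩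
      simp [h]
    rw [h1]
    exact (BES.isConfig_empty _).insert ⟨id, fun _ h => h.elim, fun _ h => h.elim⟩
  · have h1 : {_e : Unit | P} = ∅ := by
      ext ⟨⟩
      simp [h]
    rw [h1]
    exact BES.isConfig_empty _

theorem final_single {a : Option Act} {P : Prop} :
    ({_e : Unit | P} ∩ (BES.single a).final).Nonempty ↔ P :=
  ⟨fun ⟨_, h, _⟩ => h, fun h => ⟨(), h, rfl⟩⟩

theorem good_one : (one : PES Act).Good := good_single none

/-- The unlabelled event of `1` is forgotten, and its execution is answered by staying. Where it
occurs, `E` has terminated already. -/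
theorem seq_one_le {E : PES Act} (hE : E.Good) : (seq E one).Sim E := by
  refine sim_of_fun (hE.seq good_one).finDist
    (fun z => ⟨Sum.inl ⁻¹' z.1, (BES.isConfig_seq_iff.1 z.2).1⟩)
    (Sum.elim some fun _ => none) rfl (fun x x' h a ha => h ha) ?_ ?_ ?_ ?_ ?_ ?_
  · rintro x (b | b) a h
    · cases h
      rfl
    · cases h
  · rintro (b | b) a h <;> cases h
    rfl
  · rintro (b | b) h
    · cases h
    · rfl
  · exact fun a _ => ⟨Sum.inl a, rfl⟩
  · rintro z _ hp
    obtain ⟨⟨q, hq, rfl⟩ | ⟨q, hq, rfl⟩, -⟩ := id hp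
    · rw [PMF.map_comp]
      refine weak_image (j := id) (by rwa [PMF.map_id]) (fun e he => ?_) fun e he => ?_
      · exact (hp.enab_map he).1
      · change Sum.inl ⁻¹' (add z _).1 = _
        rw [add_val (hp.enab_map he)]
        exact BES.inl_preimage_insert_inl
    · rw [PMF.map_comp]
      refine weak_stay fun e he => ?_
      change Sum.inl ⁻¹' (add z _).1 = _
      rw [add_val (hp.enab_map he)]
      exact BES.inl_preimage_insert_inr
  · intro z hz
    have h1 := final_inter_seq.1 hz
    exact (BES.isConfig_seq_iff.1 z.2).2.2 (h1.mono Set.inter_subset_left)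

/-- The event of `1` is executed eagerly, as soon as `E` has terminated, since the answer to a final
configuration has to be final. -/
theorem le_seq_one {E : PES Act} (hE : E.Good) : E.Sim (seq E one) := by
  refine sim_of_fun hE.finDist
    (fun x => ⟨BES.sumSet x.1 {_e | (x.1 ∩ E.final).Nonempty},
      BES.isConfig_seq x.2 (isConfig_single none _) fun ⟨_, h⟩ => h⟩)
    (fun e => some (Sum.inl e)) ?_ ?_ ?_ ?_ ?_ ?_ ?_ ?_
  · ext (a | a)
    · simp [BES.emptyConfig]
    · simp [BES.emptyConfig]
  · exact fun x x' h => BES.sumSet_mono h fun _ h' => h'.mono (Set.inter_subset_inter_left _ h)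
  · rintro x b a h
    cases h
    exact BES.inl_mem_sumSet
  · rintro b a h
    cases h
    rfl
  · rintro b h
    cases h
  · rintro (a | a) h
    · exact ⟨a, rfl⟩
    · exact (h rfl).elim
  · intro x p hp
    -- A further step is possible, so `x` is not final and the event of `1` has not been executed
    -- before the step.
    have hx : ¬ (x.1 ∩ E.final).Nonempty := fun h => final_max_config hE h hp
    refine weak_image_trans (hE.seq good_one).finDist (j := Sum.inl)
      (k := fun e => seqCfg (add x e) (one : PES Act).emptyConfig) (hE.finDist p hp.1)
      (Or.inl ⟨p, hp.1, rfl⟩) (fun e he => ?_) (fun e he => ?_) fun e he => ?_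
    · rw [BES.inl_mem_sumSet]
      exact (hp.2 e he).1
    · rw [seqCfg_empty_val, add_val (hp.2 e he), BES.insert_inl_sumSet]
      congr 1
      ext
      simp [hx]
    · by_cases h : ((add x e).1 ∩ E.final).Nonempty
      · refine weak_insert (e := Sum.inr ()) (Or.inr ⟨_, rfl, PMF.pure_map _ _⟩) ?_
        rw [seqCfg_empty_val]
        ext (a | a) <;> simp [h]
      · refine weak_of_eq ?_
        rw [seqCfg_empty_val]
        ext (a | a) <;> simp [h]
  · exact fun x hx => final_inter_seq.2 (by
      rw [BES.inr_preimage_sumSet]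
      exact final_single.2 hx)

theorem one_seq_le {E : PES Act} (hE : E.Good) : (seq one E).Sim E := by
  refine sim_of_fun (good_one.seq hE).finDist
    (fun z => ⟨Sum.inr ⁻¹' z.1, (BES.isConfig_seq_iff.1 z.2).2.1⟩)
    (Sum.elim (fun _ => none) some) rfl (fun x x' h a ha => h ha) ?_ ?_ ?_ ?_ ?_ ?_
  · rintro x (b | b) a h <;> cases h
    rfl
  · rintro (b | b) a h <;> cases h
    rfl
  · rintro (b | b) h
    · rfl
    · cases h
  · exact fun a _ => ⟨Sum.inr a, rfl⟩
  · rintro z _ hp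
    obtain ⟨⟨q, hq, rfl⟩ | ⟨q, hq, rfl⟩, -⟩ := id hp
    · rw [PMF.map_comp]
      refine weak_stay fun e he => ?_
      change Sum.inr ⁻¹' (add z _).1 = _
      rw [add_val (hp.enab_map he)]
      exact BES.inr_preimage_insert_inl
    · rw [PMF.map_comp]
      refine weak_image (j := id) (by rwa [PMF.map_id]) (fun e he => ?_) fun e he => ?_
      · exact (hp.enab_map he).1
      · change Sum.inr ⁻¹' (add z _).1 = _
        rw [add_val (hp.enab_map he)]
        exact BES.inr_preimage_insert_inr
  · exact fun z hz => final_inter_seq.1 hz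

/-- The event of `1` is executed together with the first step of `E`, not earlier: the empty
configuration has to be answered by the empty one. -/
theorem le_one_seq {E : PES Act} (hE : E.Good) : E.Sim (seq one E) := by
  refine sim_of_fun hE.finDist
    (fun x => ⟨BES.sumSet {_e | x.1.Nonempty} x.1,
      BES.isConfig_seq (isConfig_single none _) x.2 fun h => final_single.2 h⟩)
    (fun e => some (Sum.inr e)) ?_ ?_ ?_ ?_ ?_ ?_ ?_ ?_
  · ext (a | a)
    · simp [BES.emptyConfig]
    · simp [BES.emptyConfig]
  · exact fun x x' h => BES.sumSet_mono (fun _ h' => h'.mono h) h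
  · rintro x b a h
    cases h
    exact BES.inr_mem_sumSet
  · rintro b a h
    cases h
    rfl
  · rintro b h
    cases h
  · rintro (a | a) h
    · exact (h rfl).elim
    · exact ⟨a, rfl⟩
  · intro x p hp
    have hc : ∀ y : E.Config, (seq one E).IsConfig (BES.sumSet {_e | True} y.1) := fun y =>
      BES.isConfig_seq (isConfig_single none _) y.2 fun _ => final_single.2 trivial
    have h1 : ∀ h, (seq one E).Weak (PMF.pure ⟨BES.sumSet {_e | x.1.Nonempty} x.1, h⟩)
        (PMF.pure ⟨_, hc x⟩) := by
      intro h
      refine weak_insert (e := Sum.inl ()) (Or.inl ⟨_, rfl, PMF.pure_map _ _⟩) ?_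
      rw [BES.insert_inl_sumSet]
      ext (a | a) <;> simp
    refine (h1 _).trans (weak_image (j := Sum.inr) (Or.inr ⟨p, hp.1, rfl⟩) (fun e he => ?_)
      fun e he => ?_)
    · rw [BES.inr_mem_sumSet]
      exact (hp.2 e he).1
    · change BES.sumSet {_e | (add x e).1.Nonempty} (add x e).1 = _
      rw [BES.insert_inr_sumSet, add_val (hp.2 e he)]
      ext (a | a) <;> simp
  · exact fun x hx => final_inter_seq.2 (by rwa [BES.inr_preimage_sumSet])

/-- Deadlock has no final event, so nothing of `E` can ever be reached and `∅` is the only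
configuration. -/
theorem zero_seq_le {E : PES Act} (hE : E.Good) : (seq zero E).Sim zero := by
  have h0 : ∀ z : (seq zero E).Config, z = (seq zero E).emptyConfig := by
    intro z
    apply Subtype.ext
    obtain ⟨-, -, h⟩ := BES.isConfig_seq_iff.1 z.2
    ext (a | a)
    · exact a.elim
    · exact ⟨fun ha => (h ⟨a, ha⟩).some.elim, fun h => h.elim⟩
  refine sim_of_rel (good_zero.seq hE).finDist (fun _ _ => True) trivial ?_ ?_ ?_
  · intro z y _
    rw [h0 z, Subsingleton.elim y zero.emptyConfig]
    exact implements_empty _ _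
  · intro z _ _ p hp
    obtain ⟨e, he⟩ := p.support_nonempty
    have h1 := add_val (hp.2 e he)
    rw [h0 (add z e)] at h1
    exact ((Set.insert_nonempty _ _).ne_empty h1.symm).elim
  · intro z _ _ hz
    rw [h0 z] at hz
    exact (not_final_empty hz).elim

end PES
end PBES

namespace PBES

namespace PES

variable {Act : Type u}

/-! ### Skip as the unit of concurrent composition -/

theorem one_par_le {E : PES Act} (hE : E.Good) : (par one E).Sim E := by
  let i : BES.ParEv Unit E.Ev → Option E.Ev
    | .right e => some e
    | _ => none
  refine sim_of_fun (good_one.par hE).finDist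
    (fun z => ⟨BES.ParEv.right ⁻¹' z.1, (BES.isConfig_par_iff.1 z.2).2.1⟩)
    i rfl (fun x x' h a ha => h ha) ?_ ?_ ?_ ?_ ?_ ?_
  · rintro x (b | b | _ | _) a h <;> cases h
    rfl
  · rintro (b | b | _ | _) a h <;> cases h
    rfl
  · rintro (b | b | _ | _) h <;> first | rfl | cases h
  · exact fun a _ => ⟨.right a, rfl⟩
  · have stay : ∀ (z : (par one E).Config) (p : PMF (par one E).Ev), (par one E).PEnab z.1 p →
        (∀ e ∈ p.support, ∀ b, e ≠ .right b) → E.Weak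
        (PMF.pure ⟨BES.ParEv.right ⁻¹' z.1, (BES.isConfig_par_iff.1 z.2).2.1⟩)
        (p.map fun e => ⟨BES.ParEv.right ⁻¹' (add z e).1,
          (BES.isConfig_par_iff.1 (add z e).2).2.1⟩) := by
      intro z p hp h
      refine weak_stay fun e he => ?_
      change BES.ParEv.right ⁻¹' (add z e).1 = _
      rw [add_val (hp.2 e he)]
      ext b
      have := h e he b
      simp [this.symm]
    rintro z p hp
    obtain ⟨(⟨q, hq, rfl⟩ | ⟨q, hq, rfl⟩) | rfl | rfl, -⟩ := id hp
    · refine stay z _ hp fun e he b => ?_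
      obtain ⟨a, -, rfl⟩ := (PMF.mem_support_map_iff _ _ _).1 he
      simp
    · rw [PMF.map_comp]
      refine weak_image (j := id) (by rwa [PMF.map_id]) (fun e he => ?_) fun e he => ?_
      · exact (hp.enab_map he).1
      · change BES.ParEv.right ⁻¹' (add z _).1 = _
        rw [add_val (hp.enab_map he)]
        ext b
        simp
    · refine stay z _ hp fun e he b => ?_
      rw [PMF.mem_support_pure_iff] at he
      simp [he]
    · refine stay z _ hp fun e he b => ?_
      rw [PMF.mem_support_pure_iff] at he
      simp [he]
  · exact fun z hz => ((BES.isConfig_par_iff.1 z.2).2.2.2.2 (final_inter_par.1 hz)).2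

/-- The event `start` and the event of `1` accompany the first step of `E`, and `finish` is added as
soon as `E` has terminated; so the answer is a function of `x`. -/
theorem le_one_par {E : PES Act} (hE : E.Good) : E.Sim (par one E) := by
  have hcf : ∀ (P Q R : Prop) (x : E.Config), (x.1.Nonempty → P) → (Q → P) →
      (R → Q ∧ (x.1 ∩ E.final).Nonempty) →
      (par one E).IsConfig (BES.parSet P {_e | Q} x.1 R) := fun P Q R x h1 h2 h3 =>
    BES.isConfig_par (isConfig_single none _) x.2 (fun ⟨_, h⟩ => h2 h) h1
      fun h => ⟨final_single.2 (h3 h).1, (h3 h).2⟩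
  have hne : ∀ x : E.Config, (x.1 ∩ E.final).Nonempty → x.1.Nonempty :=
    fun x h => h.mono Set.inter_subset_left
  refine sim_of_fun hE.finDist
    (fun x => ⟨BES.parSet x.1.Nonempty {_e | x.1.Nonempty} x.1 (x.1 ∩ E.final).Nonempty,
      hcf _ _ _ x id id fun h => ⟨hne x h, h⟩⟩)
    (fun e => some (BES.ParEv.right e)) ?_ ?_ ?_ ?_ ?_ ?_ ?_ ?_
  · ext (a | a | _ | _) <;> simp [BES.emptyConfig]
  · exact fun x x' h => BES.parSet_mono (fun h' => h'.mono h) (fun _ h' => h'.mono h) h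
      fun h' => h'.mono (Set.inter_subset_inter_left _ h)
  · rintro x b a h
    cases h
    exact BES.right_mem_parSet
  · rintro b a h
    cases h
    rfl
  · rintro b h
    cases h
  · rintro (a | a | _ | _) h
    · exact (h rfl).elim
    · exact ⟨a, rfl⟩
    · exact (h rfl).elim
    · exact (h rfl).elim
  · intro x p hp
    have hx : ¬ (x.1 ∩ E.final).Nonempty := fun h => final_max_config hE h hp
    have h1 : ∀ h, (par one E).Weak
        (PMF.pure ⟨BES.parSet x.1.Nonempty {_e | x.1.Nonempty} x.1 (x.1 ∩ E.final).Nonempty, h⟩)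
        (PMF.pure ⟨BES.parSet True {_e | x.1.Nonempty} x.1 False,
          hcf _ _ _ x (fun _ => trivial) (fun _ => trivial) False.elim⟩) := fun h =>
      weak_insert (e := .start) start_mem_dist (by
        rw [BES.insert_start_parSet]
        ext (a | a | _ | _) <;> simp [hx])
    have h2 : ∀ h, (par one E).Weak
        (PMF.pure ⟨BES.parSet True {_e | x.1.Nonempty} x.1 False, h⟩)
        (PMF.pure ⟨BES.parSet True {_e | True} x.1 False,
          hcf _ _ _ x (fun _ => trivial) (fun _ => trivial) False.elim⟩) := fun h =>
      weak_insert (e := .left ()) (Or.inl (Or.inl ⟨_, rfl, PMF.pure_map _ _⟩)) (by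
        rw [BES.insert_left_parSet]
        ext (a | a | _ | _) <;> simp)
    refine (h1 _).trans ((h2 _).trans ?_)
    refine weak_image_trans (good_one.par hE).finDist (j := .right)
      (k := fun e => ⟨BES.parSet True {_e | True} (add x e).1 False,
        hcf _ _ _ (add x e) (fun _ => trivial) (fun _ => trivial) False.elim⟩)
      (hE.finDist p hp.1) (Or.inl (Or.inr ⟨p, hp.1, rfl⟩)) (fun e he => ?_) (fun e he => ?_)
      fun e he => ?_
    · rw [BES.right_mem_parSet]
      exact (hp.2 e he).1
    · change BES.parSet True {_e | True} (add x e).1 False = _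
      rw [BES.insert_right_parSet, add_val (hp.2 e he)]
    · have h3 : (add x e).1.Nonempty := by
        rw [add_val (hp.2 e he)]
        exact Set.insert_nonempty _ _
      by_cases h : ((add x e).1 ∩ E.final).Nonempty
      · refine weak_insert (e := .finish) finish_mem_dist ?_
        rw [BES.insert_finish_parSet]
        ext (a | a | _ | _) <;> simp [h, h3]
      · refine weak_of_eq ?_
        ext (a | a | _ | _) <;> simp [h, h3]
  · exact fun x hx => final_inter_par.2 hx

/-! ### Associativity of concurrent composition -/

/-- The configuration of `(E ‖ F) ‖ G` in which the delimiters of `E ‖ F` are executed as early as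
possible. -/
def assocSet {E F G : PES Act} (z : Set (par E (par F G)).Ev) : Set (par (par E F) G).Ev :=
  BES.parSet (.start ∈ z)
    (BES.parSet (.start ∈ z) {a | .left a ∈ z} {a | .right (.left a) ∈ z}
      ((∃ a ∈ E.final, .left a ∈ z) ∧ ∃ a ∈ F.final, .right (.left a) ∈ z))
    {a | .right (.right a) ∈ z} (.finish ∈ z)

theorem isConfig_assocSet {E F G : PES Act} {z : Set (par E (par F G)).Ev}
    (hz : (par E (par F G)).IsConfig z) : (par (par E F) G).IsConfig (assocSet z) := by
  obtain ⟨h1, h2, h3, h4, h5⟩ := BES.isConfig_par_iff.1 hz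
  obtain ⟨k1, k2, -, -, k5⟩ := BES.isConfig_par_iff.1 h2
  refine BES.isConfig_par (BES.isConfig_par h1 k1 h3 (fun ⟨a, ha⟩ => h4 ⟨_, ha⟩) ?_) k2 ?_
    (fun ⟨a, ha⟩ => h4 ⟨_, ha⟩) ?_
  · rintro ⟨⟨a, ha, ha'⟩, b, hb, hb'⟩
    exact ⟨⟨a, ha', ha⟩, b, hb', hb⟩
  · rintro ⟨a | a | _ | _, h⟩
    · exact h3 ⟨a, h⟩
    · exact h4 ⟨_, h⟩
    · exact h
    · obtain ⟨⟨a, -, ha⟩, -⟩ := h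
      exact h3 ⟨a, ha⟩
  · intro hf
    obtain ⟨⟨a, ha, ha'⟩, h7⟩ := h5 hf
    obtain ⟨⟨b, hb, hb'⟩, h9⟩ := k5 (final_inter_par.1 h7)
    exact ⟨final_inter_par.2 ⟨⟨a, ha', ha⟩, b, hb', hb⟩, h9⟩

theorem assocSet_mono {E F G : PES Act} {z z' : Set (par E (par F G)).Ev} (h : z ⊆ z') :
    assocSet z ⊆ assocSet z' := by
  refine BES.parSet_mono (fun h' => h h') (BES.parSet_mono (fun h' => h h') (fun _ h' => h h')
    (fun _ h' => h h') ?_) (fun _ h' => h h') fun h' => h h'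
  rintro ⟨⟨a, ha, ha'⟩, b, hb, hb'⟩
  exact ⟨⟨a, ha, h ha'⟩, b, hb, h hb'⟩

/-- The labelled events correspond, but the inner delimiters do not. Those of `E ‖ F` are executed
at the earliest moment: its `start` with the outer one, its `finish` as soon as `E` and `F` have
terminated. Those of `F ‖ G` are ignored. -/
theorem par_assoc_le {E F G : PES Act} (hE : E.Good) (hF : F.Good) (hG : G.Good) :
    (par E (par F G)).Sim (par (par E F) G) := by
  let i : (par E (par F G)).Ev → Option (par (par E F) G).Ev
    | .left a => some (.left (.left a))
    | .right (.left a) => some (.left (.right a))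
    | .right (.right a) => some (.right a)
    | _ => none
  have hY := ((hE.par hF).par hG).finDist
  refine sim_of_fun (hE.par (hF.par hG)).finDist
    (fun z => ⟨assocSet z.1, isConfig_assocSet z.2⟩) i ?_ ?_ ?_ ?_ ?_ ?_ ?_ ?_
  · ext ((a | a | _ | _) | a | _ | _) <;> simp [BES.emptyConfig, assocSet]
  · exact fun x x' h => assocSet_mono h
  · rintro x (b | (b | b | _ | _) | _ | _) a h <;> cases h <;> rfl
  · rintro (b | (b | b | _ | _) | _ | _) a h <;> cases h <;> rfl
  · rintro (b | (b | b | _ | _) | _ | _) h <;> first | rfl | cases h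
  · rintro ((a | a | _ | _) | a | _ | _) h
    · exact ⟨.left a, rfl⟩
    · exact ⟨.right (.left a), rfl⟩
    · exact (h rfl).elim
    · exact (h rfl).elim
    · exact ⟨.right (.right a), rfl⟩
    · exact (h rfl).elim
    · exact (h rfl).elim
  · intro z p hp
    obtain ⟨-, h2, -, h4, -⟩ := BES.isConfig_par_iff.1 z.2
    -- After an event of `E` or `F` the inner `finish` may have become due. At most this one event
    -- separates `w` from `w'`.
    have fin : ∀ (w w' : (par (par E F) G).Config),
        (∀ a, a ≠ .left .finish → (a ∈ w'.1 ↔ a ∈ w.1)) →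
        (.left .finish ∈ w.1 → .left .finish ∈ w'.1) →
        (par (par E F) G).Weak (PMF.pure w) (PMF.pure w') := by
      intro w w' h h'
      by_cases hf : .left .finish ∈ w'.1
      · refine weak_insert (e := .left .finish)
          (Or.inl (Or.inl ⟨_, finish_mem_dist, PMF.pure_map _ _⟩)) (Set.ext fun a => ?_)
        by_cases ha : a = .left .finish
        · subst ha
          simp [hf]
        · simp [ha, h a ha]
      · refine weak_of_eq (Set.ext fun a => ?_)
        by_cases ha : a = .left .finish
        · subst ha
          exact iff_of_false hf fun h1 => hf (h' h1)
        · exact h a ha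
    have stepF : ∀ {A : Type} (q : PMF A) (j : A → (par E (par F G)).Ev)
        (j' : A → (par (par E F) G).Ev), FinSupp q → (par E (par F G)).PEnab z.1 (q.map j) →
        q.map j' ∈ (par (par E F) G).dist →
        (∀ a ∈ q.support, (par (par E F) G).Enab (assocSet z.1) (j' a)) →
        (∀ a b, b ≠ .left .finish →
          (b ∈ assocSet (insert (j a) z.1) ↔ b ∈ insert (j' a) (assocSet z.1))) →
        (∀ a, j' a ≠ .left .finish) →
        (par (par E F) G).Weak (PMF.pure ⟨assocSet z.1, isConfig_assocSet z.2⟩)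
          ((q.map j).map fun e => ⟨assocSet (add z e).1, isConfig_assocSet (add z e).2⟩) := by
      intro A q j j' hq hp hd hen hins hj'
      rw [PMF.map_comp]
      refine weak_image_trans hY hq hd
        (k := fun a => add ⟨assocSet z.1, isConfig_assocSet z.2⟩ (j' a))
        (fun a ha => (hen a ha).1) (fun a ha => add_val (hen a ha)) fun a ha => ?_
      have h5 := add_val (x := (⟨assocSet z.1, isConfig_assocSet z.2⟩ : (par (par E F) G).Config))
        (hen a ha)
      have h6 := add_val (hp.enab_map ha)
      refine fin _ _ (fun b hb => ?_) fun hf => ?_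
      · rw [h5]
        change b ∈ assocSet (add z (j a)).1 ↔ _
        rw [h6]
        exact hins a b hb
      · rw [h5] at hf
        change _ ∈ assocSet (add z (j a)).1
        rw [h6]
        exact assocSet_mono (Set.subset_insert _ _) (hf.resolve_left fun h => hj' a h.symm)
    have stay : ∀ e, (par E (par F G)).PEnab z.1 (PMF.pure e) →
        assocSet (insert e z.1) = assocSet z.1 → (par (par E F) G).Weak
          (PMF.pure ⟨assocSet z.1, isConfig_assocSet z.2⟩)
          ((PMF.pure e).map fun e => ⟨assocSet (add z e).1, isConfig_assocSet (add z e).2⟩) := by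
      intro e hp he
      refine weak_stay fun a ha => ?_
      rw [PMF.mem_support_pure_iff] at ha
      subst ha
      change assocSet (add z a).1 = _
      rw [add_val hp.enab_pure, he]
    obtain ⟨(⟨q, hq, rfl⟩ | ⟨_, (⟨q, hq, rfl⟩ | ⟨q, hq, rfl⟩) | rfl | rfl, rfl⟩) | rfl | rfl, -⟩ :=
      id hp
    · refine stepF q _ (fun e => .left (.left e)) (hE.finDist q hq) hp
        (Or.inl (Or.inl ⟨_, Or.inl (Or.inl ⟨q, hq, rfl⟩), PMF.map_comp _ _ _⟩)) (fun a ha => ?_)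
        (fun a b hb => ?_) fun a h => by cases h
      · have h5 := BES.enab_par_left.1 (hp.enab_map ha)
        exact BES.enab_par_left.2 ⟨BES.enab_par_left.2 h5, fun h => by cases BES.mem_init_par.1 h⟩
      · rcases b with (b | b | _ | _) | b | _ | _ <;> simp [assocSet] at hb ⊢
    · rw [PMF.map_comp _ q] at hp ⊢
      refine stepF q _ (fun e => .left (.right e)) (hF.finDist q hq) hp
        (Or.inl (Or.inl ⟨_, Or.inl (Or.inr ⟨q, hq, rfl⟩), PMF.map_comp _ _ _⟩)) (fun a ha => ?_)
        (fun a b hb => ?_) fun a h => by cases h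
      · have h5 := BES.enab_par_left.1 (BES.enab_par_right.1 (hp.enab_map ha)).1
        exact BES.enab_par_left.2 ⟨BES.enab_par_right.2 ⟨h5.1, fun h => h4 ⟨_, h5.2 h⟩⟩,
          fun h => by cases BES.mem_init_par.1 h⟩
      · rcases b with (b | b | _ | _) | b | _ | _ <;> simp [assocSet] at hb ⊢
    · rw [PMF.map_comp _ q] at hp ⊢
      refine stepF q _ (fun e => .right e) (hG.finDist q hq) hp
        (Or.inl (Or.inr ⟨q, hq, rfl⟩)) (fun a ha => ?_)
        (fun a b hb => ?_) fun a h => by cases h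
      · have h5 := BES.enab_par_right.1 (BES.enab_par_right.1 (hp.enab_map ha)).1
        exact BES.enab_par_right.2 ⟨h5.1, fun h => h4 ⟨_, h5.2 h⟩⟩
      · rcases b with (b | b | _ | _) | b | _ | _ <;> simp [assocSet] at hb ⊢
    -- The delimiters of `F ‖ G` have no counterpart, and their execution is answered by staying.
    · rw [PMF.pure_map] at hp ⊢
      refine stay _ hp ?_
      ext ((b | b | _ | _) | b | _ | _) <;> simp [assocSet]
    · rw [PMF.pure_map] at hp ⊢
      refine stay _ hp ?_
      ext ((b | b | _ | _) | b | _ | _) <;> simp [assocSet]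
    · have h5 := BES.enab_par_start.1 hp.enab_pure
      have h6 : (par (par E F) G).Enab (assocSet z.1) .start := BES.enab_par_start.2 h5
      rw [PMF.pure_map]
      refine (weak_add start_mem_dist h6).trans
        (weak_insert (e := .left .start) (Or.inl (Or.inl ⟨_, start_mem_dist, PMF.pure_map _ _⟩)) ?_)
      change assocSet (add z _).1 = _
      rw [add_val hp.enab_pure, add_val h6]
      ext ((b | b | _ | _) | b | _ | _) <;> simp [assocSet]
    · rw [PMF.pure_map]
      refine weak_insert (e := .finish) finish_mem_dist ?_
      change assocSet (add z _).1 = _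
      rw [add_val hp.enab_pure]
      ext ((b | b | _ | _) | b | _ | _) <;> simp [assocSet]
  · intro z hz
    have h1 := (final_inter_par (E := E.toBES) (F := (par F G).toBES)).1 hz
    exact final_inter_par.2 h1

/-- The other inequality, with the components in reverse order, combined with commutativity inside
and outside. -/
theorem par_assoc_ge {E F G : PES Act} (hE : E.Good) (hF : F.Good) (hG : G.Good) :
    (par (par E F) G).Sim (par E (par F G)) := by
  have e1 := (hE.par hF).par hG
  have e2 := hG.par (hE.par hF)
  have e3 := hG.par (hF.par hE)
  have e4 := (hG.par hF).par hE
  have e5 := hE.par (hG.par hF)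
  have e6 := hE.par (hF.par hG)
  have h1 := par_comm_le (hE.par hF) hG
  have h2 := par_mono hG hG (hE.par hF) (hF.par hE) (Sim.refl hG.finDist) (par_comm_le hE hF)
  have h3 := par_assoc_le hG hF hE
  have h4 := par_comm_le (hG.par hF) hE
  have h5 := par_mono hE hE (hG.par hF) (hF.par hG) (Sim.refl hE.finDist) (par_comm_le hG hF)
  exact h1.trans e1.finDist e2.finDist e6.finDist (h2.trans e2.finDist e3.finDist e6.finDist
    (h3.trans e3.finDist e4.finDist e6.finDist (h4.trans e4.finDist e5.finDist e6.finDist h5)))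

/-! ### The interchange law -/

/-- The configuration of `(E·E') ‖ (F·F')` with the same events of the components. -/
def interchangeSet {E F E' F' : PES Act} (z : Set (seq (par E F) (par E' F')).Ev) :
    Set (par (seq E E') (seq F F')).Ev :=
  BES.parSet (.inl .start ∈ z) (BES.sumSet {a | .inl (.left a) ∈ z} {a | .inr (.left a) ∈ z})
    (BES.sumSet {a | .inl (.right a) ∈ z} {a | .inr (.right a) ∈ z}) (.inr .finish ∈ z)

theorem isConfig_interchangeSet {E F E' F' : PES Act} {z : Set (seq (par E F) (par E' F')).Ev}
    (hz : (seq (par E F) (par E' F')).IsConfig z) :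
    (par (seq E E') (seq F F')).IsConfig (interchangeSet z) := by
  obtain ⟨h1, h2, h3⟩ := BES.isConfig_seq_iff.1 hz
  obtain ⟨k1, k2, k3, k4, k5⟩ := BES.isConfig_par_iff.1 h1
  obtain ⟨l1, l2, l3, l4, l5⟩ := BES.isConfig_par_iff.1 h2
  have h4 : ∀ a, Sum.inr a ∈ z → _ := fun a ha => k5 (final_inter_par.1 (h3 ⟨a, ha⟩))
  refine BES.isConfig_par (BES.isConfig_seq k1 l1 fun ⟨a, ha⟩ => (h4 _ ha).1)
    (BES.isConfig_seq k2 l2 fun ⟨a, ha⟩ => (h4 _ ha).2) ?_ ?_ ?_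
  · rintro ⟨a | a, ha⟩
    · exact k3 ⟨a, BES.inl_mem_sumSet.1 ha⟩
    · have ha' := BES.inr_mem_sumSet.1 ha
      obtain ⟨⟨b, hb, -⟩, -⟩ := h4 _ ha'
      exact k3 ⟨b, hb⟩
  · rintro ⟨a | a, ha⟩
    · exact k4 ⟨a, BES.inl_mem_sumSet.1 ha⟩
    · have ha' := BES.inr_mem_sumSet.1 ha
      obtain ⟨⟨b, hb, -⟩, -⟩ := h4 _ ha'
      exact k3 ⟨b, hb⟩
  · intro hf
    obtain ⟨h5, h6⟩ := l5 hf
    refine ⟨final_inter_seq.2 ?_, final_inter_seq.2 ?_⟩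
    · rwa [BES.inr_preimage_sumSet]
    · rwa [BES.inr_preimage_sumSet]

/-- On the left `E'` and `F'` both wait for `E` and `F`; on the right each waits for its own
predecessor only, so the same labelled events form a configuration with fewer constraints. The
`finish` of the first stage and the `start` of the second are answered by staying. -/
theorem interchange_le {E F E' F' : PES Act} (hE : E.Good) (hF : F.Good) (hE' : E'.Good)
    (hF' : F'.Good) : (seq (par E F) (par E' F')).Sim (par (seq E E') (seq F F')) := by
  let i : (seq (par E F) (par E' F')).Ev → Option (par (seq E E') (seq F F')).Ev
    | .inl (.left a) => some (.left (.inl a))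
    | .inl (.right a) => some (.right (.inl a))
    | .inr (.left a) => some (.left (.inr a))
    | .inr (.right a) => some (.right (.inr a))
    | _ => none
  refine sim_of_fun ((hE.par hF).seq (hE'.par hF')).finDist
    (fun z => ⟨interchangeSet z.1, isConfig_interchangeSet z.2⟩) i ?_ ?_ ?_ ?_ ?_ ?_ ?_ ?_
  · ext ((a | a) | (a | a) | _ | _) <;> simp [BES.emptyConfig, interchangeSet]
  · exact fun x x' h => BES.parSet_mono (fun h' => h h')
      (BES.sumSet_mono (fun _ h' => h h') fun _ h' => h h')
      (BES.sumSet_mono (fun _ h' => h h') fun _ h' => h h') fun h' => h h'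
  · rintro x ((b | b | _ | _) | (b | b | _ | _)) a h <;> cases h <;> simp [interchangeSet]
  · rintro ((b | b | _ | _) | (b | b | _ | _)) a h <;> cases h <;> rfl
  · rintro ((b | b | _ | _) | (b | b | _ | _)) h <;> first | rfl | cases h
  · rintro ((a | a) | (a | a) | _ | _) h
    · exact ⟨.inl (.left a), rfl⟩
    · exact ⟨.inr (.left a), rfl⟩
    · exact ⟨.inl (.right a), rfl⟩
    · exact ⟨.inr (.right a), rfl⟩
    · exact (h rfl).elim
    · exact (h rfl).elim
  · intro z p hp
    have step : ∀ {A : Type} (q : PMF A) (j : A → (seq (par E F) (par E' F')).Ev)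
        (j' : A → (par (seq E E') (seq F F')).Ev),
        (seq (par E F) (par E' F')).PEnab z.1 (q.map j) →
        q.map j' ∈ (par (seq E E') (seq F F')).dist →
        (∀ a, j a ∉ z.1 → j' a ∉ interchangeSet z.1) →
        (∀ a, interchangeSet (insert (j a) z.1) = insert (j' a) (interchangeSet z.1)) →
        (par (seq E E') (seq F F')).Weak
          (PMF.pure ⟨interchangeSet z.1, isConfig_interchangeSet z.2⟩)
          ((q.map j).map fun e => ⟨interchangeSet (add z e).1,
            isConfig_interchangeSet (add z e).2⟩) := by
      intro A q j j' hp hd hn hins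
      rw [PMF.map_comp]
      refine weak_image hd (fun a ha => hn a (hp.enab_map ha).1) fun a ha => ?_
      change interchangeSet (add z (j a)).1 = _
      rw [add_val (hp.enab_map ha)]
      exact hins a
    have stay : ∀ e, (seq (par E F) (par E' F')).PEnab z.1 (PMF.pure e) →
        interchangeSet (insert e z.1) = interchangeSet z.1 → (par (seq E E') (seq F F')).Weak
          (PMF.pure ⟨interchangeSet z.1, isConfig_interchangeSet z.2⟩)
          ((PMF.pure e).map fun e => ⟨interchangeSet (add z e).1,
            isConfig_interchangeSet (add z e).2⟩) := by
      intro e hp he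
      refine weak_stay fun a ha => ?_
      rw [PMF.mem_support_pure_iff] at ha
      subst ha
      change interchangeSet (add z a).1 = _
      rw [add_val hp.enab_pure, he]
    obtain ⟨⟨_, (⟨q, hq, rfl⟩ | ⟨q, hq, rfl⟩) | rfl | rfl, rfl⟩ |
      ⟨_, (⟨q, hq, rfl⟩ | ⟨q, hq, rfl⟩) | rfl | rfl, rfl⟩, -⟩ := id hp
    · rw [PMF.map_comp _ q] at hp ⊢
      refine step q _ (fun a => .left (.inl a)) hp
        (Or.inl (Or.inl ⟨_, Or.inl ⟨q, hq, rfl⟩, PMF.map_comp _ _ _⟩)) (fun a ha => ?_) fun a => ?_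
      · simpa [interchangeSet] using ha
      · ext ((b | b) | (b | b) | _ | _) <;> simp [interchangeSet]
    · rw [PMF.map_comp _ q] at hp ⊢
      refine step q _ (fun a => .right (.inl a)) hp
        (Or.inl (Or.inr ⟨_, Or.inl ⟨q, hq, rfl⟩, PMF.map_comp _ _ _⟩)) (fun a ha => ?_) fun a => ?_
      · simpa [interchangeSet] using ha
      · ext ((b | b) | (b | b) | _ | _) <;> simp [interchangeSet]
    · rw [PMF.pure_map] at hp ⊢
      rw [PMF.pure_map]
      refine weak_insert (e := .start) start_mem_dist ?_
      change interchangeSet (add z _).1 = _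
      rw [add_val hp.enab_pure]
      ext ((b | b) | (b | b) | _ | _) <;> simp [interchangeSet]
    · rw [PMF.pure_map] at hp ⊢
      refine stay _ hp ?_
      ext ((b | b) | (b | b) | _ | _) <;> simp [interchangeSet]
    · rw [PMF.map_comp _ q] at hp ⊢
      refine step q _ (fun a => .left (.inr a)) hp
        (Or.inl (Or.inl ⟨_, Or.inr ⟨q, hq, rfl⟩, PMF.map_comp _ _ _⟩)) (fun a ha => ?_) fun a => ?_
      · simpa [interchangeSet] using ha
      · ext ((b | b) | (b | b) | _ | _) <;> simp [interchangeSet]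
    · rw [PMF.map_comp _ q] at hp ⊢
      refine step q _ (fun a => .right (.inr a)) hp
        (Or.inl (Or.inr ⟨_, Or.inr ⟨q, hq, rfl⟩, PMF.map_comp _ _ _⟩)) (fun a ha => ?_) fun a => ?_
      · simpa [interchangeSet] using ha
      · ext ((b | b) | (b | b) | _ | _) <;> simp [interchangeSet]
    · rw [PMF.pure_map] at hp ⊢
      refine stay _ hp ?_
      ext ((b | b) | (b | b) | _ | _) <;> simp [interchangeSet]
    · rw [PMF.pure_map] at hp ⊢
      rw [PMF.pure_map]
      refine weak_insert (e := .finish) finish_mem_dist ?_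
      change interchangeSet (add z _).1 = _
      rw [add_val hp.enab_pure]
      ext ((b | b) | (b | b) | _ | _) <;> simp [interchangeSet]
  · intro z hz
    have h1 := (final_inter_seq (E := (par E F).toBES) (F := (par E' F').toBES)).1 hz
    have h2 := final_inter_par.1 h1
    exact final_inter_par.2 h2

end PES
end PBES

namespace PBES

namespace PES

variable {Act : Type u}

/-! ### Right distributivity -/

/-- Simulations along a covering: a map between events such that steps can be lifted. -/
theorem sim_of_cover {X Y : PES Act} (hX : X.FinDist) (j : Y.Ev → X.Ev)
    (hen : ∀ y, Y.IsConfig y → ∀ e, Y.Enab y e → X.Enab (j '' y) (j e))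
    (hl : ∀ e, X.label (j e) = Y.label e) (hf : ∀ e, j e ∈ X.final → e ∈ Y.final)
    (hb : ∀ y, Y.IsConfig y → ∀ a ∈ y, ∀ b, Y.bundle b a → ∃ b', X.bundle b' (j a) ∧
      ∀ c ∈ y, j c ∈ b' → c ∈ b)
    (hd : ∀ y, Y.IsConfig y → ∀ p, X.PEnab (j '' y) p → ∃ q, p = q.map j ∧
      Set.InjOn j q.support ∧ Y.PEnab y q) :
    X.Sim Y := by
  -- Subconfigurations of the image lift to subconfigurations of `y`: by `hb`, a bundle of `Y` is
  -- met as soon as a suitable bundle of `X` is met by images of events of `y`.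
  have hcfg : ∀ y, Y.IsConfig y → ∀ w, X.IsConfig w → w ⊆ j '' y →
      Y.IsConfig {a | a ∈ y ∧ j a ∈ w} := by
    intro y hy w hw
    have hinj := injOn_of_enab hen hy
    induction hw using BES.IsConfig.induction with
    | h0 =>
      intro _
      simpa using BES.isConfig_empty _
    | h1 w e hw he ih =>
      intro hwy
      have hwy' : w ⊆ j '' y := (Set.subset_insert _ _).trans hwy
      obtain ⟨a, ha, rfl⟩ := hwy (Set.mem_insert _ _)
      have h1 : {b | b ∈ y ∧ j b ∈ insert (j a) w} = insert a {b | b ∈ y ∧ j b ∈ w} := by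
        ext b
        constructor
        · rintro ⟨hb, h | h⟩
          · exact Or.inl (hinj hb ha h)
          · exact Or.inr ⟨hb, h⟩
        · rintro (rfl | ⟨hb, h⟩)
          · exact ⟨ha, Or.inl rfl⟩
          · exact ⟨hb, Or.inr h⟩
      rw [h1]
      refine (ih hwy').insert ⟨fun h => he.1 h.2, fun e' he' => ?_, fun b hb' => ?_⟩
      · exact hy.conflictFree _ ha _ he'.1
      · obtain ⟨b', h2, h3⟩ := hb y hy a ha b hb'
        obtain ⟨c, hc, hcb⟩ := he.2.2 b' h2
        obtain ⟨c, hcy, rfl⟩ := hwy' hc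
        exact ⟨c, ⟨hcy, hc⟩, h3 c hcy hcb⟩
  refine sim_of_rel hX (fun x y => x.1 = j '' y.1) (by simp [BES.emptyConfig]) ?_ ?_ ?_
  · intro x y h
    refine BES.implements_of_configs (fun a b => a ∈ y.1 ∧ j a = b) x.2 y.2 ?_ ?_ ?_ ?_ ?_ ?_
    · rintro a _ ⟨ha, rfl⟩
      exact ⟨ha, h ▸ ⟨a, ha, rfl⟩⟩
    · rintro a _ ⟨-, rfl⟩
      exact hl a
    · exact fun a ha _ => ⟨_, ha, rfl⟩
    · intro b hb _
      rw [h] at hb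
      obtain ⟨a, ha, rfl⟩ := hb
      exact ⟨a, ha, rfl⟩
    · rintro a a' _ - ⟨ha, rfl⟩ ⟨ha', h'⟩
      exact injOn_of_enab hen y.2 ha ha' h'.symm
    · intro w hw hwx
      refine ⟨_, hcfg y.1 y.2 w hw (h ▸ hwx), fun a ha => ha.1, ?_⟩
      rintro a _ ⟨ha, rfl⟩
      exact ⟨fun h => h.2, fun h => ⟨ha, h⟩⟩
  · intro x y h p hp
    obtain ⟨q, rfl, hinj, hq⟩ := hd y.1 y.2 p (h ▸ hp)
    have : Nonempty Y.Ev := q.support_nonempty.to_type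
    -- The map is injective on the support of `q`, so each event of the step in `X` has one lift
    -- there; the value of the inverse elsewhere does not matter.
    have hinv : ∀ a ∈ q.support, Function.invFunOn j q.support (j a) = a :=
      hinj.leftInvOn_invFunOn
    refine ⟨fun e => add y (Function.invFunOn j q.support e), fun e he => ?_, ?_⟩
    · obtain ⟨a, ha, rfl⟩ := (PMF.mem_support_map_iff _ _ _).1 he
      change _ = j '' (add y (Function.invFunOn j q.support (j a))).1
      rw [hinv a ha, add_val (hq.2 a ha), Set.image_insert_eq, ← h, add_val (hp.enab_map ha)]
    · rw [PMF.map_comp]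
      have h1 : q.map ((fun e => add y (Function.invFunOn j q.support e)) ∘ j) = q.map (add y) :=
        map_congr_support fun a ha => by rw [Function.comp, hinv a ha]
      rw [h1]
      exact Weak.of_pEnab hq
  · rintro x y h ⟨e, he, hef⟩
    rw [h] at he
    obtain ⟨a, ha, rfl⟩ := he
    exact ⟨a, ha, hf a hef⟩

/-- The map from `E·G + F·G` to `(E + F)·G` that identifies the copies of `G`. -/
def distribMap (E F G : PES Act) : (plus (seq E G) (seq F G)).Ev → (seq (plus E F) G).Ev
  | .inl (.inl e) => .inl (.inl e)
  | .inr (.inl e) => .inl (.inr e)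
  | .inl (.inr e) => .inr e
  | .inr (.inr e) => .inr e

/-! ### The covering of `(E + F)·G` by `E·G + F·G` -/

section Distrib

variable {E F G : PES Act}

theorem inl_preimage_distribMap (y : Set (plus (seq E G) (seq F G)).Ev) :
    Sum.inl ⁻¹' (distribMap E F G '' y) =
      BES.sumSet (Sum.inl ⁻¹' (Sum.inl ⁻¹' y)) (Sum.inl ⁻¹' (Sum.inr ⁻¹' y)) := by
  ext (a | a)
  · rw [BES.inl_mem_sumSet]
    constructor
    · rintro ⟨(b | b) | (b | b), h, hb⟩ <;> cases hb
      exact h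
    · exact fun h => ⟨_, h, rfl⟩
  · rw [BES.inr_mem_sumSet]
    constructor
    · rintro ⟨(b | b) | (b | b), h, hb⟩ <;> cases hb
      exact h
    · exact fun h => ⟨_, h, rfl⟩

theorem inr_preimage_distribMap (y : Set (plus (seq E G) (seq F G)).Ev) :
    Sum.inr ⁻¹' (distribMap E F G '' y) =
      Sum.inr ⁻¹' (Sum.inl ⁻¹' y) ∪ Sum.inr ⁻¹' (Sum.inr ⁻¹' y) := by
  ext a
  constructor
  · rintro ⟨(b | b) | (b | b), h, hb⟩ <;> cases hb
    · exact Or.inl h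
    · exact Or.inr h
  · rintro (h | h)
    · exact ⟨_, h, rfl⟩
    · exact ⟨_, h, rfl⟩

theorem enab_distribMap {y : Set (plus (seq E G) (seq F G)).Ev}
    (hy : (plus (seq E G) (seq F G)).IsConfig y) {e : (plus (seq E G) (seq F G)).Ev}
    (he : (plus (seq E G) (seq F G)).Enab y e) :
    (seq (plus E F) G).Enab (distribMap E F G '' y) (distribMap E F G e) := by
  rcases e with e | e
  · obtain ⟨h1, h2⟩ := enab_plus_inl_config hy he
    rcases e with e | e
    · refine BES.enab_seq_inl.2 ?_
      rw [inl_preimage_distribMap, h2]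
      exact enab_plus_inl_of (by simpa using BES.enab_seq_inl.1 h1) (by simp)
    · refine BES.enab_seq_inr.2 ?_
      rw [inl_preimage_distribMap, inr_preimage_distribMap, h2, Set.preimage_empty,
        Set.preimage_empty, Set.union_empty]
      obtain ⟨h3, h4⟩ := BES.enab_seq_inr.1 h1
      exact ⟨h3, fun hi => final_inter_plus.2 (Or.inl (by simpa using h4 hi))⟩
  · obtain ⟨h1, h2⟩ := enab_plus_inr_config hy he
    rcases e with e | e
    · refine BES.enab_seq_inl.2 ?_
      rw [inl_preimage_distribMap, h2]
      exact enab_plus_inr_of (by simpa using BES.enab_seq_inl.1 h1) (by simp)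
    · refine BES.enab_seq_inr.2 ?_
      rw [inl_preimage_distribMap, inr_preimage_distribMap, h2, Set.preimage_empty,
        Set.preimage_empty, Set.empty_union]
      obtain ⟨h3, h4⟩ := BES.enab_seq_inr.1 h1
      exact ⟨h3, fun hi => final_inter_plus.2 (Or.inr (by simpa using h4 hi))⟩

theorem label_distribMap (e : (plus (seq E G) (seq F G)).Ev) :
    (seq (plus E F) G).label (distribMap E F G e) = (plus (seq E G) (seq F G)).label e := by
  rcases e with (e | e) | (e | e) <;> rfl

theorem final_distribMap (e : (plus (seq E G) (seq F G)).Ev) :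
    distribMap E F G e ∈ (seq (plus E F) G).final ↔ e ∈ (plus (seq E G) (seq F G)).final := by
  rcases e with (e | e) | (e | e)
  · constructor
    · rintro ⟨_, _, h⟩
      cases h
    · rintro (⟨_, ⟨_, _, rfl⟩, h⟩ | ⟨_, ⟨_, _, rfl⟩, h⟩) <;> cases h
  · constructor
    · rintro ⟨a, ha, h⟩
      cases h
      exact Or.inl ⟨_, ⟨e, ha, rfl⟩, rfl⟩
    · rintro (⟨_, ⟨a, ha, rfl⟩, h⟩ | ⟨_, ⟨_, _, rfl⟩, h⟩) <;> cases h
      exact ⟨e, ha, rfl⟩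
  · constructor
    · rintro ⟨_, _, h⟩
      cases h
    · rintro (⟨_, ⟨_, _, rfl⟩, h⟩ | ⟨_, ⟨_, _, rfl⟩, h⟩) <;> cases h
  · constructor
    · rintro ⟨a, ha, h⟩
      cases h
      exact Or.inr ⟨_, ⟨e, ha, rfl⟩, rfl⟩
    · rintro (⟨_, ⟨_, _, rfl⟩, h⟩ | ⟨_, ⟨a, ha, rfl⟩, h⟩) <;> cases h
      exact ⟨e, ha, rfl⟩

/-- A bundle of `(E + F)·G` may correspond to a larger set, with events from both copies of `G` or
with final events of both `E` and `F`. But `y` lives on the side of `a`, so no event of the other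
side can meet it. -/
theorem bundle_distribMap {y : Set (plus (seq E G) (seq F G)).Ev}
    (hy : (plus (seq E G) (seq F G)).IsConfig y) {a : (plus (seq E G) (seq F G)).Ev} (ha : a ∈ y)
    {b : Set (plus (seq E G) (seq F G)).Ev} (hb : (plus (seq E G) (seq F G)).bundle b a) :
    ∃ b', (seq (plus E F) G).bundle b' (distribMap E F G a) ∧
      ∀ c ∈ y, distribMap E F G c ∈ b' → c ∈ b := by
  obtain ⟨-, -, hy⟩ := BES.isConfig_plus_iff.1 hy
  simp only [Set.eq_empty_iff_forall_notMem, Set.mem_preimage] at hy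
  rcases hb with ⟨_, _, ⟨x, e, h⟩ | ⟨x, e, h⟩ | ⟨e, h⟩⟩ | ⟨_, _, ⟨x, e, h⟩ | ⟨x, e, h⟩ | ⟨e, h⟩⟩
  · refine ⟨_, .left _ _ (.left x e h), ?_⟩
    rintro ((c | c) | (c | c)) hc ⟨_, ⟨d, hd, rfl⟩, hh⟩ <;> cases hh
    exact ⟨_, ⟨_, hd, rfl⟩, rfl⟩
  · refine ⟨_, .right x e h, ?_⟩
    rintro ((c | c) | (c | c)) hc ⟨d, hd, hh⟩ <;> cases hh
    · exact ⟨_, ⟨_, hd, rfl⟩, rfl⟩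
    · exact (hy.elim (fun h => h _ ha) fun h => h _ hc).elim
  · refine ⟨_, .link e h, ?_⟩
    rintro ((c | c) | (c | c)) hc ⟨_, ⟨d, hd, rfl⟩ | ⟨d, hd, rfl⟩, hh⟩ <;> cases hh
    · exact ⟨_, ⟨_, hd, rfl⟩, rfl⟩
    · exact (hy.elim (fun h => h _ ha) fun h => h _ hc).elim
  · refine ⟨_, .left _ _ (.right x e h), ?_⟩
    rintro ((c | c) | (c | c)) hc ⟨_, ⟨d, hd, rfl⟩, hh⟩ <;> cases hh
    exact ⟨_, ⟨_, hd, rfl⟩, rfl⟩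
  · refine ⟨_, .right x e h, ?_⟩
    rintro ((c | c) | (c | c)) hc ⟨d, hd, hh⟩ <;> cases hh
    · exact (hy.elim (fun h => h _ hc) fun h => h _ ha).elim
    · exact ⟨_, ⟨_, hd, rfl⟩, rfl⟩
  · refine ⟨_, .link e h, ?_⟩
    rintro ((c | c) | (c | c)) hc ⟨_, ⟨d, hd, rfl⟩ | ⟨d, hd, rfl⟩, hh⟩ <;> cases hh
    · exact (hy.elim (fun h => h _ hc) fun h => h _ ha).elim
    · exact ⟨_, ⟨_, hd, rfl⟩, rfl⟩

variable {y : Set (plus (seq E G) (seq F G)).Ev}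

theorem inr_eq_empty_of_seq (hy : (plus (seq E G) (seq F G)).IsConfig y)
    (h : Sum.inl ⁻¹' (Sum.inr ⁻¹' y) = ∅) : Sum.inr ⁻¹' y = ∅ := by
  obtain ⟨-, -, h3⟩ := BES.isConfig_seq_iff.1 (BES.isConfig_plus_iff.1 hy).2.1
  rw [h, Set.empty_inter] at h3
  ext (a | a)
  · exact iff_of_false (Set.eq_empty_iff_forall_notMem.1 h a) id
  · exact iff_of_false (fun ha => Set.not_nonempty_empty (h3 ⟨a, ha⟩)) id

theorem inl_eq_empty_of_seq (hy : (plus (seq E G) (seq F G)).IsConfig y)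
    (h : Sum.inl ⁻¹' (Sum.inl ⁻¹' y) = ∅) : Sum.inl ⁻¹' y = ∅ := by
  obtain ⟨-, -, h3⟩ := BES.isConfig_seq_iff.1 (BES.isConfig_plus_iff.1 hy).1
  rw [h, Set.empty_inter] at h3
  ext (a | a)
  · exact iff_of_false (Set.eq_empty_iff_forall_notMem.1 h a) id
  · exact iff_of_false (fun ha => Set.not_nonempty_empty (h3 ⟨a, ha⟩)) id

theorem enab_of_distribMap_inl (hy : (plus (seq E G) (seq F G)).IsConfig y) {e : E.Ev}
    (he : (seq (plus E F) G).Enab (distribMap E F G '' y) (.inl (.inl e))) :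
    (plus (seq E G) (seq F G)).Enab y (.inl (.inl e)) := by
  have hx := isConfig_image (X := plus (seq E G) (seq F G)) (Y := seq (plus E F) G)
    (fun _ hy _ he => enab_distribMap hy he) hy
  obtain ⟨h1, h2⟩ := enab_plus_inl_config (BES.isConfig_seq_iff.1 hx).1 (BES.enab_seq_inl.1 he)
  rw [inl_preimage_distribMap, BES.inl_preimage_sumSet] at h1
  rw [inl_preimage_distribMap, BES.inr_preimage_sumSet] at h2
  exact enab_plus_inl_of (BES.enab_seq_inl.2 h1) (inr_eq_empty_of_seq hy h2)

theorem enab_of_distribMap_inr (hy : (plus (seq E G) (seq F G)).IsConfig y) {e : F.Ev}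
    (he : (seq (plus E F) G).Enab (distribMap E F G '' y) (.inl (.inr e))) :
    (plus (seq E G) (seq F G)).Enab y (.inr (.inl e)) := by
  have hx := isConfig_image (X := plus (seq E G) (seq F G)) (Y := seq (plus E F) G)
    (fun _ hy _ he => enab_distribMap hy he) hy
  obtain ⟨h1, h2⟩ := enab_plus_inr_config (BES.isConfig_seq_iff.1 hx).1 (BES.enab_seq_inl.1 he)
  rw [inl_preimage_distribMap, BES.inr_preimage_sumSet] at h1
  rw [inl_preimage_distribMap, BES.inl_preimage_sumSet] at h2
  exact enab_plus_inr_of (BES.enab_seq_inl.2 h1) (inl_eq_empty_of_seq hy h2)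

/-- The copy of `G` in which the step takes place is decided by `y` and not by the event, so the
whole support is lifted into the same copy. -/
theorem enab_of_distribMap_right (hy : (plus (seq E G) (seq F G)).IsConfig y) {q : PMF G.Ev}
    (he : ∀ e ∈ q.support, (seq (plus E F) G).Enab (distribMap E F G '' y) (.inr e)) :
    (∀ e ∈ q.support, (plus (seq E G) (seq F G)).Enab y (.inl (.inr e))) ∨
    ∀ e ∈ q.support, (plus (seq E G) (seq F G)).Enab y (.inr (.inr e)) := by
  have he' : ∀ e ∈ q.support,
      G.Enab (Sum.inr ⁻¹' (Sum.inl ⁻¹' y) ∪ Sum.inr ⁻¹' (Sum.inr ⁻¹' y)) e ∧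
      (e ∈ G.init → (Sum.inl ⁻¹' (Sum.inl ⁻¹' y) ∩ E.final).Nonempty ∨
        (Sum.inl ⁻¹' (Sum.inr ⁻¹' y) ∩ F.final).Nonempty) := by
    intro e hs
    obtain ⟨h1, h2⟩ := BES.enab_seq_inr.1 (he e hs)
    rw [inr_preimage_distribMap] at h1
    refine ⟨h1, fun hi => ?_⟩
    have h3 := final_inter_plus.1 (h2 hi)
    rwa [inl_preimage_distribMap, BES.inl_preimage_sumSet, BES.inr_preimage_sumSet] at h3
  rcases (BES.isConfig_plus_iff.1 hy).2.2 with h | h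
  · refine Or.inr fun e hs => enab_plus_inr_of (BES.enab_seq_inr.2 ?_) h
    have h1 := he' e hs
    rwa [h, Set.preimage_empty, Set.preimage_empty, Set.empty_union, Set.empty_inter,
      or_iff_right Set.not_nonempty_empty] at h1
  · refine Or.inl fun e hs => enab_plus_inl_of (BES.enab_seq_inr.2 ?_) h
    have h1 := he' e hs
    rwa [h, Set.preimage_empty, Set.preimage_empty, Set.union_empty, Set.empty_inter,
      or_iff_left Set.not_nonempty_empty] at h1

theorem injective_distribMap_inl :
    Function.Injective fun e => distribMap E F G (Sum.inl e) := by
  rintro (a | a) (b | b) h <;> cases h <;> rfl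

theorem injective_distribMap_inr :
    Function.Injective fun e => distribMap E F G (Sum.inr e) := by
  rintro (a | a) (b | b) h <;> cases h <;> rfl

theorem injOn_distribMap_of_inl {p : PMF (seq E G).Ev} :
    Set.InjOn (distribMap E F G) (p.map Sum.inl).support := by
  intro a ha b hb h
  obtain ⟨a, -, rfl⟩ := (PMF.mem_support_map_iff _ _ _).1 ha
  obtain ⟨b, -, rfl⟩ := (PMF.mem_support_map_iff _ _ _).1 hb
  exact congrArg _ (injective_distribMap_inl h)

theorem injOn_distribMap_of_inr {p : PMF (seq F G).Ev} :
    Set.InjOn (distribMap E F G) (p.map Sum.inr).support := by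
  intro a ha b hb h
  obtain ⟨a, -, rfl⟩ := (PMF.mem_support_map_iff _ _ _).1 ha
  obtain ⟨b, -, rfl⟩ := (PMF.mem_support_map_iff _ _ _).1 hb
  exact congrArg _ (injective_distribMap_inr h)

end Distrib

/-- By the time `G` is reached, `E + F` has been decided by its first event, so every step of `G`
can be lifted to the copy behind the chosen component. -/
theorem plus_seq_le {E F G : PES Act} (hE : E.Good) (hF : F.Good) (hG : G.Good) :
    (seq (plus E F) G).Sim (plus (seq E G) (seq F G)) := by
  refine sim_of_cover ((hE.plus hF).seq hG).finDist (distribMap E F G)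
    (fun y hy e he => enab_distribMap hy he) label_distribMap
    (fun e => (final_distribMap e).1) (fun y hy a ha b hb => bundle_distribMap hy ha hb) ?_
  intro y hy p hp
  obtain ⟨⟨_, ⟨q, hq, rfl⟩ | ⟨q, hq, rfl⟩, rfl⟩ | ⟨q, hq, rfl⟩, -⟩ := id hp
  · rw [PMF.map_comp _ q] at hp
    refine ⟨(q.map Sum.inl).map Sum.inl, ?_, injOn_distribMap_of_inl,
      Or.inl ⟨_, Or.inl ⟨q, hq, rfl⟩, rfl⟩, ?_⟩
    · simp only [PMF.map_comp]; rfl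
    · intro e he
      rw [PMF.map_comp] at he
      obtain ⟨a, ha, rfl⟩ := (PMF.mem_support_map_iff _ _ _).1 he
      exact enab_of_distribMap_inl hy (hp.enab_map ha)
  · rw [PMF.map_comp _ q] at hp
    refine ⟨(q.map Sum.inl).map Sum.inr, ?_, injOn_distribMap_of_inr,
      Or.inr ⟨_, Or.inl ⟨q, hq, rfl⟩, rfl⟩, ?_⟩
    · simp only [PMF.map_comp]; rfl
    · intro e he
      rw [PMF.map_comp] at he
      obtain ⟨a, ha, rfl⟩ := (PMF.mem_support_map_iff _ _ _).1 he
      exact enab_of_distribMap_inr hy (hp.enab_map ha)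
  · rcases enab_of_distribMap_right hy fun e he => hp.enab_map he with h | h
    · refine ⟨(q.map Sum.inr).map Sum.inl, ?_, injOn_distribMap_of_inl,
        Or.inl ⟨_, Or.inr ⟨q, hq, rfl⟩, rfl⟩, ?_⟩
      · simp only [PMF.map_comp]; rfl
      · intro e he
        rw [PMF.map_comp] at he
        obtain ⟨a, ha, rfl⟩ := (PMF.mem_support_map_iff _ _ _).1 he
        exact h a ha
    · refine ⟨(q.map Sum.inr).map Sum.inr, ?_, injOn_distribMap_of_inr,
        Or.inr ⟨_, Or.inr ⟨q, hq, rfl⟩, rfl⟩, ?_⟩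
      · simp only [PMF.map_comp]; rfl
      · intro e he
        rw [PMF.map_comp] at he
        obtain ⟨a, ha, rfl⟩ := (PMF.mem_support_map_iff _ _ _).1 he
        exact h a ha

theorem le_plus_seq {E F G : PES Act} (hE : E.Good) (hF : F.Good) (hG : G.Good) :
    (plus (seq E G) (seq F G)).Sim (seq (plus E F) G) :=
  plus_le (hE.seq hG) (hF.seq hG) ((hE.plus hF).seq hG)
    (seq_mono_left hE (hE.plus hF) hG (le_plus_left hE))
    (seq_mono_left hF (hE.plus hF) hG (le_plus_right hF))

/-- Events of the second factor are never initial, so a probabilistic choice between sequential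
compositions never mixes their distributions. -/
theorem not_support_map_inr_subset {E G : PES Act} (q : PMF G.Ev) :
    ¬ (q.map Sum.inr).support ⊆ (seq E G).init := by
  intro h
  obtain ⟨e, he⟩ := q.support_nonempty
  exact BES.inr_notMem_init_seq (h ((PMF.mem_support_map_iff _ _ _).2 ⟨e, he, rfl⟩))

theorem support_map_inl_subset_seq {E G : PES Act} {p : PMF E.Ev} :
    (p.map Sum.inl).support ⊆ (seq E G).init ↔ p.support ⊆ E.init := by
  rw [PMF.support_map, Set.image_subset_iff]
  exact forall_congr' fun e => imp_congr_right fun _ => BES.inl_mem_init_seq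

/-- The covering is the one used for `+`. Mixtures on the left come from initial events of `E` and
`F`, which are the initial events of `E·G` and `F·G`, so they lift to mixtures with the same
weights. -/
theorem pc_seq_le {E F G : PES Act} (hE : E.Good) (hF : F.Good) (hG : G.Good)
    (α : unitInterval) : (seq (pchoice α E F) G).Sim (pchoice α (seq E G) (seq F G)) := by
  refine sim_of_cover ((hE.pchoice α hF).seq hG).finDist (distribMap E F G)
    (fun y hy e he => enab_distribMap hy he) label_distribMap
    (fun e => (final_distribMap e).1) (fun y hy a ha b hb => bundle_distribMap hy ha hb) ?_
  intro y hy p hp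
  obtain ⟨⟨r, hr, rfl⟩ | ⟨q, hq, rfl⟩, -⟩ := id hp
  · have hj : ∀ e : E.Ev ⊕ F.Ev, distribMap E F G (Sum.map Sum.inl Sum.inl e) = Sum.inl e := by
      rintro (e | e) <;> rfl
    refine ⟨r.map (Sum.map Sum.inl Sum.inl), ?_, ?_, ?_, ?_⟩
    · rw [PMF.map_comp]
      exact map_congr_support fun e _ => (hj e).symm
    · intro a ha b hb h
      obtain ⟨a, -, rfl⟩ := (PMF.mem_support_map_iff _ _ _).1 ha
      obtain ⟨b, -, rfl⟩ := (PMF.mem_support_map_iff _ _ _).1 hb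
      rw [hj, hj] at h
      rw [Sum.inl_injective h]
    · rw [mem_pchoice_dist] at hr ⊢
      rcases hr with ⟨p, hp', q, hq, h1, h2, rfl⟩ | ⟨p, hp', rfl, h⟩ | ⟨p, hp', rfl, h⟩
      · refine Or.inl ⟨_, Or.inl ⟨p, hp', rfl⟩, _, Or.inl ⟨q, hq, rfl⟩,
          support_map_inl_subset_seq.2 h1, support_map_inl_subset_seq.2 h2, ?_⟩
        rw [PMF.map_bind]
        refine bind_congr_support fun b _ => ?_
        cases b <;> simp only [cond_true, cond_false, PMF.map_comp] <;> rfl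
      · exact Or.inr (Or.inl ⟨_, Or.inl ⟨p, hp', rfl⟩, by simp only [PMF.map_comp]; rfl,
          fun h' => h (support_map_inl_subset_seq.1 h')⟩)
      · exact Or.inr (Or.inr ⟨_, Or.inl ⟨p, hp', rfl⟩, by simp only [PMF.map_comp]; rfl,
          fun h' => h (support_map_inl_subset_seq.1 h')⟩)
    · intro e he
      obtain ⟨a | a, ha, rfl⟩ := (PMF.mem_support_map_iff _ _ _).1 he
      · exact enab_of_distribMap_inl hy (hp.enab_map ha)
      · exact enab_of_distribMap_inr hy (hp.enab_map ha)
  · rcases enab_of_distribMap_right hy fun e he => hp.enab_map he with h | h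
    · refine ⟨(q.map Sum.inr).map Sum.inl, ?_, injOn_distribMap_of_inl,
        mem_pchoice_dist.2 (Or.inr (Or.inl ⟨_, Or.inr ⟨q, hq, rfl⟩, rfl,
          not_support_map_inr_subset q⟩)), ?_⟩
      · simp only [PMF.map_comp]; rfl
      · intro e he
        rw [PMF.map_comp] at he
        obtain ⟨a, ha, rfl⟩ := (PMF.mem_support_map_iff _ _ _).1 he
        exact h a ha
    · refine ⟨(q.map Sum.inr).map Sum.inr, ?_, injOn_distribMap_of_inr,
        mem_pchoice_dist.2 (Or.inr (Or.inr ⟨_, Or.inr ⟨q, hq, rfl⟩, rfl,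
          not_support_map_inr_subset q⟩)), ?_⟩
      · simp only [PMF.map_comp]; rfl
      · intro e he
        rw [PMF.map_comp] at he
        obtain ⟨a, ha, rfl⟩ := (PMF.mem_support_map_iff _ _ _).1 he
        exact h a ha

theorem le_pc_seq {E F G : PES Act} (hE : E.Good) (hF : F.Good) (hG : G.Good)
    (α : unitInterval) : (pchoice α (seq E G) (seq F G)).Sim (seq (pchoice α E F) G) := by
  refine sim_of_map_dist ((hE.seq hG).pchoice α (hF.seq hG)).finDist (distribMap E F G)
    (fun y hy e he => enab_distribMap hy he) label_distribMap
    (fun e => (final_distribMap e).2) ?_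
  intro y hy p hp
  replace hp := mem_pchoice_dist.1 hp.1
  rcases hp with ⟨p, hp, q, hq, h1, h2, rfl⟩ | ⟨p, hp, rfl, h⟩ | ⟨p, hp, rfl, h⟩
  · rcases hp with ⟨p, hp, rfl⟩ | ⟨p, hp, rfl⟩
    · rcases hq with ⟨q, hq, rfl⟩ | ⟨q, hq, rfl⟩
      · refine Or.inl ⟨_, mem_pchoice_dist.2 (Or.inl ⟨p, hp, q, hq,
          support_map_inl_subset_seq.1 h1, support_map_inl_subset_seq.1 h2, rfl⟩), ?_⟩
        rw [PMF.map_bind, PMF.map_bind]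
        refine bind_congr_support fun b _ => ?_
        cases b <;> simp only [cond_true, cond_false, PMF.map_comp] <;> rfl
      · exact (not_support_map_inr_subset q h2).elim
    · exact (not_support_map_inr_subset p h1).elim
  · rcases hp with ⟨p, hp, rfl⟩ | ⟨p, hp, rfl⟩
    · refine Or.inl ⟨_, mem_pchoice_dist.2 (Or.inr (Or.inl ⟨p, hp, rfl,
        fun h' => h (support_map_inl_subset_seq.2 h')⟩)), ?_⟩
      simp only [PMF.map_comp]; rfl
    · exact Or.inr ⟨p, hp, by simp only [PMF.map_comp]; rfl⟩
  · rcases hp with ⟨p, hp, rfl⟩ | ⟨p, hp, rfl⟩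
    · refine Or.inl ⟨_, mem_pchoice_dist.2 (Or.inr (Or.inr ⟨p, hp, rfl,
        fun h' => h (support_map_inl_subset_seq.2 h')⟩)), ?_⟩
      simp only [PMF.map_comp]; rfl
    · exact Or.inr ⟨p, hp, by simp only [PMF.map_comp]; rfl⟩

end PES
end PBES

namespace PBES

namespace PES

variable {Act : Type u}

/-! ### Probabilistic choice -/

/-- A configuration of `E` as one of a choice between `E` and `F`. -/
def pcL (α : unitInterval) {E F : PES Act} (x : E.Config) : (pchoice α E F).Config :=
  ⟨BES.sumSet x.1 ∅, BES.isConfig_plus_inl x.2⟩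

/-- A configuration of `F` as one of a choice between `E` and `F`. -/
def pcR (α : unitInterval) {E F : PES Act} (x : F.Config) : (pchoice α E F).Config :=
  ⟨BES.sumSet ∅ x.1, BES.isConfig_plus_inr x.2⟩

/-- The random choice between a configuration of `E` and one of `F`. -/
noncomputable def pcMix (α : unitInterval) {E F : PES Act} (x : E.Config) (y : F.Config) :
    PMF (pchoice α E F).Config :=
  (coin α).map fun b => cond b (pcR α y) (pcL α x)

section

variable {α : unitInterval} {E F : PES Act}

theorem pcL_empty : (pcL α E.emptyConfig : (pchoice α E F).Config) = (pchoice α E F).emptyConfig :=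
  Subtype.ext BES.sumSet_empty

theorem pcR_empty : (pcR α F.emptyConfig : (pchoice α E F).Config) = (pchoice α E F).emptyConfig :=
  Subtype.ext BES.sumSet_empty

theorem pcMix_empty : (pcMix α E.emptyConfig F.emptyConfig) =
    PMF.pure (pchoice α E F).emptyConfig := by
  rw [pcMix, pcL_empty, pcR_empty]
  simp only [Bool.cond_self]
  exact PMF.map_const _ _

theorem pcL_ne_empty {x : E.Config} (h : x.1.Nonempty) :
    (pcL α x : (pchoice α E F).Config) ≠ (pchoice α E F).emptyConfig := by
  obtain ⟨e, he⟩ := h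
  intro h
  exact Set.notMem_empty (Sum.inl e : E.Ev ⊕ F.Ev)
    ((Set.ext_iff.1 (congrArg Subtype.val h) (.inl e)).1 (BES.inl_mem_sumSet.2 he))

theorem pcR_ne_empty {x : F.Config} (h : x.1.Nonempty) :
    (pcR α x : (pchoice α E F).Config) ≠ (pchoice α E F).emptyConfig := by
  obtain ⟨e, he⟩ := h
  intro h
  exact Set.notMem_empty (Sum.inr e : E.Ev ⊕ F.Ev)
    ((Set.ext_iff.1 (congrArg Subtype.val h) (.inr e)).1 (BES.inr_mem_sumSet.2 he))

theorem mem_support_pcMix {x : E.Config} {y : F.Config} {z : (pchoice α E F).Config}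
    (h : z ∈ (pcMix α x y).support) : z = pcL α x ∨ z = pcR α y := by
  obtain ⟨b, -, rfl⟩ := (PMF.mem_support_map_iff _ _ _).1 h
  cases b
  · exact Or.inl rfl
  · exact Or.inr rfl

theorem enab_pcL {x : E.Config} {e : E.Ev} (h : E.Enab x.1 e) :
    (pchoice α E F).Enab (pcL α x : (pchoice α E F).Config).1 (.inl e) := by
  refine enab_plus_inl_of ?_ BES.inr_preimage_sumSet
  change E.Enab (Sum.inl ⁻¹' (BES.sumSet x.1 ∅)) e
  rwa [BES.inl_preimage_sumSet]

theorem enab_pcR {x : F.Config} {e : F.Ev} (h : F.Enab x.1 e) :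
    (pchoice α E F).Enab (pcR α x : (pchoice α E F).Config).1 (.inr e) := by
  refine enab_plus_inr_of ?_ BES.inl_preimage_sumSet
  change F.Enab (Sum.inr ⁻¹' (BES.sumSet ∅ x.1)) e
  rwa [BES.inr_preimage_sumSet]

theorem add_pcL {x : E.Config} {e : E.Ev} (h : E.Enab x.1 e) :
    add (pcL α x : (pchoice α E F).Config) (.inl e) = pcL α (add x e) := by
  refine Subtype.ext ?_
  rw [add_val (enab_pcL h)]
  change insert (Sum.inl e) (BES.sumSet x.1 ∅) = BES.sumSet (add x e).1 ∅
  rw [add_val h]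
  ext (a | a) <;> simp

theorem add_pcR {x : F.Config} {e : F.Ev} (h : F.Enab x.1 e) :
    add (pcR α x : (pchoice α E F).Config) (.inr e) = pcR α (add x e) := by
  refine Subtype.ext ?_
  rw [add_val (enab_pcR h)]
  change insert (Sum.inr e) (BES.sumSet ∅ x.1) = BES.sumSet ∅ (add x e).1
  rw [add_val h]
  ext (a | a) <;> simp

/-- After the first event no initial event is enabled any more. Hence a component of a probabilistic
choice that has been entered continues with its own unmixed distributions. -/
theorem Good.not_support_subset_init (hE : E.Good) {x : E.Config} (hx : x.1.Nonempty)
    {p : PMF E.Ev} (hp : E.PEnab x.1 p) : ¬ p.support ⊆ E.init := by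
  intro h
  obtain ⟨e, he⟩ := p.support_nonempty
  exact hx.ne_empty (hE.eq_empty x.2 (h he) (hp.2 e he))

theorem weak_pcL (hE : E.Good) {x : E.Config} (hx : x.1.Nonempty) {p : PMF E.Ev}
    (hp : E.PEnab x.1 p) :
    (pchoice α E F).Weak (PMF.pure (pcL α x)) (p.map fun e => pcL α (add x e)) := by
  have h : (pchoice α E F).PEnab (pcL α x : (pchoice α E F).Config).1 (p.map Sum.inl) := by
    refine ⟨mem_pchoice_dist.2 (Or.inr (Or.inl ⟨p, hp.1, rfl,
      hE.not_support_subset_init hx hp⟩)), fun z hz => ?_⟩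
    obtain ⟨e, he, rfl⟩ := (PMF.mem_support_map_iff _ _ _).1 hz
    exact enab_pcL (hp.2 e he)
  have h1 := Weak.of_pEnab h
  rw [PMF.map_comp] at h1
  have h2 : p.map (add (pcL α x : (pchoice α E F).Config) ∘ Sum.inl) =
      p.map fun e => pcL α (add x e) := map_congr_support fun e he => add_pcL (hp.2 e he)
  rwa [h2] at h1

theorem weak_pcR (hF : F.Good) {x : F.Config} (hx : x.1.Nonempty) {p : PMF F.Ev}
    (hp : F.PEnab x.1 p) :
    (pchoice α E F).Weak (PMF.pure (pcR α x)) (p.map fun e => pcR α (add x e)) := by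
  have h : (pchoice α E F).PEnab (pcR α x : (pchoice α E F).Config).1 (p.map Sum.inr) := by
    refine ⟨mem_pchoice_dist.2 (Or.inr (Or.inr ⟨p, hp.1, rfl,
      hF.not_support_subset_init hx hp⟩)), fun z hz => ?_⟩
    obtain ⟨e, he, rfl⟩ := (PMF.mem_support_map_iff _ _ _).1 hz
    exact enab_pcR (hp.2 e he)
  have h1 := Weak.of_pEnab h
  rw [PMF.map_comp] at h1
  have h2 : p.map (add (pcR α x : (pchoice α E F).Config) ∘ Sum.inr) =
      p.map fun e => pcR α (add x e) := map_congr_support fun e he => add_pcR (hp.2 e he)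
  rwa [h2] at h1

/-- If both components have been entered, `pcMix` is a genuine mixture and its two parts move
separately. If neither has, it is the point distribution at `∅` and the mixed distribution tosses
the coin. The hypothesis `hxy` excludes the hybrid case, in which no single step would do. -/
theorem weak_pcMix (hE : E.Good) (hF : F.Good) {x : E.Config} {y : F.Config}
    (hxy : x.1.Nonempty ↔ y.1.Nonempty) {p : PMF E.Ev} {q : PMF F.Ev} (hp : E.PEnab x.1 p)
    (hq : F.PEnab y.1 q) :
    (pchoice α E F).Weak (pcMix α x y) ((coin α).bind fun b =>
      cond b (q.map fun e => pcR α (add y e)) (p.map fun e => pcL α (add x e))) := by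
  by_cases hx : x.1.Nonempty
  · refine Weak.bind_pure (hE.pchoice α hF).finDist (finSupp_coin α) fun b _ => ?_
    cases b
    · exact weak_pcL hE hx hp
    · exact weak_pcR hF (hxy.1 hx) hq
  · obtain rfl := eq_emptyConfig hx
    obtain rfl := eq_emptyConfig fun hy => hx (hxy.2 hy)
    have h : (pchoice α E F).PEnab (pchoice α E F).emptyConfig.1
        ((coin α).bind fun b => cond b (q.map Sum.inr) (p.map Sum.inl)) := by
      refine ⟨mem_pchoice_dist.2 (Or.inl ⟨p, hp.1, q, hq.1, fun e he => (hp.2 e he).mem_init,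
        fun e he => (hq.2 e he).mem_init, rfl⟩), fun z hz => ?_⟩
      obtain ⟨b, -, hb⟩ := (PMF.mem_support_bind_iff _ _ _).1 hz
      cases b
      · obtain ⟨e, he, rfl⟩ := (PMF.mem_support_map_iff _ _ _).1 hb
        rw [← pcL_empty]
        exact enab_pcL (hp.2 e he)
      · obtain ⟨e, he, rfl⟩ := (PMF.mem_support_map_iff _ _ _).1 hb
        rw [← pcR_empty]
        exact enab_pcR (hq.2 e he)
    have h1 := Weak.of_pEnab h
    rw [PMF.map_bind] at h1
    rw [pcMix_empty]
    convert h1 using 1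
    refine bind_congr_support fun b _ => ?_
    cases b <;> simp only [cond_true, cond_false, PMF.map_comp]
    · refine map_congr_support fun e he => ?_
      rw [Function.comp, ← pcL_empty]
      exact (add_pcL (hp.2 e he)).symm
    · refine map_congr_support fun e he => ?_
      rw [Function.comp, ← pcR_empty]
      exact (add_pcR (hq.2 e he)).symm

/-- A mixture cannot be dismissed at once, because the coin may be degenerate. Events of `F` are not
enabled at `x`, so a mixture that can be executed has no weight on `F` and equals its first part. -/
theorem pEnab_pcL {x : E.Config} (hx : x.1.Nonempty) {p : PMF (pchoice α E F).Ev}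
    (hp : (pchoice α E F).PEnab (pcL α x : (pchoice α E F).Config).1 p) :
    ∃ q, E.PEnab x.1 q ∧ p = q.map Sum.inl := by
  have hn : ∀ e, ¬ (BES.plus E.toBES F.toBES).Enab (BES.sumSet x.1 ∅) (.inr e) := by
    intro e he
    obtain ⟨-, h⟩ := enab_plus_inr_config (BES.isConfig_plus_inl x.2) he
    rw [BES.inl_preimage_sumSet] at h
    exact hx.ne_empty h
  obtain ⟨q, hq, h1⟩ : ∃ q ∈ E.dist, p = q.map Sum.inl := by
    obtain ⟨h, h'⟩ := hp
    rcases mem_pchoice_dist.1 h with ⟨p₁, h1, q₁, h2, h3, h4, rfl⟩ | ⟨q, hq, rfl, -⟩ | ⟨q, hq, rfl, -⟩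
    · refine ⟨p₁, h1, ?_⟩
      obtain ⟨e, he⟩ := q₁.support_nonempty
      have ht : true ∉ (coin α).support := fun ht => hn e (h' _
        ((PMF.mem_support_bind_iff _ _ _).2 ⟨true, ht, (PMF.mem_support_map_iff _ _ _).2
          ⟨e, he, rfl⟩⟩))
      refine bind_eq_of_support fun b hb => ?_
      cases b
      · rfl
      · exact (ht hb).elim
    · exact ⟨q, hq, rfl⟩
    · obtain ⟨e, he⟩ := q.support_nonempty
      exact (hn e (h' _ ((PMF.mem_support_map_iff _ _ _).2 ⟨e, he, rfl⟩))).elim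
  subst h1
  refine ⟨q, ⟨hq, fun e he => ?_⟩, rfl⟩
  have h1 := (enab_plus_inl_config (BES.isConfig_plus_inl x.2) (hp.enab_map he)).1
  change E.Enab (Sum.inl ⁻¹' (BES.sumSet x.1 ∅)) e at h1
  rwa [BES.inl_preimage_sumSet] at h1

theorem pEnab_pcR {x : F.Config} (hx : x.1.Nonempty) {p : PMF (pchoice α E F).Ev}
    (hp : (pchoice α E F).PEnab (pcR α x : (pchoice α E F).Config).1 p) :
    ∃ q, F.PEnab x.1 q ∧ p = q.map Sum.inr := by
  have hn : ∀ e, ¬ (BES.plus E.toBES F.toBES).Enab (BES.sumSet ∅ x.1) (.inl e) := by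
    intro e he
    obtain ⟨-, h⟩ := enab_plus_inl_config (BES.isConfig_plus_inr x.2) he
    rw [BES.inr_preimage_sumSet] at h
    exact hx.ne_empty h
  obtain ⟨q, hq, h1⟩ : ∃ q ∈ F.dist, p = q.map Sum.inr := by
    obtain ⟨h, h'⟩ := hp
    rcases mem_pchoice_dist.1 h with ⟨p₁, h1, q₁, h2, h3, h4, rfl⟩ | ⟨q, hq, rfl, -⟩ | ⟨q, hq, rfl, -⟩
    · refine ⟨q₁, h2, ?_⟩
      obtain ⟨e, he⟩ := p₁.support_nonempty
      have ht : false ∉ (coin α).support := fun ht => hn e (h' _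
        ((PMF.mem_support_bind_iff _ _ _).2 ⟨false, ht, (PMF.mem_support_map_iff _ _ _).2
          ⟨e, he, rfl⟩⟩))
      refine bind_eq_of_support fun b hb => ?_
      cases b
      · exact (ht hb).elim
      · rfl
    · obtain ⟨e, he⟩ := q.support_nonempty
      exact (hn e (h' _ ((PMF.mem_support_map_iff _ _ _).2 ⟨e, he, rfl⟩))).elim
    · exact ⟨q, hq, rfl⟩
  subst h1
  refine ⟨q, ⟨hq, fun e he => ?_⟩, rfl⟩
  have h1 := (enab_plus_inr_config (BES.isConfig_plus_inr x.2) (hp.enab_map he)).1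
  change F.Enab (Sum.inr ⁻¹' (BES.sumSet ∅ x.1)) e at h1
  rwa [BES.inr_preimage_sumSet] at h1

theorem pEnab_pchoice_empty {p : PMF (pchoice α E F).Ev}
    (hp : (pchoice α E F).PEnab (pchoice α E F).emptyConfig.1 p) :
    ∃ p₁ q₁, E.PEnab E.emptyConfig.1 p₁ ∧ F.PEnab F.emptyConfig.1 q₁ ∧
      p = (coin α).bind fun b => cond b (q₁.map Sum.inr) (p₁.map Sum.inl) := by
  obtain ⟨h, h'⟩ := hp
  rcases mem_pchoice_dist.1 h with ⟨p₁, h1, q₁, h2, h3, h4, rfl⟩ | ⟨q, hq, rfl, hn⟩ | ⟨q, hq, rfl, hn⟩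
  · exact ⟨p₁, q₁, ⟨h1, fun e he => BES.enab_empty_iff.2 (h3 he)⟩,
      ⟨h2, fun e he => BES.enab_empty_iff.2 (h4 he)⟩, rfl⟩
  · refine (hn fun e he => ?_).elim
    exact BES.inl_mem_init_plus.1 (h' _ ((PMF.mem_support_map_iff _ _ _).2 ⟨e, he, rfl⟩)).mem_init
  · refine (hn fun e he => ?_).elim
    exact BES.inr_mem_init_plus.1 (h' _ ((PMF.mem_support_map_iff _ _ _).2 ⟨e, he, rfl⟩)).mem_init

theorem implements_pcL (x : E.Config) : BES.Implements E.toBES (pchoice α E F).toBES x.1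
    (pcL α x : (pchoice α E F).Config).1 := by
  have h := implements_image (X := E) (Y := pchoice α E F) (j := Sum.inl)
    (fun _ _ _ he => enab_inl_image he) (fun _ => rfl) x.2
  have h1 : Sum.inl '' x.1 = (pcL α x : (pchoice α E F).Config).1 := by
    change _ = BES.sumSet x.1 ∅
    ext (a | a) <;> simp
  rwa [h1] at h

theorem implements_pcR (x : F.Config) : BES.Implements F.toBES (pchoice α E F).toBES x.1
    (pcR α x : (pchoice α E F).Config).1 := by
  have h := implements_image (X := F) (Y := pchoice α E F) (j := Sum.inr)
    (fun _ _ _ he => enab_inr_image he) (fun _ => rfl) x.2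
  have h1 : Sum.inr '' x.1 = (pcR α x : (pchoice α E F).Config).1 := by
    change _ = BES.sumSet ∅ x.1
    ext (a | a) <;> simp
  rwa [h1] at h

theorem final_pcL {x : E.Config} :
    ((pcL α x : (pchoice α E F).Config).1 ∩ (pchoice α E F).final).Nonempty ↔
      (x.1 ∩ E.final).Nonempty := by
  refine final_inter_plus.trans ?_
  change (Sum.inl ⁻¹' (BES.sumSet x.1 ∅) ∩ E.final).Nonempty ∨
    (Sum.inr ⁻¹' (BES.sumSet x.1 ∅) ∩ F.final).Nonempty ↔ _
  rw [BES.inl_preimage_sumSet, BES.inr_preimage_sumSet, Set.empty_inter]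
  exact or_iff_left Set.not_nonempty_empty

theorem final_pcR {x : F.Config} :
    ((pcR α x : (pchoice α E F).Config).1 ∩ (pchoice α E F).final).Nonempty ↔
      (x.1 ∩ F.final).Nonempty := by
  refine final_inter_plus.trans ?_
  change (Sum.inl ⁻¹' (BES.sumSet ∅ x.1) ∩ E.final).Nonempty ∨
    (Sum.inr ⁻¹' (BES.sumSet ∅ x.1) ∩ F.final).Nonempty ↔ _
  rw [BES.inl_preimage_sumSet, BES.inr_preimage_sumSet, Set.empty_inter]
  exact or_iff_right Set.not_nonempty_empty

end

theorem coin_bind_map_comm {A B : Type} (α : unitInterval) (q : PMF A) (f g : A → B) :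
    ((coin α).bind fun b => cond b (q.map f) (q.map g)) =
      q.bind fun a => (coin α).map fun b => cond b (f a) (g a) := by
  have h : ((coin α).bind fun b => cond b (q.map f) (q.map g)) =
      (coin α).bind fun b => q.bind fun a => PMF.pure (cond b (f a) (g a)) :=
    bind_congr_support fun b _ => by cases b <;> rfl
  rw [h, PMF.bind_comm]
  rfl

/-- A configuration is answered by the random choice between its two copies. The same distribution
is executed in both, and the coin commutes with the draw of the event. -/
theorem le_pc {E : PES Act} (hE : E.Good) (α : unitInterval) : E.Sim (pchoice α E E) := by
  refine sim_of hE.finDist (fun x Θ => Θ = pcMix α x x) pcMix_empty.symm ?_ ?_ ?_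
  · rintro x _ rfl y hy
    rcases mem_support_pcMix hy with rfl | rfl
    · exact implements_pcL x
    · exact implements_pcR x
  · rintro x _ rfl p hp
    refine ⟨fun e => pcMix α (add x e) (add x e), fun e _ => rfl, ?_⟩
    have h := weak_pcMix (α := α) hE hE Iff.rfl hp hp
    rwa [coin_bind_map_comm] at h
  · rintro x _ rfl hx y hy
    rcases mem_support_pcMix hy with rfl | rfl
    · exact final_pcL.2 hx
    · exact final_pcR.2 hx

/-- The two copies are folded onto one. This is injective on configurations, as each lives in one
copy, but it turns a mixture of `p₁` and `q₁` into something that need not be a distribution of `E`.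
-/
theorem pc_le {E : PES Act} (hE : E.Good) (α : unitInterval) : (pchoice α E E).Sim E := by
  have hj : ∀ z : Set (E.Ev ⊕ E.Ev), Sum.elim id id '' z = Sum.inl ⁻¹' z ∪ Sum.inr ⁻¹' z := by
    intro z
    ext a
    constructor
    · rintro ⟨b | b, hb, rfl⟩
      · exact Or.inl hb
      · exact Or.inr hb
    · rintro (h | h)
      · exact ⟨_, h, rfl⟩
      · exact ⟨_, h, rfl⟩
  have hen : ∀ z, (pchoice α E E).IsConfig z → ∀ e, (pchoice α E E).Enab z e →
      E.Enab (Sum.elim id id '' z) (Sum.elim id id e) := by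
    rintro z hz (e | e) he
    · obtain ⟨h1, h2⟩ := enab_plus_inl_config hz he
      rw [hj, h2, Set.union_empty]
      exact h1
    · obtain ⟨h1, h2⟩ := enab_plus_inr_config hz he
      rw [hj, h2, Set.empty_union]
      exact h1
  refine sim_of_map (hE.pchoice α hE).finDist (Sum.elim id id) hen (by rintro (e | e) <;> rfl) ?_ ?_
  · rintro _ (⟨e, he, rfl⟩ | ⟨e, he, rfl⟩) <;> exact he
  · intro x y hy p hp
    have key : ∀ q ∈ E.dist, ∀ i : E.Ev → E.Ev ⊕ E.Ev, (∀ e, Sum.elim id id (i e) = e) →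
        (∀ e ∈ q.support, (pchoice α E E).Enab x.1 (i e)) →
        E.Weak (PMF.pure y) (q.map fun e => add y e) := by
      intro q hq i hi h
      refine Weak.of_pEnab ⟨hq, fun e he => ?_⟩
      have h1 := hen x.1 x.2 _ (h e he)
      rwa [hi, ← hy] at h1
    rcases mem_pchoice_dist.1 hp.1 with ⟨p₁, h1, q₁, h2, h3, h4, rfl⟩ | ⟨q, hq, rfl, hn⟩ |
      ⟨q, hq, rfl, hn⟩
    · rw [PMF.map_bind]
      -- Nothing in `E` corresponds to the coin, so the point distribution at `y` is split into two
      -- parts, which move by `p₁` and by `q₁`.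
      have h5 : PMF.pure y = (coin α).map fun _ => y := (PMF.map_const _ _).symm
      rw [h5]
      refine Weak.bind_pure hE.finDist (finSupp_coin α) fun b hb => ?_
      have h6 : ∀ z ∈ (cond b (q₁.map Sum.inr) (p₁.map Sum.inl)).support,
          (pchoice α E E).Enab x.1 z := fun z hz =>
        hp.2 z ((PMF.mem_support_bind_iff _ _ _).2 ⟨b, hb, hz⟩)
      cases b
      · rw [cond_false, PMF.map_comp]
        exact key p₁ h1 Sum.inl (fun _ => rfl) fun e he =>
          h6 _ ((PMF.mem_support_map_iff _ _ _).2 ⟨e, he, rfl⟩)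
      · rw [cond_true, PMF.map_comp]
        exact key q₁ h2 Sum.inr (fun _ => rfl) fun e he =>
          h6 _ ((PMF.mem_support_map_iff _ _ _).2 ⟨e, he, rfl⟩)
    · rw [PMF.map_comp]
      exact key q hq Sum.inl (fun _ => rfl) fun e he => hp.enab_map he
    · rw [PMF.map_comp]
      exact key q hq Sum.inr (fun _ => rfl) fun e he => hp.enab_map he

end PES
end PBES

namespace PBES

namespace PES

variable {Act : Type u}

/-! ### Probabilistic choice below sequential and concurrent composition -/

theorem seqCfg_nonempty {E F : PES Act} {x : E.Config} :
    (seqCfg x F.emptyConfig).1.Nonempty ↔ x.1.Nonempty := by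
  rw [seqCfg_empty_val, BES.sumSet, Set.image_empty, Set.union_empty, Set.image_nonempty]

theorem seqCfg_nonempty_of_right {E F : PES Act} {x : E.Config} {y : F.Config}
    (h : (x.1 ∩ E.final).Nonempty) : (seqCfg x y).1.Nonempty := by
  rw [seqCfg_val fun _ => h]
  obtain ⟨e, he⟩ := h
  exact ⟨.inl e, BES.inl_mem_sumSet.2 he.1⟩

theorem parCfg_nonempty {E F : PES Act} {x : E.Config} {y : F.Config} :
    (parCfg x y).1.Nonempty := ⟨.start, trivial⟩

theorem add_nonempty {E : PES Act} {x : E.Config} {e : E.Ev} (h : E.Enab x.1 e) :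
    (add x e).1.Nonempty := by
  rw [add_val h]
  exact Set.insert_nonempty _ _

theorem pEnab_seqCfg_inl {E F : PES Act} {x : E.Config} {p : PMF E.Ev} (hp : E.PEnab x.1 p) :
    (seq E F).PEnab (seqCfg x F.emptyConfig).1 (p.map Sum.inl) := by
  refine ⟨Or.inl ⟨p, hp.1, rfl⟩, fun z hz => ?_⟩
  obtain ⟨e, he, rfl⟩ := (PMF.mem_support_map_iff _ _ _).1 hz
  exact (enab_seqCfg_inl fun h => (Set.not_nonempty_empty h).elim).2 (hp.2 e he)

theorem pEnab_seqCfg_inr {E F : PES Act} {x : E.Config} {y : F.Config}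
    (hx : (x.1 ∩ E.final).Nonempty) {p : PMF F.Ev} (hp : F.PEnab y.1 p) :
    (seq E F).PEnab (seqCfg x y).1 (p.map Sum.inr) := by
  refine ⟨Or.inr ⟨p, hp.1, rfl⟩, fun z hz => ?_⟩
  obtain ⟨e, he, rfl⟩ := (PMF.mem_support_map_iff _ _ _).1 hz
  exact (enab_seqCfg_inr fun _ => hx).2 ⟨hp.2 e he, hx⟩

theorem pEnab_parCfg_left {E F : PES Act} {x : E.Config} {y : F.Config} {p : PMF E.Ev}
    (hp : E.PEnab x.1 p) : (par E F).PEnab (parCfg x y).1 (p.map .left) := by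
  refine ⟨Or.inl (Or.inl ⟨p, hp.1, rfl⟩), fun z hz => ?_⟩
  obtain ⟨e, he, rfl⟩ := (PMF.mem_support_map_iff _ _ _).1 hz
  exact enab_parCfg_left.2 (hp.2 e he)

theorem pEnab_parCfg_right {E F : PES Act} {x : E.Config} {y : F.Config} {p : PMF F.Ev}
    (hp : F.PEnab y.1 p) : (par E F).PEnab (parCfg x y).1 (p.map .right) := by
  refine ⟨Or.inl (Or.inr ⟨p, hp.1, rfl⟩), fun z hz => ?_⟩
  obtain ⟨e, he, rfl⟩ := (PMF.mem_support_map_iff _ _ _).1 hz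
  exact enab_parCfg_right.2 (hp.2 e he)

theorem pEnab_start {E F : PES Act} :
    (par E F).PEnab (par E F).emptyConfig.1 (PMF.pure .start) :=
  pEnab_pure start_mem_dist enab_empty_start

theorem pEnab_finish {E F : PES Act} {x : E.Config} {y : F.Config}
    (h : (x.1 ∩ E.final).Nonempty) (h' : (y.1 ∩ F.final).Nonempty) :
    (par E F).PEnab (parCfg x y).1 (PMF.pure .finish) :=
  pEnab_pure finish_mem_dist (enab_parCfg_finish.2 ⟨h, h'⟩)

/-- A relation that holds for the two components of a random choice extends to the events of the
choice. -/
theorem exists_pchoice_kernel {F G : PES Act} {α : unitInterval} {Z : Type}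
    {U : F.Ev ⊕ G.Ev → Z → Prop} {p₁ : PMF F.Ev} {q₁ : PMF G.Ev} {f : F.Ev → Z} {g : G.Ev → Z}
    (hf : ∀ e, ((.inl e : F.Ev ⊕ G.Ev) ∈
      ((coin α).bind fun b => cond b (q₁.map Sum.inr) (p₁.map Sum.inl)).support) → U (.inl e) (f e))
    (hg : ∀ e, ((.inr e : F.Ev ⊕ G.Ev) ∈
      ((coin α).bind fun b => cond b (q₁.map Sum.inr) (p₁.map Sum.inl)).support) → U (.inr e) (g e)) :
    ∃ k : F.Ev ⊕ G.Ev → PMF Z,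
      (∀ a ∈ ((coin α).bind fun b => cond b (q₁.map Sum.inr) (p₁.map Sum.inl)).support,
        ∃ z, k a = PMF.pure z ∧ U a z) ∧
      ((coin α).bind fun b => cond b (q₁.map Sum.inr) (p₁.map Sum.inl)).bind k =
        (coin α).bind fun b => cond b (q₁.map g) (p₁.map f) := by
  refine ⟨Sum.elim (fun e => PMF.pure (f e)) fun e => PMF.pure (g e), ?_, ?_⟩
  · rintro (e | e) he
    · exact ⟨_, rfl, hf e he⟩
    · exact ⟨_, rfl, hg e he⟩
  · rw [PMF.bind_bind]
    refine bind_congr_support fun b _ => ?_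
    cases b
    · rw [cond_false, cond_false, PMF.bind_map]
      rfl
    · rw [cond_true, cond_true, PMF.bind_map]
      rfl

/-- The right-hand side tosses its coin with the first event of `E`, the left-hand side only when
`E` has terminated. As long as the left is undecided, it is answered by the mixture of both
outcomes, each with a copy of `x`; afterwards by the outcome that agrees with it. -/
theorem seq_pc_le {E F G : PES Act} (hE : E.Good) (hF : F.Good) (hG : G.Good)
    (α : unitInterval) : (seq E (pchoice α F G)).Sim (pchoice α (seq E F) (seq E G)) := by
  have hEF := hE.seq hF
  have hEG := hE.seq hG
  let U : (seq E (pchoice α F G)).Config → PMF (pchoice α (seq E F) (seq E G)).Config → Prop :=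
    fun z Θ =>
    (∃ x : E.Config, z = seqCfg x (pchoice α F G).emptyConfig ∧
      Θ = pcMix α (seqCfg x F.emptyConfig) (seqCfg x G.emptyConfig)) ∨
    (∃ (x : E.Config) (y : F.Config), (x.1 ∩ E.final).Nonempty ∧ y.1.Nonempty ∧
      z = seqCfg x (pcL α y) ∧ Θ = PMF.pure (pcL α (seqCfg x y))) ∨
    (∃ (x : E.Config) (y : G.Config), (x.1 ∩ E.final).Nonempty ∧ y.1.Nonempty ∧
      z = seqCfg x (pcR α y) ∧ Θ = PMF.pure (pcR α (seqCfg x y)))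
  have hne : ∀ {X Y : PES Act} {x : X.Config},
      Y.emptyConfig.1.Nonempty → (x.1 ∩ X.final).Nonempty :=
    fun h => (Set.not_nonempty_empty h).elim
  have iL : ∀ (x : E.Config) (y : F.Config), (y.1.Nonempty → (x.1 ∩ E.final).Nonempty) →
      BES.Implements (seq E (pchoice α F G)).toBES (pchoice α (seq E F) (seq E G)).toBES
        (seqCfg x (pcL α y : (pchoice α F G).Config)).1
        (pcL α (seqCfg x y) : (pchoice α (seq E F) (seq E G)).Config).1 := by
    intro x y h
    refine BES.Implements.trans (implements_seqCfg hE (fun h' => h ?_) h (BES.Implements.refl _ _)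
      (implements_inl F.toBES G.toBES y.2)) (implements_pcL (seqCfg x y))
    by_contra hy
    obtain rfl := eq_emptyConfig hy
    rw [pcL_empty] at h'
    exact Set.not_nonempty_empty h'
  have iR : ∀ (x : E.Config) (y : G.Config), (y.1.Nonempty → (x.1 ∩ E.final).Nonempty) →
      BES.Implements (seq E (pchoice α F G)).toBES (pchoice α (seq E F) (seq E G)).toBES
        (seqCfg x (pcR α y : (pchoice α F G).Config)).1
        (pcR α (seqCfg x y) : (pchoice α (seq E F) (seq E G)).Config).1 := by
    intro x y h
    refine BES.Implements.trans (implements_seqCfg hE (fun h' => h ?_) h (BES.Implements.refl _ _)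
      (implements_inr F.toBES G.toBES y.2)) (implements_pcR (seqCfg x y))
    by_contra hy
    obtain rfl := eq_emptyConfig hy
    rw [pcR_empty] at h'
    exact Set.not_nonempty_empty h'
  refine sim_of (hE.seq (hF.pchoice α hG)).finDist U
    (Or.inl ⟨E.emptyConfig, seqCfg_empty.symm, ?_⟩) ?_ ?_ ?_
  · rw [seqCfg_empty, seqCfg_empty, pcMix_empty]
  · rintro z _ (⟨x, rfl, rfl⟩ | ⟨x, y, hx, hy, rfl, rfl⟩ | ⟨x, y, hx, hy, rfl, rfl⟩) w hw
    · rcases mem_support_pcMix hw with rfl | rfl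
      · rw [← pcL_empty]
        exact iL x _ hne
      · rw [← pcR_empty]
        exact iR x _ hne
    · rw [PMF.mem_support_pure_iff] at hw
      subst hw
      exact iL x y fun _ => hx
    · rw [PMF.mem_support_pure_iff] at hw
      subst hw
      exact iR x y fun _ => hx
  · rintro z _ (⟨x, rfl, rfl⟩ | ⟨x, y, hx, hy, rfl, rfl⟩ | ⟨x, y, hx, hy, rfl, rfl⟩) p hp
    · rcases pEnab_seqCfg hE hne hp with ⟨q, hq, rfl, -⟩ | ⟨q, hq, rfl, hx⟩
      · refine exists_kernel (U := U) .inl Sum.inl_injective q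
          (fun e => pcMix α (seqCfg (add x e) F.emptyConfig) (seqCfg (add x e) G.emptyConfig))
          (fun e he => Or.inl ⟨add x e, add_seqCfg_inl (hq.2 e he), rfl⟩) ?_
        have h := weak_pcMix (α := α) hEF hEG (seqCfg_nonempty.trans seqCfg_nonempty.symm)
          (pEnab_seqCfg_inl hq) (pEnab_seqCfg_inl hq)
        rw [PMF.map_comp, PMF.map_comp, coin_bind_map_comm] at h
        convert h using 1
        refine bind_congr_support fun e he => ?_
        simp only [Function.comp, add_seqCfg_inl (hq.2 e he)]
        rfl
      -- The left-hand side tosses its coin now. The two parts of the mixture on the right carry the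
      -- same weights already and move by `p₁` and by `q₁`.
      · obtain ⟨p₁, q₁, hp₁, hq₁, rfl⟩ := pEnab_pchoice_empty hq
        have hl := fun e he => (enab_plus_inl_config (e := e)
          (pchoice α F G).emptyConfig.2 (hq.2 _ he)).1
        have hr := fun e he => (enab_plus_inr_config (e := e)
          (pchoice α F G).emptyConfig.2 (hq.2 _ he)).1
        obtain ⟨k, hk, hb⟩ := exists_pchoice_kernel (α := α) (p₁ := p₁) (q₁ := q₁)
          (U := fun a w => U (add (seqCfg x (pchoice α F G).emptyConfig) (.inr a)) (PMF.pure w))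
          (f := fun e => pcL α (seqCfg x (add F.emptyConfig e)))
          (g := fun e => pcR α (seqCfg x (add G.emptyConfig e)))
          (fun e he => Or.inr (Or.inl ⟨x, add F.emptyConfig e, hx, add_nonempty (hl e he), by
            rw [add_seqCfg_inr hx (hq.2 _ he), ← pcL_empty, add_pcL (hl e he)], rfl⟩))
          (fun e he => Or.inr (Or.inr ⟨x, add G.emptyConfig e, hx, add_nonempty (hr e he), by
            rw [add_seqCfg_inr hx (hq.2 _ he), ← pcR_empty, add_pcR (hr e he)], rfl⟩))
        refine exists_kernel (U := U) .inr Sum.inr_injective _ k (fun a ha => ?_) ?_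
        · obtain ⟨w, hw, hU⟩ := hk a ha
          rw [hw]
          exact hU
        · rw [hb]
          have h := weak_pcMix (α := α) hEF hEG (seqCfg_nonempty.trans seqCfg_nonempty.symm)
            (pEnab_seqCfg_inr hx hp₁) (pEnab_seqCfg_inr hx hq₁)
          rw [PMF.map_comp, PMF.map_comp] at h
          convert h using 1
          refine bind_congr_support fun b _ => ?_
          cases b
          · exact map_congr_support fun e he => by
              simp only [Function.comp, add_seqCfg_inr hx (hp₁.2 e he)]
          · exact map_congr_support fun e he => by
              simp only [Function.comp, add_seqCfg_inr hx (hq₁.2 e he)]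
    · rcases pEnab_seqCfg hE (fun _ => hx) hp with ⟨q, hq, rfl, h⟩ | ⟨q, hq, rfl, -⟩
      · exact (pcL_ne_empty hy h).elim
      · obtain ⟨r, hr, rfl⟩ := pEnab_pcL hy hq
        rw [PMF.map_comp]
        refine exists_kernel (U := U) (Sum.inr ∘ Sum.inl)
          (Sum.inr_injective.comp Sum.inl_injective) r
          (fun e => PMF.pure (pcL α (seqCfg x (add y e)))) (fun e he => ?_) ?_
        · refine Or.inr (Or.inl ⟨x, add y e, hx, add_nonempty (hr.2 e he), ?_, rfl⟩)
          rw [Function.comp, add_seqCfg_inr hx (enab_pcL (hr.2 e he)), add_pcL (hr.2 e he)]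
        · have h := weak_pcL (α := α) (F := seq E G) hEF (seqCfg_nonempty_of_right hx)
            (pEnab_seqCfg_inr hx hr)
          rw [PMF.map_comp] at h
          convert h using 1
          exact map_congr_support fun e he => by
            simp only [Function.comp, add_seqCfg_inr hx (hr.2 e he)]
    · rcases pEnab_seqCfg hE (fun _ => hx) hp with ⟨q, hq, rfl, h⟩ | ⟨q, hq, rfl, -⟩
      · exact (pcR_ne_empty hy h).elim
      · obtain ⟨r, hr, rfl⟩ := pEnab_pcR hy hq
        rw [PMF.map_comp]
        refine exists_kernel (U := U) (Sum.inr ∘ Sum.inr)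
          (Sum.inr_injective.comp Sum.inr_injective) r
          (fun e => PMF.pure (pcR α (seqCfg x (add y e)))) (fun e he => ?_) ?_
        · refine Or.inr (Or.inr ⟨x, add y e, hx, add_nonempty (hr.2 e he), ?_, rfl⟩)
          rw [Function.comp, add_seqCfg_inr hx (enab_pcR (hr.2 e he)), add_pcR (hr.2 e he)]
        · have h := weak_pcR (α := α) (E := seq E F) hEG (seqCfg_nonempty_of_right hx)
            (pEnab_seqCfg_inr hx hr)
          rw [PMF.map_comp] at h
          convert h using 1
          exact map_congr_support fun e he => by
            simp only [Function.comp, add_seqCfg_inr hx (hr.2 e he)]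
  · rintro z _ (⟨x, rfl, rfl⟩ | ⟨x, y, hx, hy, rfl, rfl⟩ | ⟨x, y, hx, hy, rfl, rfl⟩) hz w hw
    · exact (not_final_empty ((final_seqCfg hne).1 hz)).elim
    · rw [PMF.mem_support_pure_iff] at hw
      subst hw
      exact final_pcL.2 ((final_seqCfg fun _ => hx).2
        (final_pcL.1 ((final_seqCfg fun _ => hx).1 hz)))
    · rw [PMF.mem_support_pure_iff] at hw
      subst hw
      exact final_pcR.2 ((final_seqCfg fun _ => hx).2
        (final_pcR.1 ((final_seqCfg fun _ => hx).1 hz)))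

/-- As in `seq_pc_le`, with the coin on the right tossed by `start`. While `F` and `G` are
untouched, steps of `E` are made in both parts of the mixture. -/
theorem par_pc_le {E F G : PES Act} (hE : E.Good) (hF : F.Good) (hG : G.Good)
    (α : unitInterval) : (par E (pchoice α F G)).Sim (pchoice α (par E F) (par E G)) := by
  have hEF := hE.par hF
  have hEG := hE.par hG
  have hFG := hF.pchoice α hG
  let U : (par E (pchoice α F G)).Config → PMF (pchoice α (par E F) (par E G)).Config → Prop :=
    fun z Θ =>
    (z = (par E (pchoice α F G)).emptyConfig ∧
      Θ = PMF.pure (pchoice α (par E F) (par E G)).emptyConfig) ∨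
    (∃ x : E.Config, z = parCfg x (pchoice α F G).emptyConfig ∧
      Θ = pcMix α (parCfg x F.emptyConfig) (parCfg x G.emptyConfig)) ∨
    (∃ (x : E.Config) (y : F.Config), y.1.Nonempty ∧
      z = parCfg x (pcL α y) ∧ Θ = PMF.pure (pcL α (parCfg x y))) ∨
    (∃ (x : E.Config) (y : G.Config), y.1.Nonempty ∧
      z = parCfg x (pcR α y) ∧ Θ = PMF.pure (pcR α (parCfg x y))) ∨
    (∃ (x : E.Config) (y : F.Config), (x.1 ∩ E.final).Nonempty ∧ (y.1 ∩ F.final).Nonempty ∧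
      z = parEnd x (pcL α y) ∧ Θ = PMF.pure (pcL α (parEnd x y))) ∨
    (∃ (x : E.Config) (y : G.Config), (x.1 ∩ E.final).Nonempty ∧ (y.1 ∩ G.final).Nonempty ∧
      z = parEnd x (pcR α y) ∧ Θ = PMF.pure (pcR α (parEnd x y)))
  have iL : ∀ (x : E.Config) (y : F.Config),
      BES.Implements (par E (pchoice α F G)).toBES (pchoice α (par E F) (par E G)).toBES
        (parCfg x (pcL α y : (pchoice α F G).Config)).1
        (pcL α (parCfg x y) : (pchoice α (par E F) (par E G)).Config).1 := fun x y =>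
    BES.Implements.trans (BES.implements_par (parCfg x (pcL α y : (pchoice α F G).Config)).2
      (parCfg x y).2 (BES.Implements.refl _ _) (implements_inl F.toBES G.toBES y.2))
      (implements_pcL (parCfg x y))
  have iR : ∀ (x : E.Config) (y : G.Config),
      BES.Implements (par E (pchoice α F G)).toBES (pchoice α (par E F) (par E G)).toBES
        (parCfg x (pcR α y : (pchoice α F G).Config)).1
        (pcR α (parCfg x y) : (pchoice α (par E F) (par E G)).Config).1 := fun x y =>
    BES.Implements.trans (BES.implements_par (parCfg x (pcR α y : (pchoice α F G).Config)).2
      (parCfg x y).2 (BES.Implements.refl _ _) (implements_inr F.toBES G.toBES y.2))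
      (implements_pcR (parCfg x y))
  refine sim_of (hE.par hFG).finDist U (Or.inl ⟨rfl, rfl⟩) ?_ ?_ ?_
  · rintro z _ (⟨rfl, rfl⟩ | ⟨x, rfl, rfl⟩ | ⟨x, y, hy, rfl, rfl⟩ | ⟨x, y, hy, rfl, rfl⟩ |
      ⟨x, y, hx, hy, rfl, rfl⟩ | ⟨x, y, hx, hy, rfl, rfl⟩) w hw
    · rw [PMF.mem_support_pure_iff] at hw
      subst hw
      exact implements_empty _ _
    · rcases mem_support_pcMix hw with rfl | rfl
      · rw [← pcL_empty]
        exact iL x _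
      · rw [← pcR_empty]
        exact iR x _
    · rw [PMF.mem_support_pure_iff] at hw
      subst hw
      exact iL x y
    · rw [PMF.mem_support_pure_iff] at hw
      subst hw
      exact iR x y
    · rw [PMF.mem_support_pure_iff] at hw
      subst hw
      refine BES.Implements.trans ?_ (implements_pcL (parEnd x y))
      have h1 := (parEnd x (pcL α y : (pchoice α F G).Config)).2
      have h2 := (parEnd x y).2
      rw [parEnd_val hx (final_pcL.2 hy)] at h1 ⊢
      rw [parEnd_val hx hy] at h2 ⊢
      exact BES.implements_par h1 h2 (BES.Implements.refl _ _)
        (implements_inl F.toBES G.toBES y.2)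
    · rw [PMF.mem_support_pure_iff] at hw
      subst hw
      refine BES.Implements.trans ?_ (implements_pcR (parEnd x y))
      have h1 := (parEnd x (pcR α y : (pchoice α F G).Config)).2
      have h2 := (parEnd x y).2
      rw [parEnd_val hx (final_pcR.2 hy)] at h1 ⊢
      rw [parEnd_val hx hy] at h2 ⊢
      exact BES.implements_par h1 h2 (BES.Implements.refl _ _)
        (implements_inr F.toBES G.toBES y.2)
  · have hnn : ∀ {x : E.Config}, (parCfg x F.emptyConfig).1.Nonempty ↔
        (parCfg x G.emptyConfig).1.Nonempty := iff_of_true parCfg_nonempty parCfg_nonempty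
    rintro z _ (⟨rfl, rfl⟩ | ⟨x, rfl, rfl⟩ | ⟨x, y, hy, rfl, rfl⟩ | ⟨x, y, hy, rfl, rfl⟩ |
      ⟨x, y, hx, hy, rfl, rfl⟩ | ⟨x, y, hx, hy, rfl, rfl⟩) p hp
    · obtain rfl := pEnab_par_empty hp
      refine ⟨fun _ => pcMix α (parCfg E.emptyConfig F.emptyConfig)
        (parCfg E.emptyConfig G.emptyConfig), fun e he => ?_, ?_⟩
      · rw [PMF.mem_support_pure_iff] at he
        subst he
        exact Or.inr (Or.inl ⟨_, add_empty_start, rfl⟩)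
      · rw [PMF.bind_const]
        -- Both alternatives begin with `start`, so the first distribution on the right is the
        -- mixture of the two.
        have h := weak_pcMix (α := α) hEF hEG (x := (par E F).emptyConfig)
          (y := (par E G).emptyConfig)
          (iff_of_false Set.not_nonempty_empty Set.not_nonempty_empty) pEnab_start pEnab_start
        rw [pcMix_empty, PMF.pure_map, PMF.pure_map, add_empty_start, add_empty_start] at h
        convert h using 1
        exact bind_congr_support fun b _ => by cases b <;> rfl
    · rcases pEnab_parCfg hp with ⟨q, hq, rfl⟩ | ⟨q, hq, rfl⟩ | ⟨-, hy, rfl⟩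
      · refine exists_kernel (U := U) .left left_injective q
          (fun e => pcMix α (parCfg (add x e) F.emptyConfig) (parCfg (add x e) G.emptyConfig))
          (fun e he => Or.inr (Or.inl ⟨add x e, add_parCfg_left (hq.2 e he), rfl⟩)) ?_
        have h := weak_pcMix (α := α) hEF hEG hnn (pEnab_parCfg_left hq) (pEnab_parCfg_left hq)
        rw [PMF.map_comp, PMF.map_comp, coin_bind_map_comm] at h
        convert h using 1
        refine bind_congr_support fun e he => ?_
        simp only [Function.comp, add_parCfg_left (hq.2 e he)]
        rfl
      · obtain ⟨p₁, q₁, hp₁, hq₁, rfl⟩ := pEnab_pchoice_empty hq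
        have hl := fun e he => (enab_plus_inl_config (e := e)
          (pchoice α F G).emptyConfig.2 (hq.2 _ he)).1
        have hr := fun e he => (enab_plus_inr_config (e := e)
          (pchoice α F G).emptyConfig.2 (hq.2 _ he)).1
        obtain ⟨k, hk, hb⟩ := exists_pchoice_kernel (α := α) (p₁ := p₁) (q₁ := q₁)
          (U := fun a w => U (add (parCfg x (pchoice α F G).emptyConfig) (.right a)) (PMF.pure w))
          (f := fun e => pcL α (parCfg x (add F.emptyConfig e)))
          (g := fun e => pcR α (parCfg x (add G.emptyConfig e)))
          (fun e he => Or.inr (Or.inr (Or.inl ⟨x, add F.emptyConfig e, add_nonempty (hl e he), by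
            rw [add_parCfg_right (hq.2 _ he), ← pcL_empty, add_pcL (hl e he)], rfl⟩)))
          (fun e he => Or.inr (Or.inr (Or.inr (Or.inl
            ⟨x, add G.emptyConfig e, add_nonempty (hr e he), by
            rw [add_parCfg_right (hq.2 _ he), ← pcR_empty, add_pcR (hr e he)], rfl⟩))))
        refine exists_kernel (U := U) .right right_injective _ k (fun a ha => ?_) ?_
        · obtain ⟨w, hw, hU⟩ := hk a ha
          rw [hw]
          exact hU
        · rw [hb]
          have h := weak_pcMix (α := α) hEF hEG hnn
            (pEnab_parCfg_right (x := x) hp₁) (pEnab_parCfg_right (x := x) hq₁)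
          rw [PMF.map_comp, PMF.map_comp] at h
          convert h using 1
          refine bind_congr_support fun b _ => ?_
          cases b
          · exact map_congr_support fun e he => by
              simp only [Function.comp, add_parCfg_right (hp₁.2 e he)]
          · exact map_congr_support fun e he => by
              simp only [Function.comp, add_parCfg_right (hq₁.2 e he)]
      · exact (not_final_empty hy).elim
    · rcases pEnab_parCfg hp with ⟨q, hq, rfl⟩ | ⟨q, hq, rfl⟩ | ⟨hx, hf, rfl⟩
      · refine exists_kernel (U := U) .left left_injective q
          (fun e => PMF.pure (pcL α (parCfg (add x e) y)))
          (fun e he => Or.inr (Or.inr (Or.inl ⟨add x e, y, hy, add_parCfg_left (hq.2 e he), rfl⟩))) ?_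
        have h := weak_pcL (α := α) (F := par E G) hEF parCfg_nonempty
          (pEnab_parCfg_left (y := y) hq)
        rw [PMF.map_comp] at h
        convert h using 1
        exact map_congr_support fun e he => by
          simp only [Function.comp, add_parCfg_left (hq.2 e he)]
      · obtain ⟨r, hr, rfl⟩ := pEnab_pcL hy hq
        rw [PMF.map_comp]
        refine exists_kernel (U := U) (BES.ParEv.right ∘ Sum.inl)
          (right_injective.comp Sum.inl_injective) r
          (fun e => PMF.pure (pcL α (parCfg x (add y e)))) (fun e he => ?_) ?_
        · refine Or.inr (Or.inr (Or.inl ⟨x, add y e, add_nonempty (hr.2 e he), ?_, rfl⟩))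
          rw [Function.comp, add_parCfg_right (enab_pcL (hr.2 e he)), add_pcL (hr.2 e he)]
        · have h := weak_pcL (α := α) (F := par E G) hEF parCfg_nonempty
            (pEnab_parCfg_right (x := x) hr)
          rw [PMF.map_comp] at h
          convert h using 1
          exact map_congr_support fun e he => by
            simp only [Function.comp, add_parCfg_right (hr.2 e he)]
      · have hy' := final_pcL.1 hf
        refine ⟨fun _ => PMF.pure (pcL α (parEnd x y)), fun e he => ?_, ?_⟩
        · rw [PMF.mem_support_pure_iff] at he
          subst he
          exact Or.inr (Or.inr (Or.inr (Or.inr (Or.inl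
            ⟨x, y, hx, hy', add_parCfg_finish hx hf, rfl⟩))))
        · rw [PMF.bind_const]
          have h := weak_pcL (α := α) (F := par E G) hEF parCfg_nonempty (pEnab_finish hx hy')
          rwa [PMF.pure_map, add_parCfg_finish hx hy'] at h
    · rcases pEnab_parCfg hp with ⟨q, hq, rfl⟩ | ⟨q, hq, rfl⟩ | ⟨hx, hf, rfl⟩
      · refine exists_kernel (U := U) .left left_injective q
          (fun e => PMF.pure (pcR α (parCfg (add x e) y)))
          (fun e he => Or.inr (Or.inr (Or.inr (Or.inl
            ⟨add x e, y, hy, add_parCfg_left (hq.2 e he), rfl⟩)))) ?_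
        have h := weak_pcR (α := α) (E := par E F) hEG parCfg_nonempty
          (pEnab_parCfg_left (y := y) hq)
        rw [PMF.map_comp] at h
        convert h using 1
        exact map_congr_support fun e he => by
          simp only [Function.comp, add_parCfg_left (hq.2 e he)]
      · obtain ⟨r, hr, rfl⟩ := pEnab_pcR hy hq
        rw [PMF.map_comp]
        refine exists_kernel (U := U) (BES.ParEv.right ∘ Sum.inr)
          (right_injective.comp Sum.inr_injective) r
          (fun e => PMF.pure (pcR α (parCfg x (add y e)))) (fun e he => ?_) ?_
        · refine Or.inr (Or.inr (Or.inr (Or.inl ⟨x, add y e, add_nonempty (hr.2 e he), ?_, rfl⟩)))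
          rw [Function.comp, add_parCfg_right (enab_pcR (hr.2 e he)), add_pcR (hr.2 e he)]
        · have h := weak_pcR (α := α) (E := par E F) hEG parCfg_nonempty
            (pEnab_parCfg_right (x := x) hr)
          rw [PMF.map_comp] at h
          convert h using 1
          exact map_congr_support fun e he => by
            simp only [Function.comp, add_parCfg_right (hr.2 e he)]
      · have hy' := final_pcR.1 hf
        refine ⟨fun _ => PMF.pure (pcR α (parEnd x y)), fun e he => ?_, ?_⟩
        · rw [PMF.mem_support_pure_iff] at he
          subst he
          exact Or.inr (Or.inr (Or.inr (Or.inr (Or.inr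
            ⟨x, y, hx, hy', add_parCfg_finish hx hf, rfl⟩))))
        · rw [PMF.bind_const]
          have h := weak_pcR (α := α) (E := par E F) hEG parCfg_nonempty (pEnab_finish hx hy')
          rwa [PMF.pure_map, add_parCfg_finish hx hy'] at h
    · exact (pEnab_parEnd hE hFG hx (final_pcL.2 hy) hp).elim
    · exact (pEnab_parEnd hE hFG hx (final_pcR.2 hy) hp).elim
  · rintro z _ (⟨rfl, rfl⟩ | ⟨x, rfl, rfl⟩ | ⟨x, y, hy, rfl, rfl⟩ | ⟨x, y, hy, rfl, rfl⟩ |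
      ⟨x, y, hx, hy, rfl, rfl⟩ | ⟨x, y, hx, hy, rfl, rfl⟩) hz w hw
    · exact (not_final_empty hz).elim
    · exact (not_final_parCfg hz).elim
    · exact (not_final_parCfg hz).elim
    · exact (not_final_parCfg hz).elim
    · rw [PMF.mem_support_pure_iff] at hw
      subst hw
      exact final_pcL.2 (final_parEnd hx hy)
    · rw [PMF.mem_support_pure_iff] at hw
      subst hw
      exact final_pcR.2 (final_parEnd hx hy)

end PES
end PBES

namespace PBES

namespace BES

variable {Act : Type u}

/-! ### Clusters -/

/-- A partition of the events into classes of alternatives. -/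
structure ClusterRel (E : BES Act) (r : E.Ev → E.Ev → Prop) : Prop where
  refl : ∀ e, r e e
  symm : ∀ {e e'}, r e e' → r e' e
  trans : ∀ {e e' e''}, r e e' → r e' e'' → r e e''
  conf : ∀ {e e'}, r e e' → e ≠ e' → E.conf e e'
  bundle : ∀ {e e' x}, r e e' → E.bundle x e → E.bundle x e'
  enab : ∀ {e e' x}, E.IsConfig x → r e e' → E.Enab x e → E.Enab x e'
  imm : ∀ {e e' x}, E.IsConfig x → E.Enab x e → E.Enab x e' → E.conf e e' → r e e'
  init : ∀ {e e'}, e ∈ E.init → e' ∈ E.init → r e e'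

namespace ClusterRel

variable {E F : BES Act} {r : E.Ev → E.Ev → Prop} {s : F.Ev → F.Ev → Prop}

theorem mem_init (h : E.ClusterRel r) {e e' : E.Ev} (hr : r e e') (he : e ∈ E.init) :
    e' ∈ E.init := fun x hx => he x (h.bundle (h.symm hr) hx)

theorem eq_empty (h : E.ClusterRel r) {x : Set E.Ev} (hx : E.IsConfig x) {e : E.Ev}
    (he : E.Enab x e) (hi : e ∈ E.init) : x = ∅ := by
  by_contra hne
  obtain ⟨a, ha, hai⟩ := hx.exists_init (Set.nonempty_iff_ne_empty.2 hne)
  exact he.2.1 a ha (h.conf (h.init hi hai) fun h => he.1 (h ▸ ha))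

theorem zero : (BES.zero : BES Act).ClusterRel fun _ _ => True where
  refl e := e.elim
  symm {e} := e.elim
  trans {e} := e.elim
  conf {e} := e.elim
  bundle {e} := e.elim
  enab {e} := e.elim
  imm {e} := e.elim
  init {e} := e.elim

theorem single (a : Option Act) : (BES.single a).ClusterRel fun _ _ => True where
  refl _ := trivial
  symm _ := trivial
  trans _ _ := trivial
  conf _ h := h rfl
  bundle _ h := h
  enab _ _ h := h
  imm _ _ _ _ := trivial
  init _ _ := trivial

/-- The clusters of a choice. -/
def plusRel (E F : BES Act) (r : E.Ev → E.Ev → Prop) (s : F.Ev → F.Ev → Prop) :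
    E.Ev ⊕ F.Ev → E.Ev ⊕ F.Ev → Prop
  | .inl a, .inl b => r a b
  | .inr a, .inr b => s a b
  | .inl a, .inr b => a ∈ E.init ∧ b ∈ F.init
  | .inr b, .inl a => a ∈ E.init ∧ b ∈ F.init

/-- The initial events of both components merge into a single class, and all other classes are kept.
The conflict between final events adds nothing: events of different components can only be enabled
together at `∅`, and then they are initial. -/
theorem plus (hE : E.ClusterRel r) (hF : F.ClusterRel s) :
    (BES.plus E F).ClusterRel (plusRel E F r s) where
  refl := by
    rintro (e | e)
    · exact hE.refl e
    · exact hF.refl e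
  symm := by
    rintro (a | a) (b | b) h
    · exact hE.symm h
    · exact h
    · exact h
    · exact hF.symm h
  trans := by
    rintro (a | a) (b | b) (c | c) h h'
    · exact hE.trans h h'
    · exact ⟨hE.mem_init (hE.symm h) h'.1, h'.2⟩
    · exact hE.init h.1 h'.1
    · exact ⟨h.1, hF.mem_init h' h.2⟩
    · exact ⟨hE.mem_init h' h.1, h.2⟩
    · exact hF.init h.2 h'.2
    · exact ⟨h'.1, hF.mem_init (hF.symm h) h'.2⟩
    · exact hF.trans h h'
  conf := by
    rintro (a | a) (b | b) h hne
    · exact hE.conf h fun h => hne (h ▸ rfl)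
    · exact Or.inl h
    · exact Or.inl h
    · exact hF.conf h fun h => hne (h ▸ rfl)
  bundle := by
    rintro (a | a) (b | b) x h hx
    · cases hx with
      | left x _ hx => exact .left x b (hE.bundle h hx)
    · cases hx with
      | left x _ hx => exact (h.1 x hx).elim
    · cases hx with
      | right x _ hx => exact (h.2 x hx).elim
    · cases hx with
      | right x _ hx => exact .right x b (hF.bundle h hx)
  enab := by
    rintro (a | a) (b | b) z hz h he
    · obtain ⟨h1, h2⟩ := PES.enab_plus_inl_config hz he
      exact PES.enab_plus_inl_of (hE.enab (isConfig_plus_iff.1 hz).1 h h1) h2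
    · obtain ⟨h1, h2⟩ := PES.enab_plus_inl_config hz he
      refine PES.enab_plus_inr_of ?_ (hE.eq_empty (isConfig_plus_iff.1 hz).1 h1 h.1)
      rw [h2]
      exact enab_empty_iff.2 h.2
    · obtain ⟨h1, h2⟩ := PES.enab_plus_inr_config hz he
      refine PES.enab_plus_inl_of ?_ (hF.eq_empty (isConfig_plus_iff.1 hz).2.1 h1 h.2)
      rw [h2]
      exact enab_empty_iff.2 h.1
    · obtain ⟨h1, h2⟩ := PES.enab_plus_inr_config hz he
      exact PES.enab_plus_inr_of (hF.enab (isConfig_plus_iff.1 hz).2.1 h h1) h2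
  imm := by
    have key : ∀ (z : Set (BES.plus E F).Ev) a b, (BES.plus E F).IsConfig z →
        (BES.plus E F).Enab z (.inl a) → (BES.plus E F).Enab z (.inr b) →
        a ∈ E.init ∧ b ∈ F.init := by
      intro z a b hz ha hb
      obtain ⟨h1, h2⟩ := PES.enab_plus_inl_config hz ha
      obtain ⟨h3, h4⟩ := PES.enab_plus_inr_config hz hb
      rw [h4] at h1
      rw [h2] at h3
      exact ⟨h1.mem_init, h3.mem_init⟩
    rintro (a | a) (b | b) z hz ha hb hc
    · exact hE.imm (isConfig_plus_iff.1 hz).1 (PES.enab_plus_inl_config hz ha).1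
        (PES.enab_plus_inl_config hz hb).1 hc
    · exact key z a b hz ha hb
    · exact key z b a hz hb ha
    · exact hF.imm (isConfig_plus_iff.1 hz).2.1 (PES.enab_plus_inr_config hz ha).1
        (PES.enab_plus_inr_config hz hb).1 hc
  init := by
    rintro (a | a) (b | b) ha hb
    · exact hE.init (inl_mem_init_plus.1 ha) (inl_mem_init_plus.1 hb)
    · exact ⟨inl_mem_init_plus.1 ha, inr_mem_init_plus.1 hb⟩
    · exact ⟨inl_mem_init_plus.1 hb, inr_mem_init_plus.1 ha⟩
    · exact hF.init (inr_mem_init_plus.1 ha) (inr_mem_init_plus.1 hb)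

/-- The clusters of a sequential composition. -/
def seqRel (r : E.Ev → E.Ev → Prop) (s : F.Ev → F.Ev → Prop) :
    E.Ev ⊕ F.Ev → E.Ev ⊕ F.Ev → Prop
  | .inl a, .inl b => r a b
  | .inr a, .inr b => s a b
  | _, _ => False

theorem seq (hE : E.ClusterRel r) (hF : F.ClusterRel s) :
    (BES.seq E F).ClusterRel (seqRel r s) where
  refl := by
    rintro (e | e)
    · exact hE.refl e
    · exact hF.refl e
  symm := by
    rintro (a | a) (b | b) h <;> try exact h.elim
    · exact hE.symm h
    · exact hF.symm h
  trans := by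
    rintro (a | a) (b | b) (c | c) h h' <;> first | exact h.elim | exact h'.elim | skip
    · exact hE.trans h h'
    · exact hF.trans h h'
  conf := by
    rintro (a | a) (b | b) h hne <;> try exact h.elim
    · exact hE.conf h fun h => hne (h ▸ rfl)
    · exact hF.conf h fun h => hne (h ▸ rfl)
  bundle := by
    rintro (a | a) (b | b) x h hx <;> try exact h.elim
    · cases hx with
      | left x _ hx => exact .left x b (hE.bundle h hx)
    · cases hx with
      | right x _ hx => exact .right x b (hF.bundle h hx)
      | link _ hi => exact .link b (hF.mem_init h hi)
  enab := by
    rintro (a | a) (b | b) z hz h he <;> try exact h.elim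
    · exact enab_seq_inl.2 (hE.enab (isConfig_seq_iff.1 hz).1 h (enab_seq_inl.1 he))
    · obtain ⟨h1, h2⟩ := enab_seq_inr.1 he
      exact enab_seq_inr.2 ⟨hF.enab (isConfig_seq_iff.1 hz).2.1 h h1,
        fun hi => h2 (hF.mem_init (hF.symm h) hi)⟩
  imm := by
    rintro (a | a) (b | b) z hz ha hb hc <;> try exact hc.elim
    · exact hE.imm (isConfig_seq_iff.1 hz).1 (enab_seq_inl.1 ha) (enab_seq_inl.1 hb) hc
    · exact hF.imm (isConfig_seq_iff.1 hz).2.1 (enab_seq_inr.1 ha).1 (enab_seq_inr.1 hb).1 hc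
  init := by
    rintro (a | a) (b | b) ha hb <;> first
      | exact (inr_notMem_init_seq ha).elim | exact (inr_notMem_init_seq hb).elim | skip
    exact hE.init (inl_mem_init_seq.1 ha) (inl_mem_init_seq.1 hb)

/-- The clusters of a concurrent composition. -/
def parRel (r : E.Ev → E.Ev → Prop) (s : F.Ev → F.Ev → Prop) :
    ParEv E.Ev F.Ev → ParEv E.Ev F.Ev → Prop
  | .left a, .left b => r a b
  | .right a, .right b => s a b
  | .start, .start => True
  | .finish, .finish => True
  | _, _ => False

theorem par (hE : E.ClusterRel r) (hF : F.ClusterRel s) :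
    (BES.par E F).ClusterRel (parRel r s) where
  refl := by
    rintro (e | e | _ | _)
    · exact hE.refl e
    · exact hF.refl e
    · trivial
    · trivial
  symm := by
    rintro (a | a | _ | _) (b | b | _ | _) h <;> try exact h
    · exact hE.symm h
    · exact hF.symm h
  trans := by
    rintro (a | a | _ | _) (b | b | _ | _) (c | c | _ | _) h h' <;>
      first | exact h.elim | exact h'.elim | trivial | skip
    · exact hE.trans h h'
    · exact hF.trans h h'
  conf := by
    rintro (a | a | _ | _) (b | b | _ | _) h hne <;>
      first | exact h.elim | exact (hne rfl).elim | skip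
    · exact hE.conf h fun h => hne (h ▸ rfl)
    · exact hF.conf h fun h => hne (h ▸ rfl)
  bundle := by
    rintro (a | a | _ | _) (b | b | _ | _) x h hx <;> first | exact h.elim | exact hx | skip
    · cases hx with
      | left x _ hx => exact .left x b (hE.bundle h hx)
      | startLeft _ hi => exact .startLeft b (hE.mem_init h hi)
    · cases hx with
      | right x _ hx => exact .right x b (hF.bundle h hx)
      | startRight _ hi => exact .startRight b (hF.mem_init h hi)
  enab := by
    rintro (a | a | _ | _) (b | b | _ | _) z hz h he <;> first | exact h.elim | exact he | skip
    · obtain ⟨h1, h2⟩ := enab_par_left.1 he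
      exact enab_par_left.2 ⟨hE.enab (isConfig_par_iff.1 hz).1 h h1,
        fun hi => h2 (hE.mem_init (hE.symm h) hi)⟩
    · obtain ⟨h1, h2⟩ := enab_par_right.1 he
      exact enab_par_right.2 ⟨hF.enab (isConfig_par_iff.1 hz).2.1 h h1,
        fun hi => h2 (hF.mem_init (hF.symm h) hi)⟩
  imm := by
    rintro (a | a | _ | _) (b | b | _ | _) z hz ha hb hc <;> try exact hc.elim
    · exact hE.imm (isConfig_par_iff.1 hz).1 (enab_par_left.1 ha).1 (enab_par_left.1 hb).1 hc
    · exact hF.imm (isConfig_par_iff.1 hz).2.1 (enab_par_right.1 ha).1 (enab_par_right.1 hb).1 hc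
  init := by
    intro a b ha hb
    rw [mem_init_par.1 ha, mem_init_par.1 hb]
    trivial

/-- The clusters of a star. -/
def starRel (E F : BES Act) (r : E.Ev → E.Ev → Prop) (s : F.Ev → F.Ev → Prop) :
    StarEv E.Ev F.Ev → StarEv E.Ev F.Ev → Prop
  | .body n a, .body m b => n = m ∧ r a b
  | .exit n a, .exit m b => n = m ∧ s a b
  | .body n a, .exit m b => n = m ∧ a ∈ E.init ∧ b ∈ F.init
  | .exit m b, .body n a => n = m ∧ a ∈ E.init ∧ b ∈ F.init

section Star

variable {z : Set (BES.star E F).Ev} {n m : ℕ}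

/-- At the level of an initial event that is enabled as far as earlier levels are concerned, a copy
of `F` at any other level has not been entered. -/
theorem exit_eq_empty_of_link (hz : StarShape E F z) (hb : StarEv.body n ⁻¹' z = ∅)
    (h : ∀ k, n = k + 1 → (StarEv.body k ⁻¹' z ∩ E.final).Nonempty) (hnm : n ≠ m) :
    StarEv.exit m ⁻¹' z = ∅ := by
  by_contra hne
  have hne := Set.nonempty_iff_ne_empty.2 hne
  rcases lt_or_gt_of_ne hnm with hlt | hlt
  · have h1 := hz.final_below hlt (Or.inr hne)
    rw [hb, Set.empty_inter] at h1
    exact Set.not_nonempty_empty h1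
  · obtain ⟨k, rfl⟩ : ∃ k, n = k + 1 := ⟨n - 1, by omega⟩
    have h1 := h k rfl
    rw [hz.body_empty hne (by omega), Set.empty_inter] at h1
    exact Set.not_nonempty_empty h1

theorem body_eq_empty_of_exit (hz : StarShape E F z) {e : F.Ev}
    (he : (BES.star E F).Enab z (.exit n e)) : StarEv.body n ⁻¹' z = ∅ := by
  by_cases hx : (StarEv.exit n ⁻¹' z).Nonempty
  · exact hz.excl n hx
  · obtain ⟨h1, h2, -⟩ := enab_star_exit.1 he
    rw [Set.not_nonempty_iff_eq_empty.1 hx] at h1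
    by_contra hne
    obtain ⟨a, ha, hai⟩ := (hz.body n).exists_init (Set.nonempty_iff_ne_empty.2 hne)
    exact h2 a ha ⟨hai, h1.mem_init⟩

theorem exit_eq_empty_of_exit (hz : StarShape E F z) {e : F.Ev}
    (he : (BES.star E F).Enab z (.exit n e)) (hnm : n ≠ m) : StarEv.exit m ⁻¹' z = ∅ := by
  by_cases hx : (StarEv.exit n ⁻¹' z).Nonempty
  · exact hz.exit_empty hx hnm
  · obtain ⟨h1, -, -, h4⟩ := enab_star_exit.1 he
    rw [Set.not_nonempty_iff_eq_empty.1 hx] at h1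
    exact exit_eq_empty_of_link hz (body_eq_empty_of_exit hz he) (h4 h1.mem_init) hnm

/-- The exit at the higher level needs termination of the copy of `E` at the lower level, whereas
the exit at the lower level needs this copy to be empty. -/
theorem eq_of_enab_exit (hz : StarShape E F z) {a b : F.Ev}
    (ha : (BES.star E F).Enab z (.exit n a)) (hb : (BES.star E F).Enab z (.exit m b)) : n = m := by
  have key : ∀ {n m : ℕ} {a b : F.Ev}, (BES.star E F).Enab z (.exit n a) →
      (BES.star E F).Enab z (.exit m b) → ¬ n < m := by
    intro n m a b ha hb hlt
    obtain ⟨h1, -, -, h4⟩ := enab_star_exit.1 hb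
    rw [exit_eq_empty_of_exit hz ha hlt.ne] at h1
    obtain ⟨k, rfl⟩ : ∃ k, m = k + 1 := ⟨m - 1, by omega⟩
    have h2 := h4 h1.mem_init k rfl
    have h3 : (StarEv.body n ⁻¹' z ∩ E.final).Nonempty := by
      rcases (Nat.lt_succ_iff.1 hlt).eq_or_lt with rfl | h
      · exact h2
      · exact hz.final_below h (Or.inl (h2.mono Set.inter_subset_left))
    rw [body_eq_empty_of_exit hz ha, Set.empty_inter] at h3
    exact Set.not_nonempty_empty h3
  exact le_antisymm (not_lt.1 (key hb ha)) (not_lt.1 (key ha hb))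

end Star

/-- At each level the initial events of the two alternatives form one class. Final events at
different levels are in conflict, but `eq_of_enab_exit` shows that they are never enabled together,
so they are not in immediate conflict. -/
theorem star (hE : E.ClusterRel r) (hF : F.ClusterRel s) :
    (BES.star E F).ClusterRel (starRel E F r s) where
  refl := by
    rintro (⟨n, e⟩ | ⟨n, e⟩)
    · exact ⟨rfl, hE.refl e⟩
    · exact ⟨rfl, hF.refl e⟩
  symm := by
    rintro (⟨n, a⟩ | ⟨n, a⟩) (⟨m, b⟩ | ⟨m, b⟩) h
    · exact ⟨h.1.symm, hE.symm h.2⟩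
    · exact h
    · exact h
    · exact ⟨h.1.symm, hF.symm h.2⟩
  trans := by
    rintro (⟨n, a⟩ | ⟨n, a⟩) (⟨m, b⟩ | ⟨m, b⟩) (⟨k, c⟩ | ⟨k, c⟩) ⟨rfl, h⟩ ⟨rfl, h'⟩
    · exact ⟨rfl, hE.trans h h'⟩
    · exact ⟨rfl, hE.mem_init (hE.symm h) h'.1, h'.2⟩
    · exact ⟨rfl, hE.init h.1 h'.1⟩
    · exact ⟨rfl, h.1, hF.mem_init h' h.2⟩
    · exact ⟨rfl, hE.mem_init h' h.1, h.2⟩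
    · exact ⟨rfl, hF.init h.2 h'.2⟩
    · exact ⟨rfl, h'.1, hF.mem_init (hF.symm h) h'.2⟩
    · exact ⟨rfl, hF.trans h h'⟩
  conf := by
    rintro (⟨n, a⟩ | ⟨n, a⟩) (⟨m, b⟩ | ⟨m, b⟩) ⟨rfl, h⟩ hne
    · exact ⟨rfl, hE.conf h fun h => hne (h ▸ rfl)⟩
    · exact ⟨rfl, h⟩
    · exact ⟨rfl, h⟩
    · exact Or.inl ⟨rfl, hF.conf h fun h => hne (h ▸ rfl)⟩
  bundle := by
    rintro (⟨n, a⟩ | ⟨n, a⟩) (⟨m, b⟩ | ⟨m, b⟩) x ⟨rfl, h⟩ hx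
    · cases hx with
      | body _ x _ hx => exact .body n x b (hE.bundle h hx)
      | linkBody n _ hi => exact .linkBody n b (hE.mem_init h hi)
    · cases hx with
      | body _ x _ hx => exact (h.1 x hx).elim
      | linkBody n _ hi => exact .linkExit n b h.2
    · cases hx with
      | exit _ x _ hx => exact (h.2 x hx).elim
      | linkExit n _ hi => exact .linkBody n b h.1
    · cases hx with
      | exit _ x _ hx => exact .exit n x b (hF.bundle h hx)
      | linkExit n _ hi => exact .linkExit n b (hF.mem_init h hi)
  enab := by
    rintro (⟨n, a⟩ | ⟨n, a⟩) (⟨m, b⟩ | ⟨m, b⟩) z hz ⟨rfl, h⟩ he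
    · obtain ⟨h1, h2, h3⟩ := enab_star_body.1 he
      exact enab_star_body.2 ⟨hE.enab (hz.starShape.body n) h h1,
        fun f hf hi => h2 f hf ⟨hE.mem_init (hE.symm h) hi.1, hi.2⟩,
        fun hi => h3 (hE.mem_init (hE.symm h) hi)⟩
    · obtain ⟨h1, h2, h3⟩ := enab_star_body.1 he
      have hb := hE.eq_empty (hz.starShape.body n) h1 h.1
      have hx : StarEv.exit n ⁻¹' z = ∅ := by
        by_contra hne
        obtain ⟨f, hf, hfi⟩ :=
          (hz.starShape.exit n).exists_init (Set.nonempty_iff_ne_empty.2 hne)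
        exact h2 f hf ⟨h.1, hfi⟩
      refine enab_star_exit.2 ⟨hx ▸ enab_empty_iff.2 h.2, ?_, ?_, fun _ => h3 h.1⟩
      · rw [hb]
        exact fun _ hc => hc.elim
      · intro m hm
        rw [exit_eq_empty_of_link hz.starShape hb (h3 h.1) hm]
        exact fun _ hc => hc.elim
    · obtain ⟨h1, h2, h3, h4⟩ := enab_star_exit.1 he
      have hx := hF.eq_empty (hz.starShape.exit m) h1 h.2
      refine enab_star_body.2 ⟨?_, ?_, fun _ => h4 h.2⟩
      · rw [body_eq_empty_of_exit hz.starShape he]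
        exact enab_empty_iff.2 h.1
      · rw [hx]
        exact fun _ hc => hc.elim
    · obtain ⟨h1, h2, h3, h4⟩ := enab_star_exit.1 he
      refine enab_star_exit.2 ⟨hF.enab (hz.starShape.exit n) h h1, ?_, ?_,
        fun hi => h4 (hF.mem_init (hF.symm h) hi)⟩
      · exact fun c hc hi => h2 c hc ⟨hi.1, hF.mem_init (hF.symm h) hi.2⟩
      · intro m hm
        rw [exit_eq_empty_of_exit hz.starShape he hm]
        exact fun _ hc => hc.elim
  imm := by
    rintro (⟨n, a⟩ | ⟨n, a⟩) (⟨m, b⟩ | ⟨m, b⟩) z hz ha hb hc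
    · obtain ⟨rfl, hc⟩ := hc
      exact ⟨rfl, hE.imm (hz.starShape.body n) (enab_star_body.1 ha).1 (enab_star_body.1 hb).1 hc⟩
    · exact hc
    · exact hc
    · obtain rfl := eq_of_enab_exit hz.starShape ha hb
      rcases hc with ⟨-, hc⟩ | ⟨hc, -⟩
      · exact ⟨rfl, hF.imm (hz.starShape.exit n) (enab_star_exit.1 ha).1
          (enab_star_exit.1 hb).1 hc⟩
      · exact (hc rfl).elim
  init := by
    have hb : ∀ {n e}, StarEv.body n e ∈ (BES.star E F).init → n = 0 ∧ e ∈ E.init := by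
      intro n e h
      have he : e ∈ E.init := fun x hx => h _ (.body n x e hx)
      cases n with
      | zero => exact ⟨rfl, he⟩
      | succ n => exact (h _ (.linkBody n e he)).elim
    have hx : ∀ {n e}, StarEv.exit n e ∈ (BES.star E F).init → n = 0 ∧ e ∈ F.init := by
      intro n e h
      have he : e ∈ F.init := fun x hx => h _ (.exit n x e hx)
      cases n with
      | zero => exact ⟨rfl, he⟩
      | succ n => exact (h _ (.linkExit n e he)).elim
    rintro (⟨n, a⟩ | ⟨n, a⟩) (⟨m, b⟩ | ⟨m, b⟩) h h'
    · exact ⟨(hb h).1.trans (hb h').1.symm, hE.init (hb h).2 (hb h').2⟩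
    · exact ⟨(hb h).1.trans (hx h').1.symm, (hb h).2, (hx h').2⟩
    · exact ⟨(hb h').1.trans (hx h).1.symm, (hb h').2, (hx h).2⟩
    · exact ⟨(hx h).1.trans (hx h').1.symm, hF.init (hx h).2 (hx h').2⟩

theorem rel_of_immConf (h : E.ClusterRel r) {e e' : E.Ev} (hi : E.ImmConf e e') : r e e' := by
  obtain ⟨hc, x, hx, h1, h2⟩ := hi
  refine h.imm hx (h1.enab_of_insert fun he => ?_) (h2.enab_of_insert fun he => ?_) hc
  · exact h2.conflictFree e (Or.inr he) e' (Or.inl rfl) hc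
  · exact h1.conflictFree e (Or.inl rfl) e' (Or.inr he) hc

theorem immConf_of_enab (h : E.ClusterRel r) {x : Set E.Ev} (hx : E.IsConfig x) {e e' : E.Ev}
    (he : E.Enab x e) (hr : r e e') (hne : e ≠ e') : E.ImmConf e e' :=
  ⟨h.conf hr hne, x, hx, hx.insert he, hx.insert (h.enab hx hr he)⟩

theorem immConf_symm {e e' : E.Ev} (h : E.ImmConf e e') : E.ImmConf e' e := by
  obtain ⟨hc, x, hx, h1, h2⟩ := h
  exact ⟨E.conf_symm _ _ hc, x, hx, h2, h1⟩

/-- In the presence of a cluster relation, every event lies in exactly one cluster. -/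
theorem clusterOf_eq (h : E.ClusterRel r) (e : E.Ev) :
    E.clusterOf e = {e' | e' = e ∨ E.ImmConf e e'} := by
  have hrel : ∀ a ∈ {e' | e' = e ∨ E.ImmConf e e'}, r e a := by
    rintro a (rfl | ha)
    · exact h.refl _
    · exact h.rel_of_immConf ha
  have hK : E.IsPartialCluster {e' | e' = e ∨ E.ImmConf e e'} := by
    refine ⟨fun a ha b hb hne => ?_,
      fun a ha b hb x hx => h.bundle (h.trans (h.symm (hrel a ha)) (hrel b hb)) hx⟩
    have hab := h.trans (h.symm (hrel a ha)) (hrel b hb)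
    rcases ha with rfl | ha
    · exact hb.resolve_left fun h => hne h.symm
    -- The configuration that witnesses the immediate conflict of `e` and `a` enables `a`, and so it
    -- enables the related event `b`.
    · obtain ⟨hc, x, hx, h1, h2⟩ := id ha
      refine h.immConf_of_enab hx (h2.enab_of_insert fun hax => ?_) hab hne
      exact h1.conflictFree e (Or.inl rfl) a (Or.inr hax) hc
  have hmax : ∀ K, E.IsPartialCluster K → e ∈ K → K ⊆ {e' | e' = e ∨ E.ImmConf e e'} := by
    intro K hK' he a ha
    by_cases hae : a = e
    · exact Or.inl hae
    · exact Or.inr (hK'.1 e he a ha fun h => hae h.symm)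
  refine Set.Subset.antisymm (Set.sInter_subset_of_mem ⟨⟨hK, ?_⟩, Or.inl rfl⟩)
    (Set.subset_sInter ?_)
  · exact fun K hK' hle => hmax K hK' (hle (Or.inl rfl))
  · rintro K ⟨hK', he⟩
    exact hK'.2 hK (hmax K hK'.1 he)

/-- A cluster is `e` with its immediate conflicts, so the first condition is symmetry of immediate
conflict; the second holds because related events are enabled together. -/
theorem confusionFree (h : E.ClusterRel r) : E.ConfusionFree := by
  refine ⟨fun e e' hi => ?_, fun e x hx hd hi e'' he => ?_⟩
  · rw [h.clusterOf_eq]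
    exact Or.inr (immConf_symm hi)
  · have hex : e ∉ x := fun hex => by
      refine Set.notMem_empty e (hd ▸ ⟨?_, hex⟩)
      rw [h.clusterOf_eq]
      exact Or.inl rfl
    rw [h.clusterOf_eq] at he
    rcases he with rfl | he
    · exact hi
    · exact hx.insert (h.enab hx (h.rel_of_immConf he) (hi.enab_of_insert hex))

end ClusterRel

end BES

namespace PES

variable {Act : Type u}

theorem Regular.exists_clusterRel {E : PES Act} (h : E.Regular) : ∃ r, E.ClusterRel r := by
  induction h with
  | zero => exact ⟨_, .zero⟩
  | one => exact ⟨_, .single _⟩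
  | atom a => exact ⟨_, .single _⟩
  | plus _ _ h h' | pchoice _ _ _ h h' => exact ⟨_, h.choose_spec.plus h'.choose_spec⟩
  | seq _ _ h h' => exact ⟨_, h.choose_spec.seq h'.choose_spec⟩
  | par _ _ h h' => exact ⟨_, h.choose_spec.par h'.choose_spec⟩
  | star _ _ h h' => exact ⟨_, h.choose_spec.star h'.choose_spec⟩

end PES
end PBES

namespace PBES

namespace BES

variable {Act : Type u}

/-! ### Transport of immediate conflict into composite structures -/

/-- A map of events that preserves conflict and along which concurrent enabledness is preserved. -/
structure Transport (E F : BES Act) (j : E.Ev → F.Ev) : Prop where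
  conf : ∀ a b, E.conf a b → F.conf (j a) (j b)
  config : ∀ x, E.IsConfig x → ∃ z, F.IsConfig z ∧ ∀ e, E.Enab x e → F.Enab z (j e)

theorem Transport.immConf {E F : BES Act} {j : E.Ev → F.Ev} (h : Transport E F j) {a b : E.Ev}
    (hi : E.ImmConf a b) : F.ImmConf (j a) (j b) := by
  obtain ⟨hc, x, hx, h1, h2⟩ := hi
  have ha : E.Enab x a := h1.enab_of_insert fun ha =>
    h2.conflictFree a (Or.inr ha) b (Or.inl rfl) hc
  have hb : E.Enab x b := h2.enab_of_insert fun hb =>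
    h1.conflictFree a (Or.inl rfl) b (Or.inr hb) hc
  obtain ⟨z, hz, he⟩ := h.config x hx
  exact ⟨h.conf a b hc, z, hz, hz.insert (he a ha), hz.insert (he b hb)⟩

theorem transport_plus_inl (E F : BES Act) : Transport E (plus E F) Sum.inl where
  conf _ _ h := h
  config x hx := ⟨_, isConfig_plus_inl hx, fun _ he =>
    PES.enab_plus_inl_of (by rwa [inl_preimage_sumSet]) inr_preimage_sumSet⟩

theorem transport_plus_inr (E F : BES Act) : Transport F (plus E F) Sum.inr where
  conf _ _ h := h
  config x hx := ⟨_, isConfig_plus_inr hx, fun _ he =>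
    PES.enab_plus_inr_of (by rwa [inr_preimage_sumSet]) inl_preimage_sumSet⟩

theorem transport_seq_inl (E F : BES Act) : Transport E (seq E F) Sum.inl where
  conf _ _ h := h
  config x hx := ⟨_, isConfig_seq hx (isConfig_empty F) fun h => (Set.not_nonempty_empty h).elim,
    fun e he => enab_seq_inl.2 (by rwa [inl_preimage_sumSet])⟩

/-- The witnesses are placed behind a fixed terminated configuration of `E`. Without one, events of
`F` would never be enabled and their immediate conflicts would be lost. -/
theorem transport_seq_inr {E : BES Act} (F : BES Act) (h : E.CanTerminate) :
    Transport F (seq E F) Sum.inr where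
  conf _ _ h := h
  config x hx := by
    obtain ⟨w, hw, hf⟩ := h
    exact ⟨_, isConfig_seq hw hx fun _ => hf, fun e he => enab_seq_inr.2
      ⟨by rwa [inr_preimage_sumSet], fun _ => by rwa [inl_preimage_sumSet]⟩⟩

theorem transport_par_left (E F : BES Act) : Transport E (par E F) ParEv.left where
  conf _ _ h := h
  config x hx := ⟨parSet True x ∅ False, isConfig_par hx (isConfig_empty F) (fun _ => trivial)
    (fun _ => trivial) False.elim, fun _ he => enab_par_left.2 ⟨he, fun _ => trivial⟩⟩

theorem transport_par_right (E F : BES Act) : Transport F (par E F) ParEv.right where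
  conf _ _ h := h
  config x hx := ⟨parSet True ∅ x False, isConfig_par (isConfig_empty E) hx (fun _ => trivial)
    (fun _ => trivial) False.elim, fun _ he => enab_par_right.2 ⟨he, fun _ => trivial⟩⟩

/-- In a star, `w` at all levels below `n`, followed by `x` and `y` at level `n`. -/
def levelSet {α β : Type} (n : ℕ) (w x : Set α) (y : Set β) : Set (StarEv α β)
  | .body k a => k < n ∧ a ∈ w ∨ k = n ∧ a ∈ x
  | .exit k b => k = n ∧ b ∈ y

section Level

variable {α β : Type} {n k : ℕ} {w x : Set α} {y : Set β}

theorem body_preimage_levelSet : StarEv.body n ⁻¹' levelSet n w x y = x := by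
  ext a
  exact ⟨fun h => h.elim (fun h => (lt_irrefl n h.1).elim) And.right, fun h => Or.inr ⟨rfl, h⟩⟩

theorem exit_preimage_levelSet : StarEv.exit n ⁻¹' levelSet n w x y = y := by
  ext a
  exact ⟨And.right, fun h => ⟨rfl, h⟩⟩

theorem body_preimage_levelSet_of_lt (h : k < n) : StarEv.body k ⁻¹' levelSet n w x y = w := by
  ext a
  exact ⟨fun h' => h'.elim And.right fun h' => (h.ne h'.1).elim, fun h' => Or.inl ⟨h, h'⟩⟩

theorem exit_preimage_levelSet_of_ne (h : n ≠ k) : StarEv.exit k ⁻¹' levelSet n w x y = ∅ := by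
  ext a
  exact ⟨fun h' => (h h'.1.symm).elim, False.elim⟩

theorem levelSet_zero : levelSet 0 w ∅ (∅ : Set β) = ∅ := by
  ext (⟨k, a⟩ | ⟨k, a⟩)
  · exact ⟨fun h => h.elim (fun h => (Nat.not_lt_zero k h.1).elim) And.right, False.elim⟩
  · exact ⟨And.right, False.elim⟩

theorem levelSet_succ : levelSet (n + 1) w ∅ (∅ : Set β) = levelSet n w w ∅ := by
  ext (⟨k, a⟩ | ⟨k, a⟩)
  · constructor
    · rintro (⟨h, ha⟩ | ⟨-, ha⟩)
      · exact (Nat.lt_succ_iff_lt_or_eq.1 h).imp (fun h => ⟨h, ha⟩) fun h => ⟨h, ha⟩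
      · exact ha.elim
    · rintro (⟨h, ha⟩ | ⟨rfl, ha⟩)
      · exact Or.inl ⟨h.trans n.lt_succ_self, ha⟩
      · exact Or.inl ⟨k.lt_succ_self, ha⟩
  · exact ⟨fun h => h.2.elim, fun h => h.2.elim⟩

theorem insert_body_levelSet {a : α} :
    insert (StarEv.body n a) (levelSet n w x y) = levelSet n w (insert a x) y := by
  ext (⟨k, b⟩ | ⟨k, b⟩)
  · constructor
    · rintro (h | h | ⟨rfl, h⟩)
      · cases h
        exact Or.inr ⟨rfl, Or.inl rfl⟩
      · exact Or.inl h
      · exact Or.inr ⟨rfl, Or.inr h⟩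
    · rintro (h | ⟨rfl, rfl | h⟩)
      · exact Or.inr (Or.inl h)
      · exact Or.inl rfl
      · exact Or.inr (Or.inr ⟨rfl, h⟩)
  · exact ⟨fun h => h.resolve_left nofun, Or.inr⟩

theorem insert_exit_levelSet {b : β} :
    insert (StarEv.exit n b) (levelSet n w x y) = levelSet n w x (insert b y) := by
  ext (⟨k, c⟩ | ⟨k, c⟩)
  · exact ⟨fun h => h.resolve_left nofun, Or.inr⟩
  · constructor
    · rintro (h | ⟨rfl, h⟩)
      · cases h
        exact ⟨rfl, Or.inl rfl⟩
      · exact ⟨rfl, Or.inr h⟩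
    · rintro ⟨rfl, rfl | h⟩
      · exact Or.inl rfl
      · exact Or.inr ⟨rfl, h⟩

end Level

section StarTransport

variable {E F : BES Act} {w : Set E.Ev} {n : ℕ}

theorem enab_body_levelSet (hf : (w ∩ E.final).Nonempty) {x : Set E.Ev} {e : E.Ev}
    (he : E.Enab x e) : (star E F).Enab (levelSet n w x ∅) (.body n e) := by
  refine enab_star_body.2 ⟨by rwa [body_preimage_levelSet], ?_, ?_⟩
  · rw [exit_preimage_levelSet]
    exact fun _ h => h.elim
  · rintro - k rfl
    rwa [body_preimage_levelSet_of_lt k.lt_succ_self]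

theorem enab_exit_levelSet (hf : (w ∩ E.final).Nonempty) {y : Set F.Ev} {e : F.Ev}
    (he : F.Enab y e) : (star E F).Enab (levelSet n w ∅ y) (.exit n e) := by
  refine enab_star_exit.2 ⟨by rwa [exit_preimage_levelSet], ?_, ?_, ?_⟩
  · rw [body_preimage_levelSet]
    exact fun _ h => h.elim
  · intro k hk
    rw [exit_preimage_levelSet_of_ne hk]
    exact fun _ h => h.elim
  · rintro - k rfl
    rwa [body_preimage_levelSet_of_lt k.lt_succ_self]

theorem isConfig_levelSet_body (hf : (w ∩ E.final).Nonempty)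
    (h0 : (star E F).IsConfig (levelSet n w ∅ ∅)) {x : Set E.Ev} (hx : E.IsConfig x) :
    (star E F).IsConfig (levelSet n w x ∅) := by
  induction hx using IsConfig.induction with
  | h0 => exact h0
  | h1 x e hx he ih =>
    rw [← insert_body_levelSet]
    exact ih.insert (enab_body_levelSet hf he)

/-- One terminated configuration `w` is repeated at all levels below `n`, so that level `n` becomes
accessible. -/
theorem isConfig_levelSet (hw : E.IsConfig w) (hf : (w ∩ E.final).Nonempty) (n : ℕ) :
    (star E F).IsConfig (levelSet n w ∅ ∅) := by
  induction n with
  | zero =>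
    rw [levelSet_zero]
    exact isConfig_empty _
  | succ n ih =>
    rw [levelSet_succ]
    exact isConfig_levelSet_body hf ih hw

theorem isConfig_levelSet_exit (hf : (w ∩ E.final).Nonempty)
    (h0 : (star E F).IsConfig (levelSet n w ∅ ∅)) {y : Set F.Ev} (hy : F.IsConfig y) :
    (star E F).IsConfig (levelSet n w ∅ y) := by
  induction hy using IsConfig.induction with
  | h0 => exact h0
  | h1 y e hy he ih =>
    rw [← insert_exit_levelSet]
    exact ih.insert (enab_exit_levelSet hf he)

theorem transport_star_body (F : BES Act) (h : E.CanTerminate) (n : ℕ) :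
    Transport E (star E F) (StarEv.body n) where
  conf _ _ h := ⟨rfl, h⟩
  config x hx := by
    obtain ⟨w, hw, hf⟩ := h
    exact ⟨_, isConfig_levelSet_body hf (isConfig_levelSet hw hf n) hx,
      fun e he => enab_body_levelSet hf he⟩

theorem transport_star_exit (F : BES Act) (h : E.CanTerminate) (n : ℕ) :
    Transport F (star E F) (StarEv.exit n) where
  conf _ _ h := Or.inl ⟨rfl, h⟩
  config x hx := by
    obtain ⟨w, hw, hf⟩ := h
    exact ⟨_, isConfig_levelSet_exit hf (isConfig_levelSet hw hf n) hx,
      fun e he => enab_exit_levelSet hf he⟩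

end StarTransport

end BES

namespace PES

variable {Act : Type u} {E F : PES Act}

theorem Regular.confusionFree (h : E.Regular) : E.ConfusionFree :=
  h.exists_clusterRel.choose_spec.confusionFree

theorem Regular.clusterOf_eq (h : E.Regular) (e : E.Ev) :
    E.clusterOf e = {e' | e' = e ∨ E.ImmConf e e'} :=
  h.exists_clusterRel.choose_spec.clusterOf_eq e

/-- A cluster is an event with its immediate conflicts, and `j` preserves these. -/
theorem Regular.support_map_subset (hE : E.Regular) (hF : F.Regular) {j : E.Ev → F.Ev}
    (hj : BES.Transport E.toBES F.toBES j) {p : PMF E.Ev}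
    (hp : ∃ e, p.support ⊆ E.clusterOf e) : ∃ e, (p.map j).support ⊆ F.clusterOf e := by
  obtain ⟨e, he⟩ := hp
  rw [hE.clusterOf_eq] at he
  refine ⟨j e, ?_⟩
  rw [hF.clusterOf_eq, PMF.support_map]
  rintro _ ⟨a, ha, rfl⟩
  exact (he ha).imp (congrArg j) hj.immConf

theorem Regular.mem_clusterOf_of_init (hE : E.Regular) {a b : E.Ev} (ha : a ∈ E.init)
    (hb : b ∈ E.init) : b ∈ E.clusterOf a := by
  rw [hE.clusterOf_eq]
  by_cases hab : b = a
  · exact Or.inl hab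
  · obtain ⟨r, hr⟩ := hE.exists_clusterRel
    exact Or.inr (hr.immConf_of_enab (BES.isConfig_empty _) (BES.enab_empty_iff.2 ha)
      (hr.init ha hb) fun h => hab h.symm)

/-- The events of the support lie in one cluster and hence have the same bundles, so they are
initial together. -/
theorem IsPBES.support_subset_init (h : E.IsPBES) (hE : E.Regular) {p : PMF E.Ev}
    (hp : p ∈ E.dist) {a : E.Ev} (ha : a ∈ p.support) (hi : a ∈ E.init) :
    p.support ⊆ E.init := by
  obtain ⟨r, hr⟩ := hE.exists_clusterRel
  obtain ⟨e, he⟩ := h.support_subset p hp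
  rw [hE.clusterOf_eq] at he
  have hrel : ∀ b ∈ p.support, r e b := fun b hb =>
    (he hb).elim (fun h => h ▸ hr.refl _) hr.rel_of_immConf
  exact fun b hb => hr.mem_init (hr.trans (hr.symm (hrel a ha)) (hrel b hb)) hi

theorem mem_support_map {α β : Type} {f : α → β} {p : PMF α} {a : α} (h : a ∈ p.support) :
    f a ∈ (p.map f).support := (PMF.mem_support_map_iff _ _ _).2 ⟨a, h, rfl⟩

theorem mem_clusterOf_self (E : BES Act) (e : E.Ev) : e ∈ E.clusterOf e :=
  Set.mem_sInter.2 fun _ h => h.2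

theorem support_pure_subset_clusterOf (E : BES Act) (e : E.Ev) :
    (PMF.pure e).support ⊆ E.clusterOf e := by
  rw [PMF.support_pure, Set.singleton_subset_iff]
  exact mem_clusterOf_self E e

/-! ### Closure of probabilistic bundle event structures under the operations -/

theorem isPBES_zero : (zero : PES Act).IsPBES where
  confusionFree := Regular.zero.confusionFree
  support_subset _ h := h.elim
  covered e := e.elim
  final_disjoint _ _ h := h.elim

theorem isPBES_one : (one : PES Act).IsPBES where
  confusionFree := Regular.one.confusionFree
  support_subset := by
    rintro _ rfl
    exact ⟨(), support_pure_subset_clusterOf _ _⟩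
  covered e := ⟨_, rfl, (PMF.mem_support_pure_iff _ _).2 rfl⟩
  final_disjoint _ _ h := h.elim

theorem isPBES_atom (a : Act) : (atom a).IsPBES where
  confusionFree := (Regular.atom a).confusionFree
  support_subset := by
    rintro _ rfl
    exact ⟨(), support_pure_subset_clusterOf _ _⟩
  covered e := ⟨_, rfl, (PMF.mem_support_pure_iff _ _).2 rfl⟩
  final_disjoint _ _ h := h.elim

theorem final_disjoint_plus (hE : E.IsPBES) (hF : F.IsPBES) (x : Set (E.Ev ⊕ F.Ev))
    (e : E.Ev ⊕ F.Ev) (h : (BES.plus E.toBES F.toBES).bundle x e) :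
    (BES.plus E.toBES F.toBES).final ∩ x = ∅ := by
  rw [Set.eq_empty_iff_forall_notMem]
  rcases h with ⟨x, e, h⟩ | ⟨x, e, h⟩
  · rintro _ ⟨⟨a, ha, rfl⟩ | ⟨a, ha, rfl⟩, ⟨b, hb, hab⟩⟩ <;> cases hab
    exact Set.eq_empty_iff_forall_notMem.1 (hE.final_disjoint x e h) a ⟨ha, hb⟩
  · rintro _ ⟨⟨a, ha, rfl⟩ | ⟨a, ha, rfl⟩, ⟨b, hb, hab⟩⟩ <;> cases hab
    exact Set.eq_empty_iff_forall_notMem.1 (hF.final_disjoint x e h) a ⟨ha, hb⟩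

theorem IsPBES.plus (hE : E.IsPBES) (hF : F.IsPBES) (rE : E.Regular) (rF : F.Regular) :
    (plus E F).IsPBES where
  confusionFree := (rE.plus rF).confusionFree
  support_subset := by
    rintro _ (⟨p, hp, rfl⟩ | ⟨p, hp, rfl⟩)
    · exact rE.support_map_subset (rE.plus rF) (BES.transport_plus_inl _ _)
        (hE.support_subset p hp)
    · exact rF.support_map_subset (rE.plus rF) (BES.transport_plus_inr _ _)
        (hF.support_subset p hp)
  covered := by
    rintro (e | e)
    · obtain ⟨p, hp, he⟩ := hE.covered e
      exact ⟨_, Or.inl ⟨p, hp, rfl⟩, mem_support_map he⟩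
    · obtain ⟨p, hp, he⟩ := hF.covered e
      exact ⟨_, Or.inr ⟨p, hp, rfl⟩, mem_support_map he⟩
  final_disjoint := final_disjoint_plus hE hF

theorem IsPBES.seq (hE : E.IsPBES) (hF : F.IsPBES) (rE : E.Regular) (rF : F.Regular)
    (ht : E.CanTerminate) : (seq E F).IsPBES where
  confusionFree := (rE.seq rF).confusionFree
  support_subset := by
    rintro _ (⟨p, hp, rfl⟩ | ⟨p, hp, rfl⟩)
    · exact rE.support_map_subset (rE.seq rF) (BES.transport_seq_inl _ _) (hE.support_subset p hp)
    · exact rF.support_map_subset (rE.seq rF) (BES.transport_seq_inr _ ht)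
        (hF.support_subset p hp)
  covered := by
    rintro (e | e)
    · obtain ⟨p, hp, he⟩ := hE.covered e
      exact ⟨_, Or.inl ⟨p, hp, rfl⟩, mem_support_map he⟩
    · obtain ⟨p, hp, he⟩ := hF.covered e
      exact ⟨_, Or.inr ⟨p, hp, rfl⟩, mem_support_map he⟩
  final_disjoint x e h := by
    rw [Set.eq_empty_iff_forall_notMem]
    rcases h with ⟨x, e, h⟩ | ⟨x, e, h⟩ | ⟨e, h⟩
    · rintro _ ⟨⟨a, ha, rfl⟩, b, hb, hab⟩
      cases hab
    · rintro _ ⟨⟨a, ha, rfl⟩, b, hb, hab⟩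
      cases hab
      exact Set.eq_empty_iff_forall_notMem.1 (hF.final_disjoint x e h) a ⟨ha, hb⟩
    · rintro _ ⟨⟨a, ha, rfl⟩, b, hb, hab⟩
      cases hab

theorem IsPBES.par (hE : E.IsPBES) (hF : F.IsPBES) (rE : E.Regular) (rF : F.Regular) :
    (par E F).IsPBES where
  confusionFree := (rE.par rF).confusionFree
  support_subset := by
    rintro _ ((⟨p, hp, rfl⟩ | ⟨p, hp, rfl⟩) | rfl | rfl)
    · exact rE.support_map_subset (rE.par rF) (BES.transport_par_left _ _)
        (hE.support_subset p hp)
    · exact rF.support_map_subset (rE.par rF) (BES.transport_par_right _ _)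
        (hF.support_subset p hp)
    · exact ⟨_, support_pure_subset_clusterOf _ _⟩
    · exact ⟨_, support_pure_subset_clusterOf _ _⟩
  covered := by
    rintro (e | e | _ | _)
    · obtain ⟨p, hp, he⟩ := hE.covered e
      exact ⟨_, Or.inl (Or.inl ⟨p, hp, rfl⟩), mem_support_map he⟩
    · obtain ⟨p, hp, he⟩ := hF.covered e
      exact ⟨_, Or.inl (Or.inr ⟨p, hp, rfl⟩), mem_support_map he⟩
    · exact ⟨_, start_mem_dist, (PMF.mem_support_pure_iff _ _).2 rfl⟩
    · exact ⟨_, finish_mem_dist, (PMF.mem_support_pure_iff _ _).2 rfl⟩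
  final_disjoint x e h := by
    rw [Set.eq_empty_iff_forall_notMem]
    rintro _ ⟨rfl, hx⟩
    cases h with
    | startLeft _ _ | startRight _ _ => cases hx
    | left _ _ _ | right _ _ _ | finishLeft | finishRight =>
      obtain ⟨_, _, hx⟩ := hx
      cases hx

theorem IsPBES.star (hE : E.IsPBES) (hF : F.IsPBES) (rE : E.Regular) (rF : F.Regular)
    (ht : E.CanTerminate) : (star E F).IsPBES where
  confusionFree := (rE.star rF).confusionFree
  support_subset := by
    rintro _ ⟨n, ⟨p, hp, rfl⟩ | ⟨p, hp, rfl⟩⟩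
    · exact rE.support_map_subset (rE.star rF) (BES.transport_star_body _ ht n)
        (hE.support_subset p hp)
    · exact rF.support_map_subset (rE.star rF) (BES.transport_star_exit _ ht n)
        (hF.support_subset p hp)
  covered := by
    rintro (⟨n, e⟩ | ⟨n, e⟩)
    · obtain ⟨p, hp, he⟩ := hE.covered e
      exact ⟨_, ⟨n, Or.inl ⟨p, hp, rfl⟩⟩, mem_support_map he⟩
    · obtain ⟨p, hp, he⟩ := hF.covered e
      exact ⟨_, ⟨n, Or.inr ⟨p, hp, rfl⟩⟩, mem_support_map he⟩
  final_disjoint x e h := by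
    rw [Set.eq_empty_iff_forall_notMem]
    rintro _ ⟨⟨m, a, ha, rfl⟩, hx⟩
    cases h with
    | body n x e h | linkBody n e h | linkExit n e h =>
      obtain ⟨b, hb, hab⟩ := hx
      cases hab
    | exit n x e h =>
      obtain ⟨b, hb, hab⟩ := hx
      cases hab
      exact Set.eq_empty_iff_forall_notMem.1 (hF.final_disjoint x e h) a ⟨ha, hb⟩

theorem false_mem_support_coin {α : unitInterval} (h : α < 1) : false ∈ (coin α).support := by
  rw [PMF.mem_support_iff]
  have h1 := coin_bind_apply α PMF.pure false
  rw [PMF.bind_pure] at h1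
  rw [h1]
  have h2 : (α : ℝ) < 1 := h
  simp [h2]

theorem true_mem_support_coin {α : unitInterval} (h : 0 < α) : true ∈ (coin α).support := by
  rw [PMF.mem_support_iff]
  have h1 := coin_bind_apply α PMF.pure true
  rw [PMF.bind_pure] at h1
  rw [h1]
  have h2 : 0 < (α : ℝ) := h
  simp [h2]

/-- Only the coverage of events needs the extra hypotheses. A distribution on initial events
survives only inside a mixture, so it needs a partner on the other side, and the coin must give
weight to its own side. -/
theorem IsPBES.pchoice (hE : E.IsPBES) (hF : F.IsPBES) (rE : E.Regular) (rF : F.Regular)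
    {α : unitInterval} (h0 : 0 < α) (h1 : α < 1) (iE : E.init.Nonempty) (iF : F.init.Nonempty) :
    (pchoice α E F).IsPBES where
  confusionFree := (rE.pchoice α rF).confusionFree
  support_subset := by
    intro p hp
    rcases mem_pchoice_dist.1 hp with ⟨p, hp', q, hq, h2, h3, rfl⟩ | ⟨p, hp', rfl, -⟩ |
      ⟨p, hp', rfl, -⟩
    · obtain ⟨e, he⟩ := iE
      exact ⟨.inl e, fun z hz => (rE.pchoice α rF).mem_clusterOf_of_init
        (BES.inl_mem_init_plus.2 he) (support_mix_subset α h2 h3 hz)⟩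
    · exact rE.support_map_subset (rE.pchoice α rF) (BES.transport_plus_inl _ _)
        (hE.support_subset p hp')
    · exact rF.support_map_subset (rE.pchoice α rF) (BES.transport_plus_inr _ _)
        (hF.support_subset p hp')
  covered := by
    rintro (e | e)
    · obtain ⟨p, hp, he⟩ := hE.covered e
      by_cases hi : p.support ⊆ E.init
      -- The partner is a distribution that covers an initial event of `F`; its whole support is
      -- then initial.
      · obtain ⟨f, hf⟩ := iF
        obtain ⟨q, hq, hfq⟩ := hF.covered f
        exact ⟨_, mem_pchoice_dist.2 (Or.inl ⟨p, hp, q, hq, hi,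
          hF.support_subset_init rF hq hfq hf, rfl⟩), (PMF.mem_support_bind_iff _ _ _).2
          ⟨false, false_mem_support_coin h1, mem_support_map he⟩⟩
      · exact ⟨_, mem_pchoice_dist.2 (Or.inr (Or.inl ⟨p, hp, rfl, hi⟩)), mem_support_map he⟩
    · obtain ⟨q, hq, he⟩ := hF.covered e
      by_cases hi : q.support ⊆ F.init
      · obtain ⟨f, hf⟩ := iE
        obtain ⟨p, hp, hfp⟩ := hE.covered f
        exact ⟨_, mem_pchoice_dist.2 (Or.inl ⟨p, hp, q, hq,
          hE.support_subset_init rE hp hfp hf, hi, rfl⟩), (PMF.mem_support_bind_iff _ _ _).2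
          ⟨true, true_mem_support_coin h0, mem_support_map he⟩⟩
      · exact ⟨_, mem_pchoice_dist.2 (Or.inr (Or.inr ⟨q, hq, rfl, hi⟩)), mem_support_map he⟩
  final_disjoint := final_disjoint_plus hE hF

end PES
end PBES

/-! ### The axioms for regular structures -/

namespace PBES
namespace PES
variable {Act : Type u}

/-- Regular structures modulo simulation form a probabilistic concurrent Kleene algebra. -/
theorem isPCKA_regular (Act : Type u) :
    IsPCKA (A := RegPES Act) RegPES.le RegPES.zero RegPES.one RegPES.plus RegPES.pchoice
      RegPES.seq RegPES.par RegPES.star where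
  le_refl x := Sim.refl x.2.good.finDist
  le_trans x y z := Sim.trans x.2.good.finDist y.2.good.finDist z.2.good.finDist
  plus_mono x x' y y' := plus_mono x.2.good x'.2.good y.2.good y'.2.good
  seq_mono x x' y y' := seq_mono x.2.good x'.2.good y.2.good y'.2.good
  par_mono x x' y y' := par_mono x.2.good x'.2.good y.2.good y'.2.good
  star_mono x x' y y' := star_mono x.2.good x'.2.good y.2.good y'.2.good
  le_iff_plus x y :=
    ⟨fun h => ⟨plus_le x.2.good y.2.good y.2.good h (Sim.refl y.2.good.finDist),
      le_plus_right y.2.good⟩,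
      fun h => Sim.trans x.2.good.finDist (x.2.plus y.2).good.finDist y.2.good.finDist
        (le_plus_left x.2.good) h.1⟩
  plus_idem x := ⟨plus_le x.2.good x.2.good x.2.good (Sim.refl x.2.good.finDist)
    (Sim.refl x.2.good.finDist), le_plus_left x.2.good⟩
  plus_comm x y :=
    ⟨plus_le x.2.good y.2.good (y.2.plus x.2).good (le_plus_right x.2.good)
      (le_plus_left y.2.good),
      plus_le y.2.good x.2.good (x.2.plus y.2).good (le_plus_right y.2.good)
      (le_plus_left x.2.good)⟩
  plus_assoc x y z := by
    have hx := x.2.good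
    have hy := y.2.good
    have hz := z.2.good
    have hl := (hx.plus hy).plus hz
    have hr := hx.plus (hy.plus hz)
    refine ⟨plus_le hx (hy.plus hz) hl ?_ (plus_le hy hz hl ?_ (le_plus_right hz)),
      plus_le (hx.plus hy) hz hr (plus_le hx hy hr (le_plus_left hx) ?_) ?_⟩
    · exact (le_plus_left hx).trans hx.finDist (hx.plus hy).finDist hl.finDist
        (le_plus_left (hx.plus hy))
    · exact (le_plus_right hy).trans hy.finDist (hx.plus hy).finDist hl.finDist
        (le_plus_left (hx.plus hy))
    · exact (le_plus_left hy).trans hy.finDist (hy.plus hz).finDist hr.finDist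
        (le_plus_right (hy.plus hz))
    · exact (le_plus_right hz).trans hz.finDist (hy.plus hz).finDist hr.finDist
        (le_plus_right (hy.plus hz))
  plus_zero x := ⟨plus_le x.2.good good_zero x.2.good (Sim.refl x.2.good.finDist)
    (zero_le x.2.good), le_plus_left x.2.good⟩
  pc_idem α x := ⟨le_pc x.2.good α, pc_le x.2.good α⟩
  pc_comm α x y := by
    refine ⟨pc_comm_le x.2.good y.2.good α, ?_⟩
    have h := pc_comm_le y.2.good x.2.good (unitInterval.symm α)
    rwa [unitInterval.symm_symm] at h
  pc_assoc α β γ x y z h hγ := ⟨pc_assoc_le x.2.good y.2.good z.2.good h hγ,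
    pc_assoc_ge x.2.good y.2.good z.2.good h hγ⟩
  pc_seq α x y z := ⟨pc_seq_le x.2.good y.2.good z.2.good α,
    le_pc_seq x.2.good y.2.good z.2.good α⟩
  seq_assoc x y z := ⟨seq_assoc_le x.2.good y.2.good z.2.good,
    seq_assoc_ge x.2.good y.2.good z.2.good⟩
  seq_one x := ⟨seq_one_le x.2.good, le_seq_one x.2.good⟩
  one_seq x := ⟨one_seq_le x.2.good, le_one_seq x.2.good⟩
  zero_seq x := ⟨zero_seq_le x.2.good, zero_le (good_zero.seq x.2.good)⟩
  one_par x := ⟨one_par_le x.2.good, le_one_par x.2.good⟩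
  par_comm x y := ⟨par_comm_le x.2.good y.2.good, par_comm_le y.2.good x.2.good⟩
  par_assoc x y z := ⟨par_assoc_le x.2.good y.2.good z.2.good,
    par_assoc_ge x.2.good y.2.good z.2.good⟩
  plus_seq x y z := ⟨plus_seq_le x.2.good y.2.good z.2.good,
    le_plus_seq x.2.good y.2.good z.2.good⟩
  seq_plus_le x y z := by
    have hx := x.2.good
    have hy := y.2.good
    have hz := z.2.good
    exact plus_le (hx.seq hy) (hx.seq hz) (hx.seq (hy.plus hz))
      (seq_mono_right hx hy (hy.plus hz) (le_plus_left hy))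
      (seq_mono_right hx hz (hy.plus hz) (le_plus_right hz))
  seq_pc_le α x y z := seq_pc_le x.2.good y.2.good z.2.good α
  par_plus_le x y z := by
    have hx := x.2.good
    have hy := y.2.good
    have hz := z.2.good
    have hr := Sim.refl hx.finDist
    exact plus_le (hx.par hy) (hx.par hz) (hx.par (hy.plus hz))
      (par_mono hx hx hy (hy.plus hz) hr (le_plus_left hy))
      (par_mono hx hx hz (hy.plus hz) hr (le_plus_right hz))
  par_pc_le α x y z := par_pc_le x.2.good y.2.good z.2.good α
  interchange x y x' y' := interchange_le x.2.good y.2.good x'.2.good y'.2.good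
  star_unfold x y := ⟨star_unfold_le x.2.good y.2.good, star_unfold_ge x.2.good y.2.good⟩
  star_induction x y z := star_le x.2.good y.2.good z.2.good
end PES
end PBES

theorem mainTheorem1 (Act : Type u) :
    -- the axioms, modulo probabilistic simulation
    PBES.IsPCKA (A := PBES.RegPES Act) PBES.RegPES.le PBES.RegPES.zero PBES.RegPES.one
      PBES.RegPES.plus PBES.RegPES.pchoice PBES.RegPES.seq PBES.RegPES.par PBES.RegPES.star ∧
    -- the operations produce probabilistic bundle event structures
    (∀ E : PBES.RegPES Act, E.1.ConfusionFree) ∧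
    (PBES.RegPES.zero : PBES.RegPES Act).1.IsPBES ∧
    (PBES.RegPES.one : PBES.RegPES Act).1.IsPBES ∧
    (∀ a : Act, (PBES.RegPES.atom a).1.IsPBES) ∧
    (∀ E F : PBES.RegPES Act, E.1.IsPBES → F.1.IsPBES →
      (E.plus F).1.IsPBES ∧
      (E.par F).1.IsPBES ∧
      (∀ α : unitInterval, 0 < α → α < 1 → E.1.init.Nonempty → F.1.init.Nonempty →
        (PBES.RegPES.pchoice α E F).1.IsPBES) ∧
      (E.1.CanTerminate → (E.seq F).1.IsPBES ∧ (E.star F).1.IsPBES)) := by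
  exact ⟨PBES.PES.isPCKA_regular Act, fun E => E.2.confusionFree, PBES.PES.isPBES_zero,
    PBES.PES.isPBES_one, PBES.PES.isPBES_atom, fun E F hE hF => ⟨hE.plus hF E.2 F.2,
    hE.par hF E.2 F.2, fun α h0 h1 iE iF => hE.pchoice hF E.2 F.2 h0 h1 iE iF,
    fun ht => ⟨hE.seq hF E.2 F.2 ht, hE.star hF E.2 F.2 ht⟩⟩⟩
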